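/- Let $\Omega\subset\mathbb R^3$ be a bounded Lipschitz polyhedron and let $\mathcal T$ be a conforming tetrahedral mesh of $\Omega$: finitely many closed nondegenerate tetrahedra with pairwise disjoint interiors fill $\overline\Omega$, and each face of a tetrahedron is either contained in $\partial\Omega$ or a face of another tetrahedron. Let $\Gamma_D\subseteq\partial\Omega$ be a (possibly empty) union of faces of tetrahedra of $\mathcal T$. Put $h_K=\operatorname{diam}K$, let $h$ be the piecewise constant function with $h|_K=h_K$, let $\rho_K$ be the ratio of $h_K$ to the radius of the largest ball contained in $K$, and let $\rho_{\mathcal T}=\max_K\rho_K$. Let $H_{\Gamma_D}(\mathbf{curl})$ be the space of $\mathbf v\in L^2(\Omega)^3$ with $\mathbf{curl}\,\mathbf v\in L^2(\Omega)^3$ whose tangential components vanish on $\Gamma_D$, and let $$\mathbf U(\mathcal T)=\{\mathbf v\in H_{\Gamma_D}(\mathbf{curl}):\ \forall K\in\mathcal T\ \exists\,\mathbf a,\mathbf b\in\mathbb R^3:\ \mathbf v(\mathbf x)=\mathbf a+\mathbf b\times\mathbf x\ \text{for a.e. }\mathbf x\in K\},$$ $$X(\mathcal T)=\{\boldsymbol\Psi\in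 H^1(\Omega)^3\cap H_{\Gamma_D}(\mathbf{curl}):\ \mathbf{curl}\,\boldsymbol\Psi\in\mathbf{curl}\,\mathbf U(\mathcal T)\}.$$ The nodal edge interpolation operator is $$\boldsymbol\Pi_h\boldsymbol\Psi=\sum_E\Big(\int_E\boldsymbol\Psi\cdot d\vec s\Big)\,\mathbf b_E ,$$ where $E$ runs over the (oriented) edges of $\mathcal T$ not contained in $\Gamma_D$, $\mathbf b_E|_K=\lambda_i\nabla\lambda_j-\lambda_j\nabla\lambda_i$ for each $K\in\mathcal T$ having the edge $E=[\mathbf a_i,\mathbf a_j]$ ($\lambda_i$ being the barycentric coordinate functions of $K$), and $\mathbf b_E|_K=0$ for all other $K$. For $\boldsymbol\Psi\in X(\mathcal T)$ the path integral $\int_E\boldsymbol\Psi\cdot d\vec s$ is understood, on each $K\in\mathcal T$ having the edge $E$, as the extension by continuity in the norm of $H^1(K)$ of the classical path integral of smooth fields with constant curl on $K$. For every $\rho$ there is a constant $C=C(\rho)>0$ such that the following holds for all such $\Omega$, $\Gamma_D$ and $\mathcal T$ with $\rho_{\mathcal T}\le\rho$. 1. $\boldsymbol\Pi_h$ is a well-defined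 bounded linear operator from $X(\mathcal T)$, with the $H^1(\Omega)$-norm, to $\mathbf U(\mathcal T)$: for all $\boldsymbol\Psi\in X(\mathcal T)$ and all edges $E$ of $\mathcal T$, the path integral $\int_E\boldsymbol\Psi\cdot d\vec s$ in the above sense exists, does not depend on the tetrahedron $K$ having the edge $E$, and is the classical one whenever $\boldsymbol\Psi$ is continuous on some such closed $K$; moreover $\boldsymbol\Pi_h\boldsymbol\Psi\in\mathbf U(\mathcal T)$, $\boldsymbol\Pi_h$ is linear on $X(\mathcal T)$, and $$\|\boldsymbol\Pi_h\boldsymbol\Psi\|_{H(\mathbf{curl};\Omega)}\le C\,(1+\operatorname{diam}\Omega)\,\|\boldsymbol\Psi\|_{H^1(\Omega)}\qquad\forall\,\boldsymbol\Psi\in X(\mathcal T).$$ 2. For all $\boldsymbol\Psi\in X(\mathcal T)$, $$\|h^{-1}(\mathrm{Id}-\boldsymbol\Pi_h)\boldsymbol\Psi\|_{L^2(\Omega)}\le C\,|\boldsymbol\Psi|_{H^1(\Omega)} .$$ -/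

import Mathlib

open MeasureTheory Set Filter Topology
open scoped ENNReal NNReal ContDiff

namespace EdgeFEM

noncomputable section

/-- Three-dimensional Euclidean space. -/
abbrev E3 : Type := EuclideanSpace ℝ (Fin 3)

/-- The `i`-th standard unit vector. -/
def unitVec (i : Fin 3) : E3 := EuclideanSpace.single i (1 : ℝ)

/-- The cross product on `E3`. -/
def cross (a b : E3) : E3 := WithLp.toLp 2 (crossProduct a.ofLp b.ofLp)

/-- The classical partial derivative `∂ᵢ φⱼ` of a vector field. -/
def pd (φ : E3 → E3) (i j : Fin 3) (x : E3) : ℝ := (fderiv ℝ φ x (unitVec i)) j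

/-- The classical curl of a differentiable vector field. -/
def curl (φ : E3 → E3) (x : E3) : E3 :=
  !₂[pd φ 1 2 x - pd φ 2 1 x, pd φ 2 0 x - pd φ 0 2 x, pd φ 0 1 x - pd φ 1 0 x]

/-! ### Sobolev spaces -/

/-- `G i = ∂ᵢ Ψ` on the open set `U` in the sense of weak derivatives, with all `G i` in `L²(U)`. -/
def IsWeakGrad (U : Set E3) (Ψ : E3 → E3) (G : Fin 3 → E3 → E3) : Prop :=
  (∀ i, MemLp (G i) 2 (volume.restrict U)) ∧
  ∀ (i : Fin 3) (φ : E3 → ℝ), ContDiff ℝ ∞ φ → HasCompactSupport φ → tsupport φ ⊆ U →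
    ∫ x in U, (fderiv ℝ φ x (unitVec i)) • Ψ x = - ∫ x in U, φ x • G i x

/-- `Ψ ∈ (H¹(U))³`. -/
def MemH1 (U : Set E3) (Ψ : E3 → E3) : Prop :=
  MemLp Ψ 2 (volume.restrict U) ∧ ∃ G, IsWeakGrad U Ψ G

/-- The `L²(U)` norm of a vector field. -/
def l2Norm (U : Set E3) (Ψ : E3 → E3) : ℝ≥0∞ := eLpNorm Ψ 2 (volume.restrict U)

/-- The seminorm `|Ψ|_{H¹(U)} = (∑ᵢ ‖∂ᵢ Ψ‖²)^{1/2}`. The weak gradient is unique almost everywhere,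
so the infimum only selects it; the value is `∞` if there is no weak gradient in `L²`. -/
def h1Seminorm (U : Set E3) (Ψ : E3 → E3) : ℝ≥0∞ :=
  ⨅ (G : Fin 3 → E3 → E3) (_ : IsWeakGrad U Ψ G), (∑ i, l2Norm U (G i) ^ 2) ^ (1 / 2 : ℝ)

/-- The norm `‖Ψ‖_{H¹(U)}`. -/
def h1Norm (U : Set E3) (Ψ : E3 → E3) : ℝ≥0∞ :=
  (l2Norm U Ψ ^ 2 + h1Seminorm U Ψ ^ 2) ^ (1 / 2 : ℝ)

/-- `v ∈ H(curl; Ω)`, with vanishing tangential components on `Γ ⊆ ∂Ω`, and `curl v = w`. The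
boundary condition is imposed weakly: integration by parts produces no boundary term for
smooth test fields that vanish near `∂Ω \ Γ`. For `Γ = ∅` the test fields vanish near `∂Ω`, and this
says just that `v, w ∈ L²(Ω)` and that `w` is the weak curl of `v`. -/
def IsHcurl (Ω Γ : Set E3) (v w : E3 → E3) : Prop :=
  MemLp v 2 (volume.restrict Ω) ∧ MemLp w 2 (volume.restrict Ω) ∧
  ∀ φ : E3 → E3, ContDiff ℝ ∞ φ → HasCompactSupport φ →
    Disjoint (tsupport φ) (closure (frontier Ω \ Γ)) →
    ∫ x in Ω, inner ℝ (v x) (curl φ x) = ∫ x in Ω, inner ℝ (w x) (φ x)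

/-- The norm `(‖v‖² + ‖curl v‖²)^{1/2}` of `H(curl; Ω)` (the weak curl is unique almost
everywhere). -/
def hcurlNorm (Ω : Set E3) (v : E3 → E3) : ℝ≥0∞ :=
  (l2Norm Ω v ^ 2 + (⨅ (w : E3 → E3) (_ : IsHcurl Ω ∅ v w), l2Norm Ω w) ^ 2) ^ (1 / 2 : ℝ)

/-! ### Domains and meshes -/

/-- Lipschitz domain: open, and near each boundary point, in suitable Cartesian coordinates, the set
of points that lie strictly above the graph of a Lipschitz function. -/
def IsLipschitzDomain (Ω : Set E3) : Prop :=
  IsOpen Ω ∧ ∀ x ∈ frontier Ω, ∃ (A : E3 ≃ᵃⁱ[ℝ] E3) (g : EuclideanSpace ℝ (Fin 2) → ℝ)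
    (L : ℝ≥0) (r : ℝ), LipschitzWith L g ∧ 0 < r ∧
    ∀ y ∈ Metric.ball x r, y ∈ Ω ↔ g !₂[A y 0, A y 1] < A y 2

/-- The closed simplex with a given vertex set. -/
def hull (S : Finset E3) : Set E3 := convexHull ℝ (S : Set E3)

/-- `T` is (the family of vertex sets of) a conforming tetrahedral mesh of `Ω`: finitely many closed
nondegenerate tetrahedra with pairwise disjoint interiors fill the closure of `Ω`, and each face of a
tetrahedron is either contained in `∂Ω` or a face of another tetrahedron. -/
structure IsConformingMesh (Ω : Set E3) (T : Finset (Finset E3)) : Prop where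
  card_eq : ∀ K ∈ T, K.card = 4
  nondegenerate : ∀ K ∈ T, AffineIndependent ℝ (fun p : K => (p : E3))
  cover : closure Ω = ⋃ K ∈ T, hull K
  disjoint : ∀ K ∈ T, ∀ K' ∈ T, K ≠ K' → Disjoint (interior (hull K)) (interior (hull K'))
  faces : ∀ K ∈ T, ∀ F ⊆ K, F.card = 3 →
    hull F ⊆ frontier Ω ∨ ∃ K' ∈ T, K' ≠ K ∧ F ⊆ K'

/-- `Γ ⊆ ∂Ω` is a (possibly empty) union of faces of tetrahedra of the mesh `T`. -/
def Resolves (Ω Γ : Set E3) (T : Finset (Finset E3)) : Prop :=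
  Γ ⊆ frontier Ω ∧ ∃ 𝓕 : Finset (Finset E3),
    (∀ F ∈ 𝓕, F.card = 3 ∧ ∃ K ∈ T, F ⊆ K) ∧ Γ = ⋃ F ∈ 𝓕, hull F

/-- The element diameter `h_K`. -/
def elemDiam (K : Finset E3) : ℝ := Metric.diam (hull K)

/-- The radius of the largest ball contained in the closed tetrahedron. -/
def inRadius (K : Finset E3) : ℝ :=
  sSup {r : ℝ | 0 ≤ r ∧ ∃ c : E3, Metric.closedBall c r ⊆ hull K}

/-- The shape regularity measure `ρ_K` of a tetrahedron. -/
def shapeMeasure (K : Finset E3) : ℝ := elemDiam K / inRadius K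

/-- The shape regularity measure of the mesh: the maximum of all `ρ_K`. -/
def meshShapeMeasure (T : Finset (Finset E3)) : ℝ := ⨆ K : T, shapeMeasure (K : Finset E3)

/-- The mesh width function: the piecewise constant function with value `h_K` in the element `K`
(set to `0` on the null set of points outside all open elements). -/
def meshWidth (T : Finset (Finset E3)) (x : E3) : ℝ :=
  ∑ K ∈ T, (interior (hull K)).indicator (fun _ => elemDiam K) x

/-! ### Edge elements -/

/-- The lowest order edge element space: fields in `H(curl; Ω)` with vanishing tangential components
on `Γ` that have the form `a + b × x` in each element. -/
def MemEdgeSpace (Ω Γ : Set E3) (T : Finset (Finset E3)) (v : E3 → E3) : Prop :=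
  (∃ w, IsHcurl Ω Γ v w) ∧
  ∀ K ∈ T, ∃ a b : E3, ∀ᵐ x ∂(volume.restrict (hull K)), v x = a + cross b x

/-- The fields `Ψ ∈ (H¹(Ω))³`, with vanishing tangential components on `Γ`, whose curl is the
curl of some edge element function. -/
def discreteCurlFields (Ω Γ : Set E3) (T : Finset (Finset E3)) : Set (E3 → E3) :=
  {Ψ | MemH1 Ω Ψ ∧ ∃ v w, MemEdgeSpace Ω Γ T v ∧ IsHcurl Ω Γ v w ∧ IsHcurl Ω Γ Ψ w}

/-- All edges of the mesh, each given by its two endpoints. -/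
def allEdges (T : Finset (Finset E3)) : Finset (Finset E3) :=
  open scoped Classical in T.biUnion (fun K => K.powersetCard 2)

/-- The edges of the mesh that are not contained in `Γ`. -/
def activeEdges (Γ : Set E3) (T : Finset (Finset E3)) : Finset (Finset E3) :=
  open scoped Classical in (allEdges T).filter (fun E => ¬ hull E ⊆ Γ)

/-- Start point of an edge, for an arbitrary but fixed orientation. -/
def tail (E : Finset E3) : E3 := E.toList.getD 0 0

/-- End point of an edge, for the same orientation. -/
def head (E : Finset E3) : E3 := E.toList.getD 1 0

/-- The classical path integral `∫_E ψ · ds` along an oriented edge. -/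
def lineIntegral (E : Finset E3) (ψ : E3 → E3) : ℝ :=
  ∫ t in (0 : ℝ)..1, inner ℝ (ψ (tail E + t • (head E - tail E))) (head E - tail E)

/-- The barycentric coordinate function of the vertex `a` of the tetrahedron `K`: the affine function
with value `1` at `a` and `0` at the other vertices. -/
def bary (K : Finset E3) (a : E3) : E3 →ᵃ[ℝ] ℝ :=
  open scoped Classical in
  if h : ∃ l : E3 →ᵃ[ℝ] ℝ, l a = 1 ∧ ∀ b ∈ K, b ≠ a → l b = 0 then h.choose else 0

/-- The local shape function `λᵢ grad λⱼ - λⱼ grad λᵢ` on `K` for the edge `E = [aᵢ, aⱼ]`. -/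
def shapeFn (K E : Finset E3) (x : E3) : E3 :=
  bary K (tail E) x • gradient (fun y => bary K (head E) y) x
    - bary K (head E) x • gradient (fun y => bary K (tail E) y) x

/-- The nodal basis function `b_E`: the local shape function in each element that has the edge `E`,
and zero in all other elements. -/
def basisFn (T : Finset (Finset E3)) (E : Finset E3) (x : E3) : E3 :=
  open scoped Classical in
  ∑ K ∈ T.filter (fun K => E ⊆ K), (interior (hull K)).indicator (shapeFn K E) x

/-- Smooth vector fields whose curl is constant on `K`. -/
def smoothConstCurl (K : Finset E3) : Set (E3 → E3) :=
  {ψ | ContDiff ℝ ∞ ψ ∧ ∃ w : E3, ∀ x ∈ hull K, curl ψ x = w}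

/-- `c` is the value at `Ψ` of the extension by continuity, in the norm of `H¹(K)`, of the path
integral along `E` from the smooth fields with constant curl on `K`: such smooth fields come
arbitrarily close to `Ψ`, and their path integrals tend to `c` as they approach `Ψ`. There is at most
one such `c`. (General fields in `H¹` have no path integral along an edge.) -/
structure HasEdgeIntegralOn (K E : Finset E3) (Ψ : E3 → E3) (c : ℝ) : Prop where
  approx : ∀ δ : ℝ, 0 < δ → ∃ ψ ∈ smoothConstCurl K,
    h1Norm (interior (hull K)) (ψ - Ψ) < ENNReal.ofReal δ
  lim : ∀ ε : ℝ, 0 < ε → ∃ δ : ℝ, 0 < δ ∧ ∀ ψ ∈ smoothConstCurl K,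
    h1Norm (interior (hull K)) (ψ - Ψ) < ENNReal.ofReal δ → |lineIntegral E ψ - c| < ε

/-- `c` is the path integral of `Ψ` along the edge `E` of the mesh, no matter from which adjacent
element it is computed. -/
def HasEdgeIntegral (T : Finset (Finset E3)) (E : Finset E3) (Ψ : E3 → E3) (c : ℝ) : Prop :=
  ∀ K ∈ T, E ⊆ K → HasEdgeIntegralOn K E Ψ c

/-- The path integral of `Ψ` along the edge `E` of the mesh (zero if it does not exist). -/
def edgeIntegral (T : Finset (Finset E3)) (E : Finset E3) (Ψ : E3 → E3) : ℝ :=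
  open scoped Classical in
  if h : ∃ c, HasEdgeIntegral T E Ψ c then h.choose else 0

/-- The nodal edge interpolation operator `Π_h Ψ = ∑_E (∫_E Ψ · ds) b_E`, the sum being over all
edges that are not contained in `Γ`. -/
def edgeInterp (Γ : Set E3) (T : Finset (Finset E3)) (Ψ : E3 → E3) : E3 → E3 :=
  fun x => ∑ E ∈ activeEdges Γ T, edgeIntegral T E Ψ • basisFn T E x

end

end EdgeFEM

open EdgeFEM

namespace EdgeFEM

theorem map_linear_volume (f : E3 →ₗ[ℝ] E3) (hf : LinearMap.det f ≠ 0) (b : E3) :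
    Measure.map (fun x => f x + b) (volume : Measure E3)
      = ENNReal.ofReal |(LinearMap.det f)⁻¹| • volume := by
  have h1 : (fun x => f x + b) = (fun y => y + b) ∘ f := rfl
  have hm : Measurable f := (LinearMap.continuous_of_finiteDimensional f).measurable
  rw [h1, ← Measure.map_map (measurable_add_const b) hm,
    Measure.map_linearMap_addHaar_eq_smul_addHaar _ hf, Measure.map_smul, map_add_right_eq_self]

theorem map_homothety_volume {r : ℝ} (hr : r ≠ 0) (b : E3) :
    Measure.map (fun x => r • x + b) (volume : Measure E3)
      = ENNReal.ofReal |(r ^ 3)⁻¹| • volume := by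
  have h := map_linear_volume (r • LinearMap.id) (by simp [LinearMap.det_smul, hr]) b
  simpa [LinearMap.det_smul] using h

theorem measurableEmbedding_homothety {r : ℝ} (hr : r ≠ 0) (b : E3) :
    MeasurableEmbedding (fun x : E3 => r • x + b) :=
  ((Homeomorph.smulOfNeZero r hr).trans (Homeomorph.addRight b)).measurableEmbedding

theorem lintegral_homothety {r : ℝ} (hr : r ≠ 0) (b : E3) (f : E3 → ℝ≥0∞) :
    ∫⁻ x, f (r • x + b) = ENNReal.ofReal |(r ^ 3)⁻¹| * ∫⁻ x, f x := by
  rw [← (measurableEmbedding_homothety hr b).lintegral_map, map_homothety_volume hr,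
    lintegral_smul_measure, smul_eq_mul]

theorem lintegral_homothety_le {U : Set E3} (hU : MeasurableSet U) {r : ℝ} (hr : 0 < r) {b : E3}
    (h : ∀ x ∈ U, r • x + b ∈ U) (f : E3 → ℝ≥0∞) :
    ∫⁻ x in U, f (r • x + b) ≤ ENNReal.ofReal (r ^ 3)⁻¹ * ∫⁻ x in U, f x := by
  rw [← lintegral_indicator hU, ← lintegral_indicator hU]
  calc ∫⁻ x, U.indicator (fun x => f (r • x + b)) x
      ≤ ∫⁻ x, U.indicator f (r • x + b) := by
        refine lintegral_mono fun x => ?_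
        by_cases hx : x ∈ U
        · simp [hx, h x hx]
        · simp [hx]
    _ = _ := by
        rw [lintegral_homothety hr.ne', abs_of_pos (by positivity)]

theorem sq_eLpNorm_two {α F : Type*} [MeasurableSpace α] [NormedAddCommGroup F] (f : α → F)
    (μ : Measure α) : eLpNorm f 2 μ ^ 2 = ∫⁻ x, ‖f x‖ₑ ^ 2 ∂μ := by
  have := eLpNorm_nnreal_pow_eq_lintegral (f := f) (μ := μ) (p := 2) (by norm_num)
  simpa using this

theorem rpow_half_sq (x : ℝ≥0∞) : (x ^ (1 / 2 : ℝ)) ^ 2 = x := by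
  rw [← ENNReal.rpow_natCast, ← ENNReal.rpow_mul]; norm_num

theorem sq_rpow_half (x : ℝ≥0∞) : (x ^ 2) ^ (1 / 2 : ℝ) = x := by
  rw [← ENNReal.rpow_natCast, ← ENNReal.rpow_mul]; norm_num

theorem ENNReal_le_of_sq_le {a b : ℝ≥0∞} (h : a ^ 2 ≤ b ^ 2) : a ≤ b := by
  have := ENNReal.rpow_le_rpow h (show (0:ℝ) ≤ 1/2 by norm_num)
  rwa [sq_rpow_half, sq_rpow_half] at this

theorem lintegral_sq_le {α : Type*} [MeasurableSpace α] (μ : Measure α) {f g : α → ℝ≥0∞}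
    (hf : AEMeasurable f μ) (hg : AEMeasurable g μ) :
    (∫⁻ x, f x * g x ∂μ) ^ 2 ≤ (∫⁻ x, f x ^ 2 ∂μ) * ∫⁻ x, g x ^ 2 ∂μ := by
  have h := ENNReal.lintegral_mul_le_Lp_mul_Lq μ (p := 2) (q := 2)
    (Real.HolderConjugate.two_two) hf hg
  have h2 := pow_le_pow_left₀ (zero_le) h 2
  rw [mul_pow, rpow_half_sq, rpow_half_sq] at h2
  simpa using h2

theorem lintegral_le_measure_mul {α : Type*} [MeasurableSpace α] (μ : Measure α) {f : α → ℝ≥0∞}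
    (hf : AEMeasurable f μ) :
    ∫⁻ x, f x ∂μ ≤ (μ univ) ^ (1 / 2 : ℝ) * (∫⁻ x, f x ^ 2 ∂μ) ^ (1 / 2 : ℝ) := by
  apply ENNReal_le_of_sq_le
  rw [mul_pow, rpow_half_sq, rpow_half_sq]
  have := lintegral_sq_le μ (f := fun _ => 1) (g := f) aemeasurable_const hf
  simpa using this

theorem eLpNorm_two_eq {α F : Type*} [MeasurableSpace α] [NormedAddCommGroup F] (f : α → F)
    (μ : Measure α) : eLpNorm f 2 μ = (∫⁻ x, ‖f x‖ₑ ^ 2 ∂μ) ^ (1 / 2 : ℝ) := by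
  rw [← sq_eLpNorm_two, sq_rpow_half]

theorem lintegral_enorm_le_eLpNorm_two {α F : Type*} [MeasurableSpace α] [NormedAddCommGroup F]
    {f : α → F} {μ : Measure α} (hf : AEStronglyMeasurable f μ) :
    ∫⁻ x, ‖f x‖ₑ ∂μ ≤ (μ univ) ^ (1 / 2 : ℝ) * eLpNorm f 2 μ := by
  rw [eLpNorm_two_eq]; exact lintegral_le_measure_mul μ hf.enorm

theorem lintegral_inv_sqrt : ∫⁻ t in Ioc (0:ℝ) 1, ENNReal.ofReal (t ^ (-(1/2) : ℝ)) = 2 := by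
  rw [← ofReal_integral_eq_lintegral_ofReal]
  · rw [← intervalIntegral.integral_of_le zero_le_one, integral_rpow (by norm_num)]
    norm_num
  · have := intervalIntegral.intervalIntegrable_rpow' (a := 0) (b := 1) (r := -(1/2)) (by norm_num)
    rwa [intervalIntegrable_iff_integrableOn_Ioc_of_le zero_le_one] at this
  · filter_upwards [ae_restrict_mem measurableSet_Ioc] with t ht
    exact Real.rpow_nonneg ht.1.le _

/-- The line integral of a field along the segment from `a` to `b`. -/
noncomputable def segInt (ψ : E3 → E3) (a b : E3) : ℝ :=
  ∫ t in (0 : ℝ)..1, inner ℝ (ψ (a + t • (b - a))) (b - a)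

theorem segInt_eq_sub {ψ : E3 → E3} (hψ : ContDiff ℝ 1 ψ) (a y : E3) :
    segInt ψ a y = inner ℝ (ψ y) (y - a)
      - ∫ t in (0 : ℝ)..1, t * inner ℝ (fderiv ℝ ψ (a + t • (y - a)) (y - a)) (y - a) := by
  have hd : Differentiable ℝ ψ := hψ.differentiable (by norm_num)
  have hline : ∀ t : ℝ, HasDerivAt (fun t : ℝ => a + t • (y - a)) (y - a) t := fun t => by
    simpa using ((hasDerivAt_id t).smul_const (y - a)).const_add a
  have hf : ∀ t : ℝ, HasDerivAt (fun t : ℝ => t * inner ℝ (ψ (a + t • (y - a))) (y - a))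
      (inner ℝ (ψ (a + t • (y - a))) (y - a)
        + t * inner ℝ (fderiv ℝ ψ (a + t • (y - a)) (y - a)) (y - a)) t := fun t => by
    have h1 := (hd (a + t • (y - a))).hasFDerivAt.comp_hasDerivAt t (hline t)
    have h2 := h1.inner ℝ (hasDerivAt_const t (y - a))
    have h3 := (hasDerivAt_id t).mul h2
    convert! h3 using 1
    simp
  have hc1 : Continuous fun t : ℝ => (inner ℝ (ψ (a + t • (y - a))) (y - a) : ℝ) := by
    have := hψ.continuous
    fun_prop
  have hc2 : Continuous fun t : ℝ =>
      t * (inner ℝ (fderiv ℝ ψ (a + t • (y - a)) (y - a)) (y - a) : ℝ) := by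
    have := hψ.continuous_fderiv (by norm_num)
    fun_prop
  have := intervalIntegral.integral_eq_sub_of_hasDerivAt (a := 0) (b := 1)
    (fun t _ => hf t) ((hc1.add hc2).intervalIntegrable _ _)
  rw [intervalIntegral.integral_add (hc1.intervalIntegrable _ _) (hc2.intervalIntegrable _ _)] at this
  simp only [one_smul, add_sub_cancel, one_mul, zero_mul, sub_zero] at this
  unfold segInt
  linarith

theorem enorm_segInt_le {ψ : E3 → E3} (hψ : ContDiff ℝ 1 ψ) {a y : E3} {h : ℝ}
    (hay : ‖y - a‖ ≤ h) :
    ‖segInt ψ a y‖ₑ ≤ ENNReal.ofReal h * ‖ψ y‖ₑ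
      + ∫⁻ t in Ioc (0:ℝ) 1, ENNReal.ofReal (h ^ 2) *
        (ENNReal.ofReal t * ‖fderiv ℝ ψ (a + t • (y - a))‖ₑ) := by
  have h0 : 0 ≤ h := (norm_nonneg _).trans hay
  rw [segInt_eq_sub hψ]
  refine (enorm_sub_le).trans (add_le_add ?_ ?_)
  · rw [← ofReal_norm, ← ofReal_norm, ← ENNReal.ofReal_mul h0]
    apply ENNReal.ofReal_le_ofReal
    refine (norm_inner_le_norm _ _).trans ?_
    rw [mul_comm]; gcongr
  · rw [intervalIntegral.integral_of_le zero_le_one]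
    refine (enorm_integral_le_lintegral_enorm _).trans ?_
    refine setLIntegral_mono' measurableSet_Ioc fun t ht => ?_
    rw [← ofReal_norm, ← ofReal_norm, ← ENNReal.ofReal_mul ht.1.le,
      ← ENNReal.ofReal_mul (by positivity)]
    apply ENNReal.ofReal_le_ofReal
    rw [norm_mul, Real.norm_of_nonneg ht.1.le]
    have h1 := norm_inner_le_norm (𝕜 := ℝ) (fderiv ℝ ψ (a + t • (y - a)) (y - a)) (y - a)
    have h2 := (fderiv ℝ ψ (a + t • (y - a))).le_opNorm (y - a)
    calc t * ‖inner ℝ (fderiv ℝ ψ (a + t • (y - a)) (y - a)) (y - a)‖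
        ≤ t * ((‖fderiv ℝ ψ (a + t • (y - a))‖ * h) * h) := by
          have := ht.1.le
          gcongr
          refine h1.trans ?_
          gcongr
          refine h2.trans ?_
          gcongr
      _ = _ := by ring

/-- The convex, open, bounded sets used as elements. -/
structure ConvexElement (U : Set E3) (h : ℝ) : Prop where
  isOpen : IsOpen U
  convex : Convex ℝ U
  nonempty : U.Nonempty
  dist_le : ∀ x ∈ closure U, ∀ y ∈ closure U, dist x y ≤ h

namespace ConvexElement

variable {U : Set E3} {h : ℝ}

theorem h_nonneg (hU : ConvexElement U h) : 0 ≤ h := by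
  obtain ⟨x, hx⟩ := hU.nonempty
  simpa using hU.dist_le x (subset_closure hx) x (subset_closure hx)

theorem isBounded (hU : ConvexElement U h) : Bornology.IsBounded U :=
  Metric.isBounded_iff.2 ⟨h, fun x hx y hy =>
    hU.dist_le x (subset_closure hx) y (subset_closure hy)⟩

theorem isCompact_closure (hU : ConvexElement U h) : IsCompact (closure U) :=
  hU.isBounded.isCompact_closure

theorem volume_ne_top (hU : ConvexElement U h) : volume U ≠ ⊤ := hU.isBounded.measure_lt_top.ne

theorem volume_ne_zero (hU : ConvexElement U h) : volume U ≠ 0 :=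
  (hU.isOpen.measure_pos _ hU.nonempty).ne'

theorem combo_mem (hU : ConvexElement U h) {a y : E3} (ha : a ∈ closure U) (hy : y ∈ U) {t : ℝ}
    (ht : t ∈ Ioc (0:ℝ) 1) : a + t • (y - a) ∈ U := by
  have := hU.convex.combo_closure_interior_mem_interior (x := a) (y := y) (a := 1 - t) (b := t) ha
    (by rwa [hU.isOpen.interior_eq]) (by linarith [ht.2]) ht.1 (by ring)
  rw [hU.isOpen.interior_eq] at this
  convert! this using 1
  module

theorem lintegral_segInt_le (hU : ConvexElement U h) {ψ : E3 → E3} (hψ : ContDiff ℝ 1 ψ) {a : E3}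
    (ha : a ∈ closure U) :
    ∫⁻ y in U, ‖segInt ψ a y‖ₑ ≤ volume U ^ (1 / 2 : ℝ) *
      (ENNReal.ofReal h * l2Norm U ψ
        + 2 * ENNReal.ofReal (h ^ 2) * eLpNorm (fderiv ℝ ψ) 2 (volume.restrict U)) := by
  have hcf : Continuous (fderiv ℝ ψ) := hψ.continuous_fderiv (by norm_num)
  have hc := hψ.continuous
  have hUm := hU.isOpen.measurableSet
  have hμ : (volume.restrict U) univ = volume U := by simp
  calc ∫⁻ y in U, ‖segInt ψ a y‖ₑ
      ≤ ∫⁻ y in U, (ENNReal.ofReal h * ‖ψ y‖ₑ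
        + ∫⁻ t in Ioc (0:ℝ) 1, ENNReal.ofReal (h ^ 2) *
          (ENNReal.ofReal t * ‖fderiv ℝ ψ (a + t • (y - a))‖ₑ)) := by
        refine setLIntegral_mono' hUm fun y hy => enorm_segInt_le hψ ?_
        rw [← dist_eq_norm]
        exact hU.dist_le _ (subset_closure hy) _ ha
    _ = ENNReal.ofReal h * (∫⁻ y in U, ‖ψ y‖ₑ)
        + ∫⁻ t in Ioc (0:ℝ) 1, ENNReal.ofReal (h ^ 2) *
          (ENNReal.ofReal t * ∫⁻ y in U, ‖fderiv ℝ ψ (a + t • (y - a))‖ₑ) := by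
        rw [lintegral_add_left (by fun_prop), lintegral_const_mul _ (by fun_prop),
          lintegral_lintegral_swap]
        · congr 1
          refine lintegral_congr fun t => ?_
          rw [lintegral_const_mul _ (by fun_prop), lintegral_const_mul _ (by fun_prop)]
        · refine Measurable.aemeasurable ?_
          unfold Function.uncurry
          have : Continuous fun p : E3 × ℝ => fderiv ℝ ψ (a + p.2 • (p.1 - a)) := by fun_prop
          have := this.measurable
          fun_prop
    _ ≤ ENNReal.ofReal h * (volume U ^ (1 / 2 : ℝ) * l2Norm U ψ)
        + ∫⁻ t in Ioc (0:ℝ) 1, (ENNReal.ofReal (h ^ 2) * (volume U ^ (1 / 2 : ℝ) *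
          eLpNorm (fderiv ℝ ψ) 2 (volume.restrict U))) * ENNReal.ofReal (t ^ (-(1/2) : ℝ)) := by
        refine add_le_add ?_ ?_
        · gcongr
          have := lintegral_enorm_le_eLpNorm_two (μ := volume.restrict U)
            hc.aestronglyMeasurable
          rwa [hμ] at this
        · refine setLIntegral_mono' measurableSet_Ioc fun t ht => ?_
          rw [mul_assoc (ENNReal.ofReal (h ^ 2))]
          gcongr ENNReal.ofReal (h ^ 2) * ?_
          have h1 := lintegral_le_measure_mul (volume.restrict U)
            (f := fun y => ‖fderiv ℝ ψ (a + t • (y - a))‖ₑ) (by fun_prop)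
          rw [hμ] at h1
          have h2 : ∫⁻ y in U, ‖fderiv ℝ ψ (a + t • (y - a))‖ₑ ^ 2
              ≤ ENNReal.ofReal (t ^ 3)⁻¹ * eLpNorm (fderiv ℝ ψ) 2 (volume.restrict U) ^ 2 := by
            rw [sq_eLpNorm_two]
            have := lintegral_homothety_le hUm ht.1 (b := a - t • a)
              (fun x hx => by
                have := hU.combo_mem ha hx ht
                convert! this using 1; module) (fun x => ‖fderiv ℝ ψ x‖ₑ ^ 2)
            refine le_trans (le_of_eq ?_) this
            refine lintegral_congr fun y => ?_
            congr 3; rw [show a + t • (y - a) = t • y + (a - t • a) by module]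
          have h3 : ENNReal.ofReal t * (ENNReal.ofReal (t ^ 3)⁻¹) ^ (1 / 2 : ℝ)
              = ENNReal.ofReal (t ^ (-(1/2) : ℝ)) := by
            rw [ENNReal.ofReal_rpow_of_nonneg (by have := ht.1; positivity) (by norm_num),
              ← ENNReal.ofReal_mul ht.1.le]
            congr 1
            rw [← Real.rpow_natCast, ← Real.rpow_neg ht.1.le, ← Real.rpow_mul ht.1.le]
            nth_rw 1 [← Real.rpow_one t]
            rw [← Real.rpow_add ht.1]
            norm_num
          calc ENNReal.ofReal t * ∫⁻ y in U, ‖fderiv ℝ ψ (a + t • (y - a))‖ₑ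
              ≤ ENNReal.ofReal t * (volume U ^ (1 / 2 : ℝ) * (ENNReal.ofReal (t ^ 3)⁻¹ *
                eLpNorm (fderiv ℝ ψ) 2 (volume.restrict U) ^ 2) ^ (1 / 2 : ℝ)) := by
                gcongr
                refine h1.trans ?_
                gcongr
            _ = _ := by
                rw [ENNReal.mul_rpow_of_nonneg _ _ (by norm_num), sq_rpow_half, ← h3]
                ring
    _ = _ := by
        rw [lintegral_const_mul _ (by fun_prop), lintegral_inv_sqrt]
        ring

end ConvexElement

@[simp] theorem cross_apply_zero (a b : E3) : cross a b 0 = a 1 * b 2 - a 2 * b 1 := by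
  simp [cross, crossProduct]

@[simp] theorem cross_apply_one (a b : E3) : cross a b 1 = a 2 * b 0 - a 0 * b 2 := by
  simp [cross, crossProduct]

@[simp] theorem cross_apply_two (a b : E3) : cross a b 2 = a 0 * b 1 - a 1 * b 0 := by
  simp [cross, crossProduct]

theorem E3.ext3 {a b : E3} (h0 : a 0 = b 0) (h1 : a 1 = b 1) (h2 : a 2 = b 2) : a = b := by
  ext i; fin_cases i <;> assumption

theorem inner_eq (a b : E3) : (inner ℝ a b : ℝ) = a 0 * b 0 + a 1 * b 1 + a 2 * b 2 := by
  simp [PiLp.inner_apply, Fin.sum_univ_three]; ring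

theorem norm_sq_eq (a : E3) : ‖a‖ ^ 2 = a 0 ^ 2 + a 1 ^ 2 + a 2 ^ 2 := by
  rw [← real_inner_self_eq_norm_sq, inner_eq]; ring

theorem norm_cross_le (a b : E3) : ‖cross a b‖ ≤ ‖a‖ * ‖b‖ := by
  apply le_of_sq_le_sq _ (by positivity)
  rw [mul_pow, norm_sq_eq, norm_sq_eq, norm_sq_eq]
  simp only [cross_apply_zero, cross_apply_one, cross_apply_two]
  nlinarith [sq_nonneg (a 0 * b 0 + a 1 * b 1 + a 2 * b 2)]

theorem eq_sum_unitVec (v : E3) : v = v 0 • unitVec 0 + v 1 • unitVec 1 + v 2 • unitVec 2 := by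
  apply E3.ext3 <;> simp [unitVec]

theorem inner_cross_self (w v : E3) : (inner ℝ (cross w v) v : ℝ) = 0 := by
  rw [inner_eq]; simp; ring

/-- The cross product with a fixed vector as a continuous linear map. -/
noncomputable def crossL (w : E3) : E3 →L[ℝ] E3 :=
  LinearMap.toContinuousLinearMap
    { toFun := cross w
      map_add' := fun x y => by apply E3.ext3 <;> simp <;> ring
      map_smul' := fun r x => by apply E3.ext3 <;> simp <;> ring }

@[simp] theorem crossL_apply (w x : E3) : crossL w x = cross w x := rfl

theorem norm_crossL_le (w : E3) : ‖crossL w‖ ≤ ‖w‖ :=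
  (crossL w).opNorm_le_bound (norm_nonneg _) fun x => norm_cross_le w x

theorem inner_fderiv_sub (ψ : E3 → E3) (x u v : E3) :
    (inner ℝ (fderiv ℝ ψ x u) v : ℝ) - inner ℝ (fderiv ℝ ψ x v) u
      = inner ℝ (curl ψ x) (cross u v) := by
  rw [inner_eq, inner_eq, inner_eq]
  have h : ∀ (w : E3) (j : Fin 3), fderiv ℝ ψ x w j
      = w 0 * pd ψ 0 j x + w 1 * pd ψ 1 j x + w 2 * pd ψ 2 j x := by
    intro w j
    conv_lhs => rw [eq_sum_unitVec w]
    simp [pd]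
  simp only [h, curl, cross_apply_zero, cross_apply_one, cross_apply_two]
  simp
  ring

theorem norm_curl_le (ψ : E3 → E3) (x : E3) : ‖curl ψ x‖ ≤ 4 * ‖fderiv ℝ ψ x‖ := by
  have hpd : ∀ i j, |pd ψ i j x| ≤ ‖fderiv ℝ ψ x‖ := by
    intro i j
    have h1 := (fderiv ℝ ψ x).le_opNorm (unitVec i)
    have h2 := PiLp.norm_apply_le (fderiv ℝ ψ x (unitVec i)) j
    have h3 : ‖unitVec i‖ = 1 := by simp [unitVec]
    rw [h3, mul_one] at h1
    exact h2.trans h1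
  set D := ‖fderiv ℝ ψ x‖
  have hD : 0 ≤ D := norm_nonneg _
  have hsub : ∀ i j, (pd ψ i j x - pd ψ j i x) ^ 2 ≤ 4 * D ^ 2 := by
    intro i j
    have h1 := abs_le.1 (hpd i j)
    have h2 := abs_le.1 (hpd j i)
    nlinarith [mul_nonneg (by linarith : 0 ≤ 2 * D - (pd ψ i j x - pd ψ j i x))
      (by linarith : 0 ≤ 2 * D + (pd ψ i j x - pd ψ j i x))]
  apply le_of_sq_le_sq _ (by positivity)
  rw [norm_sq_eq]
  have h1 := hsub 1 2
  have h2 := hsub 2 0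
  have h3 := hsub 0 1
  simp only [curl]
  simp
  nlinarith [sq_nonneg D]

theorem segInt_eq_curveIntegral (ψ : E3 → E3) (a b : E3) :
    segInt ψ a b = curveIntegral (fun x => innerSL ℝ (ψ x)) (Path.segment a b) := by
  rw [curveIntegral_segment]
  simp [segInt, AffineMap.lineMap_apply, add_comm]

theorem segInt_add_of_curl_eq_zero {s : Set E3} (hs : Convex ℝ s) {ψ : E3 → E3}
    (hψ : ContDiff ℝ 1 ψ) (h0 : ∀ x ∈ s, curl ψ x = 0) {a b c : E3} (ha : a ∈ s) (hb : b ∈ s)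
    (hc : c ∈ s) : segInt ψ a b + segInt ψ b c = segInt ψ a c := by
  simp only [segInt_eq_curveIntegral]
  have hd : Differentiable ℝ ψ := hψ.differentiable (by norm_num)
  refine hs.curveIntegral_segment_add_eq_of_hasFDerivWithinAt_symmetric
    (dω := fun x => (innerSL ℝ).toContinuousLinearMap.comp (fderiv ℝ ψ x)) ?_ ?_ ha hb hc
  · intro x _
    exact ((innerSL ℝ).toContinuousLinearMap.hasFDerivAt.comp x
      (hd x).hasFDerivAt).hasFDerivWithinAt
  · intro x hx u _ v _
    have := inner_fderiv_sub ψ x u v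
    rw [h0 x hx, inner_zero_left, sub_eq_zero] at this
    simpa using this

theorem continuous_segInt {ψ : E3 → E3} (hψ : Continuous ψ) :
    Continuous fun p : E3 × E3 => segInt ψ p.1 p.2 := by
  unfold segInt
  apply intervalIntegral.continuous_parametric_intervalIntegral_of_continuous'
  unfold Function.uncurry
  fun_prop

theorem segInt_sub {ψ φ : E3 → E3} (hψ : Continuous ψ) (hφ : Continuous φ) (a b : E3) :
    segInt (ψ - φ) a b = segInt ψ a b - segInt φ a b := by
  unfold segInt
  rw [← intervalIntegral.integral_sub]
  · simp [inner_sub_left]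
  all_goals
    apply Continuous.intervalIntegrable
    fun_prop

theorem curl_sub_cross {ψ : E3 → E3} {x : E3} (hψ : DifferentiableAt ℝ ψ x) (w a : E3) :
    curl (fun x => ψ x - (1 / 2 : ℝ) • cross w (x - a)) x = curl ψ x - w := by
  have hd : HasFDerivAt (fun x => ψ x - (1 / 2 : ℝ) • cross w (x - a))
      (fderiv ℝ ψ x - (1 / 2 : ℝ) • crossL w) x := by
    have h1 : HasFDerivAt (fun x => cross w (x - a)) (crossL w) x := by
      have h := ((crossL w).hasFDerivAt (x := x - a)).comp x ((hasFDerivAt_id x).sub_const a)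
      rw [ContinuousLinearMap.comp_id] at h
      exact h
    exact hψ.hasFDerivAt.sub (h1.const_smul (1 / 2 : ℝ))
  unfold curl pd
  rw [hd.fderiv]
  apply E3.ext3 <;> simp [unitVec] <;> ring

theorem fderiv_sub_cross {ψ : E3 → E3} {x : E3} (hψ : DifferentiableAt ℝ ψ x) (w a : E3) :
    fderiv ℝ (fun x => ψ x - (1 / 2 : ℝ) • cross w (x - a)) x
      = fderiv ℝ ψ x - (1 / 2 : ℝ) • crossL w := by
  have h1 : HasFDerivAt (fun x => cross w (x - a)) (crossL w) x := by
    have h := ((crossL w).hasFDerivAt (x := x - a)).comp x ((hasFDerivAt_id x).sub_const a)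
    rw [ContinuousLinearMap.comp_id] at h
    exact h
  exact (hψ.hasFDerivAt.sub (h1.const_smul (1 / 2 : ℝ))).fderiv

theorem contDiff_sub_cross {n : ℕ∞ω} {ψ : E3 → E3} (hψ : ContDiff ℝ n ψ) (w a : E3) :
    ContDiff ℝ n fun x => ψ x - (1 / 2 : ℝ) • cross w (x - a) := by
  have : ContDiff ℝ n fun x => crossL w (x - a) := by fun_prop
  exact hψ.sub (this.const_smul (1 / 2 : ℝ))

theorem segInt_sub_cross {ψ : E3 → E3} (w a b : E3) :
    segInt (fun x => ψ x - (1 / 2 : ℝ) • cross w (x - a)) a b = segInt ψ a b := by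
  unfold segInt
  refine intervalIntegral.integral_congr fun t _ => ?_
  have : (inner ℝ (cross w (t • (b - a))) (b - a) : ℝ) = 0 := by
    have h : cross w (t • (b - a)) = t • cross w (b - a) := (crossL w).map_smul t (b - a)
    rw [h, inner_smul_left, inner_cross_self]; simp
  simp [inner_sub_left, inner_smul_left, this]

theorem eLpNorm_const_two {F : Type*} [NormedAddCommGroup F] (U : Set E3) (c : F) :
    eLpNorm (fun _ : E3 => c) 2 (volume.restrict U) = ‖c‖ₑ * volume U ^ (1 / 2 : ℝ) := by
  rw [eLpNorm_const' _ (by norm_num) (by norm_num)]; simp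

namespace ConvexElement

variable {U : Set E3} {h : ℝ}

theorem enorm_segInt_le_of_curl_eq_zero (hU : ConvexElement U h) {ψ : E3 → E3}
    (hψ : ContDiff ℝ 1 ψ) (h0 : ∀ x ∈ closure U, curl ψ x = 0) {a b : E3} (ha : a ∈ closure U)
    (hb : b ∈ closure U) :
    volume U ^ (1 / 2 : ℝ) * ‖segInt ψ a b‖ₑ ≤ 2 * (ENNReal.ofReal h * l2Norm U ψ
        + 2 * ENNReal.ofReal (h ^ 2) * eLpNorm (fderiv ℝ ψ) 2 (volume.restrict U)) := by
  have hs : Convex ℝ (closure U) := hU.convex.closure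
  have key : volume U * ‖segInt ψ a b‖ₑ ≤
      ∫⁻ y in U, (‖segInt ψ a y‖ₑ + ‖segInt ψ b y‖ₑ) := by
    rw [mul_comm, ← setLIntegral_const]
    refine setLIntegral_mono' hU.isOpen.measurableSet fun y hy => ?_
    have := segInt_add_of_curl_eq_zero hs hψ h0 ha hb (subset_closure hy)
    rw [eq_sub_of_add_eq this]
    exact enorm_sub_le
  have hc := continuous_segInt hψ.continuous
  rw [lintegral_add_left (by
    exact (hc.comp (by fun_prop : Continuous fun y => (a, y))).measurable.enorm)] at key
  have h1 := hU.lintegral_segInt_le hψ ha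
  have h2 := hU.lintegral_segInt_le hψ hb
  have h3 := key.trans (add_le_add h1 h2)
  have hV0 : volume U ^ (1 / 2 : ℝ) ≠ 0 := by
    simp [ENNReal.rpow_eq_zero_iff, hU.volume_ne_zero]
  have hVt : volume U ^ (1 / 2 : ℝ) ≠ ⊤ := by
    simp [ENNReal.rpow_eq_top_iff, hU.volume_ne_top]
  have h4 : volume U = volume U ^ (1 / 2 : ℝ) * volume U ^ (1 / 2 : ℝ) := by
    rw [← sq, rpow_half_sq]
  rw [← mul_add] at h3
  have h5 := (mul_assoc _ _ ‖segInt ψ a b‖ₑ).symm.trans_le ((congrArg (· * _) h4).symm.trans_le h3)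
  rw [ENNReal.mul_le_mul_iff_right hV0 hVt] at h5
  rw [two_mul]
  exact h5

theorem enorm_segInt_le_of_curl_const (hU : ConvexElement U h) {ψ : E3 → E3} {w : E3}
    (hψ : ContDiff ℝ 1 ψ) (h0 : ∀ x ∈ closure U, curl ψ x = w) {a b : E3} (ha : a ∈ closure U)
    (hb : b ∈ closure U) :
    volume U ^ (1 / 2 : ℝ) * ‖segInt ψ a b‖ₑ ≤ 2 * ENNReal.ofReal h * l2Norm U ψ
        + 16 * ENNReal.ofReal (h ^ 2) * eLpNorm (fderiv ℝ ψ) 2 (volume.restrict U) := by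
  have hd : Differentiable ℝ ψ := hψ.differentiable (by norm_num)
  have hh := hU.h_nonneg
  set ψ₀ : E3 → E3 := fun x => ψ x - (1 / 2 : ℝ) • cross w (x - a)
  have hcf : Continuous (fderiv ℝ ψ) := hψ.continuous_fderiv (by norm_num)
  have h1 := hU.enorm_segInt_le_of_curl_eq_zero (contDiff_sub_cross hψ w a)
    (fun x hx => by rw [curl_sub_cross (hd x), h0 x hx, sub_self]) ha hb
  rw [segInt_sub_cross] at h1
  set D := eLpNorm (fderiv ℝ ψ) 2 (volume.restrict U)
  have hUm := hU.isOpen.measurableSet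
  have hw : ‖w‖ₑ * volume U ^ (1 / 2 : ℝ) ≤ 4 * D := by
    rw [← eLpNorm_const_two]
    have : (4 : ℝ≥0∞) * D = eLpNorm ((4 : ℝ) • fderiv ℝ ψ) 2 (volume.restrict U) := by
      rw [eLpNorm_const_smul (4 : ℝ) (fderiv ℝ ψ)]
      congr 1
      rw [← ofReal_norm]; norm_num
    rw [this]
    refine eLpNorm_mono_ae ?_
    filter_upwards [ae_restrict_mem hUm] with x hx
    rw [← h0 x (subset_closure hx), Pi.smul_apply, norm_smul]
    refine (norm_curl_le ψ x).trans (by norm_num)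
  have e1 : l2Norm U ψ₀ ≤ l2Norm U ψ + 2 * ENNReal.ofReal h * D := by
    have hcr : Continuous fun x => (1 / 2 : ℝ) • crossL w (x - a) := by fun_prop
    have hm2 : AEStronglyMeasurable (fun x => (1 / 2 : ℝ) • cross w (x - a))
      (volume.restrict U) := hcr.aestronglyMeasurable
    refine (eLpNorm_sub_le hψ.continuous.aestronglyMeasurable hm2 (by norm_num)).trans ?_
    refine add_le_add le_rfl ?_
    have : eLpNorm (fun x => (1 / 2 : ℝ) • cross w (x - a)) 2 (volume.restrict U)
        ≤ eLpNorm (fun _ => (h / 2) • w) 2 (volume.restrict U) := by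
      refine eLpNorm_mono_ae ?_
      filter_upwards [ae_restrict_mem hUm] with x hx
      rw [norm_smul, norm_smul, Real.norm_of_nonneg (by positivity),
        Real.norm_of_nonneg (by positivity)]
      have h3 := norm_cross_le w (x - a)
      have h4 := hU.dist_le x (subset_closure hx) a ha
      rw [dist_eq_norm] at h4
      nlinarith [norm_nonneg w]
    refine this.trans ?_
    rw [eLpNorm_const_two, enorm_smul, mul_assoc]
    have e : ‖h / 2‖ₑ = ENNReal.ofReal h / 2 := by
      rw [Real.enorm_of_nonneg (by positivity), ENNReal.ofReal_div_of_pos (by norm_num)]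
      norm_num
    rw [e]
    calc ENNReal.ofReal h / 2 * (‖w‖ₑ * volume U ^ (1 / 2 : ℝ))
        ≤ ENNReal.ofReal h / 2 * (4 * D) := by gcongr
      _ = ENNReal.ofReal h * D * (2 * (2 / 2)) := by
        rw [ENNReal.div_eq_inv_mul, ENNReal.div_eq_inv_mul]; ring
      _ = _ := by rw [ENNReal.div_self (by norm_num) (by norm_num)]; ring
  have e2 : eLpNorm (fderiv ℝ ψ₀) 2 (volume.restrict U) ≤ 3 * D := by
    have : fderiv ℝ ψ₀ = fderiv ℝ ψ - fun _ => (1 / 2 : ℝ) • crossL w :=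
      funext fun x => fderiv_sub_cross (hd x) w a
    rw [this]
    refine (eLpNorm_sub_le hcf.aestronglyMeasurable aestronglyMeasurable_const
      (by norm_num)).trans ?_
    have h5 : eLpNorm (fun _ : E3 => (1 / 2 : ℝ) • crossL w) 2 (volume.restrict U)
        ≤ eLpNorm (fun _ : E3 => (1 / 2 : ℝ) • w) 2 (volume.restrict U) := by
      refine eLpNorm_mono fun x => ?_
      rw [norm_smul, norm_smul]
      gcongr
      exact norm_crossL_le w
    have e : ‖(1 / 2 : ℝ)‖ₑ = 2⁻¹ := by
      rw [Real.enorm_of_nonneg (by positivity), one_div, ENNReal.ofReal_inv_of_pos (by norm_num)]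
      norm_num
    rw [eLpNorm_const_two U ((1 / 2 : ℝ) • w), enorm_smul, e, mul_assoc] at h5
    calc D + _ ≤ D + 2⁻¹ * (4 * D) := by
          refine add_le_add le_rfl (h5.trans ?_)
          gcongr
      _ = D + (2⁻¹ * 2) * (2 * D) := by ring
      _ = 3 * D := by rw [ENNReal.inv_mul_cancel (by norm_num) (by norm_num)]; ring
  refine h1.trans ?_
  calc _ ≤ 2 * (ENNReal.ofReal h * (l2Norm U ψ + 2 * ENNReal.ofReal h * D)
          + 2 * ENNReal.ofReal (h ^ 2) * (3 * D)) := by gcongr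
    _ = _ := by
      rw [ENNReal.ofReal_pow hh]
      ring

theorem enorm_sub_sq_le {ψ : E3 → E3} (hψ : ContDiff ℝ 1 ψ) {x y : E3} (hxy : ‖y - x‖ ≤ h) :
    ‖ψ y - ψ x‖ₑ ^ 2 ≤ ENNReal.ofReal (h ^ 2) *
      ∫⁻ t in Ioc (0:ℝ) 1, ‖fderiv ℝ ψ (x + t • (y - x))‖ₑ ^ 2 := by
  have h0 : 0 ≤ h := (norm_nonneg _).trans hxy
  have hd : Differentiable ℝ ψ := hψ.differentiable (by norm_num)
  have hcf : Continuous (fderiv ℝ ψ) := hψ.continuous_fderiv (by norm_num)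
  have hline : ∀ t : ℝ, HasDerivAt (fun t : ℝ => x + t • (y - x)) (y - x) t := fun t => by
    simpa using ((hasDerivAt_id t).smul_const (y - x)).const_add x
  have h1 := intervalIntegral.integral_eq_sub_of_hasDerivAt (a := 0) (b := 1)
    (f := fun t : ℝ => ψ (x + t • (y - x)))
    (fun t _ => (hd (x + t • (y - x))).hasFDerivAt.comp_hasDerivAt t (hline t))
    (by apply Continuous.intervalIntegrable; fun_prop)
  simp only [one_smul, add_sub_cancel, zero_smul, add_zero] at h1
  rw [← h1, intervalIntegral.integral_of_le zero_le_one]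
  have h2 : ‖∫ t in Ioc (0:ℝ) 1, fderiv ℝ ψ (x + t • (y - x)) (y - x)‖ₑ ≤
      ∫⁻ t in Ioc (0:ℝ) 1, ENNReal.ofReal h * ‖fderiv ℝ ψ (x + t • (y - x))‖ₑ := by
    refine (enorm_integral_le_lintegral_enorm _).trans (lintegral_mono fun t => ?_)
    rw [← ofReal_norm, ← ofReal_norm, ← ENNReal.ofReal_mul h0]
    apply ENNReal.ofReal_le_ofReal
    refine ((fderiv ℝ ψ (x + t • (y - x))).le_opNorm (y - x)).trans ?_
    rw [mul_comm]; gcongr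
  refine (pow_le_pow_left₀ zero_le h2 2).trans ?_
  rw [lintegral_const_mul _ (by fun_prop), mul_pow, ENNReal.ofReal_pow h0]
  gcongr
  have h3 := lintegral_sq_le (volume.restrict (Ioc (0:ℝ) 1)) (f := fun _ => 1)
    (g := fun t => ‖fderiv ℝ ψ (x + t • (y - x))‖ₑ) aemeasurable_const (by fun_prop)
  simpa using h3

theorem lintegral_combo_le (hU : ConvexElement U h) {t : ℝ} (ht : t ∈ Ico (0:ℝ) 1) {y : E3}
    (hy : y ∈ closure U) (f : E3 → ℝ≥0∞) :
    ∫⁻ x in U, f (x + t • (y - x)) ≤ ENNReal.ofReal ((1 - t) ^ 3)⁻¹ * ∫⁻ x in U, f x := by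
  have h1 := lintegral_homothety_le hU.isOpen.measurableSet (r := 1 - t) (by linarith [ht.2])
    (b := t • y) (U := U) (fun x hx => by
      have := hU.combo_mem hy hx (t := 1 - t) ⟨by linarith [ht.2], by linarith [ht.1]⟩
      convert! this using 1; module) f
  refine le_trans (le_of_eq (lintegral_congr fun x => ?_)) h1
  congr 1; module

theorem lintegral_segment_le (hU : ConvexElement U h) {g : E3 → ℝ≥0∞} (hg : Measurable g) :
    ∫⁻ x in U, ∫⁻ y in U, ∫⁻ t in Ioc (0:ℝ) 1, g (x + t • (y - x))
      ≤ 8 * volume U * ∫⁻ x in U, g x := by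
  have hUm := hU.isOpen.measurableSet
  have hmeas : Measurable fun p : (E3 × E3) × ℝ => g (p.1.1 + p.2 • (p.1.2 - p.1.1)) :=
    hg.comp (by fun_prop)
  have h8 : ∀ t : ℝ, 1 / 2 ≤ t → ENNReal.ofReal (t ^ 3)⁻¹ ≤ 8 := by
    intro t h1
    have : (t ^ 3)⁻¹ ≤ 8 := by
      rw [inv_le_comm₀ (by positivity) (by norm_num)]
      calc (8:ℝ)⁻¹ = (1/2) ^ 3 := by norm_num
        _ ≤ t ^ 3 := by gcongr
    exact (ENNReal.ofReal_le_ofReal this).trans (by norm_num)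
  have hswap : ∫⁻ x in U, ∫⁻ y in U, ∫⁻ t in Ioc (0:ℝ) 1, g (x + t • (y - x))
      = ∫⁻ t in Ioc (0:ℝ) 1, ∫⁻ x in U, ∫⁻ y in U, g (x + t • (y - x)) := by
    have h1 : ∀ x : E3, ∫⁻ y in U, ∫⁻ t in Ioc (0:ℝ) 1, g (x + t • (y - x))
        = ∫⁻ t in Ioc (0:ℝ) 1, ∫⁻ y in U, g (x + t • (y - x)) := by
      intro x
      rw [lintegral_lintegral_swap]
      exact (hmeas.comp
        (by fun_prop : Measurable fun p : E3 × ℝ => ((x, p.1), p.2))).aemeasurable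
    rw [lintegral_congr h1, lintegral_lintegral_swap]
    have hm3 : Measurable fun q : (E3 × ℝ) × E3 => g (q.1.1 + q.1.2 • (q.2 - q.1.1)) :=
      hmeas.comp (by fun_prop : Measurable fun q : (E3 × ℝ) × E3 => ((q.1.1, q.2), q.1.2))
    exact hm3.lintegral_prod_right'.aemeasurable
  have hbound : ∀ t ∈ Ioc (0:ℝ) 1, ∫⁻ x in U, ∫⁻ y in U, g (x + t • (y - x))
      ≤ 8 * volume U * ∫⁻ x in U, g x := by
    intro t ht
    have hconst : ∫⁻ _ in U, 8 * ∫⁻ y in U, g y = 8 * volume U * ∫⁻ x in U, g x := by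
      rw [setLIntegral_const]; ring
    rw [← hconst]
    rcases le_total (1/2) t with h1 | h1
    · refine setLIntegral_mono' hUm fun x hx => ?_
      have := hU.lintegral_combo_le (t := 1 - t) ⟨by linarith [ht.2], by linarith⟩
        (subset_closure hx) g
      rw [sub_sub_cancel] at this
      refine le_trans (le_of_eq (lintegral_congr fun y => ?_)) (this.trans ?_)
      · congr 1; module
      · gcongr; exact h8 t h1
    · have hm2 : Measurable fun p : E3 × E3 => g (p.1 + t • (p.2 - p.1)) := hg.comp (by fun_prop)
      rw [lintegral_lintegral_swap (f := fun x y => g (x + t • (y - x))) hm2.aemeasurable]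
      refine setLIntegral_mono' hUm fun y hy => ?_
      refine (hU.lintegral_combo_le (t := t) ⟨ht.1.le, by linarith⟩
        (subset_closure hy) g).trans ?_
      gcongr
      exact h8 _ (by linarith)
  rw [hswap]
  refine (setLIntegral_mono' measurableSet_Ioc hbound).trans ?_
  rw [setLIntegral_const]; simp

theorem poincare_double (hU : ConvexElement U h) {ψ : E3 → E3} (hψ : ContDiff ℝ 1 ψ) :
    ∫⁻ x in U, ∫⁻ y in U, ‖ψ y - ψ x‖ₑ ^ 2 ≤ ENNReal.ofReal (h ^ 2) *
      (8 * volume U * eLpNorm (fderiv ℝ ψ) 2 (volume.restrict U) ^ 2) := by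
  have hcf : Continuous (fderiv ℝ ψ) := hψ.continuous_fderiv (by norm_num)
  have hUm := hU.isOpen.measurableSet
  rw [sq_eLpNorm_two]
  have hg : Measurable fun x => ‖fderiv ℝ ψ x‖ₑ ^ 2 := by fun_prop
  refine le_trans ?_ (mul_le_mul_right (hU.lintegral_segment_le hg) _)
  rw [← lintegral_const_mul' _ _ ENNReal.ofReal_ne_top]
  refine setLIntegral_mono' hUm fun x hx => ?_
  rw [← lintegral_const_mul' _ _ ENNReal.ofReal_ne_top]
  refine setLIntegral_mono' hUm fun y hy => enorm_sub_sq_le hψ ?_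
  rw [← dist_eq_norm]
  exact hU.dist_le _ (subset_closure hy) _ (subset_closure hx)

theorem memLp_of_continuousOn (hU : ConvexElement U h) {F : Type*} [NormedAddCommGroup F]
    {f : E3 → F} (hf : ContinuousOn f (closure U)) (p : ℝ≥0∞) :
    MemLp f p (volume.restrict U) := by
  obtain ⟨C, hC⟩ := hU.isCompact_closure.exists_bound_of_continuousOn hf
  have : IsFiniteMeasure (volume.restrict U) := ⟨by simpa using hU.volume_ne_top.lt_top⟩
  refine MemLp.of_bound (C := C) ?_ ?_
  · exact (hf.mono subset_closure).aestronglyMeasurable hU.isOpen.measurableSet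
  · filter_upwards [ae_restrict_mem hU.isOpen.measurableSet] with x hx
    exact hC x (subset_closure hx)

theorem exists_mean (hU : ConvexElement U h) {ψ : E3 → E3} (hψ : ContDiff ℝ 1 ψ) :
    ∃ m : E3, l2Norm U (fun x => ψ x - m) ≤ 3 * ENNReal.ofReal h *
      eLpNorm (fderiv ℝ ψ) 2 (volume.restrict U) := by
  have hh := hU.h_nonneg
  have hcf : Continuous (fderiv ℝ ψ) := hψ.continuous_fderiv (by norm_num)
  have h2 := hU.poincare_double hψ
  set D := eLpNorm (fderiv ℝ ψ) 2 (volume.restrict U)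
  have hm : Measurable fun p : E3 × E3 => ‖ψ p.2 - ψ p.1‖ₑ ^ 2 := by
    have := hψ.continuous
    have : Continuous fun p : E3 × E3 => ψ p.2 - ψ p.1 := by fun_prop
    exact this.measurable.enorm.pow_const 2
  obtain ⟨x, -, hx⟩ := exists_le_setLAverage hU.volume_ne_zero hU.volume_ne_top
    hm.lintegral_prod_right'.aemeasurable (f := fun x => ∫⁻ y in U, ‖ψ y - ψ x‖ₑ ^ 2)
  refine ⟨ψ x, ENNReal_le_of_sq_le ?_⟩
  rw [l2Norm, sq_eLpNorm_two]
  refine hx.trans ?_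
  rw [setLAverage_eq]
  refine ENNReal.div_le_of_le_mul (h2.trans ?_)
  rw [mul_pow, mul_pow, ← ENNReal.ofReal_pow hh]
  calc ENNReal.ofReal (h ^ 2) * (8 * volume U * D ^ 2)
      = 8 * (ENNReal.ofReal (h ^ 2) * (volume U * D ^ 2)) := by ring
    _ ≤ 3 ^ 2 * (ENNReal.ofReal (h ^ 2) * (volume U * D ^ 2)) := by gcongr; norm_num
    _ = _ := by ring

end ConvexElement

/-! ### Weak gradients -/

theorem setIntegral_eq_of_tsupport_subset {F : Type*} [NormedAddCommGroup F] [NormedSpace ℝ F]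
    {U : Set E3} {f : E3 → F} (h : Function.support f ⊆ U) : ∫ x in U, f x = ∫ x, f x :=
  setIntegral_eq_integral_of_forall_compl_eq_zero fun x hx => by
    by_contra h0; exact hx (h h0)

theorem MemLp.integrable_smul_two {F : Type*} [NormedAddCommGroup F] [NormedSpace ℝ F]
    {μ : Measure E3} {φ : E3 → ℝ} {f : E3 → F} (hφ : MemLp φ 2 μ) (hf : MemLp f 2 μ) :
    Integrable (fun x => φ x • f x) μ :=
  memLp_one_iff_integrable.1 (hf.smul hφ)

theorem integrable_smul_of_memLp {F : Type*} [NormedAddCommGroup F] [NormedSpace ℝ F] {U : Set E3}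
    {φ : E3 → ℝ} (hφ : Continuous φ) (hc : HasCompactSupport φ) {f : E3 → F}
    (hf : MemLp f 2 (volume.restrict U)) :
    Integrable (fun x => φ x • f x) (volume.restrict U) :=
  MemLp.integrable_smul_two (hφ.memLp_of_hasCompactSupport hc) hf

theorem continuous_pderiv {φ : E3 → ℝ} (hφ : ContDiff ℝ ∞ φ) (v : E3) :
    Continuous fun x => fderiv ℝ φ x v := by
  have := hφ.continuous_fderiv (by simp)
  fun_prop

theorem hasCompactSupport_pderiv {φ : E3 → ℝ} (hc : HasCompactSupport φ) (v : E3) :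
    HasCompactSupport fun x => fderiv ℝ φ x v :=
  (hc.fderiv ℝ).comp_left (g := fun L : E3 →L[ℝ] ℝ => L v) (by simp)

theorem IsWeakGrad.mono {U V : Set E3} {Ψ : E3 → E3} {G : Fin 3 → E3 → E3}
    (h : IsWeakGrad U Ψ G) (hV : V ⊆ U) : IsWeakGrad V Ψ G := by
  refine ⟨fun i => (h.1 i).mono_measure (Measure.restrict_mono hV le_rfl), fun i φ hφ hc hs => ?_⟩
  have h1 := h.2 i φ hφ hc (hs.trans hV)
  have hsφ := (subset_tsupport φ).trans hs
  have hs' : Function.support (fun x => fderiv ℝ φ x (unitVec i)) ⊆ V := by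
    refine Subset.trans (fun x hx => ?_) hs
    apply support_fderiv_subset ℝ
    intro h0
    exact hx (by simp [h0])
  have a1 : Function.support (fun x => fderiv ℝ φ x (unitVec i) • Ψ x) ⊆ V :=
    (Function.support_smul_subset_left _ _).trans hs'
  have a2 : Function.support (fun x => φ x • G i x) ⊆ V :=
    (Function.support_smul_subset_left _ _).trans hsφ
  rw [setIntegral_eq_of_tsupport_subset (a1.trans hV),
    setIntegral_eq_of_tsupport_subset (a2.trans hV)] at h1
  rwa [setIntegral_eq_of_tsupport_subset a1, setIntegral_eq_of_tsupport_subset a2]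

theorem IsWeakGrad.ae_eq {U : Set E3} (hU : IsOpen U) {Ψ : E3 → E3} {G G' : Fin 3 → E3 → E3}
    (h : IsWeakGrad U Ψ G) (h' : IsWeakGrad U Ψ G') (i : Fin 3) :
    G i =ᵐ[volume.restrict U] G' i := by
  have hl : LocallyIntegrableOn (G i - G' i) U := by
    have := ((h.1 i).sub (h'.1 i)).locallyIntegrable (by norm_num)
    exact locallyIntegrableOn_of_locallyIntegrable_restrict this
  have := hU.ae_eq_zero_of_integral_contDiff_smul_eq_zero hl (fun φ hφ hc hs => by
    have hsφ : Function.support (fun x => φ x • (G i - G' i) x) ⊆ U :=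
      (Function.support_smul_subset_left _ _).trans ((subset_tsupport φ).trans hs)
    rw [← setIntegral_eq_of_tsupport_subset hsφ]
    have e1 := h.2 i φ hφ hc hs
    have e2 := h'.2 i φ hφ hc hs
    simp only [Pi.sub_apply, smul_sub]
    rw [integral_sub (integrable_smul_of_memLp hφ.continuous hc (h.1 i))
      (integrable_smul_of_memLp hφ.continuous hc (h'.1 i)), sub_eq_zero, ← neg_inj, ← e1, ← e2])
  refine (ae_restrict_iff' hU.measurableSet).2 (this.mono fun x hx hxU => ?_)
  exact sub_eq_zero.1 (hx hxU)

theorem IsWeakGrad.lincomb {U : Set E3} {Ψ Φ : E3 → E3} {G H : Fin 3 → E3 → E3}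
    (hΨ : MemLp Ψ 2 (volume.restrict U)) (hΦ : MemLp Φ 2 (volume.restrict U))
    (h : IsWeakGrad U Ψ G) (h' : IsWeakGrad U Φ H) (α β : ℝ) :
    IsWeakGrad U (α • Ψ + β • Φ) (fun i => α • G i + β • H i) := by
  refine ⟨fun i => ((h.1 i).const_smul α).add ((h'.1 i).const_smul β), fun i φ hφ hc hs => ?_⟩
  have c1 := continuous_pderiv hφ (unitVec i)
  have c2 := hasCompactSupport_pderiv hc (unitVec i)
  have e : ∀ (f : E3 → ℝ) (A B : E3 → E3) (x : E3),
      f x • (α • A + β • B) x = α • (f x • A x) + β • (f x • B x) := by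
    intro f A B x; simp only [Pi.add_apply, Pi.smul_apply]; module
  simp_rw [e φ, e (fun x => fderiv ℝ φ x (unitVec i))]
  have key : ∀ (f : E3 → ℝ) (A B : E3 → E3), Continuous f → HasCompactSupport f →
      MemLp A 2 (volume.restrict U) → MemLp B 2 (volume.restrict U) →
      ∫ x in U, α • (f x • A x) + β • (f x • B x)
        = α • (∫ x in U, f x • A x) + β • ∫ x in U, f x • B x := by
    intro f A B hf hfc hA hB
    rw [integral_add (f := fun x => α • (f x • A x)) (g := fun x => β • (f x • B x))
      ((integrable_smul_of_memLp hf hfc hA).smul α) ((integrable_smul_of_memLp hf hfc hB).smul β),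
      integral_smul, integral_smul]
  rw [key _ _ _ c1 c2 hΨ hΦ, key _ _ _ hφ.continuous hc (h.1 i) (h'.1 i)]
  rw [h.2 i φ hφ hc hs, h'.2 i φ hφ hc hs]
  module

theorem IsWeakGrad.sub {U : Set E3} {Ψ Φ : E3 → E3} {G H : Fin 3 → E3 → E3}
    (hΨ : MemLp Ψ 2 (volume.restrict U)) (hΦ : MemLp Φ 2 (volume.restrict U))
    (h : IsWeakGrad U Ψ G) (h' : IsWeakGrad U Φ H) :
    IsWeakGrad U (Ψ - Φ) (fun i => G i - H i) := by
  have := IsWeakGrad.lincomb hΨ hΦ h h' 1 (-1)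
  simpa [sub_eq_add_neg] using this

theorem integral_pderiv_smul {ψ : E3 → E3} (hψ : ContDiff ℝ 1 ψ) {φ : E3 → ℝ}
    (hφ : ContDiff ℝ 1 φ) (hc : HasCompactSupport φ) (v : E3) :
    ∫ x, fderiv ℝ φ x v • ψ x = - ∫ x, φ x • fderiv ℝ ψ x v := by
  have h1 := hφ.continuous_fderiv (by norm_num)
  have h2 := hψ.continuous_fderiv (by norm_num)
  have h3 := hψ.continuous
  have h4 := hφ.continuous
  have hcd : HasCompactSupport fun x => fderiv ℝ φ x v :=
    (hc.fderiv ℝ).comp_left (g := fun L : E3 →L[ℝ] ℝ => L v) (by simp)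
  rw [integral_smul_fderiv_eq_neg_fderiv_smul_of_integrable, neg_neg]
  · exact Continuous.integrable_of_hasCompactSupport (by fun_prop) hcd.smul_right
  · exact Continuous.integrable_of_hasCompactSupport (by fun_prop) hc.smul_right
  · exact Continuous.integrable_of_hasCompactSupport (by fun_prop) hc.smul_right
  · exact fun x _ => hφ.differentiable (by norm_num) x
  · exact fun x _ => hψ.differentiable (by norm_num) x

theorem isWeakGrad_of_contDiff {U : Set E3} {ψ : E3 → E3} (hψ : ContDiff ℝ 1 ψ)
    (hm : ∀ i, MemLp (fun x => fderiv ℝ ψ x (unitVec i)) 2 (volume.restrict U)) :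
    IsWeakGrad U ψ (fun i x => fderiv ℝ ψ x (unitVec i)) := by
  refine ⟨hm, fun i φ hφ hc hs => ?_⟩
  have hs' : Function.support (fun x => fderiv ℝ φ x (unitVec i)) ⊆ U := by
    refine Subset.trans (fun x hx => ?_) hs
    apply support_fderiv_subset ℝ
    intro h0
    exact hx (by simp [h0])
  have a1 : Function.support (fun x => fderiv ℝ φ x (unitVec i) • ψ x) ⊆ U :=
    (Function.support_smul_subset_left _ _).trans hs'
  have a2 : Function.support (fun x => φ x • fderiv ℝ ψ x (unitVec i)) ⊆ U :=
    (Function.support_smul_subset_left _ _).trans ((subset_tsupport φ).trans hs)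
  rw [setIntegral_eq_of_tsupport_subset a1, setIntegral_eq_of_tsupport_subset a2]
  exact integral_pderiv_smul hψ (hφ.of_le (by simp)) hc _

theorem h1Seminorm_eq {U : Set E3} (hU : IsOpen U) {Ψ : E3 → E3} {G : Fin 3 → E3 → E3}
    (hG : IsWeakGrad U Ψ G) :
    h1Seminorm U Ψ = (∑ i, l2Norm U (G i) ^ 2) ^ (1 / 2 : ℝ) := by
  apply le_antisymm (iInf₂_le G hG)
  refine le_iInf₂ fun G' hG' => le_of_eq ?_
  congr 1
  refine Finset.sum_congr rfl fun i _ => ?_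
  rw [l2Norm, l2Norm, eLpNorm_congr_ae (hG.ae_eq hU hG' i)]

theorem l2Norm_le_h1Norm (U : Set E3) (Ψ : E3 → E3) : l2Norm U Ψ ≤ h1Norm U Ψ := by
  apply ENNReal_le_of_sq_le
  rw [h1Norm, rpow_half_sq]
  exact le_self_add

theorem h1Seminorm_le_h1Norm (U : Set E3) (Ψ : E3 → E3) : h1Seminorm U Ψ ≤ h1Norm U Ψ := by
  apply ENNReal_le_of_sq_le
  rw [h1Norm, rpow_half_sq]
  exact le_add_self

theorem sqrt_sum_sq_le (a : Fin 3 → ℝ≥0∞) : (∑ i, a i ^ 2) ^ (1 / 2 : ℝ) ≤ ∑ i, a i := by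
  apply ENNReal_le_of_sq_le
  rw [rpow_half_sq]
  simp only [Fin.sum_univ_three]
  calc a 0 ^ 2 + a 1 ^ 2 + a 2 ^ 2 ≤ a 0 ^ 2 + a 1 ^ 2 + a 2 ^ 2
        + 2 * (a 0 * a 1 + a 0 * a 2 + a 1 * a 2) := le_self_add
    _ = _ := by ring

theorem l2Norm_le_h1Seminorm {U : Set E3} (hU : IsOpen U) {Ψ : E3 → E3} {G : Fin 3 → E3 → E3}
    (hG : IsWeakGrad U Ψ G) (i : Fin 3) : l2Norm U (G i) ≤ h1Seminorm U Ψ := by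
  apply ENNReal_le_of_sq_le
  rw [h1Seminorm_eq hU hG, rpow_half_sq]
  exact Finset.single_le_sum (f := fun i => l2Norm U (G i) ^ 2) (fun _ _ => zero_le)
    (Finset.mem_univ i)

theorem h1Norm_le {U : Set E3} (hU : IsOpen U) {Ψ : E3 → E3} {G : Fin 3 → E3 → E3}
    (hG : IsWeakGrad U Ψ G) : h1Norm U Ψ ≤ l2Norm U Ψ + ∑ i, l2Norm U (G i) := by
  have h := h1Seminorm_eq hU hG ▸ sqrt_sum_sq_le (fun i => l2Norm U (G i))
  apply ENNReal_le_of_sq_le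
  rw [h1Norm, rpow_half_sq]
  refine (add_le_add le_rfl (pow_le_pow_left₀ zero_le h 2)).trans ?_
  set A := l2Norm U Ψ
  set B := ∑ i, l2Norm U (G i)
  calc A ^ 2 + B ^ 2 ≤ A ^ 2 + B ^ 2 + 2 * (A * B) := le_self_add
    _ = _ := by ring

theorem norm_fderiv_le_sum (ψ : E3 → E3) (x : E3) :
    ‖fderiv ℝ ψ x‖ ≤ ∑ i, ‖fderiv ℝ ψ x (unitVec i)‖ := by
  refine ContinuousLinearMap.opNorm_le_bound _ (Finset.sum_nonneg fun _ _ => norm_nonneg _)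
    fun v => ?_
  conv_lhs => rw [eq_sum_unitVec v]
  have hv : ∀ i, |v i| ≤ ‖v‖ := fun i => PiLp.norm_apply_le v i
  simp only [map_add, map_smul, Fin.sum_univ_three]
  refine (norm_add₃_le).trans ?_
  rw [norm_smul, norm_smul, norm_smul, Real.norm_eq_abs, Real.norm_eq_abs, Real.norm_eq_abs]
  have h0 := mul_le_mul_of_nonneg_right (hv 0) (norm_nonneg (fderiv ℝ ψ x (unitVec 0)))
  have h1 := mul_le_mul_of_nonneg_right (hv 1) (norm_nonneg (fderiv ℝ ψ x (unitVec 1)))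
  have h2 := mul_le_mul_of_nonneg_right (hv 2) (norm_nonneg (fderiv ℝ ψ x (unitVec 2)))
  linarith

theorem eLpNorm_fderiv_le {ψ : E3 → E3} (hψ : ContDiff ℝ 1 ψ) (U : Set E3) :
    eLpNorm (fderiv ℝ ψ) 2 (volume.restrict U)
      ≤ ∑ i, l2Norm U (fun x => fderiv ℝ ψ x (unitVec i)) := by
  have hcf : Continuous (fderiv ℝ ψ) := hψ.continuous_fderiv (by norm_num)
  have hc : ∀ i, AEStronglyMeasurable (fun x => ‖fderiv ℝ ψ x (unitVec i)‖)
      (volume.restrict U) := fun i => by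
    apply Continuous.aestronglyMeasurable; fun_prop
  have : eLpNorm (fderiv ℝ ψ) 2 (volume.restrict U)
      ≤ eLpNorm (∑ i, fun x => ‖fderiv ℝ ψ x (unitVec i)‖) 2 (volume.restrict U) := by
    refine eLpNorm_mono fun x => ?_
    rw [Finset.sum_apply]
    exact (norm_fderiv_le_sum ψ x).trans (le_abs_self _)
  refine this.trans ((eLpNorm_sum_le (fun i _ => hc i) (by norm_num)).trans (le_of_eq ?_))
  refine Finset.sum_congr rfl fun i _ => ?_
  rw [l2Norm, eLpNorm_norm]

/-- The curl computed from a family of partial derivatives. -/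
noncomputable def gradCurl (G : Fin 3 → E3 → E3) (x : E3) : E3 :=
  !₂[G 1 x 2 - G 2 x 1, G 2 x 0 - G 0 x 2, G 0 x 1 - G 1 x 0]

theorem curl_eq_gradCurl (ψ : E3 → E3) (x : E3) :
    curl ψ x = gradCurl (fun i x => fderiv ℝ ψ x (unitVec i)) x := rfl

/-! ### Smoothing by averages of convex combinations -/

/-- A smooth probability density with compact support in `U`. -/
structure IsKernel (U : Set E3) (η : E3 → ℝ) : Prop where
  contDiff : ContDiff ℝ ∞ η
  nonneg : ∀ y, 0 ≤ η y
  integral_eq : ∫ y, η y = 1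
  compact : HasCompactSupport η
  subset : tsupport η ⊆ U

theorem exists_isKernel {U : Set E3} (hU : IsOpen U) (hne : U.Nonempty) : ∃ η, IsKernel U η := by
  obtain ⟨c, hc⟩ := hne
  obtain ⟨r, hr, hrU⟩ := Metric.nhds_basis_closedBall.mem_iff.1 (hU.mem_nhds hc)
  let f : ContDiffBump c := ⟨r / 2, r, by positivity, by linarith⟩
  refine ⟨f.normed volume, f.contDiff_normed, f.nonneg_normed, f.integral_normed,
    f.hasCompactSupport_normed, ?_⟩
  rw [f.tsupport_normed_eq]
  exact hrU

/-- Average of `f` over convex combinations of `x` with the points of the kernel `η`. -/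
noncomputable def smoothing (η : E3 → ℝ) (U : Set E3) (s : ℝ) (f : E3 → E3) (x : E3) : E3 :=
  ∫ y, η y • U.indicator f ((1 - s) • x + s • y)

namespace IsKernel

variable {U : Set E3} {h : ℝ} {η : E3 → ℝ} {s : ℝ}

theorem combo_mem (hη : IsKernel U η) (hU : ConvexElement U h) (hs : s ∈ Ioc (0:ℝ) 1) {x y : E3}
    (hx : x ∈ closure U) (hy : η y ≠ 0) : (1 - s) • x + s • y ∈ U := by
  have := hU.combo_mem hx (hη.subset (subset_tsupport _ hy)) hs
  convert! this using 1; module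

theorem memLp_comp (hU : ConvexElement U h) (hs : s ≠ 0) {f : E3 → E3}
    (hf : MemLp f 2 (volume.restrict U)) (x : E3) :
    MemLp (fun y => U.indicator f ((1 - s) • x + s • y)) 2 volume := by
  have h1 : MemLp (U.indicator f) 2 volume := (memLp_indicator_iff_restrict hU.isOpen.measurableSet).2 hf
  have h2 : MemLp (U.indicator f) 2
      (Measure.map (fun y => s • y + (1 - s) • x) (volume : Measure E3)) := by
    rw [map_homothety_volume hs]
    exact h1.smul_measure ENNReal.ofReal_ne_top
  have := (measurableEmbedding_homothety hs ((1 - s) • x)).memLp_map_measure_iff.1 h2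
  convert! this using 2 with y
  simp [add_comm]

theorem integrable (hη : IsKernel U η) (hU : ConvexElement U h) (hs : s ≠ 0) {f : E3 → E3}
    (hf : MemLp f 2 (volume.restrict U)) (x : E3) :
    Integrable fun y => η y • U.indicator f ((1 - s) • x + s • y) :=
  MemLp.integrable_smul_two (hη.contDiff.continuous.memLp_of_hasCompactSupport hη.compact)
    (memLp_comp hU hs hf x)

theorem smoothing_sub (hη : IsKernel U η) (hU : ConvexElement U h) (hs : s ≠ 0) {f g : E3 → E3}
    (hf : MemLp f 2 (volume.restrict U)) (hg : MemLp g 2 (volume.restrict U)) (x : E3) :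
    smoothing η U s (f - g) x = smoothing η U s f x - smoothing η U s g x := by
  unfold smoothing
  rw [← integral_sub (hη.integrable hU hs hf x) (hη.integrable hU hs hg x)]
  refine integral_congr_ae (Eventually.of_forall fun y => ?_)
  simp only [indicator_sub']
  simp [smul_sub]

theorem integrable_self (hη : IsKernel U η) : Integrable η :=
  hη.contDiff.continuous.integrable_of_hasCompactSupport hη.compact

theorem norm_smoothing_sub_le (hη : IsKernel U η) (hU : ConvexElement U h) (hs : s ∈ Ioc (0:ℝ) 1)
    {f : E3 → E3} (hf : MemLp f 2 (volume.restrict U)) {x : E3} (hx : x ∈ closure U) {c : E3} {ε : ℝ}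
    (hc : ∀ y, η y ≠ 0 → ‖f ((1 - s) • x + s • y) - c‖ ≤ ε) :
    ‖smoothing η U s f x - c‖ ≤ ε := by
  have h1 : smoothing η U s f x - c = ∫ y, η y • (U.indicator f ((1 - s) • x + s • y) - c) := by
    simp_rw [smul_sub]
    rw [integral_sub (hη.integrable hU hs.1.ne' hf x) (hη.integrable_self.smul_const c),
      integral_smul_const, hη.integral_eq, one_smul, smoothing]
  rw [h1]
  calc ‖∫ y, η y • (U.indicator f ((1 - s) • x + s • y) - c)‖
      ≤ ∫ y, η y * ε := by
        refine norm_integral_le_of_norm_le (hη.integrable_self.mul_const ε)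
          (Eventually.of_forall fun y => ?_)
        rw [norm_smul, Real.norm_of_nonneg (hη.nonneg y)]
        by_cases hy : η y = 0
        · simp [hy]
        · rw [indicator_of_mem (hη.combo_mem hU hs hx hy)]
          exact mul_le_mul_of_nonneg_left (hc y hy) (hη.nonneg y)
    _ = ε := by rw [integral_mul_const, hη.integral_eq, one_mul]

theorem eventually_norm_smoothing_sub_le (hη : IsKernel U η) (hU : ConvexElement U h)
    {f : E3 → E3} (hf : ContinuousOn f (closure U)) {ε : ℝ} (hε : 0 < ε) :
    ∀ᶠ s in 𝓝[>] (0:ℝ), ∀ x ∈ closure U, ‖smoothing η U s f x - f x‖ ≤ ε := by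
  have huc := hU.isCompact_closure.uniformContinuousOn_of_continuous hf
  obtain ⟨δ, hδ, hd⟩ := Metric.uniformContinuousOn_iff.1 huc ε hε
  have hh := hU.h_nonneg
  have hpos : 0 < min 1 (δ / (h + 1)) := by positivity
  filter_upwards [Ioo_mem_nhdsGT hpos] with s hs x hx
  have hs1 : s < 1 := hs.2.trans_le (min_le_left _ _)
  have hs2 : s * (h + 1) < δ := by
    have := hs.2.trans_le (min_le_right _ _)
    rwa [lt_div_iff₀ (by positivity)] at this
  refine hη.norm_smoothing_sub_le hU ⟨hs.1, hs1.le⟩ (hU.memLp_of_continuousOn hf 2) hx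
    fun y hy => ?_
  have hm := hη.combo_mem hU ⟨hs.1, hs1.le⟩ hx hy
  rw [← dist_eq_norm]
  refine (hd _ (subset_closure hm) _ hx ?_).le
  rw [dist_eq_norm, show (1 - s) • x + s • y - x = s • (y - x) by module, norm_smul,
    Real.norm_of_nonneg hs.1.le, ← dist_eq_norm]
  have := hU.dist_le y (subset_closure (hη.subset (subset_tsupport _ hy))) x hx
  have hs0 : 0 < s := hs.1
  nlinarith

theorem l2Norm_smoothing_le (hη : IsKernel U η) (hU : ConvexElement U h)
    (hs : s ∈ Ioc (0:ℝ) (1/2)) {f : E3 → E3} (hf : MemLp f 2 (volume.restrict U)) :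
    l2Norm U (smoothing η U s f) ≤ 3 * l2Norm U f := by
  have hUm := hU.isOpen.measurableSet
  have hs' : s ∈ Ioc (0:ℝ) 1 := ⟨hs.1, hs.2.trans (by norm_num)⟩
  have hηc := hη.contDiff.continuous
  have hf1 : MemLp (U.indicator f) 2 volume := (memLp_indicator_iff_restrict hUm).2 hf
  apply ENNReal_le_of_sq_le
  rw [l2Norm, sq_eLpNorm_two, mul_pow, l2Norm, sq_eLpNorm_two]
  have hint : ∫⁻ y, ENNReal.ofReal (η y) = 1 := by
    rw [← ofReal_integral_eq_lintegral_ofReal hη.integrable_self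
      (Eventually.of_forall hη.nonneg), hη.integral_eq, ENNReal.ofReal_one]
  have h1 : ∀ x, ‖smoothing η U s f x‖ₑ ^ 2 ≤
      ∫⁻ y, ENNReal.ofReal (η y) * ‖U.indicator f ((1 - s) • x + s • y)‖ₑ ^ 2 := by
    intro x
    have hmeas : AEMeasurable (fun y => ‖U.indicator f ((1 - s) • x + s • y)‖ₑ) volume :=
      (memLp_comp hU hs.1.ne' hf x).aestronglyMeasurable.enorm
    have hsq : ∀ y, ENNReal.ofReal (√(η y)) * ENNReal.ofReal (√(η y)) = ENNReal.ofReal (η y) :=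
      fun y => by rw [← ENNReal.ofReal_mul (Real.sqrt_nonneg _), Real.mul_self_sqrt (hη.nonneg y)]
    have e1 : ‖smoothing η U s f x‖ₑ ≤ ∫⁻ y, ENNReal.ofReal (√(η y)) *
        (ENNReal.ofReal (√(η y)) * ‖U.indicator f ((1 - s) • x + s • y)‖ₑ) := by
      refine (enorm_integral_le_lintegral_enorm _).trans (lintegral_mono fun y => ?_)
      rw [enorm_smul, ← mul_assoc, hsq, Real.enorm_of_nonneg (hη.nonneg y)]
    refine (pow_le_pow_left₀ zero_le e1 2).trans ((lintegral_sq_le volume (by fun_prop)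
      (by fun_prop)).trans (le_of_eq ?_))
    simp_rw [mul_pow, sq (ENNReal.ofReal _), hsq]
    rw [hint, one_mul]
  have hmeas2 : AEMeasurable (Function.uncurry fun x y : E3 => ENNReal.ofReal (η y) *
      ‖U.indicator f ((1 - s) • x + s • y)‖ₑ ^ 2) ((volume.restrict U).prod volume) := by
    have hq : Measure.QuasiMeasurePreserving (fun p : E3 × E3 => (1 - s) • p.1 + s • p.2)
        ((volume.restrict U).prod volume) volume := by
      refine ⟨by fun_prop, ?_⟩
      refine Measure.AbsolutelyContinuous.mk fun A hA h0 => ?_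
      rw [Measure.map_apply (by fun_prop) hA, Measure.prod_apply (by measurability)]
      have : ∀ x : E3, volume (Prod.mk x ⁻¹' ((fun p : E3 × E3 => (1 - s) • p.1 + s • p.2) ⁻¹' A))
          = 0 := by
        intro x
        have e := map_homothety_volume hs.1.ne' ((1 - s) • x)
        have e2 := Measure.map_apply (μ := (volume : Measure E3))
          (f := fun y => s • y + (1 - s) • x) (by fun_prop) hA
        rw [e, Measure.smul_apply, h0, smul_zero] at e2
        rw [e2]
        congr 1; ext y; simp [add_comm]
      simp [this]
    have hf2 : AEMeasurable (fun z => ‖U.indicator f z‖ₑ ^ 2) volume :=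
      hf1.aestronglyMeasurable.enorm.pow_const 2
    have := hf2.comp_quasiMeasurePreserving hq
    refine AEMeasurable.mul ?_ this
    exact (by fun_prop : Measurable fun p : E3 × E3 => ENNReal.ofReal (η p.2)).aemeasurable
  calc ∫⁻ x in U, ‖smoothing η U s f x‖ₑ ^ 2
      ≤ ∫⁻ x in U, ∫⁻ y, ENNReal.ofReal (η y) *
          ‖U.indicator f ((1 - s) • x + s • y)‖ₑ ^ 2 := lintegral_mono h1
    _ = ∫⁻ y, ∫⁻ x in U, ENNReal.ofReal (η y) *
          ‖U.indicator f ((1 - s) • x + s • y)‖ₑ ^ 2 := lintegral_lintegral_swap hmeas2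
    _ ≤ ∫⁻ y, ENNReal.ofReal (η y) * (8 * ∫⁻ x in U, ‖f x‖ₑ ^ 2) := by
        refine lintegral_mono fun y => ?_
        rw [lintegral_const_mul' _ _ ENNReal.ofReal_ne_top]
        by_cases hy : η y = 0
        · simp [hy]
        gcongr
        have hyU := hη.subset (subset_tsupport _ hy)
        have := hU.lintegral_combo_le (t := s) ⟨hs.1.le, by linarith [hs.2]⟩
          (subset_closure hyU) (fun z => ‖f z‖ₑ ^ 2)
        refine le_trans (le_of_eq ?_) (this.trans ?_)
        · refine setLIntegral_congr_fun hUm fun x hx => ?_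
          rw [indicator_of_mem (hη.combo_mem hU hs' (subset_closure hx) hy),
            show x + s • (y - x) = (1 - s) • x + s • y by module]
        · gcongr
          have h0 : (1:ℝ)/2 ≤ 1 - s := by linarith [hs.2]
          have : ((1 - s) ^ 3)⁻¹ ≤ 8 := by
            rw [inv_le_comm₀ (by positivity) (by norm_num)]
            calc (8:ℝ)⁻¹ = (1/2) ^ 3 := by norm_num
              _ ≤ (1 - s) ^ 3 := by gcongr
          exact (ENNReal.ofReal_le_ofReal this).trans (by norm_num)
    _ = 8 * ∫⁻ x in U, ‖f x‖ₑ ^ 2 := by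
        rw [lintegral_mul_const' _ _ (by
          have := hf.eLpNorm_ne_top
          rw [eLpNorm_two_eq] at this
          have h8 : ∫⁻ x in U, ‖f x‖ₑ ^ 2 ≠ ⊤ := by
            intro h9; rw [h9] at this; simp at this
          finiteness), hint, one_mul]
    _ ≤ _ := by gcongr; norm_num

end IsKernel

namespace IsKernel

variable {U : Set E3} {h : ℝ} {η : E3 → ℝ} {s : ℝ}

theorem smoothing_eq_convolution (s0 : s ≠ 0) (f : E3 → E3) (x : E3) :
    smoothing η U s f x = ∫ t, (|(s ^ 3)⁻¹| * η (s⁻¹ • (t - (1 - s) • x))) • U.indicator f t := by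
  have h1 : ∀ g : E3 → E3, ∫ y, g (s • y + (1 - s) • x) = |(s ^ 3)⁻¹| • ∫ t, g t := by
    intro g
    rw [← (measurableEmbedding_homothety s0 _).integral_map, map_homothety_volume s0,
      integral_smul_measure, ENNReal.toReal_ofReal (abs_nonneg _)]
  simp_rw [mul_smul]
  rw [integral_smul, ← h1, smoothing]
  refine integral_congr_ae (Eventually.of_forall fun y => ?_)
  have e : s⁻¹ • (s • y + (1 - s) • x - (1 - s) • x) = y := by
    rw [add_sub_cancel_right, smul_smul, inv_mul_cancel₀ s0, one_smul]
  simp only [e, add_comm]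

/-- The convolution kernel of `smoothing`. -/
noncomputable def convKernel (η : E3 → ℝ) (s : ℝ) (u : E3) : ℝ := |(s ^ 3)⁻¹| * η (-s⁻¹ • u)

theorem contDiff_convKernel (hη : IsKernel U η) (s : ℝ) : ContDiff ℝ ∞ (convKernel η s) := by
  have := hη.contDiff
  unfold convKernel
  fun_prop

theorem hasCompactSupport_convKernel (hη : IsKernel U η) (s0 : s ≠ 0) :
    HasCompactSupport (convKernel η s) := by
  have h1 := hη.compact.comp_homeomorph (Homeomorph.smulOfNeZero (-s⁻¹) (by simpa using s0))
  exact h1.mul_left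

theorem hasFDerivAt_smoothing (hη : IsKernel U η) (hU : ConvexElement U h) (s0 : s ≠ 0)
    {f : E3 → E3} (hf : MemLp f 2 (volume.restrict U)) :
    ContDiff ℝ ∞ (smoothing η U s f) ∧ ∀ x v, fderiv ℝ (smoothing η U s f) x v
      = (1 - s) • ∫ t, fderiv ℝ (convKernel η s) ((1 - s) • x - t) v • U.indicator f t := by
  have hUm := hU.isOpen.measurableSet
  have hf1 : MemLp (U.indicator f) 2 volume := (memLp_indicator_iff_restrict hUm).2 hf
  have hloc := hf1.locallyIntegrable (by norm_num)
  have hk := hη.contDiff_convKernel s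
  have hkc := hη.hasCompactSupport_convKernel s0
  have e : smoothing η U s f = fun x => (MeasureTheory.convolution (convKernel η s) (U.indicator f)
      (ContinuousLinearMap.lsmul ℝ ℝ) volume) ((1 - s) • x) := by
    ext1 x
    rw [smoothing_eq_convolution s0, convolution_eq_swap]
    refine integral_congr_ae (Eventually.of_forall fun t => ?_)
    simp only [convKernel, ContinuousLinearMap.lsmul_apply]
    rw [show s⁻¹ • (t - (1 - s) • x) = -s⁻¹ • ((1 - s) • x - t) by module]
  have hcd : ContDiff ℝ ∞ (MeasureTheory.convolution (convKernel η s) (U.indicator f)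
      (ContinuousLinearMap.lsmul ℝ ℝ) volume) := hkc.contDiff_convolution_left _ hk hloc
  refine ⟨by rw [e]; fun_prop, fun x v => ?_⟩
  have h1 := hkc.hasFDerivAt_convolution_left (ContinuousLinearMap.lsmul ℝ ℝ)
    (hk.of_le (by simp)) hloc ((1 - s) • x)
  have h2 : HasFDerivAt (fun x : E3 => (1 - s) • x) ((1 - s) • ContinuousLinearMap.id ℝ E3) x :=
    (hasFDerivAt_id x).const_smul (1 - s)
  have h3 := h1.comp x h2
  have h4 := (h3.congr_of_eventuallyEq (f₁ := smoothing η U s f)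
    (Eventually.of_forall fun y => congrFun e y)).fderiv
  rw [h4]
  simp only [ContinuousLinearMap.comp_apply, smul_apply,
    ContinuousLinearMap.id_apply, map_smul]
  congr 1
  rw [convolution_eq_swap, ContinuousLinearMap.integral_apply]
  · refine integral_congr_ae (Eventually.of_forall fun t => ?_)
    simp [ContinuousLinearMap.precompL_apply]
  · have h5 := ((hkc.fderiv ℝ).convolutionExists_left
      ((ContinuousLinearMap.lsmul ℝ ℝ (E := E3)).precompL E3)
      (hk.continuous_fderiv (by simp)) hloc ((1 - s) • x))
    exact h5.integrable_swap

theorem fderiv_smoothing (hη : IsKernel U η) (hU : ConvexElement U h) (hs : s ∈ Ioc (0:ℝ) 1)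
    {Ψ : E3 → E3} (hΨ : MemLp Ψ 2 (volume.restrict U)) {G : Fin 3 → E3 → E3}
    (hG : IsWeakGrad U Ψ G) {x : E3} (hx : x ∈ closure U) (i : Fin 3) :
    fderiv ℝ (smoothing η U s Ψ) x (unitVec i) = (1 - s) • smoothing η U s (G i) x := by
  have hUm := hU.isOpen.measurableSet
  have hs0 : s ≠ 0 := hs.1.ne'
  rw [(hη.hasFDerivAt_smoothing hU hs0 hΨ).2]
  congr 1
  have hk := hη.contDiff_convKernel s
  set φ : E3 → ℝ := fun t => convKernel η s ((1 - s) • x - t) with hφdef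
  have hφ : ContDiff ℝ ∞ φ := hk.comp (by fun_prop)
  have hφ' : ∀ t v, fderiv ℝ φ t v = - fderiv ℝ (convKernel η s) ((1 - s) • x - t) v := by
    intro t v
    have h1 : HasFDerivAt (fun t : E3 => (1 - s) • x - t) (-ContinuousLinearMap.id ℝ E3) t :=
      (hasFDerivAt_id t).const_sub _
    have h2 := ((hk.differentiable (by simp)) ((1 - s) • x - t)).hasFDerivAt.comp t h1
    have h3 : fderiv ℝ φ t = _ := h2.fderiv
    rw [h3]; simp
  have hsupp : tsupport φ ⊆ U ∧ HasCompactSupport φ := by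
    set A : E3 → E3 := fun y => s • y + (1 - s) • x
    have hAc : Continuous A := by fun_prop
    have hK : IsCompact (A '' tsupport η) := hη.compact.isCompact.image hAc
    have hsub : Function.support φ ⊆ A '' tsupport η := by
      intro t ht
      refine ⟨-s⁻¹ • ((1 - s) • x - t), subset_tsupport _ ?_, ?_⟩
      · intro h0; apply ht; simp only [hφdef, convKernel, h0, mul_zero]
      · simp only [A]
        rw [smul_smul, mul_neg, mul_inv_cancel₀ hs0]; module
    have hsub' : tsupport φ ⊆ A '' tsupport η := closure_minimal hsub hK.isClosed
    refine ⟨hsub'.trans ?_, HasCompactSupport.of_support_subset_isCompact hK hsub⟩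
    rintro _ ⟨y, hy, rfl⟩
    have := hU.combo_mem hx (hη.subset hy) hs
    convert! this using 1; module
  have key := hG.2 i φ hφ hsupp.2 hsupp.1
  have e1 : ∀ (f : E3 → ℝ) (g : E3 → E3), ∫ t, f t • U.indicator g t = ∫ t in U, f t • g t := by
    intro f g
    rw [← integral_indicator hUm]
    refine integral_congr_ae (Eventually.of_forall fun t => ?_)
    by_cases ht : t ∈ U <;> simp [ht]
  rw [e1, smoothing_eq_convolution hs0, e1]
  simp_rw [hφ', neg_smul] at key
  rw [integral_neg, neg_inj] at key
  rw [key]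
  refine integral_congr_ae (Eventually.of_forall fun t => ?_)
  simp only [hφdef, convKernel]
  rw [show s⁻¹ • (t - (1 - s) • x) = -s⁻¹ • ((1 - s) • x - t) by module]

theorem integral_apply_coord {μ : Measure E3} {f : E3 → E3} (hf : Integrable f μ) (j : Fin 3) :
    (∫ y, f y ∂μ) j = ∫ y, f y j ∂μ :=
  ((EuclideanSpace.proj (𝕜 := ℝ) j).integral_comp_comm hf).symm

theorem curl_smoothing (hη : IsKernel U η) (hU : ConvexElement U h) (hs : s ∈ Ioc (0:ℝ) 1)
    {Ψ : E3 → E3} (hΨ : MemLp Ψ 2 (volume.restrict U)) {G : Fin 3 → E3 → E3}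
    (hG : IsWeakGrad U Ψ G) {w : E3} (hw : ∀ᵐ x ∂(volume.restrict U), gradCurl G x = w)
    {x : E3} (hx : x ∈ closure U) : curl (smoothing η U s Ψ) x = (1 - s) • w := by
  have hs0 : s ≠ 0 := hs.1.ne'
  have hUm := hU.isOpen.measurableSet
  have hae : ∀ᵐ y, η y ≠ 0 → gradCurl G ((1 - s) • x + s • y) = w := by
    have h1 : ∀ᵐ z, z ∈ U → gradCurl G z = w := (ae_restrict_iff' hUm).1 hw
    have h2 : ∀ᵐ z ∂(Measure.map (fun y => s • y + (1 - s) • x) (volume : Measure E3)),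
        z ∈ U → gradCurl G z = w := by
      rw [map_homothety_volume hs0]
      exact Measure.ae_smul_measure h1 _
    have h3 := (measurableEmbedding_homothety hs0 ((1 - s) • x)).ae_map_iff.1 h2
    filter_upwards [h3] with y hy hy0
    rw [add_comm]
    exact hy (by rw [add_comm]; exact hη.combo_mem hU hs hx hy0)
  have key : ∀ i j k : Fin 3, (∀ z, gradCurl G z k = G i z j - G j z i) →
      smoothing η U s (G i) x j - smoothing η U s (G j) x i = w k := by
    intro i j k hk
    have I1 := hη.integrable hU hs0 (hG.1 i) x
    have I2 := hη.integrable hU hs0 (hG.1 j) x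
    unfold smoothing
    rw [integral_apply_coord I1, integral_apply_coord I2, ← integral_sub]
    · have : ∫ y, η y * w k = w k := by rw [integral_mul_const, hη.integral_eq, one_mul]
      rw [← this]
      refine integral_congr_ae ?_
      filter_upwards [hae] with y hy
      by_cases hy0 : η y = 0
      · simp [hy0]
      · have := hk ((1 - s) • x + s • y)
        rw [hy hy0] at this
        rw [indicator_of_mem (hη.combo_mem hU hs hx hy0),
          indicator_of_mem (hη.combo_mem hU hs hx hy0), this]
        simp; ring
    · exact (EuclideanSpace.proj (𝕜 := ℝ) j).integrable_comp I1
    · exact (EuclideanSpace.proj (𝕜 := ℝ) i).integrable_comp I2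
  rw [curl_eq_gradCurl]
  simp only [hη.fderiv_smoothing hU hs hΨ hG hx, gradCurl]
  have k0 := key 1 2 0 (fun z => by simp [gradCurl])
  have k1 := key 2 0 1 (fun z => by simp [gradCurl])
  have k2 := key 0 1 2 (fun z => by simp [gradCurl])
  apply E3.ext3
  · simp [← k0, mul_sub]
  · simp [← k1, mul_sub]
  · simp [← k2, mul_sub]

theorem contDiff_smoothing (hη : IsKernel U η) (hU : ConvexElement U h) (s0 : s ≠ 0)
    {f : E3 → E3} (hf : MemLp f 2 (volume.restrict U)) : ContDiff ℝ ∞ (smoothing η U s f) :=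
  (hη.hasFDerivAt_smoothing hU s0 hf).1

theorem tendsto_smoothing (hη : IsKernel U η) (hU : ConvexElement U h)
    {f : E3 → E3} (hf : MemLp f 2 (volume.restrict U)) {δ : ℝ≥0∞} (hδ : δ ≠ 0) :
    ∀ᶠ s in 𝓝[>] (0:ℝ), l2Norm U (smoothing η U s f - f) ≤ δ := by
  have hVt := hU.volume_ne_top
  have hδ5 : δ / 5 ≠ 0 := by simp [ENNReal.div_eq_zero_iff, hδ]
  obtain ⟨g, -, hgf, hgc, hgm⟩ := hf.exists_hasCompactSupport_eLpNorm_sub_le (by norm_num) hδ5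
  have hV : volume U ^ (1 / 2 : ℝ) ≠ ⊤ := by simp [ENNReal.rpow_eq_top_iff, hVt]
  obtain ⟨ε, hε, hεδ⟩ : ∃ ε : ℝ, 0 < ε ∧ ENNReal.ofReal ε * volume U ^ (1 / 2 : ℝ) ≤ δ / 5 := by
    obtain ⟨e, he, hle⟩ := ENNReal.exists_nnreal_pos_mul_lt hV hδ5
    exact ⟨e, he, by simpa using hle.le⟩
  filter_upwards [hη.eventually_norm_smoothing_sub_le hU hgc.continuousOn hε,
    Ioc_mem_nhdsGT (show (0:ℝ) < 1/2 by norm_num)] with s hs1 hs2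
  have hs0 : s ≠ 0 := hs2.1.ne'
  have e : smoothing η U s f - f
      = smoothing η U s (f - g) + ((smoothing η U s g - g) + (g - f)) := by
    ext1 x
    simp only [Pi.add_apply, Pi.sub_apply]
    rw [hη.smoothing_sub hU hs0 hf hgm]; abel
  have m1 := (hη.contDiff_smoothing hU hs0 (hf.sub hgm)).continuous.aestronglyMeasurable
    (μ := volume.restrict U)
  have m2 := (hη.contDiff_smoothing hU hs0 hgm).continuous.aestronglyMeasurable
    (μ := volume.restrict U)
  have m3 := hgm.aestronglyMeasurable
  have m4 := hf.aestronglyMeasurable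
  have b1 := hη.l2Norm_smoothing_le hU hs2 (hf.sub hgm)
  have b2 : eLpNorm (smoothing η U s g - g) 2 (volume.restrict U) ≤ δ / 5 := by
    refine le_trans ?_ hεδ
    have : eLpNorm (smoothing η U s g - g) 2 (volume.restrict U)
        ≤ eLpNorm (fun _ : E3 => ε) 2 (volume.restrict U) := by
      refine eLpNorm_mono_ae ?_
      filter_upwards [ae_restrict_mem hU.isOpen.measurableSet] with x hx
      rw [Real.norm_of_nonneg hε.le]
      exact hs1 x (subset_closure hx)
    rwa [eLpNorm_const_two, Real.enorm_of_nonneg hε.le] at this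
  have b3 : eLpNorm (g - f) 2 (volume.restrict U) ≤ δ / 5 := by
    rw [eLpNorm_sub_comm]; exact hgf
  rw [l2Norm, e]
  refine (eLpNorm_add_le m1 ((m2.sub m3).add (m3.sub m4)) (by norm_num)).trans ?_
  refine (add_le_add le_rfl (eLpNorm_add_le (m2.sub m3) (m3.sub m4) (by norm_num))).trans ?_
  calc _ ≤ 3 * (δ / 5) + (δ / 5 + δ / 5) := by
        refine add_le_add (b1.trans ?_) (add_le_add b2 b3)
        gcongr
        exact hgf
    _ = 5 * (δ / 5) := by ring
    _ = δ := ENNReal.mul_div_cancel (by norm_num) (by norm_num)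

end IsKernel

/-- Fields in `H¹` with constant curl. -/
structure ConstCurlField (U : Set E3) (Ψ : E3 → E3) (G : Fin 3 → E3 → E3) : Prop where
  memLp : MemLp Ψ 2 (volume.restrict U)
  isWeakGrad : IsWeakGrad U Ψ G
  curl_const : ∃ w, ∀ᵐ x ∂(volume.restrict U), gradCurl G x = w

/-- Smooth fields with constant curl are dense among the `H¹` fields with constant curl. -/
theorem ConvexElement.exists_smooth_approx {U : Set E3} {h : ℝ} (hU : ConvexElement U h)
    {Ψ : E3 → E3} {G : Fin 3 → E3 → E3} (hΨ : ConstCurlField U Ψ G) {δ : ℝ} (hδ : 0 < δ) :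
    ∃ ψ : E3 → E3, ContDiff ℝ ∞ ψ ∧ (∃ w, ∀ x ∈ closure U, curl ψ x = w) ∧
      l2Norm U (ψ - Ψ) ≤ ENNReal.ofReal δ ∧
      (∀ i, l2Norm U (fun x => fderiv ℝ ψ x (unitVec i) - G i x) ≤ ENNReal.ofReal δ) ∧
      (ContinuousOn Ψ (closure U) → ∀ x ∈ closure U, ‖ψ x - Ψ x‖ ≤ δ) := by
  obtain ⟨η, hη⟩ := exists_isKernel hU.isOpen hU.nonempty
  obtain ⟨w, hw⟩ := hΨ.curl_const
  have hδ' : ENNReal.ofReal δ ≠ 0 := by simpa using hδ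
  have hδ2 : ENNReal.ofReal (δ / 2) ≠ 0 := by simpa using hδ
  have E1 := hη.tendsto_smoothing hU hΨ.memLp hδ'
  have E2 : ∀ᶠ s in 𝓝[>] (0:ℝ), ∀ i, l2Norm U (smoothing η U s (G i) - G i)
      ≤ ENNReal.ofReal (δ / 2) :=
    eventually_all.2 fun i => hη.tendsto_smoothing hU (hΨ.isWeakGrad.1 i) hδ2
  have E3' : ∀ᶠ s in 𝓝[>] (0:ℝ), ∀ i, ENNReal.ofReal s * l2Norm U (G i)
      ≤ ENNReal.ofReal (δ / 2) := by
    refine eventually_all.2 fun i => ?_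
    have hfin := (hΨ.isWeakGrad.1 i).eLpNorm_ne_top
    have hpos : 0 < (δ / 2) / ((l2Norm U (G i)).toReal + 1) := by positivity
    filter_upwards [Ioc_mem_nhdsGT hpos] with s hs
    have h2 := hs.2
    rw [le_div_iff₀ (by positivity)] at h2
    rw [← ENNReal.ofReal_toReal (show l2Norm U (G i) ≠ ⊤ from hfin),
      ← ENNReal.ofReal_mul hs.1.le]
    apply ENNReal.ofReal_le_ofReal
    have := hs.1
    nlinarith
  have E4 : ∀ᶠ s in 𝓝[>] (0:ℝ), ContinuousOn Ψ (closure U) →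
      ∀ x ∈ closure U, ‖smoothing η U s Ψ x - Ψ x‖ ≤ δ := by
    by_cases hc : ContinuousOn Ψ (closure U)
    · filter_upwards [hη.eventually_norm_smoothing_sub_le hU hc hδ] with s hs _ using hs
    · exact Eventually.of_forall fun s h1 => absurd h1 hc
  have E5 : ∀ᶠ s in 𝓝[>] (0:ℝ), s ∈ Ioc (0:ℝ) 1 := Ioc_mem_nhdsGT zero_lt_one
  obtain ⟨s, h1, h2, h3, h4, hs⟩ := (E1.and (E2.and (E3'.and (E4.and E5)))).exists
  have hs0 : s ≠ 0 := hs.1.ne'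
  refine ⟨smoothing η U s Ψ, hη.contDiff_smoothing hU hs0 hΨ.memLp,
    ⟨_, fun x hx => hη.curl_smoothing hU hs hΨ.memLp hΨ.isWeakGrad hw hx⟩, h1, fun i => ?_, h4⟩
  have m1 := (hη.contDiff_smoothing hU hs0 (hΨ.isWeakGrad.1 i)).continuous.aestronglyMeasurable
    (μ := volume.restrict U)
  have m2 := (hΨ.isWeakGrad.1 i).aestronglyMeasurable
  have e : l2Norm U (fun x => fderiv ℝ (smoothing η U s Ψ) x (unitVec i) - G i x)
      = l2Norm U ((1 - s) • (smoothing η U s (G i) - G i) - s • G i) := by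
    refine eLpNorm_congr_ae ?_
    filter_upwards [ae_restrict_mem hU.isOpen.measurableSet] with x hx
    rw [hη.fderiv_smoothing hU hs hΨ.memLp hΨ.isWeakGrad (subset_closure hx)]
    simp only [Pi.sub_apply, Pi.smul_apply]
    module
  rw [e, l2Norm]
  refine (eLpNorm_sub_le ((m1.sub m2).const_smul _) (m2.const_smul _) (by norm_num)).trans ?_
  rw [eLpNorm_const_smul, eLpNorm_const_smul, Real.enorm_of_nonneg hs.1.le,
    Real.enorm_of_nonneg (by linarith [hs.2])]
  calc _ ≤ 1 * ENNReal.ofReal (δ / 2) + ENNReal.ofReal (δ / 2) := by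
        refine add_le_add (mul_le_mul' ?_ (h2 i)) (h3 i)
        rw [ENNReal.ofReal_le_one]; linarith [hs.1]
    _ = ENNReal.ofReal δ := by
        rw [one_mul, ← ENNReal.ofReal_add (by positivity) (by positivity), add_halves]

/-- Distance in `H¹(U)` of a smooth field `ψ` from the field `Ψ` with weak gradient `G`. -/
noncomputable def h1Dist (U : Set E3) (Ψ : E3 → E3) (G : Fin 3 → E3 → E3) (ψ : E3 → E3) : ℝ≥0∞ :=
  l2Norm U (ψ - Ψ) + ∑ i, l2Norm U (fun x => fderiv ℝ ψ x (unitVec i) - G i x)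

/-- Smooth fields with constant curl on the closure of `U`. -/
def SmoothConst (U : Set E3) (ψ : E3 → E3) : Prop :=
  ContDiff ℝ ∞ ψ ∧ ∃ w, ∀ x ∈ closure U, curl ψ x = w

variable {U : Set E3} {h : ℝ} {Ψ : E3 → E3} {G : Fin 3 → E3 → E3}

namespace ConvexElement

theorem memLp_pderiv (hU : ConvexElement U h) {ψ : E3 → E3} (hψ : ContDiff ℝ 1 ψ) (v : E3) :
    MemLp (fun x => fderiv ℝ ψ x v) 2 (volume.restrict U) := by
  have := hψ.continuous_fderiv (by norm_num)
  exact hU.memLp_of_continuousOn (by fun_prop) 2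

theorem memLp_of_continuous (hU : ConvexElement U h) {ψ : E3 → E3} (hψ : Continuous ψ) :
    MemLp ψ 2 (volume.restrict U) :=
  hU.memLp_of_continuousOn hψ.continuousOn 2

theorem isWeakGrad_sub (hU : ConvexElement U h) (hΨ : ConstCurlField U Ψ G) {ψ : E3 → E3}
    (hψ : ContDiff ℝ 1 ψ) :
    IsWeakGrad U (ψ - Ψ) (fun i => (fun x => fderiv ℝ ψ x (unitVec i)) - G i) :=
  (isWeakGrad_of_contDiff hψ fun _ => hU.memLp_pderiv hψ _).sub
    (hU.memLp_of_continuous hψ.continuous) hΨ.memLp hΨ.isWeakGrad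

theorem h1Norm_le_h1Dist (hU : ConvexElement U h) (hΨ : ConstCurlField U Ψ G) {ψ : E3 → E3}
    (hψ : ContDiff ℝ 1 ψ) : h1Norm U (ψ - Ψ) ≤ h1Dist U Ψ G ψ :=
  h1Norm_le hU.isOpen (hU.isWeakGrad_sub hΨ hψ)

theorem h1Dist_le_h1Norm (hU : ConvexElement U h) (hΨ : ConstCurlField U Ψ G) {ψ : E3 → E3}
    (hψ : ContDiff ℝ 1 ψ) : h1Dist U Ψ G ψ ≤ 4 * h1Norm U (ψ - Ψ) := by
  have h1 := l2Norm_le_h1Norm U (ψ - Ψ)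
  have h2 := fun i => (l2Norm_le_h1Seminorm hU.isOpen (hU.isWeakGrad_sub hΨ hψ) i).trans
    (h1Seminorm_le_h1Norm U (ψ - Ψ))
  calc h1Dist U Ψ G ψ ≤ h1Norm U (ψ - Ψ) + ∑ _i : Fin 3, h1Norm U (ψ - Ψ) :=
        add_le_add h1 (Finset.sum_le_sum fun i _ => h2 i)
    _ = _ := by simp; ring

theorem exists_h1Dist_le (hU : ConvexElement U h) (hΨ : ConstCurlField U Ψ G) {δ : ℝ}
    (hδ : 0 < δ) : ∃ ψ, SmoothConst U ψ ∧ h1Dist U Ψ G ψ ≤ ENNReal.ofReal δ ∧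
      (ContinuousOn Ψ (closure U) → ∀ x ∈ closure U, ‖ψ x - Ψ x‖ ≤ δ) := by
  obtain ⟨ψ, h1, h2, h3, h4, h5⟩ := hU.exists_smooth_approx hΨ (show 0 < δ / 4 by positivity)
  refine ⟨ψ, ⟨h1, h2⟩, ?_, fun hc x hx => (h5 hc x hx).trans (by linarith)⟩
  calc h1Dist U Ψ G ψ ≤ ENNReal.ofReal (δ / 4) + ∑ _i : Fin 3, ENNReal.ofReal (δ / 4) :=
        add_le_add h3 (Finset.sum_le_sum fun i _ => h4 i)
    _ = 4 * ENNReal.ofReal (δ / 4) := by simp; ring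
    _ = ENNReal.ofReal 4 * ENNReal.ofReal (δ / 4) := by norm_num
    _ = ENNReal.ofReal δ := by
      rw [← ENNReal.ofReal_mul (by norm_num)]; congr 1; ring

/-- The constant in the continuity estimate of the segment integrals. -/
noncomputable def segConst (U : Set E3) (h : ℝ) : ℝ≥0∞ :=
  (volume U ^ (1 / 2 : ℝ))⁻¹ * (2 * ENNReal.ofReal h + 16 * ENNReal.ofReal (h ^ 2))

theorem segConst_ne_top (hU : ConvexElement U h) : segConst U h ≠ ⊤ := by
  have : (volume U ^ (1 / 2 : ℝ))⁻¹ ≠ ⊤ := by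
    simp [ENNReal.rpow_eq_zero_iff, hU.volume_ne_zero]
  unfold segConst
  finiteness

theorem le_inv_mul (hU : ConvexElement U h) {a b : ℝ≥0∞} (hab : volume U ^ (1 / 2 : ℝ) * a ≤ b) :
    a ≤ (volume U ^ (1 / 2 : ℝ))⁻¹ * b := by
  have h0 : volume U ^ (1 / 2 : ℝ) ≠ 0 := by simp [ENNReal.rpow_eq_zero_iff, hU.volume_ne_zero]
  have ht : volume U ^ (1 / 2 : ℝ) ≠ ⊤ := by simp [ENNReal.rpow_eq_top_iff, hU.volume_ne_top]
  calc a = (volume U ^ (1 / 2 : ℝ))⁻¹ * (volume U ^ (1 / 2 : ℝ) * a) := by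
        rw [← mul_assoc, ENNReal.inv_mul_cancel h0 ht, one_mul]
    _ ≤ _ := by gcongr

theorem enorm_segInt_sub_le (hU : ConvexElement U h) (hΨ : ConstCurlField U Ψ G) {ψ φ : E3 → E3}
    (hψ : SmoothConst U ψ) (hφ : SmoothConst U φ) {a b : E3} (ha : a ∈ closure U)
    (hb : b ∈ closure U) :
    ‖segInt ψ a b - segInt φ a b‖ₑ
      ≤ segConst U h * (h1Dist U Ψ G ψ + h1Dist U Ψ G φ) := by
  have cψ : ContDiff ℝ 1 ψ := hψ.1.of_le (by simp)
  have cφ : ContDiff ℝ 1 φ := hφ.1.of_le (by simp)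
  have dψ := cψ.differentiable (by norm_num)
  have dφ := cφ.differentiable (by norm_num)
  have c1 := hψ.1.continuous
  have c2 := hφ.1.continuous
  have c3 := cψ.continuous_fderiv (by norm_num)
  have c4 := cφ.continuous_fderiv (by norm_num)
  obtain ⟨w, hw⟩ := hψ.2
  obtain ⟨w', hw'⟩ := hφ.2
  have hfd : ∀ x, fderiv ℝ (ψ - φ) x = fderiv ℝ ψ x - fderiv ℝ φ x := fun x =>
    fderiv_sub (dψ x) (dφ x)
  have hcurl : ∀ x ∈ closure U, curl (ψ - φ) x = w - w' := by
    intro x hx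
    rw [← hw x hx, ← hw' x hx]
    unfold curl pd
    rw [hfd]
    apply E3.ext3 <;> simp <;> ring
  have cψφ : ContDiff ℝ 1 (ψ - φ) := cψ.sub cφ
  have key := hU.enorm_segInt_le_of_curl_const cψφ hcurl ha hb
  rw [segInt_sub c1 c2] at key
  have k1 : l2Norm U (ψ - φ) ≤ l2Norm U (ψ - Ψ) + l2Norm U (φ - Ψ) := by
    have e : ψ - φ = (ψ - Ψ) - (φ - Ψ) := by abel
    rw [l2Norm, e]
    exact eLpNorm_sub_le ((hU.memLp_of_continuous c1).sub hΨ.memLp).aestronglyMeasurable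
      ((hU.memLp_of_continuous c2).sub hΨ.memLp).aestronglyMeasurable (by norm_num)
  have k2 : eLpNorm (fderiv ℝ (ψ - φ)) 2 (volume.restrict U)
      ≤ (∑ i, l2Norm U (fun x => fderiv ℝ ψ x (unitVec i) - G i x))
        + ∑ i, l2Norm U (fun x => fderiv ℝ φ x (unitVec i) - G i x) := by
    refine (eLpNorm_fderiv_le cψφ U).trans ?_
    rw [← Finset.sum_add_distrib]
    refine Finset.sum_le_sum fun i _ => ?_
    have e : (fun x => fderiv ℝ (ψ - φ) x (unitVec i))
        = (fun x => fderiv ℝ ψ x (unitVec i) - G i x)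
          - (fun x => fderiv ℝ φ x (unitVec i) - G i x) := by
      ext1 x; rw [hfd]; simp
    rw [e]
    exact eLpNorm_sub_le ((hU.memLp_pderiv cψ _).sub (hΨ.isWeakGrad.1 i)).aestronglyMeasurable
      ((hU.memLp_pderiv cφ _).sub (hΨ.isWeakGrad.1 i)).aestronglyMeasurable (by norm_num)
  refine (hU.le_inv_mul key).trans ?_
  rw [segConst, mul_assoc ((volume U ^ (1 / 2 : ℝ))⁻¹)]
  gcongr (volume U ^ (1 / 2 : ℝ))⁻¹ * ?_
  rw [add_mul]
  gcongr
  · refine k1.trans ?_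
    unfold h1Dist
    exact add_le_add le_self_add le_self_add
  · refine k2.trans ?_
    unfold h1Dist
    exact add_le_add le_add_self le_add_self

/-- The segment integrals of smooth fields with constant curl extend to `H¹` fields with constant
curl. -/
theorem exists_segLimit (hU : ConvexElement U h) (hΨ : ConstCurlField U Ψ G) :
    ∃ ℓ : E3 → E3 → ℝ, ∀ ψ, SmoothConst U ψ → ∀ a ∈ closure U, ∀ b ∈ closure U,
      ‖segInt ψ a b - ℓ a b‖ₑ ≤ segConst U h * h1Dist U Ψ G ψ := by
  have hex : ∀ n : ℕ, ∃ ψ, SmoothConst U ψ ∧ h1Dist U Ψ G ψ ≤ ENNReal.ofReal (1 / ((n:ℝ) + 1)) :=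
    fun n => by
      obtain ⟨ψ, h1, h2, -⟩ := hU.exists_h1Dist_le hΨ (show (0:ℝ) < 1 / ((n:ℝ) + 1) by positivity)
      exact ⟨ψ, h1, h2⟩
  choose Ψs hs hd using hex
  have hC := hU.segConst_ne_top
  have hd0 : Tendsto (fun n => h1Dist U Ψ G (Ψs n)) atTop (𝓝 0) := by
    refine tendsto_of_tendsto_of_tendsto_of_le_of_le tendsto_const_nhds ?_ (fun _ => zero_le) hd
    have := ENNReal.tendsto_ofReal (tendsto_one_div_add_atTop_nhds_zero_nat (𝕜 := ℝ))
    simpa using this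
  have hlim : ∀ a ∈ closure U, ∀ b ∈ closure U, ∃ c,
      Tendsto (fun n => segInt (Ψs n) a b) atTop (𝓝 c) := by
    intro a ha b hb
    apply cauchySeq_tendsto_of_complete
    rw [EMetric.cauchySeq_iff]
    intro ε hε
    have h2 : Tendsto (fun n => segConst U h * h1Dist U Ψ G (Ψs n)) atTop (𝓝 0) := by
      simpa using ENNReal.Tendsto.const_mul hd0 (Or.inr hC)
    obtain ⟨N, hN⟩ := eventually_atTop.1 (h2.eventually (gt_mem_nhds (ENNReal.half_pos hε.ne')))
    refine ⟨N, fun m hm n hn => ?_⟩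
    rw [edist_eq_enorm_sub]
    refine (hU.enorm_segInt_sub_le hΨ (hs m) (hs n) ha hb).trans_lt ?_
    rw [mul_add, ← ENNReal.add_halves ε]
    exact ENNReal.add_lt_add (hN m hm) (hN n hn)
  classical
  refine ⟨fun a b => limUnder atTop fun n => segInt (Ψs n) a b, fun ψ hψ a ha b hb => ?_⟩
  have h1 := tendsto_nhds_limUnder (hlim a ha b hb)
  have h2 : Tendsto (fun n => ‖segInt ψ a b - segInt (Ψs n) a b‖ₑ) atTop
      (𝓝 ‖segInt ψ a b - limUnder atTop fun n => segInt (Ψs n) a b‖ₑ) :=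
    (tendsto_const_nhds.sub h1).enorm
  have h3 : Tendsto (fun n => segConst U h * (h1Dist U Ψ G ψ + h1Dist U Ψ G (Ψs n))) atTop
      (𝓝 (segConst U h * (h1Dist U Ψ G ψ + 0))) :=
    ENNReal.Tendsto.const_mul (tendsto_const_nhds.add hd0) (Or.inr hC)
  rw [add_zero] at h3
  exact le_of_tendsto_of_tendsto' h2 h3 fun n => hU.enorm_segInt_sub_le hΨ hψ (hs n) ha hb

/-- A field of segment integrals of the `H¹` field `Ψ` with constant curl. -/
def IsSegLimit (U : Set E3) (h : ℝ) (Ψ : E3 → E3) (G : Fin 3 → E3 → E3) (ℓ : E3 → E3 → ℝ) : Prop :=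
  ∀ ψ, SmoothConst U ψ → ∀ a ∈ closure U, ∀ b ∈ closure U,
      ‖segInt ψ a b - ℓ a b‖ₑ ≤ segConst U h * h1Dist U Ψ G ψ

theorem exists_uniform_approx (hU : ConvexElement U h) (hΨ : ConstCurlField U Ψ G)
    {ℓ : E3 → E3 → ℝ} (hℓ : IsSegLimit U h Ψ G ℓ) {ε : ℝ} (hε : 0 < ε) :
    ∃ ψ, SmoothConst U ψ ∧ h1Dist U Ψ G ψ ≤ ENNReal.ofReal ε ∧
      (∀ a ∈ closure U, ∀ b ∈ closure U, |segInt ψ a b - ℓ a b| ≤ ε) ∧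
      (ContinuousOn Ψ (closure U) → ∀ x ∈ closure U, ‖ψ x - Ψ x‖ ≤ ε) := by
  have hC := hU.segConst_ne_top
  set C := (segConst U h).toReal
  have hC0 : 0 ≤ C := ENNReal.toReal_nonneg
  obtain ⟨ψ, h1, h2, h3⟩ := hU.exists_h1Dist_le hΨ (show 0 < ε / (C + 1) by positivity)
  have hle : ε / (C + 1) ≤ ε := div_le_self hε.le (by linarith)
  refine ⟨ψ, h1, h2.trans (ENNReal.ofReal_le_ofReal hle), fun a ha b hb => ?_,
    fun hc x hx => (h3 hc x hx).trans hle⟩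
  have h4 := (hℓ ψ h1 a ha b hb).trans (mul_le_mul_right h2 _)
  rw [← ENNReal.ofReal_toReal hC, ← ENNReal.ofReal_mul hC0, ← ofReal_norm,
    ENNReal.ofReal_le_ofReal_iff (by positivity)] at h4
  refine h4.trans ?_
  rw [← mul_div_assoc, div_le_iff₀ (by positivity)]
  nlinarith

theorem continuousOn_segLimit (hU : ConvexElement U h) (hΨ : ConstCurlField U Ψ G)
    {ℓ : E3 → E3 → ℝ} (hℓ : IsSegLimit U h Ψ G ℓ) :
    ContinuousOn (fun p : E3 × E3 => ℓ p.1 p.2) (closure U ×ˢ closure U) := by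
  apply Metric.continuousOn_iff.2
  intro p hp ε hε
  obtain ⟨ψ, h1, -, h3, -⟩ := hU.exists_uniform_approx hΨ hℓ (show 0 < ε / 4 by positivity)
  have hc := continuous_segInt h1.1.continuous
  obtain ⟨δ, hδ, hd⟩ := Metric.continuous_iff.1 hc p (ε / 4) (by positivity)
  refine ⟨δ, hδ, fun q hq hqp => ?_⟩
  have a1 := abs_le.1 (h3 p.1 hp.1 p.2 hp.2)
  have a2 := abs_le.1 (h3 q.1 hq.1 q.2 hq.2)
  have a3 := hd q hqp
  rw [Real.dist_eq, abs_lt] at a3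
  rw [Real.dist_eq, abs_lt]
  constructor <;> linarith

end ConvexElement

/-! ### Averaging along a direction -/

/-- The average of `κ` along translates by the segment `[0, d]`. -/
noncomputable def lineSmear (κ : E3 → ℝ) (d x : E3) : ℝ := ∫ r in (0:ℝ)..1, κ (x - r • d)

theorem integral_intervalIntegral_swap {F : E3 → ℝ → ℝ} (hF : Continuous (Function.uncurry F))
    {B : Set E3} (hB : IsCompact B) (h0 : ∀ r ∈ Icc (0:ℝ) 1, ∀ x ∉ B, F x r = 0) :
    ∫ x, ∫ r in (0:ℝ)..1, F x r = ∫ r in (0:ℝ)..1, ∫ x, F x r := by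
  have e1 : ∫ x, ∫ r in (0:ℝ)..1, F x r = ∫ x in B, ∫ r in (0:ℝ)..1, F x r := by
    refine (setIntegral_eq_integral_of_forall_compl_eq_zero fun x hx => ?_).symm
    rw [intervalIntegral.integral_congr (g := fun _ => (0:ℝ)), intervalIntegral.integral_zero]
    intro r hr
    rw [uIcc_of_le zero_le_one] at hr
    exact h0 r hr x hx
  have e2 : ∫ r in (0:ℝ)..1, ∫ x, F x r = ∫ r in (0:ℝ)..1, ∫ x in B, F x r := by
    refine intervalIntegral.integral_congr fun r hr => ?_
    rw [uIcc_of_le zero_le_one] at hr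
    exact (setIntegral_eq_integral_of_forall_compl_eq_zero fun x hx => h0 r hr x hx).symm
  rw [e1, e2, intervalIntegral.integral_of_le zero_le_one]
  simp_rw [intervalIntegral.integral_of_le zero_le_one]
  apply integral_integral_swap
  rw [Measure.prod_restrict]
  have := (hF.continuousOn (s := B ×ˢ Icc (0:ℝ) 1)).integrableOn_compact
    (μ := (volume : Measure E3).prod volume) (hB.prod isCompact_Icc)
  exact this.mono_set (prod_mono le_rfl Ioc_subset_Icc_self)

theorem continuous_lineSmear {κ : E3 → ℝ} (hκ : Continuous κ) (d : E3) :
    Continuous (lineSmear κ d) := by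
  unfold lineSmear
  apply intervalIntegral.continuous_parametric_intervalIntegral_of_continuous'
  unfold Function.uncurry
  fun_prop

/-- The set swept by translating `S` along `[0, d]`. -/
def sweep (S : Set E3) (d : E3) : Set E3 := (fun p : E3 × ℝ => p.1 + p.2 • d) '' (S ×ˢ Icc 0 1)

theorem isCompact_sweep {S : Set E3} (hS : IsCompact S) (d : E3) : IsCompact (sweep S d) :=
  (hS.prod isCompact_Icc).image (by fun_prop)

theorem lineSmear_eq_zero {κ : E3 → ℝ} {S : Set E3} (hS : Function.support κ ⊆ S) {d x : E3}
    (hx : x ∉ sweep S d) : lineSmear κ d x = 0 := by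
  unfold lineSmear
  rw [intervalIntegral.integral_congr (g := fun _ => (0:ℝ)), intervalIntegral.integral_zero]
  intro r hr
  rw [uIcc_of_le zero_le_one] at hr
  by_contra hne
  exact hx ⟨(x - r • d, r), ⟨hS hne, hr⟩, by simp⟩

theorem hasCompactSupport_lineSmear {κ : E3 → ℝ} (hc : HasCompactSupport κ) (d : E3) :
    HasCompactSupport (lineSmear κ d) :=
  HasCompactSupport.intro (isCompact_sweep hc.isCompact d) fun _ hx =>
    lineSmear_eq_zero (subset_tsupport κ) hx

theorem integral_lineSmear_mul {κ : E3 → ℝ} (hκ : Continuous κ) (hc : HasCompactSupport κ)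
    {ψ : E3 → E3} (hψ : Continuous ψ) (d : E3) :
    ∫ x, lineSmear κ d x * inner ℝ (ψ x) d = ∫ x, κ x * segInt ψ x (x + d) := by
  have e1 : ∀ x, lineSmear κ d x * inner ℝ (ψ x) d
      = ∫ r in (0:ℝ)..1, κ (x - r • d) * inner ℝ (ψ x) d := fun x => by
    rw [intervalIntegral.integral_mul_const, lineSmear]
  have e2 : ∀ x, κ x * segInt ψ x (x + d)
      = ∫ r in (0:ℝ)..1, κ x * inner ℝ (ψ (x + r • d)) d := fun x => by
    rw [intervalIntegral.integral_const_mul, segInt]; simp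
  simp_rw [e1, e2]
  rw [integral_intervalIntegral_swap _ (isCompact_sweep hc.isCompact d),
    integral_intervalIntegral_swap _ hc.isCompact]
  · refine intervalIntegral.integral_congr fun r _ => ?_
    have := integral_sub_right_eq_self (μ := (volume : Measure E3))
      (fun x => κ x * inner ℝ (ψ (x + r • d)) d) (r • d)
    simpa using this
  · intro r _ x hx
    rw [image_eq_zero_of_notMem_tsupport hx, zero_mul]
  · unfold Function.uncurry; fun_prop
  · intro r hr x hx
    by_contra hne
    refine hx ⟨(x - r • d, r), ⟨subset_tsupport κ (left_ne_zero_of_mul hne), hr⟩, by simp⟩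
  · unfold Function.uncurry; fun_prop

theorem tsupport_lineSmear_subset (hU : ConvexElement U h) {κ : E3 → ℝ} {d : E3}
    (hs : ∀ x, κ x ≠ 0 → x ∈ closure U ∧ x + d ∈ closure U) :
    Function.support (lineSmear κ d) ⊆ closure U := by
  intro x hx
  by_contra hxU
  refine hx (lineSmear_eq_zero (S := Function.support κ) le_rfl ?_)
  rintro ⟨⟨y, r⟩, ⟨hy, hr⟩, rfl⟩
  obtain ⟨h1, h2⟩ := hs y hy
  apply hxU
  have := hU.convex.closure h1 h2 (a := 1 - r) (b := r) (by linarith [hr.2]) hr.1 (by ring)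
  convert! this using 1
  simp only; module

theorem measure_closure_diff (hU : ConvexElement U h) : volume (closure U \ U) = 0 := by
  have := hU.convex.addHaar_frontier (μ := (volume : Measure E3))
  rwa [frontier, hU.isOpen.interior_eq] at this

theorem restrict_closure_eq (hU : ConvexElement U h) :
    (volume : Measure E3).restrict (closure U) = volume.restrict U := by
  refine (Measure.restrict_congr_set ?_).symm
  refine (ae_eq_set).2 ⟨by simp [sdiff_eq_empty.2 subset_closure], measure_closure_diff hU⟩

theorem lintegral_mul_le_eLpNorm {μ : Measure E3} {f : E3 → ℝ} {g : E3 → E3}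
    (hf : AEStronglyMeasurable f μ) (hg : AEStronglyMeasurable g μ) :
    ∫⁻ x, ‖f x‖ₑ * ‖g x‖ₑ ∂μ ≤ eLpNorm f 2 μ * eLpNorm g 2 μ := by
  apply ENNReal_le_of_sq_le
  rw [mul_pow, sq_eLpNorm_two, sq_eLpNorm_two]
  exact lintegral_sq_le μ hf.enorm hg.enorm

/-- Weighted segment integrals of an `H¹` field with constant curl. -/
theorem ConvexElement.integral_lineSmear_mul_segLimit (hU : ConvexElement U h)
    (hΨ : ConstCurlField U Ψ G) {ℓ : E3 → E3 → ℝ} (hℓ : IsSegLimit U h Ψ G ℓ) {κ : E3 → ℝ}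
    (hκ : Continuous κ) (hc : HasCompactSupport κ) {d : E3}
    (hs : ∀ x, κ x ≠ 0 → x ∈ closure U ∧ x + d ∈ closure U) :
    ∫ x in U, lineSmear κ d x * inner ℝ (Ψ x) d = ∫ x, κ x * ℓ x (x + d) := by
  have hsc := continuous_lineSmear hκ d
  have hscc := hasCompactSupport_lineSmear hc d
  have hsL : MemLp (lineSmear κ d) 2 (volume.restrict U) := hsc.memLp_of_hasCompactSupport hscc
  have hint : ∀ f : E3 → E3, MemLp f 2 (volume.restrict U) →
      Integrable (fun x => lineSmear κ d x * inner ℝ (f x) d) (volume.restrict U) := fun f hf =>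
    MemLp.integrable_smul_two hsL (hf.inner_const d)
  have hκi : Integrable κ := hκ.integrable_of_hasCompactSupport hc
  have hℓi : Integrable fun x => κ x * ℓ x (x + d) := by
    set S : Set E3 := closure U ∩ (fun x => x + d) ⁻¹' closure U
    have hScl : IsClosed ((fun x => x + d) ⁻¹' closure U) := isClosed_closure.preimage (by fun_prop)
    have hS : IsCompact S := hU.isCompact_closure.inter_right hScl
    refine (integrableOn_iff_integrable_of_support_subset (s := S) fun x hx =>
      hs x (left_ne_zero_of_mul hx)).1 ?_
    have hcl := (hU.continuousOn_segLimit hΨ hℓ).comp (s := S) (f := fun x => (x, x + d))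
      (by fun_prop) fun x hx => ⟨hx.1, hx.2⟩
    exact (hκ.continuousOn.mul hcl).integrableOn_compact hS
  set A := ∫ x in U, lineSmear κ d x * inner ℝ (Ψ x) d
  set B := ∫ x, κ x * ℓ x (x + d)
  set M := (eLpNorm (lineSmear κ d) 2 (volume.restrict U)).toReal * ‖d‖ + ∫ x, |κ x|
  have hM : 0 ≤ M := by positivity
  have key : ∀ ε : ℝ, 0 < ε → |A - B| ≤ M * ε := by
    intro ε hε
    obtain ⟨ψ, h1, h2, h3, -⟩ := hU.exists_uniform_approx hΨ hℓ hε
    have hψc := h1.1.continuous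
    have e1 : ∫ x in U, lineSmear κ d x * inner ℝ (ψ x) d = ∫ x, κ x * segInt ψ x (x + d) := by
      rw [← integral_lineSmear_mul hκ hc hψc, ← restrict_closure_eq hU]
      refine setIntegral_eq_integral_of_forall_compl_eq_zero fun x hx => ?_
      have : lineSmear κ d x = 0 := by
        by_contra hne; exact hx (tsupport_lineSmear_subset hU hs hne)
      rw [this, zero_mul]
    have hΨψ := (hU.memLp_of_continuous hψc).sub hΨ.memLp
    have b1 : |A - ∫ x in U, lineSmear κ d x * inner ℝ (ψ x) d|
        ≤ (eLpNorm (lineSmear κ d) 2 (volume.restrict U)).toReal * ‖d‖ * ε := by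
      have hl2 : l2Norm U (ψ - Ψ) ≤ ENNReal.ofReal ε := le_self_add.trans h2
      rw [← integral_sub (hint _ hΨ.memLp) (hint _ (hU.memLp_of_continuous hψc)),
        ← ENNReal.ofReal_le_ofReal_iff (by positivity), ← Real.norm_eq_abs, ofReal_norm,
        mul_assoc, ENNReal.ofReal_mul ENNReal.toReal_nonneg,
        ENNReal.ofReal_toReal hsL.eLpNorm_ne_top, ENNReal.ofReal_mul (norm_nonneg d), ofReal_norm]
      refine (enorm_integral_le_lintegral_enorm _).trans ?_
      have h5 := lintegral_mul_le_eLpNorm hsL.aestronglyMeasurable hΨψ.aestronglyMeasurable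
      calc _ ≤ ∫⁻ x in U, ‖d‖ₑ * (‖lineSmear κ d x‖ₑ * ‖(ψ - Ψ) x‖ₑ) := by
            refine lintegral_mono fun x => ?_
            rw [← mul_sub, ← inner_sub_left, enorm_mul]
            have : ‖(inner ℝ (Ψ x - ψ x) d : ℝ)‖ₑ ≤ ‖(ψ - Ψ) x‖ₑ * ‖d‖ₑ := by
              rw [← ofReal_norm, ← ofReal_norm, ← ofReal_norm,
                ← ENNReal.ofReal_mul (norm_nonneg _), Pi.sub_apply, norm_sub_rev]
              exact ENNReal.ofReal_le_ofReal (norm_inner_le_norm _ _)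
            calc _ ≤ ‖lineSmear κ d x‖ₑ * (‖(ψ - Ψ) x‖ₑ * ‖d‖ₑ) := by gcongr
              _ = _ := by ring
        _ ≤ ‖d‖ₑ * (eLpNorm (lineSmear κ d) 2 (volume.restrict U) * l2Norm U (ψ - Ψ)) := by
            rw [lintegral_const_mul' _ _ enorm_ne_top]
            gcongr
            exact h5
        _ ≤ ‖d‖ₑ * (eLpNorm (lineSmear κ d) 2 (volume.restrict U) * ENNReal.ofReal ε) := by gcongr
        _ = _ := by ring
    have b2 : |(∫ x, κ x * segInt ψ x (x + d)) - B| ≤ (∫ x, |κ x|) * ε := by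
      have hsi : Integrable fun x => κ x * segInt ψ x (x + d) := by
        have := (continuous_segInt hψc).comp (by fun_prop : Continuous fun x : E3 => (x, x + d))
        exact (hκ.mul this).integrable_of_hasCompactSupport hc.mul_right
      rw [← integral_sub hsi hℓi, ← integral_mul_const, ← Real.norm_eq_abs]
      refine norm_integral_le_of_norm_le (hκi.abs.mul_const ε) (Eventually.of_forall fun x => ?_)
      rw [← mul_sub, norm_mul, Real.norm_eq_abs, Real.norm_eq_abs]
      by_cases hx : κ x = 0
      · simp [hx]
      · exact mul_le_mul_of_nonneg_left (h3 _ (hs x hx).1 _ (hs x hx).2) (abs_nonneg _)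
    rw [e1] at b1
    have := abs_sub_le A (∫ x, κ x * segInt ψ x (x + d)) B
    simp only [M]
    linarith
  have h0 : |A - B| ≤ 0 := by
    refine le_of_forall_pos_le_add fun ε hε => ?_
    have := key (ε / (M + 1)) (by positivity)
    refine this.trans ?_
    rw [← mul_div_assoc, div_le_iff₀ (by positivity)]
    nlinarith
  exact sub_eq_zero.1 (abs_nonpos_iff.1 h0)

theorem volume_affine_zero (g : E3 →ᵃ[ℝ] ℝ) {p : E3} (hp : g p ≠ 0) :
    volume {x | g x = 0} = 0 := by
  have hset : {x | g x = 0}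
      = ((AffineSubspace.comap g (AffineSubspace.mk' 0 ⊥) : AffineSubspace ℝ E3) : Set E3) := by
    ext x; simp
  rw [hset]
  refine Measure.addHaar_affineSubspace _ _ fun h => hp ?_
  have : p ∈ (AffineSubspace.comap g (AffineSubspace.mk' 0 ⊥) : AffineSubspace ℝ E3) := by
    rw [h]; trivial
  simpa using this

theorem exists_even_cutoff : ∃ θ p : ℝ → ℝ, ContDiff ℝ ∞ θ ∧ (∀ t, 0 ≤ θ t) ∧ (∀ t, θ t ≤ 1) ∧
    (∀ t, 1 ≤ |t| → θ t = 0) ∧ (∀ t, HasDerivAt θ (-(p t - p (-t))) t) ∧ Continuous p ∧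
    (∀ t, 0 ≤ p t) ∧ (∀ t, p t ≠ 0 → 0 < t ∧ t ≤ 1) ∧ ∃ t, p t ≠ 0 := by
  set S := Real.smoothTransition
  have hS : ContDiff ℝ ∞ S := Real.smoothTransition.contDiff
  have hSd : ∀ t, HasDerivAt S (deriv S t) t := fun t =>
    (hS.differentiable (by simp) t).hasDerivAt
  have hSc : Continuous (deriv S) := hS.continuous_deriv (by simp)
  have hS0 : ∀ t, 0 ≤ deriv S t := fun t => Real.smoothTransition.monotone.deriv_nonneg
  have hSneg : ∀ t, t < 0 → deriv S t = 0 := by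
    intro t ht
    have : S =ᶠ[𝓝 t] fun _ => 0 := by
      filter_upwards [gt_mem_nhds ht] with u hu
      exact Real.smoothTransition.zero_of_nonpos hu.le
    rw [this.deriv_eq]; simp
  have hder : ∀ t, HasDerivAt (fun t => S (1 - t ^ 2))
      (-(2 * max t 0 * deriv S (1 - t ^ 2) - 2 * max (-t) 0 * deriv S (1 - (-t) ^ 2))) t := by
    intro t
    have h1 : HasDerivAt (fun t : ℝ => 1 - t ^ 2) (-(2 * t)) t := by
      simpa using (hasDerivAt_pow 2 t).const_sub 1
    have h2 := (hSd (1 - t ^ 2)).comp t h1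
    convert! h2 using 1
    rw [neg_sq]
    rcases le_total 0 t with h0 | h0
    · rw [max_eq_left h0, max_eq_right (by linarith)]; ring
    · rw [max_eq_right h0, max_eq_left (by linarith)]; ring
  refine ⟨fun t => S (1 - t ^ 2), fun t => 2 * max t 0 * deriv S (1 - t ^ 2), by fun_prop,
    fun t => Real.smoothTransition.nonneg _, fun t => Real.smoothTransition.le_one _, ?_, hder,
    by fun_prop, fun t => mul_nonneg (by positivity) (hS0 _), ?_, ?_⟩
  · intro t ht
    apply Real.smoothTransition.zero_of_nonpos
    have := sq_le_sq' (by linarith [abs_nonneg t]) ht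
    rw [sq_abs] at this
    linarith
  · intro t ht
    constructor
    · by_contra! h0
      apply ht
      show 2 * max t 0 * deriv S (1 - t ^ 2) = 0
      rw [max_eq_right h0]; ring
    · by_contra! h1
      apply ht
      show 2 * max t 0 * deriv S (1 - t ^ 2) = 0
      rw [hSneg _ (by nlinarith)]; ring
  · by_contra! hall
    have hd0 : ∀ t, HasDerivAt (fun t => S (1 - t ^ 2)) 0 t := by
      intro t
      have := hder t
      rw [hall t, hall (-t)] at this
      simpa using this
    have hconst := is_const_of_deriv_eq_zero (f := fun t => S (1 - t ^ 2))
      (fun t => (hd0 t).differentiableAt) (fun t => (hd0 t).deriv) 0 1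
    simp [S] at hconst

theorem curl_smul_const {a : E3 → ℝ} {L : E3 →L[ℝ] ℝ} {x g : E3} (ha : HasFDerivAt a L x)
    (hg : ∀ v, L v = inner ℝ g v) (ν : E3) : curl (fun x => a x • ν) x = cross g ν := by
  have h1 : HasFDerivAt (fun x => a x • ν) (L.smulRight ν) x := ha.smul_const ν
  have h2 : ∀ i, L (unitVec i) = g i := fun i => by
    rw [hg, unitVec]; simp [EuclideanSpace.inner_single_right]
  unfold curl pd
  rw [h1.fderiv]
  apply E3.ext3 <;> simp [h2]

theorem contDiff_lineSmear {γ : E3 → ℝ} (hγ : ContDiff ℝ ∞ γ) (hc : HasCompactSupport γ) (d : E3) :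
    ContDiff ℝ ∞ (lineSmear γ d) := by
  set μ : Measure E3 := Measure.map (fun r : ℝ => r • d) (volume.restrict (Ioc (0:ℝ) 1))
  have hμ : IsFiniteMeasure μ := inferInstance
  have hloc : LocallyIntegrable (fun _ : E3 => (1 : ℝ)) μ := locallyIntegrable_const 1
  have h1 := hc.contDiff_convolution_right (ContinuousLinearMap.mul ℝ ℝ) hloc hγ
  convert! h1 using 1
  ext1 x
  have hγc := hγ.continuous
  rw [convolution_def, lineSmear, intervalIntegral.integral_of_le zero_le_one,
    integral_map (by fun_prop)]
  · simp
  · apply Continuous.aestronglyMeasurable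
    simp only [ContinuousLinearMap.mul_apply']
    fun_prop

theorem memLp_of_isBounded {F : Type*} [NormedAddCommGroup F] {W : Set E3} (hWo : IsOpen W)
    (hW : Bornology.IsBounded W) {f : E3 → F} (hf : Continuous f) (p : ℝ≥0∞) :
    MemLp f p (volume.restrict W) := by
  obtain ⟨C, hC⟩ := hW.isCompact_closure.exists_bound_of_continuousOn hf.continuousOn
  have : IsFiniteMeasure (volume.restrict W) := ⟨by simpa using hW.measure_lt_top⟩
  refine MemLp.of_bound hf.aestronglyMeasurable C ?_
  filter_upwards [ae_restrict_mem hWo.measurableSet] with x hx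
  exact hC x (subset_closure hx)

theorem abs_integral_mul_sub_le {κ ℓ : E3 → ℝ} (hκ : Continuous κ) (hc : HasCompactSupport κ)
    (h0 : ∀ x, 0 ≤ κ x) {S : Set E3} (hS : IsCompact S) (hs : ∀ x, κ x ≠ 0 → x ∈ S)
    (hℓ : ContinuousOn ℓ S) {c ε : ℝ} (hε : ∀ x, κ x ≠ 0 → |ℓ x - c| ≤ ε) :
    |(∫ x, κ x * ℓ x) - (∫ x, κ x) * c| ≤ (∫ x, κ x) * ε := by
  have hκi : Integrable κ := hκ.integrable_of_hasCompactSupport hc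
  have hint : Integrable fun x => κ x * ℓ x :=
    (integrableOn_iff_integrable_of_support_subset fun x hx => hs x (left_ne_zero_of_mul hx)).1
      ((hκ.continuousOn.mul hℓ).integrableOn_compact hS)
  rw [← integral_mul_const, ← integral_mul_const, ← integral_sub hint (hκi.mul_const c),
    ← Real.norm_eq_abs]
  refine norm_integral_le_of_norm_le (hκi.mul_const ε) (Eventually.of_forall fun x => ?_)
  rw [← mul_sub, norm_mul, Real.norm_eq_abs, Real.norm_eq_abs, abs_of_nonneg (h0 x)]
  by_cases hx : κ x = 0
  · simp [hx]
  · exact mul_le_mul_of_nonneg_left (hε x hx) (h0 x)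

section Slab

variable (n x₀ : E3)

/-- Signed distance from the plane through `x₀` with unit normal `n`. -/
noncomputable def height (x : E3) : ℝ := inner ℝ n (x - x₀)

/-- Orthogonal projection to the plane through `x₀` with unit normal `n`. -/
noncomputable def planeProj (x : E3) : E3 := x - height n x₀ x • n

variable {n x₀}

theorem contDiff_height : ContDiff ℝ ∞ (height n x₀) := by
  show ContDiff ℝ ∞ fun x => innerSL ℝ n (x - x₀)
  fun_prop

theorem contDiff_planeProj : ContDiff ℝ ∞ (planeProj n x₀) := by
  have := contDiff_height (n := n) (x₀ := x₀)
  unfold planeProj; fun_prop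

theorem hasFDerivAt_height (x : E3) : HasFDerivAt (height n x₀) (innerSL ℝ n) x := by
  have h := ((innerSL ℝ n).hasFDerivAt (x := x - x₀)).comp x ((hasFDerivAt_id x).sub_const x₀)
  rw [ContinuousLinearMap.comp_id] at h
  exact h

theorem height_sub_smul {d : E3} (hnd : inner ℝ n d = (0:ℝ)) (x : E3) (r : ℝ) :
    height n x₀ (x - r • d) = height n x₀ x := by
  unfold height
  rw [sub_right_comm, inner_sub_right, inner_smul_right, hnd]; simp

theorem planeProj_sub_smul {d : E3} (hnd : inner ℝ n d = (0:ℝ)) (x : E3) (r : ℝ) :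
    planeProj n x₀ (x - r • d) = planeProj n x₀ x - r • d := by
  unfold planeProj
  rw [height_sub_smul hnd]; abel

theorem height_reflect (x : E3) : height n x₀ (x₀ + x₀ - x) = - height n x₀ x := by
  unfold height
  rw [← inner_neg_right]; congr 1; abel

theorem planeProj_reflect (x : E3) :
    planeProj n x₀ (x₀ + x₀ - x) = x₀ + x₀ - planeProj n x₀ x := by
  unfold planeProj
  rw [height_reflect]; module

theorem dist_le_height_add (hn : ‖n‖ = 1) (x y : E3) :
    dist x y ≤ |height n x₀ x| + dist (planeProj n x₀ x) y := by
  have : x - y = height n x₀ x • n + (planeProj n x₀ x - y) := by unfold planeProj; abel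
  rw [dist_eq_norm, dist_eq_norm, this]
  refine (norm_add_le _ _).trans ?_
  rw [norm_smul, hn, mul_one, Real.norm_eq_abs]

/-- The nonnegative weight concentrated on one side of the plane at distance at most `ε`. -/
noncomputable def slabWeight (p : ℝ → ℝ) (γ : E3 → ℝ) (n x₀ : E3) (ε : ℝ) (x : E3) : ℝ :=
  ε⁻¹ * p (height n x₀ x / ε) * γ (planeProj n x₀ x)

theorem integral_slabWeight (hn : ‖n‖ = 1) (p : ℝ → ℝ) (γ : E3 → ℝ) {ε : ℝ} (hε : 0 < ε) :
    ∫ x, slabWeight p γ n x₀ ε x = ∫ x, slabWeight p γ n x₀ 1 x := by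
  set f : E3 →ₗ[ℝ] E3 := LinearMap.transvection ((ε - 1) • (innerSL ℝ n).toLinearMap) n
  have hfa : ∀ v, f v = v + ((ε - 1) * inner ℝ n v) • n := fun v => by
    simp [f, LinearMap.transvection.apply]
  have hnn : (inner ℝ n n : ℝ) = 1 := by rw [real_inner_self_eq_norm_sq, hn]; norm_num
  have hdet : LinearMap.det f = ε := by
    rw [LinearMap.transvection.det]; simp [hn]
  have hd0 : LinearMap.det f ≠ 0 := by rw [hdet]; exact hε.ne'
  set A : E3 → E3 := fun x => f x + (x₀ - f x₀)
  have hA : ∀ x, height n x₀ (A x) = ε * height n x₀ x ∧ planeProj n x₀ (A x) = planeProj n x₀ x := by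
    intro x
    have e : A x - x₀ = (x - x₀) + ((ε - 1) * inner ℝ n (x - x₀)) • n := by
      simp only [A, hfa, inner_sub_right]; module
    have e1 : height n x₀ (A x) = ε * height n x₀ x := by
      unfold height
      rw [e, inner_add_right, inner_smul_right, hnn]; ring
    refine ⟨e1, ?_⟩
    unfold planeProj
    rw [e1]
    have : A x = x + ((ε - 1) * height n x₀ x) • n := by
      have := e; rw [sub_eq_iff_eq_add] at this; rw [this]; unfold height; module
    rw [this]; module
  have hemb : MeasurableEmbedding A :=
    (((LinearMap.equivOfDetNeZero f hd0).toContinuousLinearEquiv.toHomeomorph).trans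
      (Homeomorph.addRight (x₀ - f x₀))).measurableEmbedding
  have hmap := map_linear_volume f hd0 (x₀ - f x₀)
  have key : ∫ x, slabWeight p γ n x₀ ε (A x) = ε⁻¹ * ∫ x, slabWeight p γ n x₀ ε x := by
    rw [← hemb.integral_map, hmap, integral_smul_measure, hdet,
      ENNReal.toReal_ofReal (abs_nonneg _), abs_of_pos (by positivity), smul_eq_mul]
  have e2 : ∀ x, slabWeight p γ n x₀ ε (A x) = ε⁻¹ * slabWeight p γ n x₀ 1 x := by
    intro x
    unfold slabWeight
    rw [(hA x).1, (hA x).2, mul_div_cancel_left₀ _ hε.ne']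
    simp; ring
  simp_rw [e2] at key
  rw [integral_const_mul] at key
  exact (mul_left_cancel₀ (inv_ne_zero hε.ne') key).symm

theorem continuous_slabWeight {p : ℝ → ℝ} (hp : Continuous p) {γ : E3 → ℝ} (hγ : Continuous γ)
    (ε : ℝ) : Continuous (slabWeight p γ n x₀ ε) := by
  have h1 := (contDiff_height (n := n) (x₀ := x₀)).continuous
  have h2 := (contDiff_planeProj (n := n) (x₀ := x₀)).continuous
  unfold slabWeight
  fun_prop

theorem lineSmear_slabWeight {d : E3} (hnd : inner ℝ n d = (0:ℝ)) (p : ℝ → ℝ) (γ : E3 → ℝ) (ε : ℝ)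
    (x : E3) : lineSmear (slabWeight p γ n x₀ ε) d x
      = ε⁻¹ * p (height n x₀ x / ε) * lineSmear γ d (planeProj n x₀ x) := by
  unfold lineSmear slabWeight
  simp_rw [height_sub_smul hnd, planeProj_sub_smul hnd]
  rw [intervalIntegral.integral_const_mul]

end Slab

theorem integral_pos_slabWeight {n x₀ : E3} (hn : ‖n‖ = 1) {p : ℝ → ℝ} (hp : Continuous p)
    (hp0 : ∀ t, 0 ≤ p t) (hps : ∀ t, p t ≠ 0 → 0 < t ∧ t ≤ 1) (hpe : ∃ t, p t ≠ 0)
    {δ : ℝ} (γ : ContDiffBump x₀) (hγ : γ.rOut = δ) :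
    0 < ∫ x, slabWeight p γ n x₀ 1 x := by
  have hnn : (inner ℝ n n : ℝ) = 1 := by rw [real_inner_self_eq_norm_sq, hn]; norm_num
  obtain ⟨t, ht⟩ := hpe
  have hh : height n x₀ (x₀ + t • n) = t := by simp [height, inner_smul_right, hn]
  have hpp : planeProj n x₀ (x₀ + t • n) = x₀ := by unfold planeProj; rw [hh]; simp
  refine Continuous.integral_pos_of_hasCompactSupport_nonneg_nonzero (x := x₀ + t • n)
    (continuous_slabWeight hp γ.continuous 1) ?_ ?_ ?_
  · refine HasCompactSupport.intro (isCompact_closedBall x₀ (1 + δ)) fun x hx => ?_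
    by_contra hne
    apply hx
    unfold slabWeight at hne
    have h1 : p (height n x₀ x / 1) ≠ 0 := fun h => hne (by rw [h]; simp)
    have h2 : γ (planeProj n x₀ x) ≠ 0 := fun h => hne (by rw [h]; simp)
    have h3 : planeProj n x₀ x ∈ Metric.ball x₀ δ := by
      rw [← hγ, ← γ.support_eq]; exact h2
    have h4 := hps _ h1
    rw [div_one] at h4
    have h5 := dist_le_height_add (x₀ := x₀) hn x x₀
    rw [abs_of_pos h4.1] at h5
    rw [Metric.mem_ball] at h3
    rw [Metric.mem_closedBall]
    linarith [h4.2]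
  · intro x
    exact mul_nonneg (mul_nonneg (by norm_num) (hp0 _)) γ.nonneg
  · unfold slabWeight
    rw [hh, hpp, γ.one_of_mem_closedBall (Metric.mem_closedBall_self γ.rIn_pos.le)]
    simpa using ht

theorem tendsto_integral_cutoff {W : Set E3} {n x₀ : E3} (hn : ‖n‖ = 1) {θ : ℝ → ℝ}
    (hθ : Continuous θ) (h0 : ∀ t, 0 ≤ θ t) (h1 : ∀ t, θ t ≤ 1) (hs : ∀ t, 1 ≤ |t| → θ t = 0)
    {H : E3 → ℝ} (hH : Integrable H (volume.restrict W)) :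
    Tendsto (fun ε : ℝ => ∫ x in W, θ (height n x₀ x / ε) * H x) (𝓝[>] 0) (𝓝 0) := by
  have hc := (contDiff_height (n := n) (x₀ := x₀)).continuous
  rw [show 𝓝 (0:ℝ) = 𝓝 (∫ x in W, (0:ℝ)) by simp]
  refine tendsto_integral_filter_of_dominated_convergence (fun x => ‖H x‖) ?_ ?_ hH.norm ?_
  · filter_upwards with ε
    refine AEStronglyMeasurable.mul ?_ hH.aestronglyMeasurable
    exact Continuous.aestronglyMeasurable (by fun_prop)
  · filter_upwards with ε
    filter_upwards with x
    rw [norm_mul, Real.norm_eq_abs, abs_of_nonneg (h0 _)]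
    exact mul_le_of_le_one_left (norm_nonneg _) (h1 _)
  · have hz : volume {x | height n x₀ x = 0} = 0 := by
      have := volume_affine_zero ((innerSL ℝ n).toLinearMap.toAffineMap.comp
        (AffineEquiv.vaddConst ℝ x₀).symm.toAffineMap) (p := x₀ + n) (by simp [hn])
      simpa [height] using this
    have hz' : ∀ᵐ x ∂(volume.restrict W), height n x₀ x ≠ 0 :=
      ae_restrict_of_ae (measure_eq_zero_iff_ae_notMem.1 hz)
    filter_upwards [hz'] with x hx
    refine tendsto_const_nhds.congr' ?_
    have hpos : 0 < |height n x₀ x| := abs_pos.2 hx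
    filter_upwards [Ioo_mem_nhdsGT hpos] with ε hε
    rw [hs, zero_mul]
    rw [abs_div, abs_of_pos hε.1, le_div_iff₀ hε.1]
    linarith [hε.2]

theorem inner_gradient {a : E3 → ℝ} (x v : E3) : (inner ℝ (gradient a x) v : ℝ) = fderiv ℝ a x v := by
  rw [gradient, InnerProductSpace.toDual_symm_apply]

theorem continuous_gradient {a : E3 → ℝ} (ha : ContDiff ℝ ∞ a) : Continuous (gradient a) := by
  unfold gradient
  exact (LinearIsometryEquiv.continuous _).comp (ha.continuous_fderiv (by simp))

theorem exists_tau {ℓ : E3 → ℝ} {S : Set E3} {x₀ : E3} (hx : x₀ ∈ S) (hℓ : ContinuousOn ℓ S)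
    {η : ℝ} (hη : 0 < η) : ∃ τ > 0, ∀ x ∈ S, dist x x₀ < τ → |ℓ x - ℓ x₀| ≤ η := by
  obtain ⟨τ, h1, h2⟩ := Metric.continuousOn_iff.1 hℓ x₀ hx η hη
  exact ⟨τ, h1, fun x hx hd => (Real.dist_eq _ _ ▸ h2 x hx hd).le⟩

theorem cross_add_right (a b c : E3) : cross a (b + c) = cross a b + cross a c := by
  apply E3.ext3 <;> simp <;> ring
theorem cross_add_left (a b c : E3) : cross (a + b) c = cross a c + cross b c := by
  apply E3.ext3 <;> simp <;> ring
theorem cross_smul_left (r : ℝ) (a b : E3) : cross (r • a) b = r • cross a b := by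
  apply E3.ext3 <;> simp <;> ring
theorem cross_cross_of_orthonormal {n d : E3} (hn : ‖n‖ = 1) (hnd : inner ℝ n d = (0:ℝ)) :
    cross n (cross n d) = - d := by
  have h1 : n 0 * n 0 + n 1 * n 1 + n 2 * n 2 = 1 := by
    rw [← inner_eq, real_inner_self_eq_norm_sq, hn]; norm_num
  rw [inner_eq] at hnd
  apply E3.ext3 <;> simp
  · linear_combination n 0 * hnd - d 0 * h1
  · linear_combination n 1 * hnd - d 1 * h1
  · linear_combination n 2 * hnd - d 2 * h1

theorem memLp_coord {μ : Measure E3} {f : E3 → E3} (hf : MemLp f 2 μ) (i : Fin 3) :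
    MemLp (fun x => f x i) 2 μ := by
  have h : MemLp (fun x => (inner ℝ (f x) (unitVec i) : ℝ)) 2 μ := hf.inner_const (unitVec i)
  simpa [unitVec, EuclideanSpace.inner_single_right] using h

theorem integrable_inner_of_memLp {μ : Measure E3} {f g : E3 → E3} (hf : MemLp f 2 μ)
    (hg : MemLp g 2 μ) : Integrable (fun x => (inner ℝ (f x) (g x) : ℝ)) μ := by
  simp_rw [inner_eq]
  have h : ∀ i, Integrable (fun x => f x i * g x i) μ := fun i =>
    MemLp.integrable_smul_two (memLp_coord hf i) (memLp_coord hg i)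
  exact ((h 0).add (h 1)).add (h 2)

theorem face_jump_zero {W : Set E3} (hWo : IsOpen W) (hWb : Bornology.IsBounded W) {f w : E3 → E3}
    (hf : MemLp f 2 (volume.restrict W)) (hw : MemLp w 2 (volume.restrict W))
    (hcurl : ∀ φ : E3 → E3, ContDiff ℝ ∞ φ → HasCompactSupport φ → tsupport φ ⊆ W →
      ∫ x in W, inner ℝ (f x) (curl φ x) = ∫ x in W, inner ℝ (w x) (φ x))
    {n d x₀ : E3} (hn : ‖n‖ = 1) (hnd : inner ℝ n d = (0:ℝ))
    (hseg : ∀ r ∈ Icc (0:ℝ) 1, x₀ + r • d ∈ W) {r₀ : ℝ} (hr₀ : 0 < r₀) {ℓp ℓm : E3 → ℝ}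
    (hℓp : ContinuousOn ℓp (Metric.closedBall x₀ r₀ ∩ {x | 0 ≤ height n x₀ x}))
    (hℓm : ContinuousOn ℓm (Metric.closedBall x₀ r₀ ∩ {x | height n x₀ x ≤ 0}))
    (hP : ∀ κ : E3 → ℝ, Continuous κ → HasCompactSupport κ →
      (∀ x, κ x ≠ 0 → x ∈ Metric.closedBall x₀ r₀ ∧ 0 ≤ height n x₀ x) →
      ∫ x in W, lineSmear κ d x * inner ℝ (f x) d = ∫ x, κ x * ℓp x)
    (hM : ∀ κ : E3 → ℝ, Continuous κ → HasCompactSupport κ →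
      (∀ x, κ x ≠ 0 → x ∈ Metric.closedBall x₀ r₀ ∧ height n x₀ x ≤ 0) →
      ∫ x in W, lineSmear κ d x * inner ℝ (f x) d = ∫ x, κ x * ℓm x) :
    ℓp x₀ = ℓm x₀ := by
  have hhc := (contDiff_height (n := n) (x₀ := x₀)).continuous
  have hmain : ∀ η : ℝ, 0 < η → |ℓp x₀ - ℓm x₀| ≤ 2 * η := by
    intro η hη
    have hh0 : height n x₀ x₀ = 0 := by simp [height]
    obtain ⟨τp, hτp, hp'⟩ := exists_tau (x₀ := x₀)
      (S := Metric.closedBall x₀ r₀ ∩ {x | 0 ≤ height n x₀ x}) ⟨Metric.mem_closedBall_self hr₀.le, hh0.ge⟩ hℓp hη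
    obtain ⟨τm, hτm, hm'⟩ := exists_tau (x₀ := x₀)
      (S := Metric.closedBall x₀ r₀ ∩ {x | height n x₀ x ≤ 0}) ⟨Metric.mem_closedBall_self hr₀.le, hh0.le⟩ hℓm hη
    set seg : Set E3 := (fun r : ℝ => x₀ + r • d) '' Icc 0 1
    have hsegc : IsCompact seg := isCompact_Icc.image (by fun_prop)
    obtain ⟨δ₀, hδ₀, hδW⟩ := hsegc.exists_cthickening_subset_open hWo
      (by rintro _ ⟨r, hr, rfl⟩; exact hseg r hr)
    obtain ⟨δ, hδ, hδ1, hδ2, hδ3, hδ4⟩ : ∃ δ > 0, 2 * δ ≤ δ₀ ∧ 2 * δ < τp ∧ 2 * δ < τm ∧ 2 * δ ≤ r₀ := by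
      refine ⟨min (min δ₀ r₀) (min τp τm) / 3, by positivity, ?_, ?_, ?_, ?_⟩
      · have : min (min δ₀ r₀) (min τp τm) ≤ δ₀ := (min_le_left _ _).trans (min_le_left _ _)
        linarith
      · have : min (min δ₀ r₀) (min τp τm) ≤ τp := (min_le_right _ _).trans (min_le_left _ _)
        linarith
      · have : min (min δ₀ r₀) (min τp τm) ≤ τm := (min_le_right _ _).trans (min_le_right _ _)
        linarith
      · have : min (min δ₀ r₀) (min τp τm) ≤ r₀ := (min_le_left _ _).trans (min_le_right _ _)
        linarith
    obtain ⟨θ, p, hθs, hθ0, hθ1, hθv, hθd, hpc, hp0, hps, hpe⟩ := exists_even_cutoff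
    let γ : ContDiffBump x₀ := ⟨δ / 2, δ, by positivity, by linarith⟩
    have hγs : ContDiff ℝ ∞ (γ : E3 → ℝ) := γ.contDiff
    have hγsupp : ∀ y, γ y ≠ 0 → dist y x₀ < δ := fun y hy => by
      have : y ∈ Function.support γ := hy
      rwa [γ.support_eq] at this
    set α : E3 → ℝ := fun x => lineSmear γ d (planeProj n x₀ x)
    have hα : ContDiff ℝ ∞ α := (contDiff_lineSmear hγs γ.hasCompactSupport d).comp contDiff_planeProj
    have hαc := hα.continuous
    have hαd : ∀ x, HasFDerivAt α (fderiv ℝ α x) x := fun x =>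
      (hα.differentiable (by simp) x).hasFDerivAt
    set ν := cross n d
    set H : E3 → ℝ := fun x => α x * inner ℝ (w x) ν - inner ℝ (f x) (cross (gradient α x) ν)
    have hgc : Continuous fun x => cross (gradient α x) ν := by
      have := continuous_gradient hα
      have e : ∀ x, cross (gradient α x) ν = - crossL ν (gradient α x) := fun x => by
        rw [crossL_apply]; apply E3.ext3 <;> simp <;> ring
      simp_rw [e]; fun_prop
    have hfin : IsFiniteMeasure (volume.restrict W) := ⟨by simpa using hWb.measure_lt_top⟩
    have hI1 : Integrable (fun x => α x * inner ℝ (w x) ν) (volume.restrict W) :=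
      MemLp.integrable_smul_two (memLp_of_isBounded hWo hWb hαc 2) (hw.inner_const ν)
    have hI2 : Integrable (fun x => inner ℝ (f x) (cross (gradient α x) ν)) (volume.restrict W) :=
      integrable_inner_of_memLp hf (memLp_of_isBounded hWo hWb hgc 2)
    have hH : Integrable H (volume.restrict W) := hI1.sub hI2
    set M := ∫ x, slabWeight p γ n x₀ 1 x
    have hMpos : 0 < M := integral_pos_slabWeight hn hpc hp0 hps hpe γ rfl
    have hM' : ∫ x, slabWeight (fun t => p (-t)) γ n x₀ 1 x = M := by
      rw [← integral_sub_left_eq_self _ volume (x₀ + x₀)]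
      refine integral_congr_ae (Eventually.of_forall fun x => ?_)
      simp only [slabWeight, height_reflect, planeProj_reflect]
      have : γ (x₀ + x₀ - planeProj n x₀ x) = γ (planeProj n x₀ x) := by
        have e := γ.sub (planeProj n x₀ x - x₀)
        rw [show x₀ - (planeProj n x₀ x - x₀) = x₀ + x₀ - planeProj n x₀ x by abel] at e
        rw [e]; congr 1; abel
      rw [this]; norm_num
    have hbound : ∀ ε : ℝ, 0 < ε → ε ≤ δ →
        M * |ℓp x₀ - ℓm x₀| ≤ |∫ x in W, θ (height n x₀ x / ε) * H x| + 2 * (M * η) := by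
      intro ε hε hεδ
      set κ := slabWeight p γ n x₀ ε with hκdef
      set κ' := slabWeight (fun t => p (-t)) γ n x₀ ε with hκdef'
      have hκc : Continuous κ := continuous_slabWeight hpc γ.continuous ε
      have hκc' : Continuous κ' := continuous_slabWeight (by fun_prop) γ.continuous ε
      have hsupp : ∀ x, κ x ≠ 0 → dist x x₀ < 2 * δ ∧ 0 ≤ height n x₀ x := by
        intro x hx
        have h1 : p (height n x₀ x / ε) ≠ 0 := fun h => hx (by rw [hκdef, slabWeight, h]; simp)
        have h2 : γ (planeProj n x₀ x) ≠ 0 := fun h => hx (by rw [hκdef, slabWeight, h]; simp)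
        have h3 := hps _ h1
        have h4 := hγsupp _ h2
        have h5 := dist_le_height_add (x₀ := x₀) hn x x₀
        have h6 : 0 < height n x₀ x := by have := h3.1; rwa [div_pos_iff_of_pos_right hε] at this
        have h7 : height n x₀ x ≤ ε := by have := h3.2; rwa [div_le_one hε] at this
        rw [abs_of_pos h6] at h5
        exact ⟨by linarith, h6.le⟩
      have hsupp' : ∀ x, κ' x ≠ 0 → dist x x₀ < 2 * δ ∧ height n x₀ x ≤ 0 := by
        intro x hx
        have h1 : p (-(height n x₀ x / ε)) ≠ 0 := fun h => hx (by rw [hκdef', slabWeight, h]; simp)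
        have h2 : γ (planeProj n x₀ x) ≠ 0 := fun h => hx (by rw [hκdef', slabWeight, h]; simp)
        have h3 := hps _ h1
        rw [← neg_div] at h3
        have h4 := hγsupp _ h2
        have h5 := dist_le_height_add (x₀ := x₀) hn x x₀
        have h6 : 0 < - height n x₀ x := by have := h3.1; rwa [div_pos_iff_of_pos_right hε] at this
        have h7 : - height n x₀ x ≤ ε := by have := h3.2; rwa [div_le_one hε] at this
        rw [abs_of_neg (by linarith)] at h5
        exact ⟨by linarith, by linarith⟩
      have hcs : ∀ q : E3 → ℝ, (∀ x, q x ≠ 0 → dist x x₀ < 2 * δ) → HasCompactSupport q :=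
        fun q hq => HasCompactSupport.intro (isCompact_closedBall x₀ (2 * δ)) fun x hx => by
          by_contra hne; exact hx (hq x hne).le
      have hκs := hcs κ fun x hx => (hsupp x hx).1
      have hκs' := hcs κ' fun x hx => (hsupp' x hx).1
      have eP := hP κ hκc hκs fun x hx => ⟨(hsupp x hx).1.le.trans hδ4, (hsupp x hx).2⟩
      have eM := hM κ' hκc' hκs' fun x hx => ⟨(hsupp' x hx).1.le.trans hδ4, (hsupp' x hx).2⟩
      have hmass : ∫ x, κ x = M := integral_slabWeight hn p γ hε
      have hmass' : ∫ x, κ' x = M := (integral_slabWeight hn _ γ hε).trans hM'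
      have hnn : ∀ x, 0 ≤ κ x := fun x =>
        mul_nonneg (mul_nonneg (by positivity) (hp0 _)) γ.nonneg
      have hnn' : ∀ x, 0 ≤ κ' x := fun x =>
        mul_nonneg (mul_nonneg (by positivity) (hp0 _)) γ.nonneg
      have b1 := abs_integral_mul_sub_le hκc hκs hnn
        ((isCompact_closedBall x₀ r₀).inter_right (isClosed_le continuous_const hhc))
        (fun x hx => ⟨(hsupp x hx).1.le.trans hδ4, (hsupp x hx).2⟩) hℓp (c := ℓp x₀) (ε := η)
        (fun x hx => hp' x ⟨(hsupp x hx).1.le.trans hδ4, (hsupp x hx).2⟩ ((hsupp x hx).1.trans hδ2))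
      have b2 := abs_integral_mul_sub_le hκc' hκs' hnn'
        ((isCompact_closedBall x₀ r₀).inter_right (isClosed_le hhc continuous_const))
        (fun x hx => ⟨(hsupp' x hx).1.le.trans hδ4, (hsupp' x hx).2⟩) hℓm (c := ℓm x₀) (ε := η)
        (fun x hx => hm' x ⟨(hsupp' x hx).1.le.trans hδ4, (hsupp' x hx).2⟩
          ((hsupp' x hx).1.trans hδ3))
      rw [hmass] at b1
      rw [hmass'] at b2
      -- the test field
      set a : E3 → ℝ := fun x => θ (height n x₀ x / ε) * α x
      have haC : ContDiff ℝ ∞ a := by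
        have := contDiff_height (n := n) (x₀ := x₀)
        exact (hθs.comp (this.div_const ε)).mul hα
      have hasupp : ∀ x, a x ≠ 0 → x ∈ Metric.cthickening (2 * δ) seg := by
        intro x hx
        have h1 : θ (height n x₀ x / ε) ≠ 0 := left_ne_zero_of_mul hx
        have h2 : lineSmear γ d (planeProj n x₀ x) ≠ 0 := right_ne_zero_of_mul hx
        have h3 : |height n x₀ x| < ε := by
          by_contra! hge
          refine h1 (hθv _ ?_)
          rwa [abs_div, abs_of_pos hε, le_div_iff₀ hε, one_mul]
        have h4 : planeProj n x₀ x ∈ sweep (Function.support γ) d := by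
          by_contra hne; exact h2 (lineSmear_eq_zero le_rfl hne)
        obtain ⟨⟨y, r⟩, ⟨hy, hr⟩, hyr⟩ := h4
        simp only at hyr
        refine Metric.mem_cthickening_of_dist_le x (x₀ + r • d) _ _ ⟨r, hr, rfl⟩ ?_
        have h5 := dist_le_height_add (x₀ := x₀) hn x (x₀ + r • d)
        rw [← hyr, dist_add_right] at h5
        linarith [hγsupp y hy]
      have hts : tsupport (fun x => a x • ν) ⊆ Metric.cthickening (2 * δ) seg :=
        closure_minimal (fun x hx => hasupp x (left_ne_zero_of_smul hx)) Metric.isClosed_cthickening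
      have hφc : HasCompactSupport (fun x => a x • ν) :=
        hsegc.cthickening.of_isClosed_subset (isClosed_tsupport _) hts
      have hid := hcurl (fun x => a x • ν) (haC.smul contDiff_const) hφc
        (hts.trans ((Metric.cthickening_mono hδ1 _).trans hδW))
      have hcurlφ : ∀ x, curl (fun x => a x • ν) x
          = (lineSmear κ d x - lineSmear κ' d x) • d
            + θ (height n x₀ x / ε) • cross (gradient α x) ν := by
        intro x
        have d1 : HasFDerivAt (fun x => θ (height n x₀ x / ε))
            ((-(p (height n x₀ x / ε) - p (-(height n x₀ x / ε)))) • (ε⁻¹ • innerSL ℝ n)) x := by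
          have e := (hasFDerivAt_height (n := n) (x₀ := x₀) x).const_mul ε⁻¹
          have e' := (hθd (ε⁻¹ * height n x₀ x)).comp_hasFDerivAt x e
          simp only [div_eq_inv_mul]
          exact e'
        have d2 : HasFDerivAt a _ x := d1.mul (hαd x)
        rw [curl_smul_const (g := (α x * (-(p (height n x₀ x / ε) - p (-(height n x₀ x / ε))) * ε⁻¹)) • n
          + θ (height n x₀ x / ε) • gradient α x) d2]
        · rw [cross_add_left, cross_smul_left, cross_smul_left, cross_cross_of_orthonormal hn hnd,
            lineSmear_slabWeight hnd, lineSmear_slabWeight hnd]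
          congr 1
          simp only [α]
          rw [smul_neg, ← neg_smul]
          congr 1; ring
        · intro v
          rw [inner_add_left, inner_smul_left, inner_smul_left, inner_gradient]
          simp
          ring
      have hL1 : Integrable (fun x => lineSmear κ d x * inner ℝ (f x) d) (volume.restrict W) :=
        MemLp.integrable_smul_two (memLp_of_isBounded hWo hWb (continuous_lineSmear hκc d) 2)
          (hf.inner_const d)
      have hL2 : Integrable (fun x => lineSmear κ' d x * inner ℝ (f x) d) (volume.restrict W) :=
        MemLp.integrable_smul_two (memLp_of_isBounded hWo hWb (continuous_lineSmear hκc' d) 2)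
          (hf.inner_const d)
      have hθm : MemLp (fun x => θ (height n x₀ x / ε)) 2 (volume.restrict W) := 
        memLp_of_isBounded hWo hWb (hθs.continuous.comp (hhc.div_const ε)) 2
      have hJ : ∀ q : E3 → ℝ, Integrable q (volume.restrict W) →
          Integrable (fun x => θ (height n x₀ x / ε) * q x) (volume.restrict W) := fun q hq =>
        hq.bdd_mul (c := 1) hθm.aestronglyMeasurable (Eventually.of_forall fun x => by
          rw [Real.norm_eq_abs, abs_of_nonneg (hθ0 _)]; exact hθ1 _)
      have hfinal : (∫ x, κ x * ℓp x) - (∫ x, κ' x * ℓm x)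
          = ∫ x in W, θ (height n x₀ x / ε) * H x := by
        have hL := integral_sub (hL1.sub hL2) (hJ _ hH)
        simp only [Pi.sub_apply] at hL
        rw [← eP, ← eM, ← integral_sub hL1 hL2, ← sub_eq_zero, ← hL]
        have e0 : ∫ x in W, (inner ℝ (f x) (curl (fun x => a x • ν) x) - inner ℝ (w x) (a x • ν)) = 0 := by
          rw [integral_sub, hid, sub_self]
          · have : ∀ x, inner ℝ (f x) (curl (fun x => a x • ν) x)
                = (lineSmear κ d x * inner ℝ (f x) d - lineSmear κ' d x * inner ℝ (f x) d)
                  + θ (height n x₀ x / ε) * inner ℝ (f x) (cross (gradient α x) ν) := fun x => by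
              rw [hcurlφ, inner_add_right, inner_smul_right, inner_smul_right]; ring
            simp_rw [this]
            exact (hL1.sub hL2).add (hJ _ hI2)
          · have : ∀ x, (inner ℝ (w x) (a x • ν) : ℝ)
                = θ (height n x₀ x / ε) * (α x * inner ℝ (w x) ν) := fun x => by
              rw [inner_smul_right]; simp only [a]; ring
            simp_rw [this]
            exact hJ _ hI1
        rw [← e0]
        refine integral_congr_ae (Eventually.of_forall fun x => ?_)
        simp only [hcurlφ, inner_add_right, inner_smul_right, H, a, Pi.sub_apply]
        ring
      rw [← abs_of_pos hMpos, ← abs_mul, abs_of_pos hMpos]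
      have e3 : M * (ℓp x₀ - ℓm x₀) = (∫ x in W, θ (height n x₀ x / ε) * H x)
          - ((∫ x, κ x * ℓp x) - M * ℓp x₀) + ((∫ x, κ' x * ℓm x) - M * ℓm x₀) := by
        rw [← hfinal]; ring
      rw [e3]
      refine (abs_add_le _ _).trans ?_
      have := abs_sub (∫ x in W, θ (height n x₀ x / ε) * H x) ((∫ x, κ x * ℓp x) - M * ℓp x₀)
      linarith
    have hlim : Tendsto (fun ε : ℝ => |∫ x in W, θ (height n x₀ x / ε) * H x| + 2 * (M * η)) (𝓝[>] 0)
        (𝓝 (|0| + 2 * (M * η))) :=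
      ((tendsto_integral_cutoff hn hθs.continuous hθ0 hθ1 hθv hH).abs).add_const _
    have := ge_of_tendsto hlim (by
      filter_upwards [Ioc_mem_nhdsGT hδ] with ε hε using hbound ε hε.1 hε.2)
    rw [abs_zero, zero_add] at this
    by_contra! hlt
    nlinarith
  have : |ℓp x₀ - ℓm x₀| ≤ 0 := le_of_forall_pos_le_add fun η hη => by
    have := hmain (η / 2) (by positivity); linarith
  exact sub_eq_zero.1 (abs_eq_zero.1 (le_antisymm this (abs_nonneg _)))

/-- Vertex sets of nondegenerate tetrahedra. -/
structure IsTetra (K : Finset E3) : Prop where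
  card_eq : K.card = 4
  indep : AffineIndependent ℝ (fun p : K => (p : E3))

/-- The constant gradient of a barycentric coordinate function. -/
noncomputable def gradBary (K : Finset E3) (a : E3) : E3 :=
  (InnerProductSpace.toDual ℝ E3).symm (LinearMap.toContinuousLinearMap (bary K a).linear)

theorem inner_gradBary (K : Finset E3) (a v : E3) :
    (inner ℝ (gradBary K a) v : ℝ) = (bary K a).linear v := by
  rw [gradBary, InnerProductSpace.toDual_symm_apply]; rfl

theorem bary_sub (K : Finset E3) (a x y : E3) :
    bary K a x - bary K a y = inner ℝ (gradBary K a) (x - y) := by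
  rw [inner_gradBary, ← vsub_eq_sub x y, AffineMap.linearMap_vsub]; rfl

theorem bary_eq_add (K : Finset E3) (a x y : E3) :
    bary K a x = bary K a y + inner ℝ (gradBary K a) (x - y) := by
  rw [← bary_sub]; ring

theorem hasFDerivAt_bary (K : Finset E3) (a x : E3) :
    HasFDerivAt (fun y => bary K a y) (innerSL ℝ (gradBary K a)) x := by
  have h : (fun y => bary K a y) = fun y => bary K a 0 + innerSL ℝ (gradBary K a) y := by
    ext y
    rw [bary_eq_add K a y 0]; simp
  rw [h]
  exact (innerSL ℝ (gradBary K a)).hasFDerivAt.const_add _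

theorem gradient_bary (K : Finset E3) (a x : E3) :
    gradient (fun y => bary K a y) x = gradBary K a := by
  apply ext_inner_right ℝ
  intro v
  rw [inner_gradient, (hasFDerivAt_bary K a x).fderiv]; rfl

theorem contDiff_bary (K : Finset E3) (a : E3) : ContDiff ℝ ∞ fun y => bary K a y := by
  have h : (fun y => bary K a y) = fun y => bary K a 0 + innerSL ℝ (gradBary K a) y := by
    ext y
    rw [bary_eq_add K a y 0]; simp
  rw [h]; fun_prop

theorem continuous_bary (K : Finset E3) (a : E3) : Continuous fun y => bary K a y :=
  (contDiff_bary K a).continuous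

theorem bary_combo (K : Finset E3) (a x y : E3) (t : ℝ) :
    bary K a (x + t • (y - x)) = bary K a x + t * (bary K a y - bary K a x) := by
  rw [bary_eq_add K a _ x, bary_sub, add_sub_cancel_left, inner_smul_right]

theorem isCompact_hull (K : Finset E3) : IsCompact (hull K) :=
  K.finite_toSet.isCompact_convexHull (𝕜 := ℝ)

namespace IsTetra

variable {K F : Finset E3} (hK : IsTetra K)
include hK

theorem affineSpan_eq : affineSpan ℝ (range fun p : K => (p : E3)) = ⊤ := by
  rw [hK.indep.affineSpan_eq_top_iff_card_eq_finrank_add_one]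
  simp [hK.card_eq]

/-- The vertices as an affine basis. -/
noncomputable def basis : AffineBasis K ℝ E3 := ⟨fun p => p, hK.indep, hK.affineSpan_eq⟩

theorem bary_spec {a : E3} (ha : a ∈ K) : bary K a a = 1 ∧ ∀ b ∈ K, b ≠ a → bary K a b = 0 := by
  have h : ∃ l : E3 →ᵃ[ℝ] ℝ, l a = 1 ∧ ∀ b ∈ K, b ≠ a → l b = 0 := by
    refine ⟨hK.basis.coord ⟨a, ha⟩, hK.basis.coord_apply_eq ⟨a, ha⟩, fun b hb hne => ?_⟩
    exact hK.basis.coord_apply_ne (i := ⟨a, ha⟩) (j := ⟨b, hb⟩) fun h => hne (Subtype.ext_iff.1 h).symm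
  unfold bary
  rw [dif_pos h]
  exact h.choose_spec

theorem bary_self {a : E3} (ha : a ∈ K) : bary K a a = 1 := (hK.bary_spec ha).1

theorem bary_of_ne {a b : E3} (ha : a ∈ K) (hb : b ∈ K) (h : b ≠ a) : bary K a b = 0 :=
  (hK.bary_spec ha).2 b hb h

theorem affine_eq_sum_coord (g : E3 →ᵃ[ℝ] ℝ) (x : E3) :
    g x = ∑ a : K, hK.basis.coord a x * g a := by
  conv_lhs => rw [← hK.basis.affineCombination_coord_eq_self x]
  rw [Finset.map_affineCombination _ _ _ (hK.basis.sum_coord_apply_eq_one x),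
    Finset.affineCombination_eq_linear_combination _ _ _ (hK.basis.sum_coord_apply_eq_one x)]
  rfl

theorem bary_eq_coord (a : K) (x : E3) : bary K a x = hK.basis.coord a x := by
  rw [hK.affine_eq_sum_coord, Finset.sum_eq_single a]
  · rw [hK.bary_self a.2, mul_one]
  · intro b _ hb
    rw [hK.bary_of_ne a.2 b.2 fun h => hb (Subtype.ext h), mul_zero]
  · simp

theorem affine_eq_sum (g : E3 →ᵃ[ℝ] ℝ) (x : E3) : g x = ∑ a ∈ K, bary K a x * g a := by
  rw [hK.affine_eq_sum_coord, ← Finset.sum_coe_sort K fun a => bary K a x * g a]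
  simp_rw [hK.bary_eq_coord]

theorem affine_ext {g g' : E3 →ᵃ[ℝ] ℝ} (h : ∀ a ∈ K, g a = g' a) : g = g' := by
  ext x
  rw [hK.affine_eq_sum, hK.affine_eq_sum g']
  exact Finset.sum_congr rfl fun a ha => by rw [h a ha]

theorem sum_bary (x : E3) : ∑ a ∈ K, bary K a x = 1 := by
  have := hK.affine_eq_sum (AffineMap.const ℝ E3 (1:ℝ)) x
  simpa using this.symm

theorem sum_bary_smul (x : E3) : ∑ a ∈ K, bary K a x • a = x := by
  apply ext_inner_left ℝ
  intro v
  have := hK.affine_eq_sum (innerSL ℝ v).toLinearMap.toAffineMap x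
  simp only [LinearMap.coe_toAffineMap, ContinuousLinearMap.coe_coe, innerSL_apply_apply] at this
  rw [this, inner_sum]
  simp_rw [inner_smul_right]

theorem sum_gradBary : ∑ a ∈ K, gradBary K a = 0 := by
  apply ext_inner_right ℝ
  intro v
  rw [sum_inner, inner_zero_left]
  have h1 := hK.sum_bary v
  have h2 := hK.sum_bary 0
  have : ∀ a ∈ K, inner ℝ (gradBary K a) v = bary K a v - bary K a 0 := fun a _ => by
    rw [bary_sub, sub_zero]
  rw [Finset.sum_congr rfl this, Finset.sum_sub_distrib, h1, h2, sub_self]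

theorem sum_inner_smul_gradBary (v : E3) : ∑ a ∈ K, (inner ℝ v a : ℝ) • gradBary K a = v := by
  apply ext_inner_right ℝ
  intro u
  rw [sum_inner]
  simp_rw [inner_smul_left]
  have h1 := hK.affine_eq_sum (innerSL ℝ v).toLinearMap.toAffineMap u
  have h2 := hK.affine_eq_sum (innerSL ℝ v).toLinearMap.toAffineMap 0
  simp only [LinearMap.coe_toAffineMap, ContinuousLinearMap.coe_coe, innerSL_apply_apply,
    inner_zero_right] at h1 h2
  have : ∀ a ∈ K, (starRingEnd ℝ) (inner ℝ v a) * inner ℝ (gradBary K a) u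
      = bary K a u * inner ℝ v a - bary K a 0 * inner ℝ v a := fun a _ => by
    rw [← sub_mul, bary_sub, sub_zero]; simp; ring
  rw [Finset.sum_congr rfl this, Finset.sum_sub_distrib, ← h1, ← h2, sub_zero]

theorem mem_hull_iff {x : E3} : x ∈ hull K ↔ ∀ a ∈ K, 0 ≤ bary K a x := by
  have := hK.basis.convexHull_eq_nonneg_coord
  have hr : range hK.basis = (K : Set E3) := by
    change range (fun p : K => (p : E3)) = _
    simp
  rw [hr] at this
  rw [hull, this]
  simp only [mem_setOf_eq, ← hK.bary_eq_coord]
  exact ⟨fun h a ha => h ⟨a, ha⟩, fun h a => h a a.2⟩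

theorem mem_interior_iff {x : E3} : x ∈ interior (hull K) ↔ ∀ a ∈ K, 0 < bary K a x := by
  have := hK.basis.interior_convexHull
  have hr : range hK.basis = (K : Set E3) := by
    change range (fun p : K => (p : E3)) = _
    simp
  rw [hr] at this
  rw [hull, this]
  simp only [mem_setOf_eq, ← hK.bary_eq_coord]
  exact ⟨fun h a ha => h ⟨a, ha⟩, fun h a => h a a.2⟩

theorem mem_hull_subset_iff (hF : F ⊆ K) {x : E3} :
    x ∈ hull F ↔ x ∈ hull K ∧ ∀ a ∈ K, a ∉ F → bary K a x = 0 := by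
  constructor
  · intro hx
    refine ⟨convexHull_mono (by exact_mod_cast hF) hx, fun a ha haF => ?_⟩
    have hconv : Convex ℝ {y : E3 | bary K a y = 0} := by
      intro y hy z hz s t _ _ hst
      have : s • y + t • z = y + t • (z - y) := by
        rw [← eq_sub_iff_add_eq] at hst; rw [hst]; module
      simp only [mem_setOf_eq] at hy hz ⊢
      rw [this, bary_combo, hy, hz]; ring
    refine convexHull_min (t := {y : E3 | bary K a y = 0}) ?_ hconv hx
    intro b hb
    exact hK.bary_of_ne ha (hF hb) fun h => haF (h ▸ hb)
  · rintro ⟨hx, h0⟩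
    rw [hK.mem_hull_iff] at hx
    have e1 : ∑ a ∈ F, bary K a x • a = x := by
      conv_rhs => rw [← hK.sum_bary_smul x]
      exact Finset.sum_subset hF fun a ha haF => by rw [h0 a ha haF, zero_smul]
    have e2 : ∑ a ∈ F, bary K a x = 1 := by
      rw [← hK.sum_bary x]
      exact Finset.sum_subset hF fun a ha haF => h0 a ha haF
    rw [← e1]
    exact (convex_convexHull ℝ _).sum_mem (fun a ha => hx a (hF ha)) e2
      fun a ha => subset_convexHull ℝ _ ha

theorem bary_le_one {x : E3} (hx : x ∈ hull K) {a : E3} (ha : a ∈ K) : bary K a x ≤ 1 := by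
  rw [← hK.sum_bary x]
  exact Finset.single_le_sum (f := fun a => bary K a x) (fun b hb => hK.mem_hull_iff.1 hx b hb) ha

theorem gradBary_ne_zero {a : E3} (ha : a ∈ K) : gradBary K a ≠ 0 := by
  intro h
  obtain ⟨b, hb, hne⟩ := Finset.exists_mem_ne (by rw [hK.card_eq]; norm_num) a
  have := bary_sub K a a b
  rw [h, hK.bary_self ha, hK.bary_of_ne ha hb hne] at this
  simp at this

theorem interior_nonempty : (interior (hull K)).Nonempty := by
  refine ⟨∑ a ∈ K, (1/4 : ℝ) • a, hK.mem_interior_iff.2 fun a ha => ?_⟩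
  have e : ∀ g : E3 →ᵃ[ℝ] ℝ, g (∑ a ∈ K, (1/4 : ℝ) • a) = ∑ a ∈ K, (1/4 : ℝ) * g a := by
    intro g
    have := Finset.map_affineCombination K (fun a => a) (fun _ => (1/4:ℝ))
      (by simp [hK.card_eq]) g
    rw [Finset.affineCombination_eq_linear_combination _ _ _ (by simp [hK.card_eq]),
      Finset.affineCombination_eq_linear_combination _ _ _ (by simp [hK.card_eq])] at this
    simpa using this
  rw [e, ← Finset.mul_sum, Finset.sum_eq_single a (fun b hb hne => hK.bary_of_ne ha hb hne)
    (fun h => absurd ha h), hK.bary_self ha]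
  norm_num

theorem nonempty : K.Nonempty := by rw [← Finset.card_pos, hK.card_eq]; norm_num

theorem closure_interior : closure (interior (hull K)) = hull K := by
  have hc : Convex ℝ (hull K) := convex_convexHull ℝ _
  rw [hc.closure_interior_eq_closure_of_nonempty_interior hK.interior_nonempty]
  exact (isCompact_hull K).isClosed.closure_eq

theorem convexElement : ConvexElement (interior (hull K)) (elemDiam K) where
  isOpen := isOpen_interior
  convex := (convex_convexHull ℝ _).interior
  nonempty := hK.interior_nonempty
  dist_le := by
    intro x hx y hy
    rw [hK.closure_interior] at hx hy
    exact Metric.dist_le_diam_of_mem (isCompact_hull K).isBounded hx hy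

theorem norm_gradBary_mul_le {a : E3} (ha : a ∈ K) {r : ℝ} (hr : 0 ≤ r) {c : E3}
    (hc : Metric.closedBall c r ⊆ hull K) : r * ‖gradBary K a‖ ≤ 1 := by
  have hg := norm_pos_iff.2 (hK.gradBary_ne_zero ha)
  have h1 : c + (r / ‖gradBary K a‖) • gradBary K a ∈ hull K := by
    apply hc
    rw [Metric.mem_closedBall, dist_eq_norm, add_sub_cancel_left, norm_smul, Real.norm_eq_abs,
      abs_of_nonneg (by positivity), div_mul_cancel₀ _ hg.ne']
  have h2 : c ∈ hull K := hc (Metric.mem_closedBall_self hr)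
  have h3 := bary_sub K a (c + (r / ‖gradBary K a‖) • gradBary K a) c
  rw [add_sub_cancel_left, inner_smul_right, real_inner_self_eq_norm_sq] at h3
  have h4 := hK.bary_le_one h1 ha
  have h5 := hK.mem_hull_iff.1 h2 a ha
  have h6 : r / ‖gradBary K a‖ * ‖gradBary K a‖ ^ 2 = r * ‖gradBary K a‖ := by
    field_simp
  linarith

theorem bddAbove_radii : BddAbove {r : ℝ | 0 ≤ r ∧ ∃ c : E3, Metric.closedBall c r ⊆ hull K} := by
  obtain ⟨a, ha⟩ := hK.nonempty
  have hg := norm_pos_iff.2 (hK.gradBary_ne_zero ha)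
  refine ⟨1 / ‖gradBary K a‖, ?_⟩
  rintro r ⟨hr, c, hc⟩
  rw [le_div_iff₀ hg]
  exact hK.norm_gradBary_mul_le ha hr hc

theorem inRadius_pos : 0 < inRadius K := by
  obtain ⟨c, hc⟩ := hK.interior_nonempty
  obtain ⟨r, hr, hb⟩ := Metric.nhds_basis_closedBall.mem_iff.1 (mem_interior_iff_mem_nhds.1 hc)
  exact hr.trans_le (le_csSup hK.bddAbove_radii ⟨hr.le, c, hb⟩)

theorem inRadius_mul_le {a : E3} (ha : a ∈ K) : inRadius K * ‖gradBary K a‖ ≤ 1 := by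
  have hg := norm_pos_iff.2 (hK.gradBary_ne_zero ha)
  rw [← le_div_iff₀ hg]
  obtain ⟨c, hc⟩ := hK.interior_nonempty
  refine csSup_le ⟨0, le_rfl, c, ?_⟩ ?_
  · simpa using interior_subset hc
  · rintro r ⟨hr, c, hc⟩
    rw [le_div_iff₀ hg]
    exact hK.norm_gradBary_mul_le ha hr hc

theorem elemDiam_mul_le {ρ : ℝ} (hρ : shapeMeasure K ≤ ρ) {a : E3} (ha : a ∈ K) :
    elemDiam K * ‖gradBary K a‖ ≤ ρ := by
  have h1 := hK.inRadius_pos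
  have h0 : 0 ≤ elemDiam K := Metric.diam_nonneg
  rw [shapeMeasure, div_le_iff₀ h1] at hρ
  have hρ0 : 0 ≤ ρ := by
    by_contra! h; nlinarith
  calc _ ≤ ρ * inRadius K * ‖gradBary K a‖ := by gcongr
    _ = ρ * (inRadius K * ‖gradBary K a‖) := by ring
    _ ≤ ρ * 1 := by gcongr; exact hK.inRadius_mul_le ha
    _ = ρ := mul_one _

theorem elemDiam_pos : 0 < elemDiam K := by
  obtain ⟨a, ha⟩ := hK.nonempty
  obtain ⟨b, hb, hne⟩ := Finset.exists_mem_ne (by rw [hK.card_eq]; norm_num) a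
  refine (dist_pos.2 hne).trans_le ?_
  exact Metric.dist_le_diam_of_mem (isCompact_hull K).isBounded
    (subset_convexHull ℝ _ hb) (subset_convexHull ℝ _ ha)

end IsTetra

theorem tail_head {E : Finset E3} (hE : E.card = 2) :
    tail E ∈ E ∧ head E ∈ E ∧ tail E ≠ head E ∧ ∀ x ∈ E, x = tail E ∨ x = head E := by
  have hl : E.toList.length = 2 := by simp [hE]
  obtain ⟨a, b, hab⟩ := List.length_eq_two.1 hl
  have hm : ∀ x, x ∈ E ↔ x = a ∨ x = b := fun x => by
    rw [← Finset.mem_toList, hab]; simp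
  have hnd := E.nodup_toList
  rw [hab] at hnd
  have ht : tail E = a := by simp [tail, hab]
  have hh : head E = b := by simp [head, hab]
  rw [ht, hh]
  exact ⟨(hm a).2 (Or.inl rfl), (hm b).2 (Or.inr rfl), by simpa using hnd, fun x hx => (hm x).1 hx⟩

theorem sum_edges {K : Finset E3} {M : Type*} [AddCommGroup M] [Module ℝ M] (f : E3 → E3 → M)
    (hs : ∀ a b, f a b = f b a) (h0 : ∀ a, f a a = 0) :
    ∑ E ∈ K.powersetCard 2, f (tail E) (head E) = (2:ℝ)⁻¹ • ∑ a ∈ K, ∑ b ∈ K, f a b := by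
  classical
  have h1 : ∑ a ∈ K, ∑ b ∈ K, f a b = ∑ p ∈ K.offDiag, f p.1 p.2 := by
    rw [← Finset.sum_product']
    refine (Finset.sum_subset (fun p hp => ?_) fun p hp hn => ?_).symm
    · rw [Finset.mem_offDiag] at hp
      exact Finset.mem_product.2 ⟨hp.1, hp.2.1⟩
    · rw [Finset.mem_product] at hp
      rw [Finset.mem_offDiag] at hn
      have : p.1 = p.2 := by
        by_contra hne; exact hn ⟨hp.1, hp.2, hne⟩
      rw [this, h0]
  have hmap : ∀ p ∈ K.offDiag, ({p.1, p.2} : Finset E3) ∈ K.powersetCard 2 := by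
    intro p hp
    rw [Finset.mem_offDiag] at hp
    rw [Finset.mem_powersetCard]
    exact ⟨by simp [Finset.insert_subset_iff, hp.1, hp.2.1], Finset.card_pair hp.2.2⟩
  rw [h1, ← Finset.sum_fiberwise_of_maps_to hmap, Finset.smul_sum]
  refine Finset.sum_congr rfl fun E hE => ?_
  rw [Finset.mem_powersetCard] at hE
  obtain ⟨ht, hh, hne, hall⟩ := tail_head hE.2
  have hfil : {p ∈ K.offDiag | ({p.1, p.2} : Finset E3) = E}
      = {(tail E, head E), (head E, tail E)} := by
    have hEe : E = {tail E, head E} := by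
      ext x
      simp only [Finset.mem_insert, Finset.mem_singleton]
      exact ⟨hall x, by rintro (h | h) <;> rw [h] <;> assumption⟩
    ext ⟨a, b⟩
    simp only [Finset.mem_filter, Finset.mem_offDiag, Finset.mem_insert, Finset.mem_singleton, Prod.mk.injEq]
    constructor
    · rintro ⟨⟨ha, hb, hab⟩, he⟩
      have ha' := hall a (by rw [← he]; simp)
      have hb' := hall b (by rw [← he]; simp)
      clear he hEe
      rcases ha' with ha' | ha' <;> rcases hb' with hb' | hb'
      · exact absurd (ha'.trans hb'.symm) hab
      · exact Or.inl ⟨ha', hb'⟩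
      · exact Or.inr ⟨ha', hb'⟩
      · exact absurd (ha'.trans hb'.symm) hab
    · rintro (⟨rfl, rfl⟩ | ⟨rfl, rfl⟩)
      · exact ⟨⟨hE.1 ht, hE.1 hh, hne⟩, hEe.symm⟩
      · exact ⟨⟨hE.1 hh, hE.1 ht, hne.symm⟩, by rw [Finset.pair_comm]; exact hEe.symm⟩
  rw [hfil, Finset.sum_pair (by simp [hne]), hs (head E) (tail E), ← two_smul ℝ, smul_smul]
  norm_num

theorem shapeFn_eq (K E : Finset E3) (x : E3) : shapeFn K E x
    = bary K (tail E) x • gradBary K (head E) - bary K (head E) x • gradBary K (tail E) := by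
  unfold shapeFn
  rw [gradient_bary, gradient_bary]

theorem IsTetra.sum_inner_smul_shapeFn {K : Finset E3} (hK : IsTetra K) (m x : E3) :
    ∑ E ∈ K.powersetCard 2, (inner ℝ m (head E - tail E) : ℝ) • shapeFn K E x = m := by
  have h := sum_edges (K := K) (fun a b => (inner ℝ m (b - a) : ℝ) •
    (bary K a x • gradBary K b - bary K b x • gradBary K a))
    (fun a b => by
      rw [← neg_sub b a, inner_neg_right, neg_smul, ← smul_neg, neg_sub])
    (fun a => by simp)
  simp_rw [shapeFn_eq]
  rw [h]
  have key : ∀ a b : E3, (inner ℝ m (b - a) : ℝ) •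
      (bary K a x • gradBary K b - bary K b x • gradBary K a)
      = (bary K a x • ((inner ℝ m b : ℝ) • gradBary K b) - (bary K a x * inner ℝ m a) • gradBary K b)
      - ((bary K b x * inner ℝ m b) • gradBary K a - bary K b x • ((inner ℝ m a : ℝ) • gradBary K a)) := fun a b => by
    rw [inner_sub_right]; module
  have e1 := hK.sum_bary x
  have e2 := hK.sum_gradBary
  have e3 := hK.sum_inner_smul_gradBary m
  simp_rw [key, Finset.sum_sub_distrib, ← Finset.smul_sum, ← Finset.sum_smul, e2, e3, e1]
  rw [← Finset.smul_sum, e2, ← Finset.smul_sum, e3]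
  module

/-- Half the curl of a shape function. -/
noncomputable def shapeCurl (K E : Finset E3) : E3 := cross (gradBary K (tail E)) (gradBary K (head E))

theorem shapeFn_sub (K E : Finset E3) (x y : E3) :
    shapeFn K E x - shapeFn K E y = cross (shapeCurl K E) (x - y) := by
  rw [shapeFn_eq, shapeFn_eq, shapeCurl]
  have h1 := bary_sub K (tail E) x y
  have h2 := bary_sub K (head E) x y
  rw [inner_eq] at h1 h2
  rw [show bary K (tail E) x = _ from eq_add_of_sub_eq h1,
    show bary K (head E) x = _ from eq_add_of_sub_eq h2]
  apply E3.ext3 <;> simp <;> ring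

theorem norm_shapeCurl_le (K E : Finset E3) :
    ‖shapeCurl K E‖ ≤ ‖gradBary K (tail E)‖ * ‖gradBary K (head E)‖ := norm_cross_le _ _

theorem IsTetra.norm_shapeFn_le {K E : Finset E3} (hK : IsTetra K) (hE : E.card = 2) (hEK : E ⊆ K)
    {x : E3} (hx : x ∈ hull K) :
    ‖shapeFn K E x‖ ≤ ‖gradBary K (head E)‖ + ‖gradBary K (tail E)‖ := by
  obtain ⟨ht, hh, -, -⟩ := tail_head hE
  rw [shapeFn_eq]
  refine (norm_sub_le _ _).trans ?_
  rw [norm_smul, norm_smul, Real.norm_eq_abs, Real.norm_eq_abs,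
    abs_of_nonneg (hK.mem_hull_iff.1 hx _ (hEK ht)), abs_of_nonneg (hK.mem_hull_iff.1 hx _ (hEK hh))]
  exact add_le_add (mul_le_of_le_one_left (norm_nonneg _) (hK.bary_le_one hx (hEK ht)))
    (mul_le_of_le_one_left (norm_nonneg _) (hK.bary_le_one hx (hEK hh)))

theorem IsTetra.sum_inner_smul_shapeCurl {K : Finset E3} (hK : IsTetra K) (m : E3) :
    ∑ E ∈ K.powersetCard 2, (inner ℝ m (head E - tail E) : ℝ) • shapeCurl K E = 0 := by
  set b := ∑ E ∈ K.powersetCard 2, (inner ℝ m (head E - tail E) : ℝ) • shapeCurl K E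
  have h : ∀ v, cross b v = 0 := by
    intro v
    have h1 := hK.sum_inner_smul_shapeFn m v
    have h2 := hK.sum_inner_smul_shapeFn m 0
    have h3 : ∑ E ∈ K.powersetCard 2, (inner ℝ m (head E - tail E) : ℝ) • (shapeFn K E v - shapeFn K E 0) = 0 := by
      simp_rw [smul_sub, Finset.sum_sub_distrib]
      rw [h1, h2, sub_self]
    simp_rw [shapeFn_sub, sub_zero] at h3
    rw [← h3]
    have : ∀ c : E3, cross c v = - crossL v c := fun c => by
      rw [crossL_apply]; apply E3.ext3 <;> simp <;> ring
    simp_rw [this]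
    rw [map_sum]
    simp
  have h0 := h (unitVec 0)
  have h1 := h (unitVec 1)
  apply E3.ext3
  · have := congrFun (congrArg WithLp.ofLp h1) 2; simpa [unitVec] using this
  · have := congrFun (congrArg WithLp.ofLp h0) 2; simpa [unitVec] using this
  · have := congrFun (congrArg WithLp.ofLp h0) 1; simpa [unitVec] using this

theorem segInt_const (m a b : E3) : segInt (fun _ => m) a b = inner ℝ m (b - a) := by
  simp [segInt]

theorem curl_sub_const (ψ : E3 → E3) (m x : E3) : curl (fun y => ψ y - m) x = curl ψ x := by
  unfold curl pd
  rw [fderiv_sub_const]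

namespace ConvexElement

variable {U : Set E3} {h : ℝ} {Ψ : E3 → E3} {G : Fin 3 → E3 → E3}

theorem exists_const_approx (hU : ConvexElement U h) (hΨ : ConstCurlField U Ψ G)
    {ℓ : E3 → E3 → ℝ} (hℓ : IsSegLimit U h Ψ G ℓ) {ε : ℝ} (hε : 0 < ε) :
    ∃ m : E3, l2Norm U (fun x => Ψ x - m)
        ≤ ENNReal.ofReal (3 * h) * (∑ i, l2Norm U (G i)) + ENNReal.ofReal ε ∧
      ∀ a ∈ closure U, ∀ b ∈ closure U, volume U ^ (1 / 2 : ℝ) * ‖ℓ a b - inner ℝ m (b - a)‖ₑ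
        ≤ ENNReal.ofReal (22 * h ^ 2) * (∑ i, l2Norm U (G i)) + ENNReal.ofReal ε := by
  have hh := hU.h_nonneg
  set D := ∑ i, l2Norm U (G i)
  set v := (volume U ^ (1 / 2 : ℝ)).toReal
  have hvt : volume U ^ (1 / 2 : ℝ) ≠ ⊤ := by simp [ENNReal.rpow_eq_top_iff, hU.volume_ne_top]
  have hv : volume U ^ (1 / 2 : ℝ) = ENNReal.ofReal v := (ENNReal.ofReal_toReal hvt).symm
  have hv0 : 0 ≤ v := ENNReal.toReal_nonneg
  set δ := ε / (1 + 3 * h + v + 22 * h ^ 2)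
  have hδ : 0 < δ := by positivity
  have hδe : δ * (1 + 3 * h + v + 22 * h ^ 2) = ε := div_mul_cancel₀ _ (by positivity)
  obtain ⟨ψ, h1, h2, h3, -⟩ := hU.exists_uniform_approx hΨ hℓ hδ
  have cψ : ContDiff ℝ 1 ψ := h1.1.of_le (by simp)
  obtain ⟨m, hm⟩ := hU.exists_mean cψ
  have hD : eLpNorm (fderiv ℝ ψ) 2 (volume.restrict U) ≤ D + ENNReal.ofReal δ := by
    refine (eLpNorm_fderiv_le cψ U).trans ?_
    have : ∑ i, l2Norm U (fun x => fderiv ℝ ψ x (unitVec i))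
        ≤ ∑ i, (l2Norm U (G i) + l2Norm U (fun x => fderiv ℝ ψ x (unitVec i) - G i x)) := by
      refine Finset.sum_le_sum fun i _ => ?_
      have e : (fun x => fderiv ℝ ψ x (unitVec i))
          = G i + fun x => fderiv ℝ ψ x (unitVec i) - G i x := by ext1 x; simp
      conv_lhs => rw [e]
      exact eLpNorm_add_le (hΨ.isWeakGrad.1 i).aestronglyMeasurable
        ((hU.memLp_pderiv cψ _).sub (hΨ.isWeakGrad.1 i)).aestronglyMeasurable (by norm_num)
    refine this.trans ?_
    rw [Finset.sum_add_distrib]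
    gcongr
    exact le_add_self.trans h2
  have hl : l2Norm U (ψ - Ψ) ≤ ENNReal.ofReal δ := le_self_add.trans h2
  have hm' : l2Norm U (fun x => ψ x - m) ≤ ENNReal.ofReal (3 * h) * (D + ENNReal.ofReal δ) := by
    refine hm.trans ?_
    rw [ENNReal.ofReal_mul (by norm_num)]
    norm_num
    gcongr
  refine ⟨m, ?_, fun a ha b hb => ?_⟩
  · have e : (fun x => Ψ x - m) = (fun x => ψ x - m) - (ψ - Ψ) := by ext1 x; simp
    have cc : Continuous fun x => ψ x - m := cψ.continuous.sub continuous_const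
    calc l2Norm U (fun x => Ψ x - m) ≤ l2Norm U (fun x => ψ x - m) + l2Norm U (ψ - Ψ) := by
          rw [l2Norm, e]
          exact eLpNorm_sub_le (hU.memLp_of_continuous cc).aestronglyMeasurable
            ((hU.memLp_of_continuous cψ.continuous).sub hΨ.memLp).aestronglyMeasurable (by norm_num)
      _ ≤ ENNReal.ofReal (3 * h) * (D + ENNReal.ofReal δ) + ENNReal.ofReal δ := add_le_add hm' hl
      _ = ENNReal.ofReal (3 * h) * D + ENNReal.ofReal ((3 * h + 1) * δ) := by
          rw [mul_add, ← ENNReal.ofReal_mul (by positivity), add_assoc,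
            ← ENNReal.ofReal_add (by positivity) (by positivity)]
          ring_nf
      _ ≤ _ := by
          gcongr
          rw [← hδe]
          nlinarith [mul_nonneg hδ.le hv0, mul_nonneg hδ.le (sq_nonneg h)]
  · have hcurl : ∀ x ∈ closure U, curl (fun y => ψ y - m) x = h1.2.choose := fun x hx => by
      rw [curl_sub_const]; exact h1.2.choose_spec x hx
    have k := hU.enorm_segInt_le_of_curl_const (cψ.sub (contDiff_const (c := m))) hcurl ha hb
    have hfd : fderiv ℝ (fun y => ψ y - m) = fderiv ℝ ψ := by ext1 y; rw [fderiv_sub_const]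
    rw [hfd] at k
    have e1 : segInt (fun y => ψ y - m) a b = segInt ψ a b - inner ℝ m (b - a) := by
      rw [← segInt_const]
      exact segInt_sub cψ.continuous continuous_const a b
    rw [e1] at k
    have k2 : ‖ℓ a b - inner ℝ m (b - a)‖ₑ
        ≤ ENNReal.ofReal δ + ‖segInt ψ a b - inner ℝ m (b - a)‖ₑ := by
      have e : ℓ a b - inner ℝ m (b - a)
          = -(segInt ψ a b - ℓ a b) + (segInt ψ a b - inner ℝ m (b - a)) := by ring
      rw [e]
      refine (enorm_add_le _ _).trans ?_
      gcongr
      rw [enorm_neg, ← ofReal_norm, Real.norm_eq_abs]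
      exact ENNReal.ofReal_le_ofReal (h3 a ha b hb)
    calc _ ≤ volume U ^ (1 / 2 : ℝ) * (ENNReal.ofReal δ + ‖segInt ψ a b - inner ℝ m (b - a)‖ₑ) := by
          gcongr
      _ ≤ ENNReal.ofReal (v * δ) + (ENNReal.ofReal (2 * h) *
            (ENNReal.ofReal (3 * h) * (D + ENNReal.ofReal δ))
            + ENNReal.ofReal (16 * h ^ 2) * (D + ENNReal.ofReal δ)) := by
          rw [mul_add]
          refine add_le_add (by rw [hv, ENNReal.ofReal_mul hv0]) (k.trans ?_)
          rw [ENNReal.ofReal_mul (show (0:ℝ) ≤ 2 by norm_num),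
            ENNReal.ofReal_mul (show (0:ℝ) ≤ 16 by norm_num)]
          norm_num only [ENNReal.ofReal_ofNat]
          gcongr
      _ = ENNReal.ofReal (22 * h ^ 2) * D + ENNReal.ofReal ((v + 22 * h ^ 2) * δ) := by
          rw [← mul_assoc, ← ENNReal.ofReal_mul (by positivity), ← add_mul,
            ← ENNReal.ofReal_add (by positivity) (by positivity),
            show 2 * h * (3 * h) + 16 * h ^ 2 = 22 * h ^ 2 by ring, mul_add,
            ← ENNReal.ofReal_mul (by positivity), add_left_comm,
            ← ENNReal.ofReal_add (by positivity) (by positivity)]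
          ring_nf
      _ ≤ _ := by
          gcongr
          rw [← hδe]
          nlinarith [mul_nonneg hδ.le hh]

end ConvexElement

theorem enorm_sum_smul_le {s : Finset (Finset E3)} {f : Finset E3 → ℝ} {g : Finset E3 → E3}
    {v A : ℝ≥0∞} {B : ℝ} (hf : ∀ E ∈ s, v * ‖f E‖ₑ ≤ A) (hg : ∀ E ∈ s, ‖g E‖ ≤ B) :
    v * ‖∑ E ∈ s, f E • g E‖ₑ ≤ s.card * (ENNReal.ofReal B * A) := by
  calc v * ‖∑ E ∈ s, f E • g E‖ₑ ≤ v * ∑ E ∈ s, ‖f E • g E‖ₑ := by gcongr; exact enorm_sum_le _ _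
    _ = ∑ E ∈ s, v * ‖f E • g E‖ₑ := by rw [Finset.mul_sum]
    _ ≤ ∑ _E ∈ s, ENNReal.ofReal B * A := by
        refine Finset.sum_le_sum fun E hE => ?_
        rw [enorm_smul, ← mul_assoc, mul_comm]
        exact mul_le_mul' (by rw [← ofReal_norm]; exact ENNReal.ofReal_le_ofReal (hg E hE)) (hf E hE)
    _ = _ := by simp

theorem le_of_forall_ofReal_add {x y C : ℝ≥0∞} (hC : C ≠ ⊤)
    (h : ∀ ε : ℝ, 0 < ε → x ≤ y + C * ENNReal.ofReal ε) : x ≤ y := by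
  have h1 : Tendsto (fun ε : ℝ => y + C * ENNReal.ofReal ε) (𝓝[>] 0) (𝓝 (y + C * ENNReal.ofReal 0)) :=
    tendsto_const_nhds.add (ENNReal.Tendsto.const_mul
      ((ENNReal.tendsto_ofReal tendsto_id).mono_left nhdsWithin_le_nhds) (Or.inr hC))
  simp only [ENNReal.ofReal_zero, mul_zero, add_zero] at h1
  exact ge_of_tendsto h1 (by filter_upwards [self_mem_nhdsWithin] with ε hε using h ε hε)

namespace IsTetra

section

variable {K : Finset E3} (hK : IsTetra K)
include hK

theorem mem_closure_of_edge {E : Finset E3} (hE : E ∈ K.powersetCard 2) :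
    tail E ∈ closure (interior (hull K)) ∧ head E ∈ closure (interior (hull K)) := by
  rw [Finset.mem_powersetCard] at hE
  obtain ⟨ht, hh, -, -⟩ := tail_head hE.2
  rw [hK.closure_interior]
  exact ⟨subset_convexHull ℝ _ (hE.1 ht), subset_convexHull ℝ _ (hE.1 hh)⟩

theorem card_edges : (K.powersetCard 2).card = 6 := by
  rw [Finset.card_powersetCard, hK.card_eq]; rfl

end

variable {K : Finset E3} (hK : IsTetra K) {Ψ : E3 → E3} {G : Fin 3 → E3 → E3}
  (hΨ : ConstCurlField (interior (hull K)) Ψ G) {ℓ : E3 → E3 → ℝ}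
  (hℓ : ConvexElement.IsSegLimit (interior (hull K)) (elemDiam K) Ψ G ℓ)
include hK hΨ hℓ

theorem curl_interp_le {ρ : ℝ} (hρ : shapeMeasure K ≤ ρ) :
    volume (interior (hull K)) ^ (1 / 2 : ℝ) *
      ‖∑ E ∈ K.powersetCard 2, ℓ (tail E) (head E) • shapeCurl K E‖ₑ
      ≤ ENNReal.ofReal (132 * ρ ^ 2) * ∑ i, l2Norm (interior (hull K)) (G i) := by
  have hh := hK.elemDiam_pos
  set h := elemDiam K
  refine le_of_forall_ofReal_add (C := 6 * ENNReal.ofReal ((ρ / h) ^ 2)) (by finiteness)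
    fun ε hε => ?_
  obtain ⟨m, -, hm⟩ := hK.convexElement.exists_const_approx hΨ hℓ hε
  have e : ∑ E ∈ K.powersetCard 2, ℓ (tail E) (head E) • shapeCurl K E
      = ∑ E ∈ K.powersetCard 2, (ℓ (tail E) (head E) - inner ℝ m (head E - tail E)) • shapeCurl K E := by
    simp_rw [sub_smul, Finset.sum_sub_distrib, hK.sum_inner_smul_shapeCurl, sub_zero]
  rw [e]
  have hle : ∀ a ∈ K, ‖gradBary K a‖ ≤ ρ / h := fun a ha => by
    rw [le_div_iff₀ hh, mul_comm]; exact hK.elemDiam_mul_le hρ ha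
  refine (enorm_sum_smul_le (B := (ρ / h) ^ 2) (fun E hE => hm _ (hK.mem_closure_of_edge hE).1 _
    (hK.mem_closure_of_edge hE).2) fun E hE => ?_).trans (le_of_eq ?_)
  · rw [Finset.mem_powersetCard] at hE
    obtain ⟨ht, hh, -, -⟩ := tail_head hE.2
    refine (norm_shapeCurl_le K E).trans ?_
    rw [sq]
    exact mul_le_mul (hle _ (hE.1 ht)) (hle _ (hE.1 hh)) (norm_nonneg _)
      ((norm_nonneg _).trans (hle _ (hE.1 ht)))
  · rw [hK.card_edges, mul_add, mul_add, ← mul_assoc (ENNReal.ofReal _), ← ENNReal.ofReal_mul (by positivity),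
      show (ρ / h) ^ 2 * (22 * h ^ 2) = 22 * ρ ^ 2 by field_simp, ← mul_assoc, ← mul_assoc]
    congr 2
    rw [show (132:ℝ) * ρ ^ 2 = 6 * (22 * ρ ^ 2) by ring, ENNReal.ofReal_mul (by norm_num)]
    norm_num

theorem interp_error_le {ρ : ℝ} (hρ : shapeMeasure K ≤ ρ) :
    l2Norm (interior (hull K))
      (fun x => Ψ x - ∑ E ∈ K.powersetCard 2, ℓ (tail E) (head E) • shapeFn K E x)
      ≤ ENNReal.ofReal ((3 + 264 * ρ) * elemDiam K) * ∑ i, l2Norm (interior (hull K)) (G i) := by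
  have hh := hK.elemDiam_pos
  have hU := hK.convexElement
  have hmeas : MeasurableSet (interior (hull K)) := isOpen_interior.measurableSet
  set U := interior (hull K)
  set h := elemDiam K
  have hle : ∀ a ∈ K, ‖gradBary K a‖ ≤ ρ / h := fun a ha => by
    rw [le_div_iff₀ hh, mul_comm]; exact hK.elemDiam_mul_le hρ ha
  have hρ0 : 0 ≤ ρ := by
    obtain ⟨a, ha⟩ := hK.nonempty
    have := (norm_nonneg _).trans (hle a ha)
    have h2 := mul_nonneg this hh.le
    rwa [div_mul_cancel₀ _ hh.ne'] at h2
  refine le_of_forall_ofReal_add (C := 1 + 6 * ENNReal.ofReal (2 * (ρ / h))) (by finiteness)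
    fun ε hε => ?_
  obtain ⟨m, hm0, hm⟩ := hU.exists_const_approx hΨ hℓ hε
  set e : Finset E3 → ℝ := fun E => ℓ (tail E) (head E) - inner ℝ m (head E - tail E)
  have heq : ∀ x, Ψ x - ∑ E ∈ K.powersetCard 2, ℓ (tail E) (head E) • shapeFn K E x
      = (Ψ x - m) - ∑ E ∈ K.powersetCard 2, e E • shapeFn K E x := by
    intro x
    simp only [e]
    simp_rw [sub_smul, Finset.sum_sub_distrib, hK.sum_inner_smul_shapeFn]
    abel
  have hsc : ∀ E, Continuous (shapeFn K E) := fun E => by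
    have h1 := continuous_bary K (tail E)
    have h2 := continuous_bary K (head E)
    have : shapeFn K E = fun x => bary K (tail E) x • gradBary K (head E)
      - bary K (head E) x • gradBary K (tail E) := by ext1 x; exact shapeFn_eq K E x
    rw [this]; fun_prop
  have hcs : Continuous fun x => ∑ E ∈ K.powersetCard 2, e E • shapeFn K E x :=
    continuous_finsetSum _ fun E _ => by have := hsc E; fun_prop
  have hvt : volume U ^ (1 / 2 : ℝ) ≠ ⊤ := by simp [ENNReal.rpow_eq_top_iff, hU.volume_ne_top]
  have hv0 : volume U ^ (1 / 2 : ℝ) ≠ 0 := by simp [ENNReal.rpow_eq_zero_iff, hU.volume_ne_zero]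
  have hsum : l2Norm U (fun x => ∑ E ∈ K.powersetCard 2, e E • shapeFn K E x)
      ≤ 6 * (ENNReal.ofReal (2 * (ρ / h)) * (ENNReal.ofReal (22 * h ^ 2) * (∑ i, l2Norm U (G i))
        + ENNReal.ofReal ε)) := by
    set B := 6 * (ENNReal.ofReal (2 * (ρ / h)) * (ENNReal.ofReal (22 * h ^ 2) * (∑ i, l2Norm U (G i))
        + ENNReal.ofReal ε))
    have hpt : ∀ x ∈ U, ‖∑ E ∈ K.powersetCard 2, e E • shapeFn K E x‖ₑ ≤ (volume U ^ (1 / 2 : ℝ))⁻¹ * B := by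
      intro x hx
      apply hU.le_inv_mul
      refine (enorm_sum_smul_le (B := 2 * (ρ / h)) (fun E hE => hm _ (hK.mem_closure_of_edge hE).1 _
        (hK.mem_closure_of_edge hE).2) fun E hE => ?_).trans (le_of_eq ?_)
      · rw [Finset.mem_powersetCard] at hE
        obtain ⟨ht, hh, -, -⟩ := tail_head hE.2
        refine (hK.norm_shapeFn_le hE.2 hE.1 (interior_subset hx)).trans ?_
        linarith [hle _ (hE.1 ht), hle _ (hE.1 hh)]
      · rw [hK.card_edges]; norm_num [B]
    have : l2Norm U (fun x => ∑ E ∈ K.powersetCard 2, e E • shapeFn K E x) ^ 2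
        ≤ ((volume U ^ (1 / 2 : ℝ))⁻¹ * B) ^ 2 * volume U := by
      rw [l2Norm, sq_eLpNorm_two, ← setLIntegral_const]
      exact setLIntegral_mono' hmeas fun x hx => pow_le_pow_left₀ zero_le (hpt x hx) 2
    apply ENNReal_le_of_sq_le
    refine this.trans (le_of_eq ?_)
    have hvv : volume U = (volume U ^ (1 / 2 : ℝ)) ^ 2 := (rpow_half_sq _).symm
    conv_lhs => rw [hvv]
    rw [← mul_pow, mul_right_comm, ← hvv, ENNReal.inv_mul_cancel hv0 hvt, one_mul]
  simp_rw [heq]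
  have hmm : AEStronglyMeasurable (fun x => Ψ x - m) (volume.restrict U) :=
    hΨ.memLp.aestronglyMeasurable.sub aestronglyMeasurable_const
  refine (eLpNorm_sub_le hmm hcs.aestronglyMeasurable (by norm_num)).trans ?_
  refine (add_le_add hm0 hsum).trans (le_of_eq ?_)
  have e1 : ENNReal.ofReal ((3 + 264 * ρ) * h)
      = ENNReal.ofReal (3 * h) + 6 * (ENNReal.ofReal (2 * (ρ / h)) * ENNReal.ofReal (22 * h ^ 2)) := by
    rw [← ENNReal.ofReal_mul (by positivity), show (6:ℝ≥0∞) = ENNReal.ofReal 6 by norm_num,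
      ← ENNReal.ofReal_mul (by norm_num), ← ENNReal.ofReal_add (by positivity) (by positivity)]
    congr 1
    field_simp
    ring
  rw [e1]; ring

end IsTetra

theorem HasEdgeIntegralOn.unique {K E : Finset E3} {Ψ : E3 → E3} {c c' : ℝ}
    (h : HasEdgeIntegralOn K E Ψ c) (h' : HasEdgeIntegralOn K E Ψ c') : c = c' := by
  have : |c - c'| ≤ 0 := by
    refine le_of_forall_pos_le_add fun ε hε => ?_
    obtain ⟨δ, hδ, H⟩ := h.lim (ε / 2) (by positivity)
    obtain ⟨δ', hδ', H'⟩ := h'.lim (ε / 2) (by positivity)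
    obtain ⟨ψ, hψ, hd⟩ := h.approx (min δ δ') (by positivity)
    have h1 := abs_lt.1 (H ψ hψ (hd.trans_le (ENNReal.ofReal_le_ofReal (min_le_left _ _))))
    have h2 := abs_lt.1 (H' ψ hψ (hd.trans_le (ENNReal.ofReal_le_ofReal (min_le_right _ _))))
    rw [abs_le]; constructor <;> linarith
  exact sub_eq_zero.1 (abs_eq_zero.1 (le_antisymm this (abs_nonneg _)))

namespace IsTetra

variable {K E : Finset E3} (hK : IsTetra K) {Ψ : E3 → E3} {G : Fin 3 → E3 → E3}
  (hΨ : ConstCurlField (interior (hull K)) Ψ G) {ℓ : E3 → E3 → ℝ}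
  (hℓ : ConvexElement.IsSegLimit (interior (hull K)) (elemDiam K) Ψ G ℓ)
include hK hΨ hℓ

theorem hasEdgeIntegralOn (hE : E ∈ K.powersetCard 2) :
    HasEdgeIntegralOn K E Ψ (ℓ (tail E) (head E)) := by
  have hU := hK.convexElement
  have hcl := hK.closure_interior
  obtain ⟨ht, hh⟩ := hK.mem_closure_of_edge hE
  constructor
  · intro δ hδ
    obtain ⟨ψ, h1, h2, -⟩ := hU.exists_uniform_approx hΨ hℓ (show 0 < δ / 2 by positivity)
    refine ⟨ψ, ⟨h1.1, ?_⟩, ?_⟩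
    · have := h1.2; rwa [hcl] at this
    · refine ((hU.h1Norm_le_h1Dist hΨ (h1.1.of_le (by simp))).trans h2).trans_lt ?_
      rw [ENNReal.ofReal_lt_ofReal_iff hδ]; linarith
  · intro ε hε
    have hC := hU.segConst_ne_top
    set C := (ConvexElement.segConst (interior (hull K)) (elemDiam K)).toReal
    have hC0 : 0 ≤ C := ENNReal.toReal_nonneg
    refine ⟨ε / (4 * C + 1), by positivity, fun ψ hψ hd => ?_⟩
    have hs : SmoothConst (interior (hull K)) ψ := ⟨hψ.1, by rw [hcl]; exact hψ.2⟩
    have h1 := hℓ ψ hs _ ht _ hh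
    have h2 := hU.h1Dist_le_h1Norm hΨ (ψ := ψ) (hψ.1.of_le (by simp))
    have h3 := h1.trans (mul_le_mul_right (h2.trans (mul_le_mul_right hd.le 4)) _)
    rw [← ENNReal.ofReal_toReal hC, show (4:ℝ≥0∞) = ENNReal.ofReal 4 by norm_num,
      ← ENNReal.ofReal_mul (by norm_num), ← ENNReal.ofReal_mul hC0, ← ofReal_norm,
      ENNReal.ofReal_le_ofReal_iff (by positivity), Real.norm_eq_abs] at h3
    refine h3.trans_lt ?_
    have : C * (4 * (ε / (4 * C + 1))) = (4 * C) * ε / (4 * C + 1) := by ring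
    change C * (4 * (ε / (4 * C + 1))) < ε
    rw [this, div_lt_iff₀ (by positivity)]
    nlinarith

theorem segLimit_eq_lineIntegral (hE : E ∈ K.powersetCard 2) (hc : ContinuousOn Ψ (hull K)) :
    ℓ (tail E) (head E) = lineIntegral E Ψ := by
  have hU := hK.convexElement
  have hcl := hK.closure_interior
  obtain ⟨ht, hh⟩ := hK.mem_closure_of_edge hE
  set a := tail E
  set b := head E
  have hmem : ∀ t ∈ Icc (0:ℝ) 1, a + t • (b - a) ∈ closure (interior (hull K)) := fun t ht' =>
    hU.convex.closure.add_smul_sub_mem ht hh ht'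
  have key : |ℓ a b - segInt Ψ a b| ≤ 0 := by
    refine le_of_forall_pos_le_add fun ε hε => ?_
    obtain ⟨ψ, h1, -, h3, h4⟩ := hU.exists_uniform_approx hΨ hℓ
      (show 0 < ε / (1 + ‖b - a‖) by positivity)
    rw [hcl] at h4
    have h4 := h4 hc
    have h5 := h3 a ht b hh
    have hψc := h1.1.continuous
    have i1 : IntervalIntegrable (fun t : ℝ => (inner ℝ (ψ (a + t • (b - a))) (b - a) : ℝ)) volume 0 1 :=
      Continuous.intervalIntegrable (by fun_prop) _ _
    have i2 : IntervalIntegrable (fun t : ℝ => (inner ℝ (Ψ (a + t • (b - a))) (b - a) : ℝ)) volume 0 1 := by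
      apply ContinuousOn.intervalIntegrable
      rw [uIcc_of_le zero_le_one]
      refine ContinuousOn.inner (𝕜 := ℝ) (hc.comp (by fun_prop) fun t ht' => ?_) continuousOn_const
      rw [← hcl]; exact hmem t ht'
    have h6 : |segInt ψ a b - segInt Ψ a b| ≤ ε / (1 + ‖b - a‖) * ‖b - a‖ := by
      rw [segInt, segInt, ← intervalIntegral.integral_sub i1 i2, ← Real.norm_eq_abs]
      refine (intervalIntegral.norm_integral_le_of_norm_le_const
        (C := ε / (1 + ‖b - a‖) * ‖b - a‖) fun t ht' => ?_).trans (by simp)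
      rw [uIoc_of_le zero_le_one] at ht'
      rw [← inner_sub_left]
      refine (norm_inner_le_norm _ _).trans ?_
      gcongr
      exact h4 _ (by rw [← hcl]; exact hmem t ⟨ht'.1.le, ht'.2⟩)
    have h7 : ε / (1 + ‖b - a‖) * (1 + ‖b - a‖) = ε := div_mul_cancel₀ _ (by positivity)
    rw [abs_le] at h5 h6
    rw [abs_le]
    constructor <;> nlinarith
  exact sub_eq_zero.1 (abs_eq_zero.1 (le_antisymm key (abs_nonneg _)))

end IsTetra

/-! ### Lipschitz domains -/

theorem norm_pair_le {v : E3} {s : ℝ} : ‖(!₂[v 0, v 1] : EuclideanSpace ℝ (Fin 2))‖ ≤ ‖v - s • unitVec 2‖ := by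
  have h1 : ‖(!₂[v 0, v 1] : EuclideanSpace ℝ (Fin 2))‖ ^ 2 = v 0 * v 0 + v 1 * v 1 := by
    rw [EuclideanSpace.norm_sq_eq]; simp [Fin.sum_univ_two]; ring
  have h2 : ‖v - s • unitVec 2‖ ^ 2 = v 0 * v 0 + v 1 * v 1 + (v 2 - s) * (v 2 - s) := by
    rw [← real_inner_self_eq_norm_sq, inner_eq]; simp [unitVec]
  refine le_of_sq_le_sq ?_ (norm_nonneg _)
  rw [h1, h2]
  nlinarith [sq_nonneg (v 2 - s)]

theorem abs_coord_sub_le {v : E3} {s : ℝ} : |v 2 - s| ≤ ‖v - s • unitVec 2‖ := by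
  have := PiLp.norm_apply_le (v - s • unitVec 2) 2
  simpa [unitVec] using this

theorem map_segment_point (A : E3 ≃ᵃⁱ[ℝ] E3) (y z : E3) (t : ℝ) :
    A (y + t • (z - y)) = A y + t • (A z - A y) := by
  have := A.toAffineEquiv.toAffineMap.apply_lineMap y z t
  simpa [AffineMap.lineMap_apply, add_comm] using this

namespace IsLipschitzDomain

variable {Ω : Set E3} (hΩ : IsLipschitzDomain Ω)
include hΩ

theorem mem_frontier_iff {x : E3} : x ∈ frontier Ω ↔ x ∈ closure Ω ∧ x ∉ Ω := by
  rw [frontier, hΩ.1.interior_eq]; rfl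

theorem interior_closure : interior (closure Ω) = Ω := by
  refine Subset.antisymm (fun x hx => ?_) hΩ.1.subset_interior_closure
  by_contra hxΩ
  obtain ⟨A, g, L, r, hg, hr, hA⟩ := hΩ.2 x (hΩ.mem_frontier_iff.2 ⟨interior_subset hx, hxΩ⟩)
  obtain ⟨r', hr', hb⟩ := Metric.isOpen_iff.1 isOpen_interior x hx
  set s := min r r' / 2
  have hs : 0 < s := by positivity
  set y := A.symm (A x - s • unitVec 2)
  have hAy : A y = A x - s • unitVec 2 := by simp [y]
  have hyx : dist y x = s := by
    rw [← A.dist_map, hAy, dist_eq_norm]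
    simp [norm_smul, abs_of_pos hs, unitVec]
  have hyr : y ∈ Metric.ball x r := by
    rw [Metric.mem_ball, hyx]
    have : min r r' ≤ r := min_le_left _ _
    simp only [s]; linarith
  have hyc : y ∈ closure Ω := interior_subset (hb (by
    rw [Metric.mem_ball, hyx]
    have : min r r' ≤ r' := min_le_right _ _
    simp only [s]; linarith))
  have hxg : ¬ g !₂[A x 0, A x 1] < A x 2 := fun h =>
    hxΩ ((hA x (Metric.mem_ball_self hr)).2 h)
  have hyg : A y 2 < g !₂[A y 0, A y 1] := by
    rw [hAy]
    simp [unitVec]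
    linarith
  have hopen : IsOpen (Metric.ball x r ∩ {z | A z 2 < g !₂[A z 0, A z 1]}) := by
    have h0 : ∀ i, Continuous fun z => A z i := fun i => by
      have := A.continuous
      fun_prop
    refine Metric.isOpen_ball.inter (isOpen_lt (h0 2) ?_)
    refine hg.continuous.comp ((PiLp.continuous_toLp 2 _).comp (continuous_pi fun i => ?_))
    fin_cases i
    · exact h0 0
    · exact h0 1
  obtain ⟨z, ⟨hz1, hz2⟩, hz3⟩ := mem_closure_iff.1 hyc _ hopen ⟨hyr, hyg⟩
  have := (hA z hz1).1 hz3
  exact absurd hz2 (not_lt.2 this.le)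

/-- Points of the domain near `x` can be joined by line segments to the points of an open set. -/
theorem exists_segments {x : E3} (hx : x ∈ closure Ω) {r : ℝ} (hr : 0 < r) :
    ∃ δ > 0, ∃ Z : Set E3, IsOpen Z ∧ Z.Nonempty ∧ ∀ y ∈ Ω, dist y x < δ → ∀ z ∈ Z,
      ∀ t ∈ Icc (0:ℝ) 1, y + t • (z - y) ∈ Ω ∩ Metric.ball x r := by
  by_cases hxΩ : x ∈ Ω
  · obtain ⟨δ, hδ, hb⟩ := Metric.isOpen_iff.1 hΩ.1 x hxΩ
    refine ⟨min δ r, by positivity, Metric.ball x (min δ r), Metric.isOpen_ball,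
      ⟨x, Metric.mem_ball_self (by positivity)⟩, fun y _ hy z hz t ht => ?_⟩
    have := (convex_ball x (min δ r)).add_smul_sub_mem (Metric.mem_ball.2 hy) hz ht
    exact ⟨hb (Metric.ball_subset_ball (min_le_left _ _) this),
      Metric.ball_subset_ball (min_le_right _ _) this⟩
  · obtain ⟨A, g, L, r₀, hg, hr₀, hA⟩ := hΩ.2 x (hΩ.mem_frontier_iff.2 ⟨hx, hxΩ⟩)
    set s := min r r₀ / 2
    have hs : 0 < s := by positivity
    set δ := s / (4 * (L + 1))
    have hL : (0:ℝ) ≤ L := L.2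
    have hδ : 0 < δ := by positivity
    have hδs : δ * (4 * (L + 1)) = s := div_mul_cancel₀ _ (by positivity)
    set x' := A.symm (A x + s • unitVec 2)
    have hAx : A x' = A x + s • unitVec 2 := by simp [x']
    have hxx : dist x' x = s := by
      rw [← A.dist_map, hAx, dist_eq_norm]
      simp [norm_smul, abs_of_pos hs, unitVec]
    refine ⟨δ, hδ, Metric.ball x' δ, Metric.isOpen_ball, ⟨x', Metric.mem_ball_self hδ⟩,
      fun y hy hyx z hz t ht => ?_⟩
    have hrr : s + δ < min r r₀ := by
      have : δ ≤ s / 4 := by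
        rw [← hδs]; nlinarith
      have : min r r₀ = 2 * s := by simp only [s]; ring
      linarith
    have hmem : y + t • (z - y) ∈ Metric.ball x (min r r₀) := by
      refine (convex_ball x _).add_smul_sub_mem ?_ ?_ ht
      · rw [Metric.mem_ball]; linarith
      · rw [Metric.mem_ball]
        have := dist_triangle z x' x
        rw [Metric.mem_ball] at hz
        linarith
    have hr1 := Metric.ball_subset_ball (min_le_right r r₀) hmem
    have hr2 := Metric.ball_subset_ball (min_le_left r r₀) hmem
    refine ⟨(hA _ hr1).2 ?_, hr2⟩
    have hyr : y ∈ Metric.ball x r₀ := by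
      rw [Metric.mem_ball]
      linarith [min_le_right r r₀]
    have hyg := (hA y hyr).1 hy
    set v := A z - A y
    have hv : ‖v - s • unitVec 2‖ ≤ 2 * δ := by
      have e : v - s • unitVec 2 = (A z - A x') - (A y - A x) := by rw [hAx]; simp only [v]; abel
      rw [e]
      refine (norm_sub_le _ _).trans ?_
      rw [← dist_eq_norm, ← dist_eq_norm, A.dist_map, A.dist_map]
      linarith [Metric.mem_ball.1 hz]
    have h1 := (norm_pair_le (v := v) (s := s)).trans hv
    have h2 := abs_le.1 ((abs_coord_sub_le (v := v) (s := s)).trans hv)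
    rw [map_segment_point]
    have hgl := hg.dist_le_mul !₂[(A y + t • v) 0, (A y + t • v) 1] !₂[A y 0, A y 1]
    have e3 : (!₂[(A y + t • v) 0, (A y + t • v) 1] : EuclideanSpace ℝ (Fin 2)) - !₂[A y 0, A y 1]
        = t • !₂[v 0, v 1] := by
      ext i; fin_cases i <;> simp
    rw [dist_eq_norm _ (!₂[A y 0, A y 1]), e3, norm_smul, Real.norm_eq_abs, abs_of_nonneg ht.1, Real.dist_eq] at hgl
    have h4 := (abs_le.1 hgl).2
    have h5 : (L:ℝ) * (t * ‖(!₂[v 0, v 1] : EuclideanSpace ℝ (Fin 2))‖) ≤ t * (L * (2 * δ)) := by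
      have := mul_le_mul_of_nonneg_left h1 (mul_nonneg hL ht.1)
      linarith
    have h6 : L * (2 * δ) ≤ v 2 := by nlinarith
    have h7 := mul_le_mul_of_nonneg_left h6 ht.1
    have h8 : (A y + t • v) 2 = A y 2 + t * v 2 := by simp
    rw [h8]
    linarith

end IsLipschitzDomain

/-! ### Planes -/

theorem volume_plane (y a b : E3) :
    volume ((affineSpan ℝ (range ![y, a, b]) : AffineSubspace ℝ E3) : Set E3) = 0 := by
  refine Measure.addHaar_affineSubspace _ _ fun h => ?_
  have h1 := finrank_vectorSpan_range_le ℝ ![y, a, b] (n := 2) (by simp)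
  rw [← direction_affineSpan, h, AffineSubspace.direction_top] at h1
  simp at h1

theorem hull_subset_plane {E : Finset E3} {a b : E3} (hE : ∀ x ∈ E, x = a ∨ x = b) (y : E3) :
    hull E ⊆ (affineSpan ℝ (range ![y, a, b]) : Set E3) := by
  refine (convexHull_subset_affineSpan _).trans (affineSpan_mono ℝ fun x hx => ?_)
  rcases hE x hx with rfl | rfl
  · exact ⟨1, rfl⟩
  · exact ⟨2, rfl⟩

theorem segment_avoids {y z a b : E3} {E : Finset E3} (hE : ∀ x ∈ E, x = a ∨ x = b)
    (hy : y ∉ hull E) (hz : z ∉ (affineSpan ℝ (range ![y, a, b]) : Set E3)) (t : ℝ) :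
    y + t • (z - y) ∉ hull E := by
  intro hp
  by_cases ht : t = 0
  · rw [ht] at hp; simp at hp; exact hy hp
  · apply hz
    have h1 := hull_subset_plane hE y hp
    have h2 : y ∈ affineSpan ℝ (range ![y, a, b]) := mem_affineSpan ℝ ⟨0, rfl⟩
    have h3 := AffineMap.lineMap_mem t⁻¹ h2 h1
    have e : AffineMap.lineMap y (y + t • (z - y)) t⁻¹ = z := by
      rw [AffineMap.lineMap_apply]
      simp [smul_smul, inv_mul_cancel₀ ht]
    rwa [e] at h3

theorem exists_mem_of_null {U : Set E3} (hU : IsOpen U) (hne : U.Nonempty) {N : Set E3}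
    (hN : volume N = 0) : ∃ x ∈ U, x ∉ N := by
  by_contra! h
  have := measure_mono_null (μ := volume) h hN
  exact (hU.measure_pos volume hne).ne' this

theorem isClosed_hull (K : Finset E3) : IsClosed (hull K) := (isCompact_hull K).isClosed

theorem hull_mono {F K : Finset E3} (h : F ⊆ K) : hull F ⊆ hull K :=
  convexHull_mono (by exact_mod_cast h)

theorem convex_hull (K : Finset E3) : Convex ℝ (hull K) := convex_convexHull ℝ _

theorem exists_opposite {K F : Finset E3} (hK : K.card = 4) (hF : F ⊆ K) (hc : F.card = 3) :
    ∃ a ∈ K, a ∉ F ∧ ∀ b ∈ K, b ≠ a → b ∈ F := by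
  classical
  have h : (K \ F).card = 1 := by rw [Finset.card_sdiff_of_subset hF, hK, hc]
  obtain ⟨a, ha⟩ := Finset.card_eq_one.1 h
  have h1 : ∀ b, b ∈ K ∧ b ∉ F ↔ b = a := fun b => by
    rw [← Finset.mem_sdiff, ha, Finset.mem_singleton]
  refine ⟨a, ((h1 a).2 rfl).1, ((h1 a).2 rfl).2, fun b hb hne => ?_⟩
  by_contra hbF
  exact hne ((h1 b).1 ⟨hb, hbF⟩)

/-- The barycenter of a finite set of points. -/
noncomputable def barycenter (F : Finset E3) : E3 := ∑ a ∈ F, (F.card : ℝ)⁻¹ • a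

theorem map_barycenter {F : Finset E3} (hF : F.Nonempty) (g : E3 →ᵃ[ℝ] ℝ) :
    g (barycenter F) = ∑ a ∈ F, (F.card : ℝ)⁻¹ * g a := by
  have h0 : (F.card : ℝ) ≠ 0 := by exact_mod_cast hF.card_ne_zero
  have hs : ∑ _a ∈ F, (F.card : ℝ)⁻¹ = 1 := by simp [h0]
  have := Finset.map_affineCombination F (fun a => a) (fun _ => (F.card : ℝ)⁻¹) hs g
  rw [Finset.affineCombination_eq_linear_combination _ _ _ hs,
    Finset.affineCombination_eq_linear_combination _ _ _ hs] at this
  simpa [barycenter] using this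

theorem barycenter_mem {F : Finset E3} (hF : F.Nonempty) : barycenter F ∈ hull F := by
  have h0 : (F.card : ℝ) ≠ 0 := by exact_mod_cast hF.card_ne_zero
  exact (convex_hull F).sum_mem (fun _ _ => by positivity) (by simp [h0])
    fun a ha => subset_convexHull ℝ _ ha

namespace IsTetra

variable {K K' F : Finset E3} (hK : IsTetra K)
include hK

theorem bary_barycenter_pos (hF : F ⊆ K) {a : E3} (ha : a ∈ F) : 0 < bary K a (barycenter F) := by
  have hne : F.Nonempty := ⟨a, ha⟩
  rw [map_barycenter hne, Finset.sum_eq_single a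
    (fun b hb hba => by rw [hK.bary_of_ne (hF ha) (hF hb) hba, mul_zero])
    (fun h => absurd ha h), hK.bary_self (hF ha)]
  have := hne.card_pos
  positivity

theorem bary_eq_of_common (hK' : IsTetra K') (hF : F ⊆ K) (hF' : F ⊆ K') {x : E3} (hx : x ∈ hull F)
    {a : E3} (ha : a ∈ F) : bary K a x = bary K' a x := by
  rw [hK.affine_eq_sum (bary K' a) x, Finset.sum_eq_single a]
  · rw [hK'.bary_self (hF' ha), mul_one]
  · intro b hb hba
    by_cases hbF : b ∈ F
    · rw [hK'.bary_of_ne (hF' ha) (hF' hbF) hba, mul_zero]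
    · rw [((hK.mem_hull_subset_iff hF).1 hx).2 b hb hbF, zero_mul]
  · intro h; exact absurd (hF ha) h

theorem eventually_mem_hull_union (hK' : IsTetra K') (hF : F ⊆ K) (hF' : F ⊆ K') {a a' : E3}
    (ha : ∀ b ∈ K, b ≠ a → b ∈ F) (ha' : ∀ b ∈ K', b ≠ a' → b ∈ F)
    {κ : ℝ} (hκ : 0 < κ) (hopp : ∀ x, bary K' a' x = -κ * bary K a x) {p : E3} (hp : p ∈ hull F)
    (hpos : ∀ b ∈ F, 0 < bary K b p) : ∀ᶠ q in 𝓝 p, q ∈ hull K ∪ hull K' := by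
  have h1 : ∀ᶠ q in 𝓝 p, ∀ b ∈ F, 0 < bary K b q :=
    (Filter.eventually_all_finset F).2 fun b hb =>
      (continuous_bary K b).continuousAt.eventually (lt_mem_nhds (hpos b hb))
  have h2 : ∀ᶠ q in 𝓝 p, ∀ b ∈ F, 0 < bary K' b q :=
    (Filter.eventually_all_finset F).2 fun b hb =>
      (continuous_bary K' b).continuousAt.eventually
        (lt_mem_nhds (a := 0) (b := bary K' b p)
          (hK.bary_eq_of_common hK' hF hF' hp hb ▸ hpos b hb))
  filter_upwards [h1, h2] with q hq hq'
  rcases le_total 0 (bary K a q) with h0 | h0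
  · refine Or.inl (hK.mem_hull_iff.2 fun b hb => ?_)
    by_cases hba : b = a
    · rw [hba]; exact h0
    · exact (hq b (ha b hb hba)).le
  · refine Or.inr (hK'.mem_hull_iff.2 fun b hb => ?_)
    by_cases hba : b = a'
    · rw [hba, hopp]; nlinarith
    · exact (hq' b (ha' b hb hba)).le

/-- The vertices on which a point of the simplex depends. -/
theorem exists_support {x : E3} (hx : x ∈ hull K) :
    ∃ S ⊆ K, x ∈ hull S ∧ ∀ a ∈ K, a ∈ S ↔ 0 < bary K a x := by
  classical
  refine ⟨K.filter fun a => 0 < bary K a x, Finset.filter_subset _ _, ?_, fun a ha => ?_⟩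
  · refine (hK.mem_hull_subset_iff (Finset.filter_subset _ _)).2 ⟨hx, fun a ha hn => ?_⟩
    rw [Finset.mem_filter, not_and, not_lt] at hn
    exact le_antisymm (hn ha) (hK.mem_hull_iff.1 hx a ha)
  · simp [ha]

end IsTetra

namespace IsConformingMesh

variable {Ω : Set E3} {T : Finset (Finset E3)} (hT : IsConformingMesh Ω T)
include hT

theorem isTetra {K : Finset E3} (hK : K ∈ T) : IsTetra K := ⟨hT.card_eq K hK, hT.nondegenerate K hK⟩

theorem hull_subset {K : Finset E3} (hK : K ∈ T) : hull K ⊆ closure Ω := by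
  rw [hT.cover]; exact subset_biUnion_of_mem (u := fun K => hull K) hK

theorem interior_subset_domain (hΩ : IsLipschitzDomain Ω) {K : Finset E3} (hK : K ∈ T) :
    interior (hull K) ⊆ Ω := by
  rw [← hΩ.interior_closure]; exact interior_mono (hT.hull_subset hK)

theorem exists_mem_hull {x : E3} (hx : x ∈ closure Ω) : ∃ K ∈ T, x ∈ hull K := by
  rw [hT.cover] at hx; simpa using hx

theorem eq_of_interior_inter {K K' : Finset E3} (hK : K ∈ T) (hK' : K' ∈ T)
    {x : E3} (hx : x ∈ interior (hull K)) (hx' : x ∈ hull K') : K = K' := by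
  by_contra hne
  have h1 := (hT.disjoint K hK K' hK' hne).closure_right isOpen_interior
  rw [(hT.isTetra hK').closure_interior] at h1
  exact disjoint_left.1 h1 hx hx'

theorem opposite_bary {K K' F : Finset E3} (hK : K ∈ T) (hK' : K' ∈ T) (hne : K ≠ K') (hF : F ⊆ K)
    (hF' : F ⊆ K') (hc : F.card = 3) {a a' : E3} (haK : a ∈ K) (ha : ∀ b ∈ K, b ≠ a → b ∈ F)
    (haK' : a' ∈ K') (ha' : ∀ b ∈ K', b ≠ a' → b ∈ F) (haF : a ∉ F) (haF' : a' ∉ F) :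
    ∃ κ > 0, ∀ x, bary K' a' x = -κ * bary K a x := by
  have tK := hT.isTetra hK
  have tK' := hT.isTetra hK'
  set c := bary K' a' a
  have hg : ∀ x, bary K' a' x = c * bary K a x := by
    have : bary K' a' = c • bary K a := by
      refine tK.affine_ext fun b hb => ?_
      change bary K' a' b = c * bary K a b
      by_cases hba : b = a
      · rw [hba, tK.bary_self haK, mul_one]
      · have hbF := ha b hb hba
        rw [tK'.bary_of_ne haK' (hF' hbF) (fun h => haF' (h ▸ hbF)), tK.bary_of_ne haK hb hba, mul_zero]
    intro x; rw [this]; rfl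
  refine ⟨-c, ?_, fun x => by rw [hg]; ring⟩
  by_contra! hc0
  have hcne : c ≠ 0 := fun h => by
    have := hg a'
    rw [h, zero_mul, tK'.bary_self haK'] at this
    exact one_ne_zero this
  have hcpos : 0 < c := lt_of_le_of_ne (by linarith) hcne.symm
  have hFne : F.Nonempty := by rw [← Finset.card_pos, hc]; norm_num
  set p := barycenter F
  have hpF := barycenter_mem hFne
  have hline : Continuous fun t : ℝ => p + t • (a - p) := by fun_prop
  have e1 : ∀ᶠ t in 𝓝 (0:ℝ), ∀ b ∈ F, 0 < bary K b (p + t • (a - p)) ∧ 0 < bary K' b (p + t • (a - p)) := by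
    refine (Filter.eventually_all_finset F).2 fun b hb => ?_
    have c1 := ((continuous_bary K b).comp hline).continuousAt (x := 0)
    have c2 := ((continuous_bary K' b).comp hline).continuousAt (x := 0)
    have hb1 := tK.bary_barycenter_pos hF hb
    have hb2 := tK'.bary_barycenter_pos hF' hb
    exact (c1.eventually (lt_mem_nhds (by simpa using hb1))).and
      (c2.eventually (lt_mem_nhds (by simpa using hb2)))
  obtain ⟨t, ht, ht0⟩ := ((e1.filter_mono nhdsWithin_le_nhds).and
    (self_mem_nhdsWithin (a := (0:ℝ)) (s := Ioi 0))).exists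
  have ht0 : 0 < t := ht0
  have hpa : bary K a p = 0 := ((tK.mem_hull_subset_iff hF).1 hpF).2 a haK haF
  have hta : bary K a (p + t • (a - p)) = t := by
    rw [bary_combo, hpa, tK.bary_self haK]; ring
  refine disjoint_left.1 (hT.disjoint K hK K' hK' hne)
    (show p + t • (a - p) ∈ interior (hull K) from ?_) ?_
  · refine tK.mem_interior_iff.2 fun b hb => ?_
    by_cases hba : b = a
    · rw [hba, hta]; exact ht0
    · exact (ht b (ha b hb hba)).1
  · refine tK'.mem_interior_iff.2 fun b hb => ?_
    by_cases hba : b = a'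
    · rw [hba, hg, hta]; positivity
    · exact (ht b (ha' b hb hba)).2

/-- Near a relative interior point of a shared face, the two elements fill a neighborhood. -/
theorem eventually_mem_union {K K' F : Finset E3} (hK : K ∈ T) (hK' : K' ∈ T) (hne : K ≠ K')
    (hF : F ⊆ K) (hF' : F ⊆ K') (hc : F.card = 3) {p : E3} (hp : p ∈ hull F)
    (hpos : ∀ b ∈ F, 0 < bary K b p) : ∀ᶠ q in 𝓝 p, q ∈ hull K ∪ hull K' := by
  obtain ⟨a, haK, haF, ha⟩ := exists_opposite (hT.card_eq K hK) hF hc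
  obtain ⟨a', haK', haF', ha'⟩ := exists_opposite (hT.card_eq K' hK') hF' hc
  obtain ⟨κ, hκ, hopp⟩ := hT.opposite_bary hK hK' hne hF hF' hc haK ha haK' ha' haF haF'
  exact (hT.isTetra hK).eventually_mem_hull_union (hT.isTetra hK') hF hF' ha ha' hκ hopp hp hpos

theorem eq_or_eq_of_mem {K K' F : Finset E3} (hK : K ∈ T) (hK' : K' ∈ T) (hne : K ≠ K')
    (hF : F ⊆ K) (hF' : F ⊆ K') (hc : F.card = 3) {p : E3} (hp : p ∈ hull F)
    (hpos : ∀ b ∈ F, 0 < bary K b p) {L : Finset E3} (hL : L ∈ T) (hpL : p ∈ hull L) :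
    L = K ∨ L = K' := by
  have h1 := hT.eventually_mem_union hK hK' hne hF hF' hc hp hpos
  rw [← (hT.isTetra hL).closure_interior] at hpL
  obtain ⟨q, hq, hqL⟩ := mem_closure_iff_nhds.1 hpL _ h1
  rcases hq with hq | hq
  · exact Or.inl (hT.eq_of_interior_inter hL hK hqL hq)
  · exact Or.inr (hT.eq_of_interior_inter hL hK' hqL hq)

end IsConformingMesh

/-- Two different elements share a face that contains `x` and is not contained in the boundary. -/
def FaceAdj (Ω : Set E3) (T : Finset (Finset E3)) (x : E3) (K K' : Finset E3) : Prop :=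
  K ∈ T ∧ K' ∈ T ∧ K ≠ K' ∧ ∃ F, F ⊆ K ∧ F ⊆ K' ∧ F.card = 3 ∧ x ∈ hull F ∧ ¬ hull F ⊆ frontier Ω

theorem IsConformingMesh.star_connected {Ω : Set E3} {T : Finset (Finset E3)}
    (hΩ : IsLipschitzDomain Ω) (hT : IsConformingMesh Ω T) {K K' : Finset E3} (hK : K ∈ T)
    (hK' : K' ∈ T) {x : E3} (hx : x ∈ hull K) (hx' : x ∈ hull K') :
    Relation.ReflTransGen (FaceAdj Ω T x) K K' := by
  classical
  by_contra hcon
  have hev : ∀ᶠ y in 𝓝 x, ∀ S ∈ T.biUnion Finset.powerset, y ∈ hull S → x ∈ hull S := by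
    refine (Filter.eventually_all_finset _).2 fun S _ => ?_
    by_cases hxS : x ∈ hull S
    · exact Eventually.of_forall fun _ _ => hxS
    · filter_upwards [(isClosed_hull S).isOpen_compl.mem_nhds hxS] with y hy hyS
      exact absurd hyS hy
  obtain ⟨r, hr, hball⟩ := Metric.eventually_nhds_iff_ball.1 hev
  have hloc : ∀ L ∈ T, ∀ S ⊆ L, ∀ y ∈ Metric.ball x r, y ∈ hull S → x ∈ hull S := fun L hL S hS y hy =>
    hball y hy S (Finset.mem_biUnion.2 ⟨L, hL, Finset.mem_powerset.2 hS⟩)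
  obtain ⟨δ, hδ, Z, hZ, hZne, hseg⟩ := hΩ.exists_segments (hT.hull_subset hK hx) hr
  -- generic points
  set N : E3 → Set E3 := fun y =>
    ⋃ E ∈ (T.biUnion Finset.powerset).filter (fun E => E.card = 2),
      ((affineSpan ℝ (range ![y, tail E, head E]) : AffineSubspace ℝ E3) : Set E3)
  have hN : ∀ y, volume (N y) = 0 := fun y =>
    (measure_biUnion_null_iff (Finset.countable_toSet _)).2 fun E _ => volume_plane _ _ _
  have hNmem : ∀ y z, z ∉ N y → ∀ L ∈ T, ∀ E ⊆ L, E.card = 2 →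
      z ∉ ((affineSpan ℝ (range ![y, tail E, head E]) : AffineSubspace ℝ E3) : Set E3) := by
    intro y z hz L hL E hE hc hm
    refine hz (mem_biUnion (t := fun E => ((affineSpan ℝ (range ![y, tail E, head E])
      : AffineSubspace ℝ E3) : Set E3)) (x := E) ?_ hm)
    exact Finset.mem_filter.2 ⟨Finset.mem_biUnion.2 ⟨L, hL, Finset.mem_powerset.2 hE⟩, hc⟩
  have hgen : ∀ L ∈ T, x ∈ hull L → ∃ y ∈ interior (hull L), dist y x < δ ∧
      ∀ M ∈ T, ∀ E ⊆ M, E.card = 2 → y ∉ hull E := by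
    intro L hL hxL
    have hne : (interior (hull L) ∩ Metric.ball x δ).Nonempty := by
      rw [← (hT.isTetra hL).closure_interior] at hxL
      rw [inter_comm]
      exact mem_closure_iff_nhds.1 hxL _ (Metric.ball_mem_nhds x hδ)
    obtain ⟨y, hy, hyN⟩ := exists_mem_of_null (isOpen_interior.inter Metric.isOpen_ball) hne (hN 0)
    refine ⟨y, hy.1, hy.2, fun M hM E hE hc hyE => hNmem 0 y hyN M hM E hE hc ?_⟩
    exact hull_subset_plane (tail_head hc).2.2.2 0 hyE
  obtain ⟨y, hyK, hyx, hyE⟩ := hgen K hK hx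
  obtain ⟨y', hyK', hyx', hyE'⟩ := hgen K' hK' hx'
  obtain ⟨z, hz, hzN⟩ := exists_mem_of_null hZ hZne (N := N y ∪ N y')
    (measure_union_null (hN y) (hN y'))
  rw [mem_union, not_or] at hzN
  have hyΩ := hT.interior_subset_domain hΩ hK hyK
  have hyΩ' := hT.interior_subset_domain hΩ hK' hyK'
  set P : Set E3 := (fun t : ℝ => y + t • (z - y)) '' Icc 0 1 ∪ (fun t : ℝ => y' + t • (z - y')) '' Icc 0 1
  have hPΩ : P ⊆ Ω ∩ Metric.ball x r := by
    rintro _ (⟨t, ht, rfl⟩ | ⟨t, ht, rfl⟩)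
    · exact hseg y hyΩ hyx z hz t ht
    · exact hseg y' hyΩ' hyx' z hz t ht
  have hPE : ∀ p ∈ P, ∀ M ∈ T, ∀ E ⊆ M, E.card = 2 → p ∉ hull E := by
    rintro _ (⟨t, ht, rfl⟩ | ⟨t, ht, rfl⟩) M hM E hE hc
    · exact segment_avoids (tail_head hc).2.2.2 (hyE M hM E hE hc) (hNmem y z hzN.1 M hM E hE hc) t
    · exact segment_avoids (tail_head hc).2.2.2 (hyE' M hM E hE hc) (hNmem y' z hzN.2 M hM E hE hc) t
  have hyP : y ∈ P := Or.inl ⟨0, by simp, by simp⟩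
  have hyP' : y' ∈ P := Or.inr ⟨0, by simp, by simp⟩
  have hPc : IsPreconnected P := by
    refine IsPreconnected.union z ⟨1, by simp, by simp⟩ ⟨1, by simp, by simp⟩ ?_ ?_
    · exact isPreconnected_Icc.image _ (by fun_prop)
    · exact isPreconnected_Icc.image _ (by fun_prop)
  set R := fun L => Relation.ReflTransGen (FaceAdj Ω T x) K L
  set A : Set E3 := ⋃ L ∈ T.filter R, hull L
  set B : Set E3 := ⋃ L ∈ T.filter (fun L => ¬ R L), hull L
  have hA : IsClosed A := isClosed_biUnion_finset fun L _ => isClosed_hull L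
  have hB : IsClosed B := isClosed_biUnion_finset fun L _ => isClosed_hull L
  have hAB : P ⊆ A ∪ B := by
    intro p hp
    obtain ⟨L, hL, hpL⟩ := hT.exists_mem_hull (subset_closure (hPΩ hp).1)
    by_cases hRL : R L
    · exact Or.inl (mem_biUnion (x := L) (Finset.mem_filter.2 ⟨hL, hRL⟩) hpL)
    · exact Or.inr (mem_biUnion (x := L) (Finset.mem_filter.2 ⟨hL, hRL⟩) hpL)
  obtain ⟨p, hpP, hpA, hpB⟩ := isPreconnected_closed_iff.1 hPc A B hA hB hAB
    ⟨y, hyP, mem_biUnion (x := K) (Finset.mem_filter.2 ⟨hK, Relation.ReflTransGen.refl⟩)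
      (interior_subset hyK)⟩
    ⟨y', hyP', mem_biUnion (x := K') (Finset.mem_filter.2 ⟨hK', hcon⟩) (interior_subset hyK')⟩
  obtain ⟨K1, hK1, hpK1⟩ := mem_iUnion₂.1 hpA
  obtain ⟨K2, hK2, hpK2⟩ := mem_iUnion₂.1 hpB
  rw [Finset.mem_filter] at hK1 hK2
  have hne12 : K1 ≠ K2 := fun h => hK2.2 (h ▸ hK1.2)
  have t1 := hT.isTetra hK1.1
  obtain ⟨S, hSK, hpS, hS⟩ := t1.exists_support hpK1
  have hSc : 3 ≤ S.card := by
    by_contra! hlt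
    obtain ⟨E, hSE, hEK, hEc⟩ := Finset.exists_subsuperset_card_eq hSK (show S.card ≤ 2 by omega)
      (show 2 ≤ K1.card by rw [t1.card_eq]; norm_num)
    exact hPE p hpP K1 hK1.1 E hEK hEc (hull_mono hSE hpS)
  have hSc' : S.card ≤ 4 := t1.card_eq ▸ Finset.card_le_card hSK
  obtain hc | hc : S.card = 4 ∨ S.card = 3 := by omega
  · have hSK' : S = K1 := Finset.eq_of_subset_of_card_le hSK (by rw [t1.card_eq, hc])
    have hpi : p ∈ interior (hull K1) := t1.mem_interior_iff.2 fun a ha => (hS a ha).1 (hSK' ▸ ha)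
    exact hne12 (hT.eq_of_interior_inter hK1.1 hK2.1 hpi hpK2)
  · have hnf : ¬ hull S ⊆ frontier Ω := fun h => (hΩ.mem_frontier_iff.1 (h hpS)).2 (hPΩ hpP).1
    rcases hT.faces K1 hK1.1 S hSK hc with hfr | ⟨K3, hK3, hne, hSK3⟩
    · exact hnf hfr
    · have hpos : ∀ b ∈ S, 0 < bary K1 b p := fun b hb => (hS b (hSK hb)).1 hb
      have hxS := hloc K1 hK1.1 S hSK p (hPΩ hpP).2 hpS
      have hR3 : R K3 := Relation.ReflTransGen.tail hK1.2
        ⟨hK1.1, hK3, hne.symm, S, hSK, hSK3, hc, hxS, hnf⟩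
      rcases hT.eq_or_eq_of_mem hK1.1 hK3 hne.symm hSK hSK3 hc hpS hpos hK2.1 hpK2 with h | h
      · exact hne12 h.symm
      · exact hK2.2 (h ▸ hR3)

namespace IsConformingMesh

variable {Ω : Set E3} {T : Finset (Finset E3)} (hΩ : IsLipschitzDomain Ω)
  (hT : IsConformingMesh Ω T)
include hΩ hT

/-- The minimal subsimplex containing a point is the same in all elements. -/
theorem support_subset {K K' : Finset E3} (hK : K ∈ T)
    (hK' : K' ∈ T) {x : E3} (hx : x ∈ hull K) (hx' : x ∈ hull K') :
    ∀ a, (a ∈ K ∧ 0 < bary K a x) ↔ (a ∈ K' ∧ 0 < bary K' a x) := by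
  have key : ∀ K1 K2, FaceAdj Ω T x K1 K2 → ∀ a, (a ∈ K1 ∧ 0 < bary K1 a x) → (a ∈ K2 ∧ 0 < bary K2 a x) := by
    rintro K1 K2 ⟨h1, h2, -, F, hF1, hF2, -, hxF, -⟩ a ⟨ha, hpos⟩
    have t1 := hT.isTetra h1
    have haF : a ∈ F := by
      by_contra haF
      exact hpos.ne' (((t1.mem_hull_subset_iff hF1).1 hxF).2 a ha haF)
    exact ⟨hF2 haF, by rwa [← t1.bary_eq_of_common (hT.isTetra h2) hF1 hF2 hxF haF]⟩
  have key' : ∀ K1 ∈ T, ∀ K2 ∈ T, x ∈ hull K1 → x ∈ hull K2 →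
      ∀ a, (a ∈ K1 ∧ 0 < bary K1 a x) → (a ∈ K2 ∧ 0 < bary K2 a x) := by
    intro K1 h1 K2 h2 hx1 hx2 a
    induction hT.star_connected hΩ h1 h2 hx1 hx2 with
    | refl => exact id
    | tail h12 h23 ih =>
      intro ha
      obtain ⟨m1, m2, -, F, hF1, -, -, hxF, -⟩ := id h23
      exact key _ _ h23 a (ih m1 (hull_mono hF1 hxF) ha)
  exact fun a => ⟨key' K hK K' hK' hx hx' a, key' K' hK' K hK hx' hx a⟩

theorem frontier_face_unique {K K' F : Finset E3} (hK : K ∈ T) (hK' : K' ∈ T) (hF : F ⊆ K)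
    (hc : F.card = 3) (hfr : hull F ⊆ frontier Ω) {x : E3}
    (hx : x ∈ hull F) (hpos : ∀ a ∈ F, 0 < bary K a x) (hx' : x ∈ hull K') : K' = K := by
  have := hT.star_connected hΩ hK hK' (hull_mono hF hx) hx'
  rcases Relation.ReflTransGen.cases_head this with h | ⟨L, ⟨-, hL, hne, F', hF1, hF2, hc', hxF', hnf⟩, -⟩
  · exact h.symm
  · exfalso
    have hFF : F ⊆ F' := fun a ha => by
      by_contra haF
      exact (hpos a ha).ne' ((((hT.isTetra hK).mem_hull_subset_iff hF1).1 hxF').2 a (hF ha) haF)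
    have : F = F' := Finset.eq_of_subset_of_card_le hFF (by rw [hc, hc'])
    exact hnf (this ▸ hfr)

theorem shared_face_relint {K K' F : Finset E3} (hK : K ∈ T) (hK' : K' ∈ T) (hne : K ≠ K')
    (hF : F ⊆ K) (hF' : F ⊆ K') (hc : F.card = 3) {p : E3} (hp : p ∈ hull F)
    (hpos : ∀ b ∈ F, 0 < bary K b p) : p ∈ Ω := by
  rw [← hΩ.interior_closure, mem_interior_iff_mem_nhds]
  filter_upwards [hT.eventually_mem_union hK hK' hne hF hF' hc hp hpos] with q hq
  rcases hq with hq | hq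
  · exact hT.hull_subset hK hq
  · exact hT.hull_subset hK' hq

/-- Near a relative interior point of a boundary face the domain is a half space. -/
theorem frontier_face_local {K F : Finset E3} (hK : K ∈ T) (hF : F ⊆ K) (hc : F.card = 3)
    (hfr : hull F ⊆ frontier Ω) {a : E3} (haK : a ∈ K) (ha : ∀ b ∈ K, b ≠ a → b ∈ F)
    {x : E3} (hx : x ∈ hull F) (hpos : ∀ a ∈ F, 0 < bary K a x) :
    ∃ r > 0, ∀ y ∈ Metric.ball x r, (y ∈ Ω ↔ 0 < bary K a y) ∧ (0 ≤ bary K a y → y ∈ hull K) := by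
  classical
  have tK := hT.isTetra hK
  have h1 : ∀ᶠ q in 𝓝 x, ∀ b ∈ F, 0 < bary K b q :=
    (Filter.eventually_all_finset F).2 fun b hb =>
      (continuous_bary K b).continuousAt.eventually (lt_mem_nhds (hpos b hb))
  have h2 : ∀ᶠ q in 𝓝 x, ∀ L ∈ T, q ∈ hull L → L = K := by
    refine (Filter.eventually_all_finset T).2 fun L hL => ?_
    by_cases hxL : x ∈ hull L
    · have := hT.frontier_face_unique hΩ hK hL hF hc hfr hx hpos hxL
      exact Eventually.of_forall fun _ _ => this
    · filter_upwards [(isClosed_hull L).isOpen_compl.mem_nhds hxL] with y hy hyS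
      exact absurd hyS hy
  obtain ⟨r, hr, hb⟩ := Metric.eventually_nhds_iff_ball.1 (h1.and h2)
  have hle : ∀ y ∈ Metric.ball x r, y ∈ Ω → 0 ≤ bary K a y := by
    intro y hy hyΩ
    obtain ⟨L, hL, hyL⟩ := hT.exists_mem_hull (subset_closure hyΩ)
    have := (hb y hy).2 L hL hyL
    subst this
    exact tK.mem_hull_iff.1 hyL a haK
  refine ⟨r, hr, fun y hy => ⟨⟨fun hyΩ => ?_, fun h0 => ?_⟩, fun h0 => ?_⟩⟩
  · refine lt_of_le_of_ne (hle y hy hyΩ) fun h0 => ?_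
    have hcont : Continuous fun t : ℝ => y - t • gradBary K a := by fun_prop
    have hev : ∀ᶠ t in 𝓝 (0:ℝ), y - t • gradBary K a ∈ Metric.ball x r ∩ Ω :=
      hcont.continuousAt.eventually ((Metric.isOpen_ball.inter hΩ.1).mem_nhds (by simpa using ⟨hy, hyΩ⟩))
    obtain ⟨t, ht, ht0⟩ := ((hev.filter_mono nhdsWithin_le_nhds).and
      (self_mem_nhdsWithin (a := (0:ℝ)) (s := Ioi 0))).exists
    have ht0 : 0 < t := ht0
    have h3 := hle _ ht.1 ht.2
    rw [bary_eq_add K a _ y, ← h0, sub_sub_cancel_left, inner_neg_right, inner_smul_right,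
      real_inner_self_eq_norm_sq] at h3
    have := norm_pos_iff.2 (tK.gradBary_ne_zero haK)
    have : 0 < t * ‖gradBary K a‖ ^ 2 := by positivity
    linarith
  · refine hT.interior_subset_domain hΩ hK (tK.mem_interior_iff.2 fun b hbK => ?_)
    by_cases hba : b = a
    · rw [hba]; exact h0
    · exact (hb y hy).1 b (ha b hbK hba)
  · refine tK.mem_hull_iff.2 fun b hbK => ?_
    by_cases hba : b = a
    · rw [hba]; exact h0
    · exact ((hb y hy).1 b (ha b hbK hba)).le

end IsConformingMesh

/-- `w` is the weak curl of `f` in the open set `U`. -/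
def IsWeakCurl (U : Set E3) (f w : E3 → E3) : Prop :=
  ∀ φ : E3 → E3, ContDiff ℝ ∞ φ → HasCompactSupport φ → tsupport φ ⊆ U →
    ∫ x in U, inner ℝ (f x) (curl φ x) = ∫ x in U, inner ℝ (w x) (φ x)

theorem pd_eq {φ : E3 → E3} (hφ : ContDiff ℝ ∞ φ) (i j : Fin 3) (x : E3) :
    pd φ i j x = fderiv ℝ (fun y => φ y j) x (unitVec i) := by
  have h1 : HasFDerivAt φ (fderiv ℝ φ x) x := (hφ.differentiable (by simp) x).hasFDerivAt
  have h2 : HasFDerivAt (fun y => φ y j) ((EuclideanSpace.proj j : E3 →L[ℝ] ℝ).comp (fderiv ℝ φ x)) x :=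
    (EuclideanSpace.proj j : E3 →L[ℝ] ℝ).hasFDerivAt.comp x h1
  rw [h2.fderiv]; rfl

theorem contDiff_coord {φ : E3 → E3} (hφ : ContDiff ℝ ∞ φ) (j : Fin 3) :
    ContDiff ℝ ∞ fun y => φ y j := by fun_prop

theorem continuous_pd {φ : E3 → E3} (hφ : ContDiff ℝ ∞ φ) (i j : Fin 3) : Continuous (pd φ i j) := by
  have : pd φ i j = fun x => fderiv ℝ (fun y => φ y j) x (unitVec i) := by
    ext1 x; exact pd_eq hφ i j x
  rw [this]
  exact continuous_pderiv (contDiff_coord hφ j) _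

theorem continuous_curl {φ : E3 → E3} (hφ : ContDiff ℝ ∞ φ) : Continuous (curl φ) := by
  refine (PiLp.continuous_toLp 2 _).comp (continuous_pi fun i => ?_)
  have h := continuous_pd hφ
  fin_cases i
  · exact (h 1 2).sub (h 2 1)
  · exact (h 2 0).sub (h 0 2)
  · exact (h 0 1).sub (h 1 0)

theorem curl_eq_zero_of_notMem {φ : E3 → E3} {x : E3} (hx : x ∉ tsupport φ) : curl φ x = 0 := by
  have : fderiv ℝ φ x = 0 := by
    by_contra h
    exact hx (support_fderiv_subset ℝ (f := φ) h)
  unfold curl pd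
  rw [this]
  apply E3.ext3 <;> simp

theorem hasCompactSupport_curl {φ : E3 → E3} (hc : HasCompactSupport φ) :
    HasCompactSupport (curl φ) :=
  HasCompactSupport.intro hc.isCompact fun _ hx => curl_eq_zero_of_notMem hx

theorem IsWeakGrad.integral_coord {U : Set E3} {f : E3 → E3} {G : Fin 3 → E3 → E3}
    (hf : MemLp f 2 (volume.restrict U)) (h : IsWeakGrad U f G) {φ : E3 → ℝ} (hφ : ContDiff ℝ ∞ φ)
    (hc : HasCompactSupport φ) (hs : tsupport φ ⊆ U) (i j : Fin 3) :
    ∫ x in U, fderiv ℝ φ x (unitVec i) * f x j = - ∫ x in U, φ x * G i x j := by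
  have e := congrArg (EuclideanSpace.proj j : E3 →L[ℝ] ℝ) (h.2 i φ hφ hc hs)
  rw [map_neg, ← ContinuousLinearMap.integral_comp_comm, ← ContinuousLinearMap.integral_comp_comm] at e
  · simpa using e
  · exact integrable_smul_of_memLp hφ.continuous hc (h.1 i)
  · exact integrable_smul_of_memLp (continuous_pderiv hφ _) (hasCompactSupport_pderiv hc _) hf

theorem IsWeakGrad.isWeakCurl {U : Set E3} {f : E3 → E3} {G : Fin 3 → E3 → E3}
    (hf : MemLp f 2 (volume.restrict U)) (h : IsWeakGrad U f G) : IsWeakCurl U f (gradCurl G) := by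
  intro φ hφ hc hs
  have hcj : ∀ j, HasCompactSupport fun y => φ y j := fun j =>
    hc.comp_left (g := fun v : E3 => v j) rfl
  have hsj : ∀ j, tsupport (fun y => φ y j) ⊆ U := fun j => by
    refine Subset.trans (closure_mono fun x hx => ?_) hs
    intro h0
    exact hx (by simp [h0])
  have key : ∀ i j k, ∫ x in U, pd φ i k x * f x j = - ∫ x in U, φ x k * G i x j := by
    intro i j k
    simp_rw [pd_eq hφ]
    exact h.integral_coord hf (contDiff_coord hφ k) (hcj k) (hsj k) i j
  have I1 : ∀ i j k, Integrable (fun x => pd φ i k x * f x j) (volume.restrict U) := by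
    intro i j k
    simp_rw [pd_eq hφ]
    exact integrable_smul_of_memLp (continuous_pderiv (contDiff_coord hφ k) _)
      (hasCompactSupport_pderiv (hcj k) _) (memLp_coord hf j)
  have I2 : ∀ i j k, Integrable (fun x => φ x k * G i x j) (volume.restrict U) := fun i j k =>
    integrable_smul_of_memLp (contDiff_coord hφ k).continuous (hcj k) (memLp_coord (h.1 i) j)
  have e1 : ∀ x, (inner ℝ (f x) (curl φ x) : ℝ)
      = (pd φ 1 2 x * f x 0 - pd φ 2 1 x * f x 0) + (pd φ 2 0 x * f x 1 - pd φ 0 2 x * f x 1)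
        + (pd φ 0 1 x * f x 2 - pd φ 1 0 x * f x 2) := fun x => by
    rw [inner_eq]; simp [curl]; ring
  have e2 : ∀ x, (inner ℝ (gradCurl G x) (φ x) : ℝ)
      = (φ x 0 * G 1 x 2 - φ x 0 * G 2 x 1) + (φ x 1 * G 2 x 0 - φ x 1 * G 0 x 2)
        + (φ x 2 * G 0 x 1 - φ x 2 * G 1 x 0) := fun x => by
    rw [inner_eq]; simp [gradCurl]; ring
  simp_rw [e1, e2]
  rw [integral_add ?_ ?_, integral_add ?_ ?_, integral_sub (I1 _ _ _) (I1 _ _ _),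
    integral_sub (I1 _ _ _) (I1 _ _ _), integral_sub (I1 _ _ _) (I1 _ _ _),
    integral_add ?_ ?_, integral_add ?_ ?_, integral_sub (I2 _ _ _) (I2 _ _ _),
    integral_sub (I2 _ _ _) (I2 _ _ _), integral_sub (I2 _ _ _) (I2 _ _ _)]
  · simp_rw [key]; ring
  · exact (I2 _ _ _).sub (I2 _ _ _)
  · exact (I2 _ _ _).sub (I2 _ _ _)
  · exact ((I2 _ _ _).sub (I2 _ _ _)).add ((I2 _ _ _).sub (I2 _ _ _))
  · exact (I2 _ _ _).sub (I2 _ _ _)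
  · exact (I1 _ _ _).sub (I1 _ _ _)
  · exact (I1 _ _ _).sub (I1 _ _ _)
  · exact ((I1 _ _ _).sub (I1 _ _ _)).add ((I1 _ _ _).sub (I1 _ _ _))
  · exact (I1 _ _ _).sub (I1 _ _ _)

theorem integrable_inner_curl {U : Set E3} {f φ : E3 → E3} (hf : MemLp f 2 (volume.restrict U))
    (hφ : ContDiff ℝ ∞ φ) (hc : HasCompactSupport φ) :
    Integrable (fun x => (inner ℝ (f x) (curl φ x) : ℝ)) (volume.restrict U) :=
  integrable_inner_of_memLp hf
    ((continuous_curl hφ).memLp_of_hasCompactSupport (hasCompactSupport_curl hc))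

theorem IsWeakCurl.ae_eq {U : Set E3} (hU : IsOpen U) {f w w' : E3 → E3}
    (hw : MemLp w 2 (volume.restrict U)) (hw' : MemLp w' 2 (volume.restrict U))
    (h : IsWeakCurl U f w) (h' : IsWeakCurl U f w') : w =ᵐ[volume.restrict U] w' := by
  have hcoord : ∀ j, ∀ᵐ x ∂volume, x ∈ U → w x j - w' x j = 0 := by
    intro j
    have hm := (memLp_coord hw j).sub (memLp_coord hw' j)
    refine hU.ae_eq_zero_of_integral_contDiff_smul_eq_zero ?_ ?_
    · exact locallyIntegrableOn_of_locallyIntegrable_restrict (hm.locallyIntegrable (by norm_num))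
    · intro g hg hgc hgs
      have hφ : ContDiff ℝ ∞ fun x => g x • unitVec j := hg.smul contDiff_const
      have hφc : HasCompactSupport fun x => g x • unitVec j := hgc.smul_right
      have hφs : tsupport (fun x => g x • unitVec j) ⊆ U :=
        (closure_mono (Function.support_smul_subset_left _ _)).trans hgs
      have e := (h _ hφ hφc hφs).symm.trans (h' _ hφ hφc hφs)
      have e1 : ∀ v : E3 → E3, ∀ x, (inner ℝ (v x) (g x • unitVec j) : ℝ) = g x * v x j := fun v x => by
        rw [inner_smul_right, unitVec, EuclideanSpace.inner_single_right]; simp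
      simp_rw [e1] at e
      have hz : Function.support (fun x => g x • (w x j - w' x j)) ⊆ U :=
        (Function.support_smul_subset_left _ _).trans ((subset_tsupport g).trans hgs)
      rw [← setIntegral_eq_of_tsupport_subset hz]
      simp only [smul_eq_mul, mul_sub]
      rw [integral_sub, e, sub_self]
      · exact integrable_smul_of_memLp hg.continuous hgc (memLp_coord hw j)
      · exact integrable_smul_of_memLp hg.continuous hgc (memLp_coord hw' j)
  refine (ae_restrict_iff' hU.measurableSet).2 ?_
  filter_upwards [hcoord 0, hcoord 1, hcoord 2] with x h0 h1 h2 hx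
  exact E3.ext3 (sub_eq_zero.1 (h0 hx)) (sub_eq_zero.1 (h1 hx)) (sub_eq_zero.1 (h2 hx))

theorem IsWeakCurl.mono {U V : Set E3} (hVU : V ⊆ U) {f w : E3 → E3}
    (h : IsWeakCurl U f w) : IsWeakCurl V f w := by
  intro φ hφ hc hs
  have e1 : ∀ W : Set E3, V ⊆ W → ∫ x in W, inner ℝ (f x) (curl φ x) = ∫ x, (inner ℝ (f x) (curl φ x) : ℝ) := by
    intro W hW
    refine setIntegral_eq_integral_of_forall_compl_eq_zero fun x hx => ?_
    rw [curl_eq_zero_of_notMem (fun h => hx (hW (hs h))), inner_zero_right]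
  have e2 : ∀ W : Set E3, V ⊆ W → ∫ x in W, inner ℝ (w x) (φ x) = ∫ x, (inner ℝ (w x) (φ x) : ℝ) := by
    intro W hW
    refine setIntegral_eq_integral_of_forall_compl_eq_zero fun x hx => ?_
    rw [image_eq_zero_of_notMem_tsupport (fun h => hx (hW (hs h))), inner_zero_right]
  rw [e1 V le_rfl, e2 V le_rfl, ← e1 U hVU, ← e2 U hVU]
  exact h φ hφ hc (hs.trans hVU)

theorem IsWeakCurl.congr {U : Set E3} {f f' w : E3 → E3} (h : IsWeakCurl U f w)
    (hf : f =ᵐ[volume.restrict U] f') : IsWeakCurl U f' w := by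
  intro φ hφ hc hs
  rw [← h φ hφ hc hs]
  refine integral_congr_ae ?_
  filter_upwards [hf] with x hx
  rw [hx]

theorem IsHcurl.isWeakCurl {Ω Γ : Set E3} (hΩ : IsOpen Ω) {v w : E3 → E3} (h : IsHcurl Ω Γ v w) :
    IsWeakCurl Ω v w := by
  intro φ hφ hc hs
  refine h.2.2 φ hφ hc (disjoint_left.2 fun x hx hx' => ?_)
  have h1 : closure (frontier Ω \ Γ) ⊆ frontier Ω := closure_minimal sdiff_subset isClosed_frontier
  have h2 := h1 hx'
  rw [frontier, hΩ.interior_eq] at h2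
  exact h2.2 (hs hx)

theorem curl_affine (a b x : E3) : curl (fun y => a + cross b y) x = (2:ℝ) • b := by
  have h : HasFDerivAt (fun y => a + cross b y) (crossL b) x := (crossL b).hasFDerivAt.const_add a
  unfold curl pd
  rw [h.fderiv]
  apply E3.ext3 <;> simp [unitVec] <;> ring

theorem contDiff_affine (a b : E3) : ContDiff ℝ ∞ fun y => a + cross b y := by
  have : ContDiff ℝ ∞ fun y => a + crossL b y := by fun_prop
  exact this

theorem constCurlField_of_discrete {Ω Γ : Set E3} {T : Finset (Finset E3)}
    (hΩ : IsLipschitzDomain Ω) (hT : IsConformingMesh Ω T) {Ψ v w : E3 → E3}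
    (hΨm : MemLp Ψ 2 (volume.restrict Ω)) {G : Fin 3 → E3 → E3} (hG : IsWeakGrad Ω Ψ G)
    (hv : MemEdgeSpace Ω Γ T v) (hvw : IsHcurl Ω Γ v w) (hΨw : IsHcurl Ω Γ Ψ w)
    {K : Finset E3} (hK : K ∈ T) : ConstCurlField (interior (hull K)) Ψ G := by
  have hsub := hT.interior_subset_domain hΩ hK
  have tK := hT.isTetra hK
  have hU := tK.convexElement
  set U := interior (hull K)
  have hmono : (volume : Measure E3).restrict U ≤ volume.restrict Ω := Measure.restrict_mono hsub le_rfl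
  have hGm : ∀ i, MemLp (G i) 2 (volume.restrict U) := fun i => (hG.1 i).mono_measure hmono
  have hΨU := hΨm.mono_measure hmono
  have hGU : IsWeakGrad U Ψ G := hG.mono hsub
  refine ⟨hΨU, hGU, ?_⟩
  obtain ⟨a, b, hab⟩ := hv.2 K hK
  refine ⟨(2:ℝ) • b, ?_⟩
  have hwU : MemLp w 2 (volume.restrict U) := hvw.2.1.mono_measure hmono
  have hgc : MemLp (gradCurl G) 2 (volume.restrict U) := by
    have h := fun i j => memLp_coord (hGm i) j
    refine MemLp.of_eval_piLp fun i => ?_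
    fin_cases i
    · exact (h 1 2).sub (h 2 1)
    · exact (h 2 0).sub (h 0 2)
    · exact (h 0 1).sub (h 1 0)
  have h1 : gradCurl G =ᵐ[volume.restrict U] w :=
    IsWeakCurl.ae_eq hU.isOpen hgc hwU (hGU.isWeakCurl hΨU) ((hΨw.isWeakCurl hΩ.1).mono hsub)
  have hva : v =ᵐ[volume.restrict U] fun y => a + cross b y :=
    ae_mono (Measure.restrict_mono interior_subset le_rfl) hab
  have hc := contDiff_affine a b
  have hwk : IsWeakCurl U (fun y => a + cross b y) (fun _ => (2:ℝ) • b) := by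
    have := (isWeakGrad_of_contDiff (hc.of_le (by simp)) fun i =>
      hU.memLp_pderiv (hc.of_le (by simp)) (unitVec i)).isWeakCurl (hU.memLp_of_continuous hc.continuous)
    have e : gradCurl (fun i x => fderiv ℝ (fun y => a + cross b y) x (unitVec i)) = fun _ => (2:ℝ) • b := by
      ext1 x; rw [← curl_eq_gradCurl, curl_affine]
    rwa [e] at this
  have h2 : w =ᵐ[volume.restrict U] fun _ => (2:ℝ) • b :=
    IsWeakCurl.ae_eq hU.isOpen hwU (hU.memLp_of_continuous continuous_const)
      (((hvw.isWeakCurl hΩ.1).mono hsub).congr hva) hwk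
  filter_upwards [h1, h2] with x hx hx'
  rw [hx, hx']

/-- The segment fields of all elements. -/
structure IsSegFamily (Ω : Set E3) (T : Finset (Finset E3)) (Ψ : E3 → E3) (G : Fin 3 → E3 → E3)
    (ℓ : Finset E3 → E3 → E3 → ℝ) : Prop where
  field : ∀ K ∈ T, ConstCurlField (interior (hull K)) Ψ G
  lim : ∀ K ∈ T, ConvexElement.IsSegLimit (interior (hull K)) (elemDiam K) Ψ G (ℓ K)

variable {Ω Γ : Set E3} {T : Finset (Finset E3)} {Ψ w : E3 → E3} {G : Fin 3 → E3 → E3}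
  {ℓ : Finset E3 → E3 → E3 → ℝ}

theorem lineSmear_support {κ : E3 → ℝ} {d x : E3} (hx : lineSmear κ d x ≠ 0) :
    ∃ y, κ y ≠ 0 ∧ ∃ r ∈ Icc (0:ℝ) 1, x = y + r • d := by
  by_contra! h
  refine hx (lineSmear_eq_zero (S := Function.support κ) le_rfl ?_)
  rintro ⟨⟨y, r⟩, ⟨hy, hr⟩, rfl⟩
  exact h y hy r hr rfl

theorem integral_lineSmear_indicator (hΩ : IsLipschitzDomain Ω) (hT : IsConformingMesh Ω T)
    (hℓ : IsSegFamily Ω T Ψ G ℓ) {K : Finset E3} (hK : K ∈ T) {W : Set E3} {κ : E3 → ℝ} {d : E3}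
    (hκ : Continuous κ) (hc : HasCompactSupport κ)
    (hs : ∀ x, κ x ≠ 0 → x ∈ hull K ∧ x + d ∈ hull K)
    (hW : ∀ x, κ x ≠ 0 → ∀ r ∈ Icc (0:ℝ) 1, x + r • d ∈ W) :
    ∫ x in W, lineSmear κ d x * inner ℝ (Ω.indicator Ψ x) d = ∫ x, κ x * ℓ K x (x + d) := by
  have tK := hT.isTetra hK
  have hU := tK.convexElement
  have hcl := tK.closure_interior
  have hsub := hT.interior_subset_domain hΩ hK
  rw [← hU.integral_lineSmear_mul_segLimit (hℓ.field K hK) (hℓ.lim K hK) hκ hc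
    (fun x hx => by rw [hcl]; exact hs x hx)]
  have e1 : ∫ x in W, lineSmear κ d x * inner ℝ (Ω.indicator Ψ x) d
      = ∫ x, lineSmear κ d x * inner ℝ (Ω.indicator Ψ x) d := by
    refine setIntegral_eq_integral_of_forall_compl_eq_zero fun x hx => ?_
    have : lineSmear κ d x = 0 := by
      by_contra hne
      obtain ⟨y, hy, r, hr, rfl⟩ := lineSmear_support hne
      exact hx (hW y hy r hr)
    rw [this, zero_mul]
  have e2 : ∫ x in closure (interior (hull K)), lineSmear κ d x * inner ℝ (Ω.indicator Ψ x) d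
      = ∫ x, lineSmear κ d x * inner ℝ (Ω.indicator Ψ x) d := by
    refine setIntegral_eq_integral_of_forall_compl_eq_zero fun x hx => ?_
    have : lineSmear κ d x = 0 := by
      by_contra hne
      obtain ⟨y, hy, r, hr, rfl⟩ := lineSmear_support hne
      obtain ⟨h1, h2⟩ := hs y hy
      rw [hcl] at hx
      have := (convex_hull K).add_smul_sub_mem h1 h2 hr
      rw [add_sub_cancel_left] at this
      exact hx this
    rw [this, zero_mul]
  rw [e1, ← e2, restrict_closure_eq hU]
  refine setIntegral_congr_fun isOpen_interior.measurableSet fun x hx => ?_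
  simp only [indicator_of_mem (hsub hx)]

theorem segLimit_eq_of_trace (hΩ : IsLipschitzDomain Ω) (hT : IsConformingMesh Ω T)
    (hΨw : IsHcurl Ω Γ Ψ w) (hℓ : IsSegFamily Ω T Ψ G ℓ) {K : Finset E3} (hK : K ∈ T) {a : E3}
    (haK : a ∈ K) {x₀ d : E3} (hx₀ : bary K a x₀ = 0) (hd : inner ℝ (gradBary K a) d = (0:ℝ))
    {O : Set E3} (hO : IsOpen O) (hOΓ : Disjoint O (closure (frontier Ω \ Γ)))
    (hseg : ∀ r ∈ Icc (0:ℝ) 1, x₀ + r • d ∈ O) (hOK : ∀ y ∈ O, 0 ≤ bary K a y → y ∈ hull K)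
    {ℓm : E3 → ℝ} (hℓmc : ContinuousOn ℓm {x | bary K a x ≤ 0 ∧ ∀ r ∈ Icc (0:ℝ) 1, x + r • d ∈ O})
    (hℓm : ∀ W : Set E3, ∀ κ : E3 → ℝ, Continuous κ → HasCompactSupport κ →
      (∀ x, κ x ≠ 0 → bary K a x ≤ 0 ∧ ∀ r ∈ Icc (0:ℝ) 1, x + r • d ∈ O ∧ x + r • d ∈ W) →
      ∫ x in W, lineSmear κ d x * inner ℝ (Ω.indicator Ψ x) d = ∫ x, κ x * ℓm x) :
    ℓ K x₀ (x₀ + d) = ℓm x₀ := by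
  have tK := hT.isTetra hK
  have hg := norm_pos_iff.2 (tK.gradBary_ne_zero haK)
  have hU := tK.convexElement
  have hcl := tK.closure_interior
  set g := gradBary K a
  set n := ‖g‖⁻¹ • g
  have hn : ‖n‖ = 1 := by
    simp only [n, norm_smul, norm_inv, norm_norm]
    exact inv_mul_cancel₀ hg.ne'
  have hnd : inner ℝ n d = (0:ℝ) := by simp only [n, inner_smul_left, hd, mul_zero]
  have hht : ∀ x, height n x₀ x = ‖g‖⁻¹ * bary K a x := fun x => by
    rw [bary_eq_add K a x x₀, hx₀, zero_add]
    simp [height, n, inner_smul_left, g]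
  have hh0 : ∀ x, 0 ≤ height n x₀ x ↔ 0 ≤ bary K a x := fun x => by
    rw [hht]; exact mul_nonneg_iff_of_pos_left (inv_pos.2 hg)
  have hh1 : ∀ x, height n x₀ x ≤ 0 ↔ bary K a x ≤ 0 := fun x => by
    rw [hht, ← neg_nonneg, ← neg_nonneg (a := bary K a x), ← mul_neg]
    exact mul_nonneg_iff_of_pos_left (inv_pos.2 hg)
  set W := O ∩ Metric.ball x₀ (‖d‖ + 2)
  have hWo : IsOpen W := hO.inter Metric.isOpen_ball
  have hWb : Bornology.IsBounded W := Metric.isBounded_ball.subset inter_subset_right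
  set sg : Set E3 := (fun r : ℝ => x₀ + r • d) '' Icc 0 1
  have hsgc : IsCompact sg := isCompact_Icc.image (by fun_prop)
  obtain ⟨δ, hδ, hδO⟩ := hsgc.exists_cthickening_subset_open hO
    (by rintro _ ⟨r, hr, rfl⟩; exact hseg r hr)
  set r₀ := min δ 1
  have hr₀ : 0 < r₀ := by positivity
  have hin : ∀ x ∈ Metric.closedBall x₀ r₀, ∀ r ∈ Icc (0:ℝ) 1, x + r • d ∈ W := by
    intro x hx r hr
    rw [Metric.mem_closedBall] at hx
    refine ⟨hδO (Metric.mem_cthickening_of_dist_le _ (x₀ + r • d) _ _ ⟨r, hr, rfl⟩ ?_), ?_⟩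
    · rw [dist_add_right]; exact hx.trans (min_le_left _ _)
    · rw [Metric.mem_ball, dist_eq_norm, show x + r • d - x₀ = (x - x₀) + r • d by abel]
      have h1 : ‖x - x₀‖ ≤ 1 := by rw [← dist_eq_norm]; exact hx.trans (min_le_right _ _)
      have h2 : ‖r • d‖ ≤ ‖d‖ := by
        rw [norm_smul, Real.norm_eq_abs, abs_of_nonneg hr.1]
        exact mul_le_of_le_one_left (norm_nonneg _) hr.2
      linarith [norm_add_le (x - x₀) (r • d)]
  have hshift : ∀ x r, bary K a (x + r • d) = bary K a x := fun x r => by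
    rw [bary_eq_add K a _ x, add_sub_cancel_left, inner_smul_right, hd]; ring
  have hmemK : ∀ x ∈ Metric.closedBall x₀ r₀, 0 ≤ bary K a x → ∀ r ∈ Icc (0:ℝ) 1, x + r • d ∈ hull K :=
    fun x hx h0 r hr => hOK _ (hin x hx r hr).1 (by rw [hshift]; exact h0)
  have hmemK0 : ∀ x ∈ Metric.closedBall x₀ r₀, 0 ≤ bary K a x → x ∈ hull K ∧ x + d ∈ hull K := by
    intro x hx h0
    have e0 := hmemK x hx h0 0 (by simp)
    have e1 := hmemK x hx h0 1 (by simp)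
    simp only [zero_smul, add_zero, one_smul] at e0 e1
    exact ⟨e0, e1⟩
  have hΩm : MeasurableSet Ω := hΩ.1.measurableSet
  have hmemLp : ∀ f : E3 → E3, MemLp f 2 (volume.restrict Ω) → MemLp (Ω.indicator f) 2 (volume.restrict W) :=
    fun f hf => ((memLp_indicator_iff_restrict hΩm).2 hf).mono_measure Measure.restrict_le_self
  refine face_jump_zero (ℓp := fun x => ℓ K x (x + d)) (ℓm := ℓm) hWo hWb (hmemLp Ψ hΨw.1)
    (hmemLp w hΨw.2.1) ?_ hn hnd
    (fun r hr => hin x₀ (Metric.mem_closedBall_self hr₀.le) r hr) hr₀ ?_ ?_ ?_ ?_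
  · intro φ hφ hφc hφs
    have key := hΨw.2.2 φ hφ hφc (hOΓ.mono_left (hφs.trans inter_subset_left))
    have e1 : ∫ x in W, inner ℝ (Ω.indicator Ψ x) (curl φ x) = ∫ x in Ω, inner ℝ (Ψ x) (curl φ x) := by
      rw [setIntegral_eq_integral_of_forall_compl_eq_zero (s := W), ← integral_indicator hΩm]
      · congr 1; ext1 x; by_cases hx : x ∈ Ω <;> simp [hx]
      · intro x hx
        rw [curl_eq_zero_of_notMem (fun h => hx (hφs h)), inner_zero_right]
    have e2 : ∫ x in W, inner ℝ (Ω.indicator w x) (φ x) = ∫ x in Ω, inner ℝ (w x) (φ x) := by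
      rw [setIntegral_eq_integral_of_forall_compl_eq_zero (s := W), ← integral_indicator hΩm]
      · congr 1; ext1 x; by_cases hx : x ∈ Ω <;> simp [hx]
      · intro x hx
        rw [image_eq_zero_of_notMem_tsupport (fun h => hx (hφs h)), inner_zero_right]
    rw [e1, e2, key]
  · have hc := hU.continuousOn_segLimit (hℓ.field K hK) (hℓ.lim K hK)
    refine hc.comp (f := fun x => (x, x + d)) (by fun_prop) fun x hx => ?_
    rw [hcl]
    exact hmemK0 x hx.1 ((hh0 x).1 hx.2)
  · refine hℓmc.mono fun x hx => ⟨(hh1 x).1 hx.2, fun r hr => (hin x hx.1 r hr).1⟩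
  · intro κ hκ hκc hs
    exact integral_lineSmear_indicator hΩ hT hℓ hK hκ hκc
      (fun x hx => hmemK0 x (hs x hx).1 ((hh0 x).1 (hs x hx).2))
      (fun x hx r hr => hin x (hs x hx).1 r hr)
  · intro κ hκ hκc hs
    exact hℓm W κ hκ hκc fun x hx =>
      ⟨(hh1 x).1 (hs x hx).2, fun r hr => ⟨(hin x (hs x hx).1 r hr).1, hin x (hs x hx).1 r hr⟩⟩

theorem contract_face {K F : Finset E3} (hK : IsTetra K) (hF : F ⊆ K) (hne : F.Nonempty) {q : E3}
    (hq : q ∈ hull F) {s : ℝ} (hs : s ∈ Ico (0:ℝ) 1) :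
    barycenter F + s • (q - barycenter F) ∈ hull F ∧
      ∀ c ∈ F, 0 < bary K c (barycenter F + s • (q - barycenter F)) := by
  refine ⟨(convex_hull F).add_smul_sub_mem (barycenter_mem hne) hq ⟨hs.1, hs.2.le⟩, fun c hc => ?_⟩
  rw [bary_combo]
  have h1 := hK.bary_barycenter_pos hF hc
  have h2 := hK.mem_hull_iff.1 (hull_mono hF hq) c (hF hc)
  have h3 := mul_pos (sub_pos.2 hs.2) h1
  have h4 := mul_nonneg hs.1 h2
  linarith

theorem eq_of_contract {f g : ℝ → ℝ} (hf : ContinuousOn f (Icc 0 1)) (hg : ContinuousOn g (Icc 0 1))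
    (h : ∀ s ∈ Ioo (0:ℝ) 1, f s = g s) : f 1 = g 1 := by
  have h1 : (1:ℝ) ∈ Icc (0:ℝ) 1 := by simp
  have l1 : Tendsto f (𝓝[Ioo 0 1] 1) (𝓝 (f 1)) := (hf 1 h1).mono Ioo_subset_Icc_self
  have l2 : Tendsto g (𝓝[Ioo 0 1] 1) (𝓝 (g 1)) := (hg 1 h1).mono Ioo_subset_Icc_self
  have hne : (𝓝[Ioo (0:ℝ) 1] 1).NeBot := by
    rw [← mem_closure_iff_nhdsWithin_neBot, closure_Ioo (by norm_num)]; simp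
  refine tendsto_nhds_unique (l1.congr' ?_) l2
  filter_upwards [self_mem_nhdsWithin] with s hs using h s hs

theorem continuousOn_contract (hT : IsConformingMesh Ω T) (hℓ : IsSegFamily Ω T Ψ G ℓ)
    {K F : Finset E3} (hK : K ∈ T) (hF : F ⊆ K) (hne : F.Nonempty) {a b : E3} (ha : a ∈ F) (hb : b ∈ F) :
    ContinuousOn (fun s : ℝ => ℓ K (barycenter F + s • (a - barycenter F))
      (barycenter F + s • (b - barycenter F))) (Icc 0 1) := by
  have tK := hT.isTetra hK
  have hc := tK.convexElement.continuousOn_segLimit (hℓ.field K hK) (hℓ.lim K hK)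
  refine hc.comp (f := fun s : ℝ => (barycenter F + s • (a - barycenter F),
    barycenter F + s • (b - barycenter F))) (by fun_prop) fun s hs => ?_
  rw [tK.closure_interior]
  exact ⟨hull_mono hF ((convex_hull F).add_smul_sub_mem (barycenter_mem hne) (subset_convexHull ℝ _ ha) hs),
    hull_mono hF ((convex_hull F).add_smul_sub_mem (barycenter_mem hne) (subset_convexHull ℝ _ hb) hs)⟩

theorem segLimit_eq_of_shared_face (hΩ : IsLipschitzDomain Ω) (hT : IsConformingMesh Ω T)
    (hΨw : IsHcurl Ω Γ Ψ w) (hℓ : IsSegFamily Ω T Ψ G ℓ) {K K' F : Finset E3} (hK : K ∈ T)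
    (hK' : K' ∈ T) (hne : K ≠ K') (hF : F ⊆ K) (hF' : F ⊆ K') (hc : F.card = 3) {a b : E3}
    (ha : a ∈ F) (hb : b ∈ F) : ℓ K a b = ℓ K' a b := by
  have tK := hT.isTetra hK
  have tK' := hT.isTetra hK'
  have hFne : F.Nonempty := ⟨a, ha⟩
  obtain ⟨a₁, haK, haF, hall⟩ := exists_opposite (hT.card_eq K hK) hF hc
  obtain ⟨a₂, haK', haF', hall'⟩ := exists_opposite (hT.card_eq K' hK') hF' hc
  obtain ⟨κ, hκ, hopp⟩ := hT.opposite_bary hK hK' hne hF hF' hc haK hall haK' hall' haF haF'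
  set m := barycenter F
  have key := eq_of_contract (continuousOn_contract hT hℓ hK hF hFne ha hb)
    (continuousOn_contract hT hℓ hK' hF' hFne ha hb) ?_
  · simpa using key
  intro s hs
  have hs' : s ∈ Ico (0:ℝ) 1 := ⟨hs.1.le, hs.2⟩
  have ed : m + s • (b - m) = (m + s • (a - m)) + s • (b - a) := by module
  show ℓ K (m + s • (a - m)) (m + s • (b - m)) = ℓ K' (m + s • (a - m)) (m + s • (b - m))
  rw [ed]
  have hzero : ∀ q ∈ hull F, bary K a₁ q = 0 := fun q hq =>
    ((tK.mem_hull_subset_iff hF).1 hq).2 a₁ haK haF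
  have hrel : ∀ r ∈ Icc (0:ℝ) 1, m + s • (a - m) + r • s • (b - a) ∈ hull F ∧
      ∀ c ∈ F, 0 < bary K c (m + s • (a - m) + r • s • (b - a)) := by
    intro r hr
    have hq : a + r • (b - a) ∈ hull F :=
      (convex_hull F).add_smul_sub_mem (subset_convexHull ℝ _ ha) (subset_convexHull ℝ _ hb) hr
    have := contract_face tK hF hFne hq hs'
    have e : m + s • (a - m) + r • s • (b - a) = m + s • ((a + r • (b - a)) - m) := by module
    rw [e]; exact this
  have hdd : inner ℝ (gradBary K a₁) (s • (b - a)) = (0:ℝ) := by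
    rw [inner_smul_right, ← bary_sub, hzero b (subset_convexHull ℝ _ hb), hzero a (subset_convexHull ℝ _ ha)]
    simp
  set O : Set E3 := {y | (∀ c ∈ F, 0 < bary K c y ∧ 0 < bary K' c y)} ∩ Ω
  have hOo : IsOpen O := by
    refine IsOpen.inter ?_ hΩ.1
    simp only [setOf_forall]
    refine isOpen_biInter_finset fun c _ => ?_
    exact (isOpen_lt continuous_const (continuous_bary K c)).inter
      (isOpen_lt continuous_const (continuous_bary K' c))
  have hOK : ∀ y ∈ O, 0 ≤ bary K a₁ y → y ∈ hull K := fun y hy h0 => tK.mem_hull_iff.2 fun c hc => by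
    by_cases h : c = a₁
    · rw [h]; exact h0
    · exact (hy.1 c (hall c hc h)).1.le
  have hOK' : ∀ y ∈ O, bary K a₁ y ≤ 0 → y ∈ hull K' := fun y hy h0 => tK'.mem_hull_iff.2 fun c hc => by
    by_cases h : c = a₂
    · rw [h, hopp]; nlinarith
    · exact (hy.1 c (hall' c hc h)).2.le
  have hshift : ∀ x r, bary K a₁ (x + r • s • (b - a)) = bary K a₁ x := fun x r => by
    rw [bary_eq_add K a₁ _ x, add_sub_cancel_left, inner_smul_right, hdd]; ring
  have hmem' : ∀ x, bary K a₁ x ≤ 0 → (∀ r ∈ Icc (0:ℝ) 1, x + r • s • (b - a) ∈ O) →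
      x ∈ hull K' ∧ x + s • (b - a) ∈ hull K' := by
    intro x h0 hx
    have e0 := hOK' _ (hx 0 (by simp)) (by rw [hshift]; exact h0)
    have e1 := hOK' _ (hx 1 (by simp)) (by rw [hshift]; exact h0)
    simp only [zero_smul, add_zero, one_smul] at e0 e1
    exact ⟨e0, e1⟩
  refine segLimit_eq_of_trace (ℓm := fun x => ℓ K' x (x + s • (b - a))) hΩ hT hΨw hℓ hK haK ?_ hdd hOo
    ?_ ?_ hOK ?_ ?_
  · have := (hrel 0 (by simp)).1
    simp only [zero_smul, add_zero] at this
    exact hzero _ this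
  · refine disjoint_left.2 fun x hx hx' => ?_
    have h1 : closure (frontier Ω \ Γ) ⊆ frontier Ω := closure_minimal sdiff_subset isClosed_frontier
    exact (hΩ.mem_frontier_iff.1 (h1 hx')).2 hx.2
  · intro r hr
    obtain ⟨h1, h2⟩ := hrel r hr
    refine ⟨fun c hcF => ⟨h2 c hcF, ?_⟩, hT.shared_face_relint hΩ hK hK' hne hF hF' hc h1 h2⟩
    rw [← tK.bary_eq_of_common tK' hF hF' h1 hcF]; exact h2 c hcF
  · have hcc := tK'.convexElement.continuousOn_segLimit (hℓ.field K' hK') (hℓ.lim K' hK')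
    refine hcc.comp (f := fun x => (x, x + s • (b - a))) (by fun_prop) fun x hx => ?_
    rw [tK'.closure_interior]
    exact hmem' x hx.1 hx.2
  · intro W κ hκ hκc hsupp
    exact integral_lineSmear_indicator hΩ hT hℓ hK' hκ hκc
      (fun x hx => hmem' x (hsupp x hx).1 fun r hr => ((hsupp x hx).2 r hr).1)
      (fun x hx r hr => ((hsupp x hx).2 r hr).2)

theorem segLimit_eq_zero_of_boundary_face (hΩ : IsLipschitzDomain Ω) (hT : IsConformingMesh Ω T)
    (hΨw : IsHcurl Ω Γ Ψ w) (hℓ : IsSegFamily Ω T Ψ G ℓ) {K F : Finset E3} (hK : K ∈ T)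
    (hF : F ⊆ K) (hc : F.card = 3) (hfr : hull F ⊆ frontier Ω) (hFΓ : hull F ⊆ Γ) {a b : E3}
    (ha : a ∈ F) (hb : b ∈ F) : ℓ K a b = 0 := by
  have tK := hT.isTetra hK
  have hFne : F.Nonempty := ⟨a, ha⟩
  obtain ⟨a₁, haK, haF, hall⟩ := exists_opposite (hT.card_eq K hK) hF hc
  set m := barycenter F
  have key := eq_of_contract (continuousOn_contract hT hℓ hK hF hFne ha hb)
    (continuousOn_const (c := (0:ℝ))) ?_
  · simpa using key
  intro s hs
  have hs' : s ∈ Ico (0:ℝ) 1 := ⟨hs.1.le, hs.2⟩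
  have ed : m + s • (b - m) = (m + s • (a - m)) + s • (b - a) := by module
  show ℓ K (m + s • (a - m)) (m + s • (b - m)) = 0
  rw [ed]
  have hzero : ∀ q ∈ hull F, bary K a₁ q = 0 := fun q hq =>
    ((tK.mem_hull_subset_iff hF).1 hq).2 a₁ haK haF
  have hrel : ∀ r ∈ Icc (0:ℝ) 1, m + s • (a - m) + r • s • (b - a) ∈ hull F ∧
      ∀ c ∈ F, 0 < bary K c (m + s • (a - m) + r • s • (b - a)) := by
    intro r hr
    have hq : a + r • (b - a) ∈ hull F :=
      (convex_hull F).add_smul_sub_mem (subset_convexHull ℝ _ ha) (subset_convexHull ℝ _ hb) hr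
    have := contract_face tK hF hFne hq hs'
    have e : m + s • (a - m) + r • s • (b - a) = m + s • ((a + r • (b - a)) - m) := by module
    rw [e]; exact this
  have hdd : inner ℝ (gradBary K a₁) (s • (b - a)) = (0:ℝ) := by
    rw [inner_smul_right, ← bary_sub, hzero b (subset_convexHull ℝ _ hb), hzero a (subset_convexHull ℝ _ ha)]
    simp
  have hshift : ∀ x r, bary K a₁ (x + r • s • (b - a)) = bary K a₁ x := fun x r => by
    rw [bary_eq_add K a₁ _ x, add_sub_cancel_left, inner_smul_right, hdd]; ring
  set O : Set E3 := interior {y | (y ∈ Ω ↔ 0 < bary K a₁ y) ∧ (0 ≤ bary K a₁ y → y ∈ hull K)}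
  have hOsub : ∀ y ∈ O, (y ∈ Ω ↔ 0 < bary K a₁ y) ∧ (0 ≤ bary K a₁ y → y ∈ hull K) := by
    intro y hy
    have h := interior_subset hy
    exact h
  refine segLimit_eq_of_trace (O := O) (ℓm := fun _ => 0) hΩ hT hΨw hℓ hK haK ?_ hdd isOpen_interior
    ?_ ?_ (fun y hy => (hOsub y hy).2) continuousOn_const ?_
  · have := (hrel 0 (by simp)).1
    simp only [zero_smul, add_zero] at this
    exact hzero _ this
  · refine Disjoint.closure_right (disjoint_left.2 fun y hy hyf => hyf.2 (hFΓ ?_)) isOpen_interior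
    obtain ⟨h1, h2⟩ := hOsub y hy
    obtain ⟨hyc, hyn⟩ := hΩ.mem_frontier_iff.1 hyf.1
    have h3 : bary K a₁ y ≤ 0 := not_lt.1 fun h => hyn (h1.2 h)
    have h4 : 0 ≤ bary K a₁ y := by
      by_contra! hlt
      have hop : IsOpen (O ∩ {y | bary K a₁ y < 0}) :=
        isOpen_interior.inter (isOpen_lt (continuous_bary K a₁) continuous_const)
      obtain ⟨z, ⟨hz, hz0⟩, hzΩ⟩ := mem_closure_iff.1 hyc _ hop ⟨hy, hlt⟩
      exact absurd ((hOsub z hz).1.1 hzΩ) (not_lt.2 (le_of_lt hz0))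
    refine (tK.mem_hull_subset_iff hF).2 ⟨h2 h4, fun c hcK hcF => ?_⟩
    have : c = a₁ := by by_contra hne; exact hcF (hall c hcK hne)
    rw [this]; exact le_antisymm h3 h4
  · intro r hr
    obtain ⟨h1, h2⟩ := hrel r hr
    obtain ⟨r', hr', hb⟩ := hT.frontier_face_local hΩ hK hF hc hfr haK hall h1 h2
    exact mem_interior.2 ⟨_, hb, Metric.isOpen_ball, Metric.mem_ball_self hr'⟩
  · intro W κ hκ hκc hsupp
    simp only [mul_zero, integral_zero]
    refine integral_eq_zero_of_ae (Eventually.of_forall fun x => ?_)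
    show lineSmear κ (s • (b - a)) x * inner ℝ (Ω.indicator Ψ x) (s • (b - a)) = 0
    by_cases hl : lineSmear κ (s • (b - a)) x = 0
    · rw [hl, zero_mul]
    · obtain ⟨y, hy, r, hr, rfl⟩ := lineSmear_support hl
      obtain ⟨h1, h2⟩ := hsupp y hy
      have h3 := (hOsub _ (h2 r hr).1).1
      rw [hshift] at h3
      rw [indicator_of_notMem (fun h => absurd (h3.1 h) (not_lt.2 h1)), inner_zero_left, mul_zero]

theorem mem_edges {E : Finset E3} : E ∈ allEdges T ↔ ∃ K ∈ T, E ∈ K.powersetCard 2 := by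
  unfold allEdges; exact Finset.mem_biUnion

theorem segLimit_eq_of_edge (hΩ : IsLipschitzDomain Ω) (hT : IsConformingMesh Ω T)
    (hΨw : IsHcurl Ω Γ Ψ w) (hℓ : IsSegFamily Ω T Ψ G ℓ) {K K' E : Finset E3} (hK : K ∈ T)
    (hK' : K' ∈ T) (hE : E ⊆ K) (hE' : E ⊆ K') (hc : E.card = 2) :
    ℓ K (tail E) (head E) = ℓ K' (tail E) (head E) := by
  obtain ⟨ht, hh, -, -⟩ := tail_head hc
  have hne : E.Nonempty := ⟨_, ht⟩
  have hx := barycenter_mem hne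
  have := hT.star_connected hΩ hK hK' (hull_mono hE hx) (hull_mono hE' hx)
  have key : ∀ L, Relation.ReflTransGen (FaceAdj Ω T (barycenter E)) K L →
      E ⊆ L ∧ ℓ K (tail E) (head E) = ℓ L (tail E) (head E) := by
    intro L hL
    induction hL with
    | refl => exact ⟨hE, rfl⟩
    | tail _ h ih =>
      obtain ⟨m1, m2, hne12, F, hF1, hF2, hFc, hxF, -⟩ := h
      have hEF : E ⊆ F := fun c hcE => by
        by_contra hcF
        exact ((hT.isTetra m1).bary_barycenter_pos ih.1 hcE).ne'
          ((((hT.isTetra m1).mem_hull_subset_iff hF1).1 hxF).2 c (ih.1 hcE) hcF)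
      exact ⟨hEF.trans hF2, ih.2.trans
        (segLimit_eq_of_shared_face hΩ hT hΨw hℓ m1 m2 hne12 hF1 hF2 hFc (hEF ht) (hEF hh))⟩
  exact (key K' this).2

theorem hasEdgeIntegral_segLimit (hΩ : IsLipschitzDomain Ω) (hT : IsConformingMesh Ω T)
    (hΨw : IsHcurl Ω Γ Ψ w) (hℓ : IsSegFamily Ω T Ψ G ℓ) {K E : Finset E3} (hK : K ∈ T)
    (hE : E ∈ K.powersetCard 2) : HasEdgeIntegral T E Ψ (ℓ K (tail E) (head E)) := by
  intro K' hK' hE'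
  rw [Finset.mem_powersetCard] at hE
  rw [segLimit_eq_of_edge hΩ hT hΨw hℓ hK hK' hE.1 hE' hE.2]
  exact (hT.isTetra hK').hasEdgeIntegralOn (hℓ.field K' hK') (hℓ.lim K' hK')
    (Finset.mem_powersetCard.2 ⟨hE', hE.2⟩)

theorem edgeIntegral_eq {K E : Finset E3} (hK : K ∈ T) (hE : E ⊆ K) {c : ℝ}
    (h : HasEdgeIntegral T E Ψ c) : edgeIntegral T E Ψ = c := by
  have hex : ∃ c, HasEdgeIntegral T E Ψ c := ⟨c, h⟩
  unfold edgeIntegral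
  rw [dif_pos hex]
  exact (hex.choose_spec K hK hE).unique (h K hK hE)

theorem segLimit_eq_zero_of_subset (hΩ : IsLipschitzDomain Ω) (hT : IsConformingMesh Ω T)
    (hΓ : Resolves Ω Γ T) (hΨw : IsHcurl Ω Γ Ψ w) (hℓ : IsSegFamily Ω T Ψ G ℓ) {K E : Finset E3}
    (hK : K ∈ T) (hE : E ∈ K.powersetCard 2) (hEΓ : hull E ⊆ Γ) : ℓ K (tail E) (head E) = 0 := by
  rw [Finset.mem_powersetCard] at hE
  obtain ⟨ht, hh, -, -⟩ := tail_head hE.2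
  have hne : E.Nonempty := ⟨_, ht⟩
  have hx := barycenter_mem hne
  obtain ⟨hΓf, 𝓕, h𝓕, hΓe⟩ := hΓ
  have hxΓ := hEΓ hx
  rw [hΓe] at hxΓ
  obtain ⟨F, hF, hxF⟩ := mem_iUnion₂.1 hxΓ
  obtain ⟨hFc, K', hK', hFK'⟩ := h𝓕 F hF
  have hFΓ : hull F ⊆ Γ := by rw [hΓe]; exact subset_biUnion_of_mem (u := fun F => hull F) hF
  have tK := hT.isTetra hK
  have hsupp := hT.support_subset hΩ hK hK' (hull_mono hE.1 hx) (hull_mono hFK' hxF)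
  have hEF : E ⊆ F := fun c hc => by
    obtain ⟨h1, h2⟩ := (hsupp c).1 ⟨hE.1 hc, tK.bary_barycenter_pos hE.1 hc⟩
    by_contra hcF
    exact h2.ne' ((((hT.isTetra hK').mem_hull_subset_iff hFK').1 hxF).2 c h1 hcF)
  rw [segLimit_eq_of_edge hΩ hT hΨw hℓ hK hK' hE.1 (hEF.trans hFK') hE.2]
  exact segLimit_eq_zero_of_boundary_face hΩ hT hΨw hℓ hK' hFK' hFc (hFΓ.trans hΓf) hFΓ (hEF ht) (hEF hh)

/-- A smooth step from `0` on `(-∞, 1/2]` to `1` on `[1, ∞)`. -/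
noncomputable def softStep (t : ℝ) : ℝ := Real.smoothTransition (2 * t - 1)

theorem contDiff_softStep : ContDiff ℝ ∞ softStep := by unfold softStep; fun_prop

theorem softStep_nonneg (t : ℝ) : 0 ≤ softStep t := Real.smoothTransition.nonneg _

theorem softStep_le_one (t : ℝ) : softStep t ≤ 1 := Real.smoothTransition.le_one _

theorem softStep_eq_zero {t : ℝ} (h : t ≤ 1 / 2) : softStep t = 0 :=
  Real.smoothTransition.zero_of_nonpos (by linarith)

theorem softStep_eq_one {t : ℝ} (h : 1 ≤ t) : softStep t = 1 :=
  Real.smoothTransition.one_of_one_le (by linarith)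

theorem softStep_pos_of_ne {t : ℝ} (h : softStep t ≠ 0) : 0 < t := by
  by_contra! h0; exact h (softStep_eq_zero (by linarith))

theorem deriv_softStep_ne {t : ℝ} (h : deriv softStep t ≠ 0) : 1 / 2 ≤ t ∧ t ≤ 1 := by
  constructor
  · by_contra! hlt
    have : softStep =ᶠ[𝓝 t] fun _ => 0 := by
      filter_upwards [gt_mem_nhds hlt] with u hu using softStep_eq_zero hu.le
    exact h (by rw [this.deriv_eq]; simp)
  · by_contra! hlt
    have : softStep =ᶠ[𝓝 t] fun _ => 1 := by
      filter_upwards [lt_mem_nhds hlt] with u hu using softStep_eq_one hu.le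
    exact h (by rw [this.deriv_eq]; simp)

theorem continuous_deriv_softStep : Continuous (deriv softStep) :=
  contDiff_softStep.continuous_deriv (by simp)

theorem exists_bound_deriv_softStep : ∃ M : ℝ, 0 ≤ M ∧ ∀ t, |deriv softStep t| ≤ M := by
  have hc : HasCompactSupport (deriv softStep) :=
    HasCompactSupport.intro (isCompact_Icc (a := (1 / 2 : ℝ)) (b := 1)) fun t ht => by
      by_contra h; exact ht (deriv_softStep_ne h)
  obtain ⟨M, hM⟩ := hc.exists_bound_of_continuous continuous_deriv_softStep
  exact ⟨M, (norm_nonneg _).trans (hM 0), hM⟩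

/-- The contribution of the face `F` opposite to `a` to the integration by parts over `K` with a
smooth cutoff of width `ε`. -/
noncomputable def faceTerm (K F : Finset E3) (a : E3) (g : E3 → ℝ) (ε : ℝ) : ℝ :=
  ∫ x, (ε⁻¹ * deriv softStep (bary K a x / ε)) * (∏ b ∈ F, softStep (bary K b x / ε)) * g x

/-- A smooth cutoff function for the element `K`. -/
noncomputable def cutoff (K : Finset E3) (ε : ℝ) (x : E3) : ℝ := ∏ b ∈ K, softStep (bary K b x / ε)

theorem prod_softStep_mem (F K : Finset E3) (ε : ℝ) (x : E3) :
    0 ≤ ∏ b ∈ F, softStep (bary K b x / ε) ∧ ∏ b ∈ F, softStep (bary K b x / ε) ≤ 1 :=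
  ⟨Finset.prod_nonneg fun _ _ => softStep_nonneg _,
    Finset.prod_le_one (fun _ _ => softStep_nonneg _) fun _ _ => softStep_le_one _⟩

theorem prod_softStep_pos {F K : Finset E3} {ε : ℝ} (hε : 0 < ε) {x : E3}
    (h : ∏ b ∈ F, softStep (bary K b x / ε) ≠ 0) : ∀ b ∈ F, 0 < bary K b x := fun b hb => by
  have := softStep_pos_of_ne (Finset.prod_ne_zero_iff.1 h b hb)
  rwa [div_pos_iff_of_pos_right hε] at this

theorem continuous_prod_softStep (F K : Finset E3) (ε : ℝ) :
    Continuous fun x => ∏ b ∈ F, softStep (bary K b x / ε) :=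
  continuous_finsetProd _ fun b _ =>
    contDiff_softStep.continuous.comp ((continuous_bary K b).div_const ε)

theorem contDiff_cutoff (K : Finset E3) (ε : ℝ) : ContDiff ℝ ∞ (cutoff K ε) := by
  unfold cutoff
  exact contDiff_prod fun b _ => contDiff_softStep.comp ((contDiff_bary K b).div_const ε)

theorem hasFDerivAt_cutoff [DecidableEq E3] (K : Finset E3) (ε : ℝ) (x : E3) :
    HasFDerivAt (cutoff K ε) (∑ a ∈ K, (∏ b ∈ K.erase a, softStep (bary K b x / ε)) •
      ((deriv softStep (bary K a x / ε)) • (ε⁻¹ • innerSL ℝ (gradBary K a)))) x := by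
  have h : ∀ a ∈ K, HasFDerivAt (fun x => softStep (bary K a x / ε))
      ((deriv softStep (bary K a x / ε)) • (ε⁻¹ • innerSL ℝ (gradBary K a))) x := fun a _ => by
    have e := (hasFDerivAt_bary K a x).const_mul ε⁻¹
    have hd : HasDerivAt softStep (deriv softStep (ε⁻¹ * bary K a x)) (ε⁻¹ * bary K a x) :=
      (contDiff_softStep.differentiable (by simp) _).hasDerivAt
    have e' := hd.comp_hasFDerivAt x e
    simp only [div_eq_inv_mul]
    exact e'
  exact HasFDerivAt.finsetProd h

variable {K F : Finset E3} {a : E3} {ε : ℝ}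

theorem IsTetra.mem_hull_of_faceTerm (hK : IsTetra K) (ha : ∀ b ∈ K, b ≠ a → b ∈ F) (hε : 0 < ε) {x : E3}
    (h1 : deriv softStep (bary K a x / ε) ≠ 0) (h2 : ∏ b ∈ F, softStep (bary K b x / ε) ≠ 0) :
    x ∈ interior (hull K) := by
  refine hK.mem_interior_iff.2 fun b hb => ?_
  by_cases hba : b = a
  · rw [hba]
    have := (deriv_softStep_ne h1).1
    rw [le_div_iff₀ hε] at this
    linarith
  · exact prod_softStep_pos hε h2 b (ha b hb hba)

theorem IsTetra.integrable_faceTerm (hK : IsTetra K) (ha : ∀ b ∈ K, b ≠ a → b ∈ F) (hε : 0 < ε)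
    {g : E3 → ℝ} (hg : Continuous g) :
    Integrable fun x => (ε⁻¹ * deriv softStep (bary K a x / ε))
      * (∏ b ∈ F, softStep (bary K b x / ε)) * g x := by
  have h1 := continuous_prod_softStep F K ε
  have h2 : Continuous fun x => deriv softStep (bary K a x / ε) :=
    continuous_deriv_softStep.comp ((continuous_bary K a).div_const ε)
  refine Continuous.integrable_of_hasCompactSupport (by fun_prop)
    (HasCompactSupport.intro (isCompact_hull K) fun x hx => ?_)
  by_contra hne
  have h3 := left_ne_zero_of_mul hne
  exact hx (interior_subset (hK.mem_hull_of_faceTerm ha hε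
    (right_ne_zero_of_mul (left_ne_zero_of_mul h3)) (right_ne_zero_of_mul h3)))

theorem IsTetra.hasCompactSupport_cutoff (hK : IsTetra K) (hε : 0 < ε) :
    HasCompactSupport (cutoff K ε) :=
  HasCompactSupport.intro (isCompact_hull K) fun x hx => by
    by_contra hne
    exact hx (interior_subset (hK.mem_interior_iff.2 (prod_softStep_pos hε hne)))

/-- The classical divergence. -/
noncomputable def divergence (V : E3 → E3) (x : E3) : ℝ := pd V 0 0 x + pd V 1 1 x + pd V 2 2 x

theorem continuous_divergence {V : E3 → E3} (hV : ContDiff ℝ ∞ V) : Continuous (divergence V) :=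
  ((continuous_pd hV 0 0).add (continuous_pd hV 1 1)).add (continuous_pd hV 2 2)

theorem IsTetra.integral_cutoff_mul_divergence [DecidableEq E3] (hK : IsTetra K) (hε : 0 < ε)
    {V : E3 → E3} (hV : ContDiff ℝ ∞ V) :
    ∫ x, cutoff K ε x * divergence V x
      = - ∑ a ∈ K, faceTerm K (K.erase a) a (fun x => inner ℝ (gradBary K a) (V x)) ε := by
  have hχ := contDiff_cutoff K ε
  have hc := hK.hasCompactSupport_cutoff hε
  have hVc := hV.continuous
  have hI1 : ∀ i, Integrable fun x => fderiv ℝ (cutoff K ε) x (unitVec i) * V x i := fun i => by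
    have := continuous_pderiv hχ (unitVec i)
    exact Continuous.integrable_of_hasCompactSupport (by fun_prop) (hasCompactSupport_pderiv hc _).mul_right
  have hI2 : ∀ i, Integrable fun x => cutoff K ε x * pd V i i x := fun i => by
    have := continuous_pd hV i i
    exact (hχ.continuous.mul this).integrable_of_hasCompactSupport hc.mul_right
  have key : ∀ i, ∫ x, fderiv ℝ (cutoff K ε) x (unitVec i) * V x i = - ∫ x, cutoff K ε x * pd V i i x := by
    intro i
    have h1 := continuous_pderiv hχ (unitVec i)
    have h2 : Continuous fun x => fderiv ℝ V x (unitVec i) := by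
      have := hV.continuous_fderiv (by simp); fun_prop
    have e := congrArg (EuclideanSpace.proj i : E3 →L[ℝ] ℝ)
      (integral_pderiv_smul (hV.of_le (by simp)) (hχ.of_le (by simp)) hc (unitVec i))
    rw [map_neg, ← ContinuousLinearMap.integral_comp_comm, ← ContinuousLinearMap.integral_comp_comm] at e
    · simpa [pd] using e
    · exact (hχ.continuous.smul h2).integrable_of_hasCompactSupport hc.smul_right
    · exact (h1.smul hVc).integrable_of_hasCompactSupport (hasCompactSupport_pderiv hc _).smul_right
  have e1 : ∀ x, cutoff K ε x * divergence V x
      = cutoff K ε x * pd V 0 0 x + cutoff K ε x * pd V 1 1 x + cutoff K ε x * pd V 2 2 x := fun x => by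
    unfold divergence; ring
  simp_rw [e1]
  rw [integral_add (f := fun x => cutoff K ε x * pd V 0 0 x + cutoff K ε x * pd V 1 1 x)
    ((hI2 0).add (hI2 1)) (hI2 2), integral_add (hI2 0) (hI2 1), ← neg_inj, neg_add, neg_add,
    ← key, ← key, ← key, ← integral_add (hI1 0) (hI1 1),
    ← integral_add (f := fun x => fderiv ℝ (cutoff K ε) x (unitVec 0) * V x 0
      + fderiv ℝ (cutoff K ε) x (unitVec 1) * V x 1) ((hI1 0).add (hI1 1)) (hI1 2), neg_neg]
  unfold faceTerm
  rw [← integral_finsetSum]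
  · refine integral_congr_ae (Eventually.of_forall fun x => ?_)
    simp only
    have e2 : fderiv ℝ (cutoff K ε) x (V x) = fderiv ℝ (cutoff K ε) x (unitVec 0) * V x 0
      + fderiv ℝ (cutoff K ε) x (unitVec 1) * V x 1 + fderiv ℝ (cutoff K ε) x (unitVec 2) * V x 2 := by
      conv_lhs => rw [eq_sum_unitVec (V x)]
      simp only [map_add, map_smul, smul_eq_mul]; ring
    rw [← e2, (hasFDerivAt_cutoff K ε x).fderiv, ContinuousLinearMap.sum_apply]
    refine Finset.sum_congr rfl fun a _ => ?_
    simp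
    ring
  · intro a haK
    exact hK.integrable_faceTerm (fun b hb hba => Finset.mem_erase.2 ⟨hba, hb⟩) hε (by fun_prop)

theorem IsTetra.tendsto_integral_cutoff (hK : IsTetra K) {D : E3 → ℝ} (hD : Continuous D) :
    Tendsto (fun ε : ℝ => ∫ x, cutoff K ε x * D x) (𝓝[>] 0) (𝓝 (∫ x in interior (hull K), D x)) := by
  rw [← integral_indicator isOpen_interior.measurableSet]
  have hint : Integrable ((hull K).indicator fun x => ‖D x‖) :=
    (hD.norm.continuousOn.integrableOn_compact (isCompact_hull K)).integrable_indicator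
      (isClosed_hull K).measurableSet
  refine tendsto_integral_filter_of_dominated_convergence _ ?_ ?_ hint ?_
  · filter_upwards with ε
    exact ((contDiff_cutoff K ε).continuous.mul hD).aestronglyMeasurable
  · filter_upwards [self_mem_nhdsWithin] with ε hε
    filter_upwards with x
    obtain ⟨h0, h1⟩ := prod_softStep_mem K K ε x
    by_cases hne : cutoff K ε x = 0
    · rw [hne, zero_mul, norm_zero]; exact indicator_nonneg (fun _ _ => norm_nonneg _) x
    · have hx := interior_subset (hK.mem_interior_iff.2 (prod_softStep_pos hε hne))
      rw [indicator_of_mem hx, norm_mul, Real.norm_eq_abs, cutoff, abs_of_nonneg h0]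
      exact mul_le_of_le_one_left (norm_nonneg _) h1
  · filter_upwards with x
    by_cases hx : x ∈ interior (hull K)
    · rw [indicator_of_mem hx]
      have hpos := hK.mem_interior_iff.1 hx
      have : ∀ᶠ ε in 𝓝[>] (0:ℝ), ∀ b ∈ K, softStep (bary K b x / ε) = 1 := by
        refine (Filter.eventually_all_finset K).2 fun b hb => ?_
        filter_upwards [Ioo_mem_nhdsGT (hpos b hb)] with ε hε
        refine softStep_eq_one ?_
        rw [le_div_iff₀ hε.1, one_mul]; exact hε.2.le
      refine tendsto_const_nhds.congr' ?_
      filter_upwards [this] with ε hε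
      rw [cutoff, Finset.prod_eq_one hε, one_mul]
    · rw [indicator_of_notMem hx]
      refine tendsto_const_nhds.congr' ?_
      filter_upwards [self_mem_nhdsWithin] with ε hε
      have : cutoff K ε x = 0 := by
        by_contra hne
        exact hx (hK.mem_interior_iff.2 (prod_softStep_pos hε hne))
      rw [this, zero_mul]

theorem IsTetra.tendsto_faceTerm (hK : IsTetra K) (haK : a ∈ K) (ha : ∀ b ∈ K, b ≠ a → b ∈ F)
    {g : E3 → ℝ} (hg : Continuous g) {C : ℝ} (hgC : ∀ x ∈ hull K, |g x| ≤ C * bary K a x) :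
    Tendsto (fun ε : ℝ => faceTerm K F a g ε) (𝓝[>] 0) (𝓝 0) := by
  obtain ⟨M, hM0, hM⟩ := exists_bound_deriv_softStep
  have hint : Integrable ((hull K).indicator fun _ => M * |C|) :=
    (continuous_const.continuousOn.integrableOn_compact (isCompact_hull K)).integrable_indicator
      (isClosed_hull K).measurableSet
  rw [show 𝓝 (0:ℝ) = 𝓝 (∫ _x : E3, (0:ℝ)) by simp]
  refine tendsto_integral_filter_of_dominated_convergence _ ?_ ?_ hint ?_
  · filter_upwards with ε
    have h1 := continuous_prod_softStep F K ε
    have h2 : Continuous fun x => deriv softStep (bary K a x / ε) :=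
      continuous_deriv_softStep.comp ((continuous_bary K a).div_const ε)
    exact Continuous.aestronglyMeasurable (by fun_prop)
  · filter_upwards [self_mem_nhdsWithin] with ε hε
    have hε : 0 < ε := hε
    filter_upwards with x
    obtain ⟨h0, h1⟩ := prod_softStep_mem F K ε x
    by_cases hne : deriv softStep (bary K a x / ε) * ∏ b ∈ F, softStep (bary K b x / ε) = 0
    · rw [mul_assoc ε⁻¹, hne, mul_zero, zero_mul, norm_zero]
      exact indicator_nonneg (fun _ _ => by positivity) x
    · have hx := interior_subset (hK.mem_hull_of_faceTerm ha hε (left_ne_zero_of_mul hne)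
        (right_ne_zero_of_mul hne))
      rw [indicator_of_mem hx]
      have h2 := (deriv_softStep_ne (left_ne_zero_of_mul hne)).2
      rw [div_le_one hε] at h2
      have h3 := hgC x hx
      have h4 := hK.mem_hull_iff.1 hx a haK
      have h5 : |g x| ≤ |C| * ε := h3.trans
        ((mul_le_mul_of_nonneg_right (le_abs_self C) h4).trans (by gcongr))
      rw [Real.norm_eq_abs, abs_mul, abs_mul, abs_mul, abs_of_nonneg h0, abs_of_pos (inv_pos.2 hε)]
      calc ε⁻¹ * |deriv softStep (bary K a x / ε)| * (∏ b ∈ F, softStep (bary K b x / ε)) * |g x|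
          ≤ ε⁻¹ * M * 1 * (|C| * ε) := by gcongr; exact hM _
        _ = M * |C| := by field_simp
  · filter_upwards with x
    refine tendsto_const_nhds.congr' ?_
    rcases le_or_gt (bary K a x) 0 with h0 | h0
    · filter_upwards [self_mem_nhdsWithin] with ε hε
      have : deriv softStep (bary K a x / ε) = 0 := by
        by_contra hne
        have h1 := (deriv_softStep_ne hne).1
        have := div_nonpos_of_nonpos_of_nonneg h0 (le_of_lt hε)
        linarith
      rw [this]; simp
    · filter_upwards [Ioo_mem_nhdsGT h0] with ε hε
      have : deriv softStep (bary K a x / ε) = 0 := by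
        by_contra hne
        have h1 := (deriv_softStep_ne hne).2
        rw [div_le_one hε.1] at h1
        exact absurd hε.2 (not_lt.2 h1)
      rw [this]; simp

theorem IsTetra.abs_le_of_lipschitz (hK : IsTetra K) (hF : F ⊆ K) (hFne : F.Nonempty) (haK : a ∈ K)
    (haF : a ∉ F) (ha : ∀ b ∈ K, b ≠ a → b ∈ F) {g : E3 → ℝ} {L : ℝ≥0} (hg : LipschitzWith L g)
    (h0 : ∀ x ∈ hull F, g x = 0) : ∃ C, ∀ x ∈ hull K, |g x| ≤ C * bary K a x := by
  obtain ⟨b, hb⟩ := hFne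
  have hba : b ≠ a := fun h => haF (h ▸ hb)
  refine ⟨L * ‖b - a‖, fun x hx => ?_⟩
  have hx0 := hK.mem_hull_iff.1 hx
  have hc : ∀ c, bary K c (x + bary K a x • (b - a)) = bary K c x + bary K a x * (bary K c b - bary K c a) :=
    fun c => by rw [bary_eq_add K c _ x, add_sub_cancel_left, inner_smul_right, bary_sub]
  have hmem : x + bary K a x • (b - a) ∈ hull F := by
    refine (hK.mem_hull_subset_iff hF).2 ⟨hK.mem_hull_iff.2 fun c hcK => ?_, fun c hcK hcF => ?_⟩
    · rw [hc]
      by_cases hca : c = a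
      · rw [hca, hK.bary_self haK, hK.bary_of_ne haK (hF hb) hba]; linarith
      · rw [hK.bary_of_ne hcK haK (Ne.symm hca)]
        have h1 := hx0 c hcK
        have h2 := hx0 a haK
        have h3 := hK.mem_hull_iff.1 (subset_convexHull ℝ (K : Set E3) (hF hb)) c hcK
        have := mul_nonneg h2 h3
        linarith
    · have : c = a := by by_contra hne; exact hcF (ha c hcK hne)
      rw [hc, this, hK.bary_self haK, hK.bary_of_ne haK (hF hb) hba]; ring
  have h1 := hg.dist_le_mul x (x + bary K a x • (b - a))
  rw [Real.dist_eq, h0 _ hmem, sub_zero, dist_eq_norm, sub_add_cancel_left, norm_neg, norm_smul,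
    Real.norm_eq_abs, abs_of_nonneg (hx0 a haK)] at h1
  linarith

/-- The affine map that fixes the face of `K` opposite to `a` and moves `a` to `a'`. -/
noncomputable def flipMap (K : Finset E3) (a a' x : E3) : E3 := x + bary K a x • (a' - a)

theorem flipMap_eq (K : Finset E3) (a a' x : E3) : flipMap K a a' x
    = LinearMap.transvection (innerSL ℝ (gradBary K a) : E3 →L[ℝ] ℝ).toLinearMap (a' - a) x
      + bary K a 0 • (a' - a) := by
  have h := bary_eq_add K a x 0
  rw [sub_zero] at h
  simp only [flipMap, LinearMap.transvection.apply, h, add_smul]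
  simp only [ContinuousLinearMap.coe_coe, innerSL_apply_apply]
  abel

section

variable {K K' F : Finset E3} {a a' : E3} {κ : ℝ}

theorem IsTetra.bary_flipMap (hK : IsTetra K) (hK' : IsTetra K') (hF : F ⊆ K) (hF' : F ⊆ K')
    (haK : a ∈ K) (haF : a ∉ F) (ha : ∀ b ∈ K, b ≠ a → b ∈ F) (haK' : a' ∈ K') (haF' : a' ∉ F) (x : E3) {b : E3}
    (hb : b ∈ F) : bary K' b (flipMap K a a' x) = bary K b x := by
  classical
  have h1 : bary K' b x = bary K b x + bary K a x * bary K' b a := by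
    rw [hK.affine_eq_sum (bary K' b) x, ← Finset.add_sum_erase K _ haK,
      Finset.sum_eq_single b]
    · rw [hK'.bary_self (hF' hb)]; ring
    · intro c hc hcb
      obtain ⟨hca, hcK⟩ := Finset.mem_erase.1 hc
      rw [hK'.bary_of_ne (hF' hb) (hF' (ha c hcK hca)) hcb, mul_zero]
    · intro h
      exact absurd (Finset.mem_erase.2 ⟨fun e : b = a => haF (e ▸ hb), hF hb⟩) h
  rw [flipMap, bary_eq_add K' b _ x, add_sub_cancel_left, inner_smul_right, ← bary_sub,
    hK'.bary_of_ne (hF' hb) haK' (fun e => haF' (e ▸ hb)), h1]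
  ring

theorem IsTetra.bary_flipMap_opposite (hK' : IsTetra K')
    (haK' : a' ∈ K') (hK : IsTetra K) (haK : a ∈ K) (hκ : ∀ x, bary K' a' x = -κ * bary K a x) (x : E3) :
    bary K' a' (flipMap K a a' x) = bary K a x := by
  rw [flipMap, bary_eq_add K' a' _ x, add_sub_cancel_left, inner_smul_right, ← bary_sub,
    hK'.bary_self haK', hκ a, hκ x, hK.bary_self haK]
  ring

theorem gradBary_of_opposite (hκ : ∀ x, bary K' a' x = -κ * bary K a x) :
    gradBary K' a' = -κ • gradBary K a := by
  refine ext_inner_right ℝ fun v => ?_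
  have h1 := bary_sub K' a' v 0
  have h2 := bary_sub K a v 0
  rw [sub_zero] at h1 h2
  rw [inner_smul_left, ← h1, ← h2, hκ, hκ]
  simp; ring

theorem IsTetra.integral_flipMap (hK : IsTetra K) (hK' : IsTetra K') (haK : a ∈ K) (haK' : a' ∈ K')
    (hκ0 : 0 < κ) (hκ : ∀ x, bary K' a' x = -κ * bary K a x) (H : E3 → ℝ) :
    ∫ x, H (flipMap K a a' x) = κ * ∫ x, H x := by
  set f := LinearMap.transvection (innerSL ℝ (gradBary K a) : E3 →L[ℝ] ℝ).toLinearMap (a' - a)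
  have hdet : LinearMap.det f = -κ⁻¹ := by
    rw [LinearMap.transvection.det]
    have h1 : -κ * bary K a a' = 1 := by rw [← hκ, hK'.bary_self haK']
    have h2 := bary_sub K a a' a
    rw [hK.bary_self haK] at h2
    simp only [ContinuousLinearMap.coe_coe, innerSL_apply_apply, ← h2]
    field_simp
    linarith
  have hd0 : LinearMap.det f ≠ 0 := by rw [hdet]; exact neg_ne_zero.2 (inv_ne_zero hκ0.ne')
  have hemb := (((LinearMap.equivOfDetNeZero f hd0).toContinuousLinearEquiv.toHomeomorph).trans
    (Homeomorph.addRight (bary K a 0 • (a' - a)))).measurableEmbedding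
  have hfun : ⇑(((LinearMap.equivOfDetNeZero f hd0).toContinuousLinearEquiv.toHomeomorph).trans
    (Homeomorph.addRight (bary K a 0 • (a' - a)))) = fun x => f x + bary K a 0 • (a' - a) := rfl
  rw [hfun] at hemb
  have hmap := map_linear_volume f hd0 (bary K a 0 • (a' - a))
  have e : ∀ x, H (flipMap K a a' x) = H (f x + bary K a 0 • (a' - a)) := fun x => by
    rw [flipMap_eq]
  simp_rw [e]
  rw [← hemb.integral_map, hmap, integral_smul_measure, hdet,
      ENNReal.toReal_ofReal (abs_nonneg _), inv_neg, inv_inv, abs_neg, abs_of_pos hκ0, smul_eq_mul]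

theorem IsTetra.faceTerm_flip (hK : IsTetra K) (hK' : IsTetra K') (hF : F ⊆ K) (hF' : F ⊆ K')
    (haK : a ∈ K) (haF : a ∉ F) (ha : ∀ b ∈ K, b ≠ a → b ∈ F) (haK' : a' ∈ K') (haF' : a' ∉ F)
    (hκ0 : 0 < κ) (hκ : ∀ x, bary K' a' x = -κ * bary K a x) (V : E3 → E3) (ε : ℝ) :
    faceTerm K' F a' (fun x => inner ℝ (gradBary K' a') (V x)) ε
      = - faceTerm K F a (fun x => inner ℝ (gradBary K a) (V (flipMap K a a' x))) ε := by
  have h := hK.integral_flipMap hK' haK haK' hκ0 hκ fun x => (ε⁻¹ * deriv softStep (bary K' a' x / ε))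
    * (∏ b ∈ F, softStep (bary K' b x / ε)) * inner ℝ (gradBary K' a') (V x)
  have h2 : faceTerm K' F a' (fun x => inner ℝ (gradBary K' a') (V x)) ε = κ⁻¹ *
    ∫ x, (fun x => (ε⁻¹ * deriv softStep (bary K' a' x / ε))
    * (∏ b ∈ F, softStep (bary K' b x / ε)) * inner ℝ (gradBary K' a') (V x)) (flipMap K a a' x) := by
    rw [h, ← mul_assoc, inv_mul_cancel₀ hκ0.ne', one_mul]; rfl
  rw [h2, faceTerm, ← integral_const_mul, ← integral_neg]
  refine integral_congr_ae (Eventually.of_forall fun x => ?_)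
  simp only
  rw [hK'.bary_flipMap_opposite haK' hK haK hκ, gradBary_of_opposite hκ, inner_smul_left,
    Finset.prod_congr rfl fun b hb => by
      rw [hK.bary_flipMap hK' hF hF' haK haF ha haK' haF' x hb]]
  simp only [map_neg, conj_trivial]
  field_simp

theorem lipschitzWith_flipMap (K : Finset E3) (a a' : E3) : ∃ L, LipschitzWith L (flipMap K a a') := by
  set f := (LinearMap.transvection (innerSL ℝ (gradBary K a) : E3 →L[ℝ] ℝ).toLinearMap
    (a' - a)).toContinuousLinearMap
  have h : flipMap K a a' = fun x => f x + bary K a 0 • (a' - a) := by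
    ext1 x; exact flipMap_eq K a a' x
  rw [h]
  exact ⟨_, f.lipschitz.add (LipschitzWith.const _)⟩

theorem IsTetra.tendsto_faceTerm_add (hK : IsTetra K) (hK' : IsTetra K') (hF : F ⊆ K) (hF' : F ⊆ K')
    (hFne : F.Nonempty)
    (haK : a ∈ K) (haF : a ∉ F) (ha : ∀ b ∈ K, b ≠ a → b ∈ F) (haK' : a' ∈ K') (haF' : a' ∉ F)
    (hκ0 : 0 < κ) (hκ : ∀ x, bary K' a' x = -κ * bary K a x) {V V' : E3 → E3}
    (hV : ContDiff ℝ ∞ V) (hVc : HasCompactSupport V) (hV' : ContDiff ℝ ∞ V')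
    (hVc' : HasCompactSupport V')
    (h : ∀ x ∈ hull F, (inner ℝ (gradBary K a) (V x - V' x) : ℝ) = 0) :
    Tendsto (fun ε => faceTerm K F a (fun x => inner ℝ (gradBary K a) (V x)) ε
      + faceTerm K' F a' (fun x => inner ℝ (gradBary K' a') (V' x)) ε) (𝓝[>] 0) (𝓝 0) := by
  obtain ⟨LR, hR⟩ := lipschitzWith_flipMap K a a'
  obtain ⟨L, hL⟩ := hV.lipschitzWith_of_hasCompactSupport hVc (by simp)
  obtain ⟨L', hL'⟩ := hV'.lipschitzWith_of_hasCompactSupport hVc' (by simp)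
  have hlip := (innerSL ℝ (gradBary K a)).lipschitz.comp (hL.sub (hL'.comp hR))
  have hc1 := hV.continuous
  have hc2 := hV'.continuous.comp hR.continuous
  have hzero : ∀ x ∈ hull F, bary K a x = 0 := fun x hx =>
    ((hK.mem_hull_subset_iff hF).1 hx).2 a haK haF
  obtain ⟨C, hC⟩ := hK.abs_le_of_lipschitz hF hFne haK haF ha hlip fun x hx => by
    have : flipMap K a a' x = x := by rw [flipMap, hzero x hx, zero_smul, add_zero]
    simpa [this] using h x hx
  refine (hK.tendsto_faceTerm haK ha (hlip.continuous) hC).congr' ?_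
  filter_upwards [self_mem_nhdsWithin] with ε hε
  rw [hK.faceTerm_flip hK' hF hF' haK haF ha haK' haF' hκ0 hκ, ← sub_eq_add_neg]
  unfold faceTerm
  rw [← integral_sub]
  · refine integral_congr_ae (Eventually.of_forall fun x => ?_)
    simp only [Function.comp, innerSL_apply_apply, inner_sub_right]
    ring
  · exact hK.integrable_faceTerm ha hε (by fun_prop)
  · exact hK.integrable_faceTerm ha hε
      ((innerSL ℝ (gradBary K a)).continuous.comp hc2)

theorem IsTetra.tendsto_faceTerm_of_zero (hK : IsTetra K) (hF : F ⊆ K) (hFne : F.Nonempty)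
    (haK : a ∈ K) (haF : a ∉ F) (ha : ∀ b ∈ K, b ≠ a → b ∈ F) {V : E3 → E3}
    (hV : ContDiff ℝ ∞ V) (hVc : HasCompactSupport V)
    (h : ∀ x ∈ hull F, (inner ℝ (gradBary K a) (V x) : ℝ) = 0) :
    Tendsto (fun ε => faceTerm K F a (fun x => inner ℝ (gradBary K a) (V x)) ε) (𝓝[>] 0) (𝓝 0) := by
  obtain ⟨L, hL⟩ := hV.lipschitzWith_of_hasCompactSupport hVc (by simp)
  have hlip := (innerSL ℝ (gradBary K a)).lipschitz.comp hL
  obtain ⟨C, hC⟩ := hK.abs_le_of_lipschitz hF hFne haK haF ha hlip h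
  exact hK.tendsto_faceTerm haK ha hlip.continuous hC

end

theorem IsConformingMesh.sum_integral_divergence {Ω : Set E3} {T : Finset (Finset E3)}
    (hT : IsConformingMesh Ω T) {V : Finset E3 → E3 → E3}
    (hV : ∀ K ∈ T, ContDiff ℝ ∞ (V K)) (hVc : ∀ K ∈ T, HasCompactSupport (V K))
    (hsh : ∀ K ∈ T, ∀ K' ∈ T, K ≠ K' → ∀ F ⊆ K, F ⊆ K' → F.card = 3 → ∀ a ∈ K, a ∉ F →
      ∀ x ∈ hull F, (inner ℝ (gradBary K a) (V K x - V K' x) : ℝ) = 0)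
    (hbd : ∀ K ∈ T, ∀ F ⊆ K, F.card = 3 → hull F ⊆ frontier Ω → ∀ a ∈ K, a ∉ F →
      ∀ x ∈ hull F, (inner ℝ (gradBary K a) (V K x) : ℝ) = 0) :
    ∑ K ∈ T, ∫ x in interior (hull K), divergence (V K) x = 0 := by
  classical
  set t : (Σ _ : Finset E3, E3) → ℝ → ℝ := fun p ε =>
    faceTerm p.1 (p.1.erase p.2) p.2 (fun x => inner ℝ (gradBary p.1 p.2) (V p.1 x)) ε
  set P : Finset (Σ _ : Finset E3, E3) := T.sigma fun K => K
  have hlim : Tendsto (fun ε => ∑ K ∈ T, ∫ x, cutoff K ε x * divergence (V K) x) (𝓝[>] 0)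
      (𝓝 (∑ K ∈ T, ∫ x in interior (hull K), divergence (V K) x)) :=
    tendsto_finsetSum _ fun K hK =>
      (hT.isTetra hK).tendsto_integral_cutoff (continuous_divergence (hV K hK))
  suffices h0 : Tendsto (fun ε => ∑ p ∈ P, t p ε) (𝓝[>] 0) (𝓝 0) by
    refine tendsto_nhds_unique hlim ?_
    rw [show 𝓝 (0:ℝ) = 𝓝 (-0) by rw [neg_zero]]
    refine h0.neg.congr' ?_
    filter_upwards [self_mem_nhdsWithin] with ε hε
    rw [Finset.sum_sigma, ← Finset.sum_neg_distrib]
    exact Finset.sum_congr rfl fun K hK =>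
      ((hT.isTetra hK).integral_cutoff_mul_divergence hε (hV K hK)).symm
  have hfib : ∀ ε, ∑ p ∈ P, t p ε
      = ∑ F ∈ P.image (fun p => p.1.erase p.2), ∑ p ∈ P with p.1.erase p.2 = F, t p ε := fun ε =>
    (Finset.sum_fiberwise_of_maps_to (fun p hp => Finset.mem_image_of_mem _ hp) _).symm
  simp_rw [hfib]
  rw [show 𝓝 (0:ℝ) = 𝓝 (∑ F ∈ P.image (fun p => p.1.erase p.2), 0) by simp]
  refine tendsto_finsetSum _ fun F hF => ?_
  obtain ⟨⟨K, a⟩, hp, hpF⟩ := Finset.mem_image.1 hF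
  have hall : ∀ p ∈ P, p.1.erase p.2 = F → p.1 ∈ T ∧ p.2 ∈ p.1 ∧ F ⊆ p.1 ∧ F.card = 3 ∧ p.2 ∉ F ∧
      ∀ b ∈ p.1, b ≠ p.2 → b ∈ F := by
    rintro ⟨L, b⟩ hL rfl
    obtain ⟨h1, h2⟩ := Finset.mem_sigma.1 hL
    refine ⟨h1, h2, Finset.erase_subset _ _, ?_, Finset.notMem_erase _ _, fun c hc hcb =>
      Finset.mem_erase.2 ⟨hcb, hc⟩⟩
    rw [Finset.card_erase_of_mem h2, hT.card_eq L h1]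
  obtain ⟨hK, haK, hFK, hFc, haF, hopp⟩ := hall _ hp hpF
  simp only at hK haK hFK haF hopp hpF
  have hFne : F.Nonempty := by rw [← Finset.card_pos, hFc]; norm_num
  rcases hT.faces K hK F hFK hFc with hfr | ⟨K', hK', hne, hFK'⟩
  · rw [show 𝓝 (0:ℝ) = 𝓝 (∑ p ∈ P with p.1.erase p.2 = F, 0) by simp]
    refine tendsto_finsetSum _ fun p hp => ?_
    obtain ⟨hp, hpF⟩ := Finset.mem_filter.1 hp
    obtain ⟨hL, hbL, hFL, -, hbF, hoppL⟩ := hall p hp hpF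
    simp only [t, hpF]
    exact (hT.isTetra hL).tendsto_faceTerm_of_zero hFL hFne hbL hbF hoppL (hV _ hL) (hVc _ hL)
      (hbd _ hL F hFL hFc hfr _ hbL hbF)
  · obtain ⟨a', haK', haF', hopp'⟩ := exists_opposite (hT.card_eq K' hK') hFK' hFc
    obtain ⟨κ, hκ0, hκ⟩ := hT.opposite_bary hK hK' hne.symm hFK hFK' hFc haK hopp haK' hopp' haF haF'
    have e' : K'.erase a' = F := by
      ext b; rw [Finset.mem_erase]
      exact ⟨fun h => hopp' b h.2 h.1, fun h => ⟨fun e => haF' (e ▸ h), hFK' h⟩⟩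
    have hfilter : (P.filter fun p => p.1.erase p.2 = F) = {⟨K, a⟩, ⟨K', a'⟩} := by
      ext ⟨L, b⟩
      simp only [Finset.mem_filter, Finset.mem_insert, Finset.mem_singleton]
      constructor
      · rintro ⟨h1, h2⟩
        obtain ⟨hL, hbL, hFL, -, hbF, hoppL⟩ := hall _ h1 h2
        simp only at hL hbL hFL hbF hoppL
        rcases hT.eq_or_eq_of_mem hK hK' hne.symm hFK hFK' hFc (barycenter_mem hFne)
          (fun b hb => (hT.isTetra hK).bary_barycenter_pos hFK hb) hL
          (hull_mono hFL (barycenter_mem hFne)) with rfl | rfl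
        · left
          have : b = a := by by_contra h; exact hbF (hopp b hbL h)
          rw [this]
        · right
          have : b = a' := by by_contra h; exact hbF (hopp' b hbL h)
          rw [this]
      · rintro (h | h) <;> cases h
        · exact ⟨hp, hpF⟩
        · exact ⟨Finset.mem_sigma.2 ⟨hK', haK'⟩, e'⟩
    have hpne : (⟨K, a⟩ : Σ _ : Finset E3, E3) ≠ ⟨K', a'⟩ := fun h => hne (congrArg Sigma.fst h).symm
    rw [hfilter]
    simp_rw [Finset.sum_pair hpne]
    simp only [t, hpF, e']
    exact (hT.isTetra hK).tendsto_faceTerm_add (hT.isTetra hK') hFK hFK' hFne haK haF hopp haK' haF'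
      hκ0 hκ (hV K hK) (hVc K hK) (hV K' hK') (hVc K' hK')
      (hsh K hK K' hK' hne.symm F hFK hFK' hFc a haK haF)

/-- The field that coincides with `f K` in the open element `K`. -/
noncomputable def meshField (T : Finset (Finset E3)) (f : Finset E3 → E3 → E3) (x : E3) : E3 :=
  ∑ K ∈ T, (interior (hull K)).indicator (f K) x

section

variable {Ω Γ : Set E3} {T : Finset (Finset E3)}

theorem IsConformingMesh.sum_indicator (hT : IsConformingMesh Ω T) {M : Type*} [AddCommMonoid M]
    (f : Finset E3 → E3 → M) {K : Finset E3} (hK : K ∈ T) {x : E3} (hx : x ∈ interior (hull K)) :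
    ∑ L ∈ T, (interior (hull L)).indicator (f L) x = f K x := by
  rw [Finset.sum_eq_single K, indicator_of_mem hx]
  · intro L hL hLK
    exact indicator_of_notMem (fun h => hLK (hT.eq_of_interior_inter hL hK h (interior_subset hx))) _
  · exact fun h => absurd hK h

theorem isBounded_interior_hull (K : Finset E3) : Bornology.IsBounded (interior (hull K)) :=
  (isCompact_hull K).isBounded.subset interior_subset

theorem memLp_meshField {f : Finset E3 → E3 → E3} (hf : ∀ K ∈ T, Continuous (f K)) :
    MemLp (meshField T f) 2 volume := by
  unfold meshField
  exact memLp_finsetSum _ fun K hK => (memLp_indicator_iff_restrict isOpen_interior.measurableSet).2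
    (memLp_of_isBounded isOpen_interior (isBounded_interior_hull K) (hf K hK) 2)

theorem IsConformingMesh.pairwise_disjoint (hT : IsConformingMesh Ω T) :
    (T : Set (Finset E3)).Pairwise (Function.onFun Disjoint fun K => interior (hull K)) :=
  fun K hK K' hK' hne => hT.disjoint K hK K' hK' hne

theorem IsConformingMesh.restrict_eq (hT : IsConformingMesh Ω T) (hΩ : IsLipschitzDomain Ω) :
    (volume : Measure E3).restrict Ω = volume.restrict (⋃ K ∈ T, interior (hull K)) := by
  refine Measure.restrict_congr_set (ae_eq_set.2 ⟨?_, ?_⟩)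
  · refine measure_mono_null (t := ⋃ K ∈ T, hull K \ interior (hull K)) ?_ ?_
    · rintro x ⟨hx, hn⟩
      obtain ⟨K, hK, hxK⟩ := hT.exists_mem_hull (subset_closure hx)
      exact mem_iUnion₂.2 ⟨K, hK, hxK, fun h => hn (mem_iUnion₂.2 ⟨K, hK, h⟩)⟩
    · refine (measure_biUnion_null_iff T.countable_toSet).2 fun K hK => ?_
      have := measure_closure_diff (hT.isTetra hK).convexElement
      rwa [(hT.isTetra hK).closure_interior] at this
  · rw [sdiff_eq_empty.2, measure_empty]
    exact iUnion₂_subset fun K hK => hT.interior_subset_domain hΩ hK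

theorem IsConformingMesh.integral_eq_sum (hT : IsConformingMesh Ω T) (hΩ : IsLipschitzDomain Ω)
    {f : E3 → ℝ} (hf : IntegrableOn f Ω) : ∫ x in Ω, f x = ∑ K ∈ T, ∫ x in interior (hull K), f x := by
  rw [hT.restrict_eq hΩ, integral_biUnion_finset T (fun K _ => isOpen_interior.measurableSet)
    hT.pairwise_disjoint fun K hK => hf.mono_set (hT.interior_subset_domain hΩ hK)]

theorem IsConformingMesh.lintegral_eq_sum (hT : IsConformingMesh Ω T) (hΩ : IsLipschitzDomain Ω)
    (f : E3 → ℝ≥0∞) : ∫⁻ x in Ω, f x = ∑ K ∈ T, ∫⁻ x in interior (hull K), f x := by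
  rw [hT.restrict_eq hΩ, lintegral_biUnion_finset hT.pairwise_disjoint
    (fun K _ => isOpen_interior.measurableSet)]

theorem contDiff_cross {φ f : E3 → E3} (hφ : ContDiff ℝ ∞ φ) (hf : ContDiff ℝ ∞ f) :
    ContDiff ℝ ∞ fun y => cross (φ y) (f y) := by
  unfold cross
  refine (PiLp.contDiff_toLp).comp (contDiff_pi.2 fun i => ?_)
  have h1 := contDiff_coord hφ
  have h2 := contDiff_coord hf
  fin_cases i <;> simp [crossProduct] <;> fun_prop

theorem divergence_cross {φ f : E3 → E3} (hφ : ContDiff ℝ ∞ φ) (hf : ContDiff ℝ ∞ f) (x : E3) :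
    divergence (fun y => cross (φ y) (f y)) x = inner ℝ (f x) (curl φ x) - inner ℝ (curl f x) (φ x) := by
  have hV := contDiff_cross hφ hf
  have dφ : ∀ j, DifferentiableAt ℝ (fun y => φ y j) x := fun j =>
    (contDiff_coord hφ j).differentiable (by simp) x
  have df : ∀ j, DifferentiableAt ℝ (fun y => f y j) x := fun j =>
    (contDiff_coord hf j).differentiable (by simp) x
  have key : ∀ i j k, fderiv ℝ (fun y => φ y j * f y k - φ y k * f y j) x (unitVec i)
      = φ x j * pd f i k x + f x k * pd φ i j x - (φ x k * pd f i j x + f x j * pd φ i k x) := by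
    intro i j k
    have e := (((dφ j).hasFDerivAt.mul (df k).hasFDerivAt).sub ((dφ k).hasFDerivAt.mul (df j).hasFDerivAt)).fderiv
    rw [pd_eq hφ, pd_eq hφ, pd_eq hf, pd_eq hf]
    have e' : fderiv ℝ (fun y => φ y j * f y k - φ y k * f y j) x = _ := e
    rw [e']
    simp
  unfold divergence
  rw [pd_eq hV, pd_eq hV, pd_eq hV]
  have c0 : (fun y => cross (φ y) (f y) 0) = fun y => φ y 1 * f y 2 - φ y 2 * f y 1 := by
    ext y; simp [cross, crossProduct]
  have c1 : (fun y => cross (φ y) (f y) 1) = fun y => φ y 2 * f y 0 - φ y 0 * f y 2 := by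
    ext y; simp [cross, crossProduct]
  have c2 : (fun y => cross (φ y) (f y) 2) = fun y => φ y 0 * f y 1 - φ y 1 * f y 0 := by
    ext y; simp [cross, crossProduct]
  rw [c0, c1, c2, key, key, key]
  simp [curl, PiLp.inner_apply, Fin.sum_univ_three]
  ring

theorem inner_cross_smul_self (n φ : E3) (t : ℝ) : (inner ℝ n (cross φ (t • n)) : ℝ) = 0 := by
  simp [cross, crossProduct, PiLp.inner_apply, Fin.sum_univ_three]
  ring

theorem IsTetra.eq_smul_gradBary {K F : Finset E3} (hK : IsTetra K) {a : E3}
    (haK : a ∈ K) (ha : ∀ b ∈ K, b ≠ a → b ∈ F) (hFne : F.Nonempty) {u : E3}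
    (hu : ∀ p ∈ F, ∀ q ∈ F, (inner ℝ u (q - p) : ℝ) = 0) : ∃ t : ℝ, u = t • gradBary K a := by
  classical
  obtain ⟨p, hp⟩ := hFne
  refine ⟨inner ℝ u a - inner ℝ u p, ?_⟩
  have h1 := hK.sum_inner_smul_gradBary u
  have h2 := hK.sum_gradBary
  have h3 : ∑ b ∈ K, ((inner ℝ u b : ℝ) - inner ℝ u p) • gradBary K b = u := by
    simp_rw [sub_smul]
    rw [Finset.sum_sub_distrib, h1, ← Finset.smul_sum, h2, smul_zero, sub_zero]
  refine h3.symm.trans (Finset.sum_eq_single a ?_ ?_)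
  · intro b hb hba
    have := hu p hp b (ha b hb hba)
    rw [inner_sub_right] at this
    rw [this, zero_smul]
  · exact fun h => absurd haK h

theorem IsConformingMesh.hull_subset_closure_diff (hT : IsConformingMesh Ω T) (hΩ : IsLipschitzDomain Ω)
    (hΓ : Resolves Ω Γ T) {K F : Finset E3} (hK : K ∈ T) (hF : F ⊆ K) (hFc : F.card = 3)
    (hfr : hull F ⊆ frontier Ω) (hFΓ : ¬ hull F ⊆ Γ) : hull F ⊆ closure (frontier Ω \ Γ) := by
  have hFne : F.Nonempty := by rw [← Finset.card_pos, hFc]; norm_num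
  have tK := hT.isTetra hK
  obtain ⟨-, 𝓕, h𝓕, hΓe⟩ := hΓ
  intro x hx
  have hc : Continuous fun s : ℝ => barycenter F + s • (x - barycenter F) := by fun_prop
  have hlim : Tendsto (fun s : ℝ => barycenter F + s • (x - barycenter F)) (𝓝[<] 1) (𝓝 x) := by
    have := (hc.tendsto 1).mono_left (nhdsWithin_le_nhds (s := Iio 1))
    simpa using this
  refine mem_closure_of_tendsto hlim ?_
  filter_upwards [Ioo_mem_nhdsLT (zero_lt_one (α := ℝ))] with s hs
  obtain ⟨h1, h2⟩ := contract_face tK hF hFne hx ⟨hs.1.le, hs.2⟩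
  refine ⟨hfr h1, fun hΓm => hFΓ ?_⟩
  rw [hΓe] at hΓm
  obtain ⟨F', hF', hxF'⟩ := mem_iUnion₂.1 hΓm
  obtain ⟨hc', K', hK', hFK'⟩ := h𝓕 F' hF'
  have hKK := hT.frontier_face_unique hΩ hK hK' hF hFc hfr h1 h2 (hull_mono hFK' hxF')
  rw [hKK] at hFK'
  have hsub : F ⊆ F' := fun b hb => by
    by_contra hbF
    exact (h2 b hb).ne' (((tK.mem_hull_subset_iff hFK').1 hxF').2 b (hF hb) hbF)
  rw [Finset.eq_of_subset_of_card_le hsub (by rw [hc', hFc]), hΓe]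
  exact subset_biUnion_of_mem (u := fun F => hull F) hF'

/-- A piecewise field `a + b × x` with matching tangential traces belongs to `H(curl)`. -/
theorem isHcurl_meshField (hΩ : IsLipschitzDomain Ω) (hT : IsConformingMesh Ω T)
    (hΓ : Resolves Ω Γ T) {A B : Finset E3 → E3}
    (hsh : ∀ K ∈ T, ∀ K' ∈ T, K ≠ K' → ∀ F ⊆ K, F ⊆ K' → F.card = 3 → ∀ x ∈ hull F,
      ∀ p ∈ F, ∀ q ∈ F, (inner ℝ (A K + cross (B K) x) (q - p) : ℝ) = inner ℝ (A K' + cross (B K') x) (q - p))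
    (hbd : ∀ K ∈ T, ∀ F ⊆ K, F.card = 3 → hull F ⊆ Γ → ∀ x ∈ hull F,
      ∀ p ∈ F, ∀ q ∈ F, (inner ℝ (A K + cross (B K) x) (q - p) : ℝ) = 0) :
    IsHcurl Ω Γ (meshField T fun K x => A K + cross (B K) x)
      (meshField T fun K _ => (2:ℝ) • B K) := by
  have hv := memLp_meshField (T := T) (f := fun K x => A K + cross (B K) x)
    fun K _ => (contDiff_affine (A K) (B K)).continuous
  have hw := memLp_meshField (T := T) (f := fun K _ => (2:ℝ) • B K) fun K _ => continuous_const
  refine ⟨hv.restrict _, hw.restrict _, fun φ hφ hφc hφd => ?_⟩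
  have hI1 := integrable_inner_curl (hv.restrict Ω) hφ hφc
  have hI2 := integrable_inner_of_memLp (hw.restrict Ω) (hφ.continuous.memLp_of_hasCompactSupport hφc)
  rw [← sub_eq_zero, ← integral_sub hI1 hI2]
  refine (hT.integral_eq_sum hΩ (hI1.sub hI2)).trans ?_
  have hVs : ∀ K, ContDiff ℝ ∞ fun y => cross (φ y) (A K + cross (B K) y) := fun K =>
    contDiff_cross hφ (contDiff_affine (A K) (B K))
  have hcross0 : ∀ u : E3, cross 0 u = 0 := fun u => by simp [cross]
  rw [← hT.sum_integral_divergence (V := fun K y => cross (φ y) (A K + cross (B K) y)) (fun K _ => hVs K)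
    (fun K _ => HasCompactSupport.intro hφc fun x hx => by
      rw [image_eq_zero_of_notMem_tsupport hx, hcross0]) ?_ ?_]
  · refine Finset.sum_congr rfl fun K hK => setIntegral_congr_fun isOpen_interior.measurableSet
      fun x hx => ?_
    simp only [Pi.sub_apply, divergence_cross hφ (contDiff_affine (A K) (B K)), curl_affine, meshField]
    rw [hT.sum_indicator _ hK hx, hT.sum_indicator _ hK hx]
  · intro K hK K' hK' hne F hF hF' hFc a haK haF x hx
    have hFne : F.Nonempty := by rw [← Finset.card_pos, hFc]; norm_num
    obtain ⟨a₁, ha₁, ha₁F, hopp⟩ := exists_opposite (hT.card_eq K hK) hF hFc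
    have ea : a = a₁ := by by_contra h; exact haF (hopp a haK h)
    subst ea
    obtain ⟨t, ht⟩ := (hT.isTetra hK).eq_smul_gradBary haK hopp hFne
      (u := (A K + cross (B K) x) - (A K' + cross (B K') x)) fun p hp q hq => by
        rw [inner_sub_left, hsh K hK K' hK' hne F hF hF' hFc x hx p hp q hq, sub_self]
    have e : cross (φ x) (A K + cross (B K) x) - cross (φ x) (A K' + cross (B K') x)
        = cross (φ x) (t • gradBary K a) := by
      rw [← ht, sub_eq_iff_eq_add, ← cross_add_right, sub_add_cancel]
    rw [e, inner_cross_smul_self]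
  · intro K hK F hF hFc hfr a haK haF x hx
    have hFne : F.Nonempty := by rw [← Finset.card_pos, hFc]; norm_num
    obtain ⟨a₁, ha₁, ha₁F, hopp⟩ := exists_opposite (hT.card_eq K hK) hF hFc
    have ea : a = a₁ := by by_contra h; exact haF (hopp a haK h)
    subst ea
    by_cases hFΓ : hull F ⊆ Γ
    · obtain ⟨t, ht⟩ := (hT.isTetra hK).eq_smul_gradBary haK hopp hFne (hbd K hK F hF hFc hFΓ x hx)
      rw [ht, inner_cross_smul_self]
    · have h1 := hT.hull_subset_closure_diff hΩ hΓ hK hF hFc hfr hFΓ hx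
      have h2 : x ∉ tsupport φ := fun h => disjoint_left.1 hφd h h1
      rw [image_eq_zero_of_notMem_tsupport h2, hcross0, inner_zero_right]

end

/-! ### The interpolant in terms of edge values -/

/-- The field on the element `K` with the path integral `c a b` along each edge `[a, b]`. -/
noncomputable def localInterp (K : Finset E3) (c : E3 → E3 → ℝ) (x : E3) : E3 :=
  ∑ E ∈ K.powersetCard 2, c (tail E) (head E) • shapeFn K E x

/-- Half the curl of `localInterp`. -/
noncomputable def localCurl (K : Finset E3) (c : E3 → E3 → ℝ) : E3 :=
  ∑ E ∈ K.powersetCard 2, c (tail E) (head E) • shapeCurl K E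

theorem cross_sum_left {ι : Type*} (s : Finset ι) (f : ι → E3) (x : E3) :
    cross (∑ i ∈ s, f i) x = ∑ i ∈ s, cross (f i) x := by
  classical
  induction s using Finset.induction_on with
  | empty => simp [cross]
  | insert i s hi ih => rw [Finset.sum_insert hi, Finset.sum_insert hi, cross_add_left, ih]

theorem localInterp_eq (K : Finset E3) (c : E3 → E3 → ℝ) (x : E3) :
    localInterp K c x = localInterp K c 0 + cross (localCurl K c) x := by
  unfold localInterp localCurl
  rw [cross_sum_left, ← Finset.sum_add_distrib]
  refine Finset.sum_congr rfl fun E _ => ?_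
  have h := shapeFn_sub K E x 0
  rw [sub_zero, sub_eq_iff_eq_add] at h
  rw [cross_smul_left, h, smul_add, add_comm]

/-- The tangential component of `localInterp` on a face depends only on data of the face. -/
theorem IsTetra.inner_localInterp {K F : Finset E3} (hK : IsTetra K) (hF : F ⊆ K) (c : E3 → E3 → ℝ)
    {x : E3} (hx : x ∈ hull F) {p q : E3} (hp : p ∈ F) (hq : q ∈ F) :
    (inner ℝ (localInterp K c x) (q - p) : ℝ) = ∑ E ∈ F.powersetCard 2, c (tail E) (head E) *
      (bary K (tail E) x * (bary K (head E) q - bary K (head E) p)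
        - bary K (head E) x * (bary K (tail E) q - bary K (tail E) p)) := by
  have hterm : ∀ E, (inner ℝ (c (tail E) (head E) • shapeFn K E x) (q - p) : ℝ) = c (tail E) (head E) *
      (bary K (tail E) x * (bary K (head E) q - bary K (head E) p)
        - bary K (head E) x * (bary K (tail E) q - bary K (tail E) p)) := fun E => by
    rw [shapeFn_eq, inner_smul_left, inner_sub_left, inner_smul_left, inner_smul_left, ← bary_sub, ← bary_sub]
    simp
  rw [localInterp, sum_inner]
  simp_rw [hterm]
  refine (Finset.sum_subset (Finset.powersetCard_mono hF) fun E hE hEF => ?_).symm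
  rw [Finset.mem_powersetCard] at hE hEF
  have hsub : ¬ E ⊆ F := fun h => hEF ⟨h, hE.2⟩
  obtain ⟨d, hd, hdF⟩ := Finset.not_subset.1 hsub
  have hz : ∀ y ∈ hull F, bary K d y = 0 := fun y hy =>
    ((hK.mem_hull_subset_iff hF).1 hy).2 d (hE.1 hd) hdF
  have hpp := hz p (subset_convexHull ℝ _ hp)
  have hqq := hz q (subset_convexHull ℝ _ hq)
  rcases (tail_head hE.2).2.2.2 d hd with e | e <;> rw [← e, hz x hx, hpp, hqq] <;> ring

section

variable {Ω Γ : Set E3} {T : Finset (Finset E3)} {Ψ w : E3 → E3} {G : Fin 3 → E3 → E3}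
  {ℓ : Finset E3 → E3 → E3 → ℝ}

theorem edgeInterp_eq_meshField (hΩ : IsLipschitzDomain Ω) (hT : IsConformingMesh Ω T)
    (hΓ : Resolves Ω Γ T) (hΨw : IsHcurl Ω Γ Ψ w) (hℓ : IsSegFamily Ω T Ψ G ℓ) :
    edgeInterp Γ T Ψ = meshField T fun K => localInterp K (ℓ K) := by
  classical
  ext1 x
  unfold edgeInterp meshField basisFn
  simp_rw [Finset.smul_sum]
  rw [Finset.sum_comm' (t' := T) (s' := fun K => (K.powersetCard 2).filter fun E => ¬ hull E ⊆ Γ)]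
  · refine Finset.sum_congr rfl fun K hK => ?_
    by_cases hx : x ∈ interior (hull K)
    · simp_rw [indicator_of_mem hx]
      rw [Finset.sum_filter, localInterp]
      refine Finset.sum_congr rfl fun E hE => ?_
      have hE' := Finset.mem_powersetCard.1 hE
      split_ifs with h
      · rw [segLimit_eq_zero_of_subset hΩ hT hΓ hΨw hℓ hK hE h, zero_smul]
      · rw [edgeIntegral_eq hK hE'.1 (hasEdgeIntegral_segLimit hΩ hT hΨw hℓ hK hE)]
    · simp_rw [indicator_of_notMem hx, smul_zero, Finset.sum_const_zero]
  · intro E K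
    simp only [activeEdges, Finset.mem_filter, mem_edges]
    constructor
    · rintro ⟨⟨⟨L, hL, hEL⟩, hn⟩, hK, hEK⟩
      exact ⟨⟨Finset.mem_powersetCard.2 ⟨hEK, (Finset.mem_powersetCard.1 hEL).2⟩, hn⟩, hK⟩
    · rintro ⟨⟨hEK, hn⟩, hK⟩
      exact ⟨⟨⟨K, hK, hEK⟩, hn⟩, hK, (Finset.mem_powersetCard.1 hEK).1⟩

theorem isHcurl_edgeInterp (hΩ : IsLipschitzDomain Ω) (hT : IsConformingMesh Ω T)
    (hΓ : Resolves Ω Γ T) (hΨw : IsHcurl Ω Γ Ψ w) (hℓ : IsSegFamily Ω T Ψ G ℓ) :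
    IsHcurl Ω Γ (edgeInterp Γ T Ψ) (meshField T fun K _ => (2:ℝ) • localCurl K (ℓ K)) := by
  rw [edgeInterp_eq_meshField hΩ hT hΓ hΨw hℓ]
  have e : (fun K : Finset E3 => localInterp K (ℓ K))
      = fun K x => localInterp K (ℓ K) 0 + cross (localCurl K (ℓ K)) x := by
    ext1 K; ext1 x; exact localInterp_eq K (ℓ K) x
  rw [e]
  refine isHcurl_meshField hΩ hT hΓ ?_ ?_
  · intro K hK K' hK' hne F hF hF' hFc x hx p hp q hq
    have tK := hT.isTetra hK
    have tK' := hT.isTetra hK'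
    rw [← localInterp_eq, ← localInterp_eq, tK.inner_localInterp hF _ hx hp hq,
      tK'.inner_localInterp hF' _ hx hp hq]
    refine Finset.sum_congr rfl fun E hE => ?_
    obtain ⟨hEF, hEc⟩ := Finset.mem_powersetCard.1 hE
    obtain ⟨ht, hh, -, -⟩ := tail_head hEc
    have hcom : ∀ y ∈ hull F, ∀ d ∈ F, bary K d y = bary K' d y := fun y hy d hd =>
      tK.bary_eq_of_common tK' hF hF' hy hd
    have hp' := subset_convexHull ℝ (F : Set E3) hp
    have hq' := subset_convexHull ℝ (F : Set E3) hq
    rw [segLimit_eq_of_edge hΩ hT hΨw hℓ hK hK' (hEF.trans hF) (hEF.trans hF') hEc,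
      hcom x hx _ (hEF ht), hcom x hx _ (hEF hh), hcom p hp' _ (hEF ht), hcom p hp' _ (hEF hh),
      hcom q hq' _ (hEF ht), hcom q hq' _ (hEF hh)]
  · intro K hK F hF hFc hFΓ x hx p hp q hq
    rw [← localInterp_eq, (hT.isTetra hK).inner_localInterp hF _ hx hp hq]
    refine Finset.sum_eq_zero fun E hE => ?_
    obtain ⟨hEF, hEc⟩ := Finset.mem_powersetCard.1 hE
    rw [segLimit_eq_zero_of_subset hΩ hT hΓ hΨw hℓ hK (Finset.mem_powersetCard.2 ⟨hEF.trans hF, hEc⟩)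
      ((hull_mono hEF).trans hFΓ), zero_mul]

theorem memEdgeSpace_edgeInterp (hΩ : IsLipschitzDomain Ω) (hT : IsConformingMesh Ω T)
    (hΓ : Resolves Ω Γ T) (hΨw : IsHcurl Ω Γ Ψ w) (hℓ : IsSegFamily Ω T Ψ G ℓ) :
    MemEdgeSpace Ω Γ T (edgeInterp Γ T Ψ) := by
  refine ⟨⟨_, isHcurl_edgeInterp hΩ hT hΓ hΨw hℓ⟩, fun K hK =>
    ⟨localInterp K (ℓ K) 0, localCurl K (ℓ K), ?_⟩⟩
  rw [← (hT.isTetra hK).closure_interior, restrict_closure_eq (hT.isTetra hK).convexElement]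
  filter_upwards [ae_restrict_mem isOpen_interior.measurableSet] with x hx
  rw [edgeInterp_eq_meshField hΩ hT hΓ hΨw hℓ, meshField, hT.sum_indicator _ hK hx, localInterp_eq]

/-! ### Existence of the edge values, and linearity -/

theorem exists_segFamily (hΩ : IsLipschitzDomain Ω) (hT : IsConformingMesh Ω T)
    (hΨ : Ψ ∈ discreteCurlFields Ω Γ T) : ∃ G w ℓ, MemLp Ψ 2 (volume.restrict Ω) ∧ IsWeakGrad Ω Ψ G ∧
      IsHcurl Ω Γ Ψ w ∧ IsSegFamily Ω T Ψ G ℓ := by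
  obtain ⟨⟨hm, G, hG⟩, v, w, hv, hvw, hΨw⟩ := hΨ
  have hf : ∀ K ∈ T, ConstCurlField (interior (hull K)) Ψ G := fun K hK =>
    constCurlField_of_discrete hΩ hT hm hG hv hvw hΨw hK
  have hex : ∀ K : Finset E3, ∃ ℓ : E3 → E3 → ℝ, K ∈ T →
      ConvexElement.IsSegLimit (interior (hull K)) (elemDiam K) Ψ G ℓ := fun K => by
    by_cases hK : K ∈ T
    · obtain ⟨ℓ, hℓ⟩ := (hT.isTetra hK).convexElement.exists_segLimit (hf K hK)
      exact ⟨ℓ, fun _ => hℓ⟩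
    · exact ⟨0, fun h => absurd h hK⟩
  choose ℓ hℓ using hex
  exact ⟨G, w, ℓ, hm, hG, hΨw, hf, hℓ⟩

theorem IsHcurl.lincomb {v v' w w' : E3 → E3} (h : IsHcurl Ω Γ v w) (h' : IsHcurl Ω Γ v' w') (α β : ℝ) :
    IsHcurl Ω Γ (α • v + β • v') (α • w + β • w') := by
  refine ⟨(h.1.const_smul α).add (h'.1.const_smul β), (h.2.1.const_smul α).add (h'.2.1.const_smul β),
    fun φ hφ hc hd => ?_⟩
  have hφL := hφ.continuous.memLp_of_hasCompactSupport (p := 2) (μ := volume.restrict Ω) hc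
  simp only [Pi.add_apply, Pi.smul_apply, inner_add_left, inner_smul_left, conj_trivial]
  rw [integral_add ((integrable_inner_curl h.1 hφ hc).const_mul α)
      ((integrable_inner_curl h'.1 hφ hc).const_mul β),
    integral_add ((integrable_inner_of_memLp h.2.1 hφL).const_mul α)
      ((integrable_inner_of_memLp h'.2.1 hφL).const_mul β),
    integral_const_mul, integral_const_mul, integral_const_mul, integral_const_mul,
    h.2.2 φ hφ hc hd, h'.2.2 φ hφ hc hd]

theorem MemEdgeSpace.lincomb {v v' : E3 → E3} (h : MemEdgeSpace Ω Γ T v) (h' : MemEdgeSpace Ω Γ T v')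
    (α β : ℝ) : MemEdgeSpace Ω Γ T (α • v + β • v') := by
  obtain ⟨⟨w, hw⟩, hK⟩ := h
  obtain ⟨⟨w', hw'⟩, hK'⟩ := h'
  refine ⟨⟨_, hw.lincomb hw' α β⟩, fun K hKT => ?_⟩
  obtain ⟨a, b, hab⟩ := hK K hKT
  obtain ⟨a', b', hab'⟩ := hK' K hKT
  refine ⟨α • a + β • a', α • b + β • b', ?_⟩
  filter_upwards [hab, hab'] with x hx hx'
  simp only [Pi.add_apply, Pi.smul_apply, hx, hx', cross_add_left, cross_smul_left]
  module

theorem discreteCurlFields_lincomb {Φ : E3 → E3} (hΨ : Ψ ∈ discreteCurlFields Ω Γ T)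
    (hΦ : Φ ∈ discreteCurlFields Ω Γ T) (α β : ℝ) : α • Ψ + β • Φ ∈ discreteCurlFields Ω Γ T := by
  obtain ⟨⟨hm, G, hG⟩, v, w, hv, hvw, hΨw⟩ := hΨ
  obtain ⟨⟨hm', G', hG'⟩, v', w', hv', hvw', hΨw'⟩ := hΦ
  exact ⟨⟨(hm.const_smul α).add (hm'.const_smul β), _, IsWeakGrad.lincomb hm hm' hG hG' α β⟩,
    _, _, hv.lincomb hv' α β, hvw.lincomb hvw' α β, hΨw.lincomb hΨw' α β⟩

theorem curl_lincomb {ψ φ : E3 → E3} (hψ : Differentiable ℝ ψ) (hφ : Differentiable ℝ φ) (α β : ℝ) (x : E3) :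
    curl (α • ψ + β • φ) x = α • curl ψ x + β • curl φ x := by
  have h : fderiv ℝ (α • ψ + β • φ) x = α • fderiv ℝ ψ x + β • fderiv ℝ φ x :=
    (((hψ x).hasFDerivAt.const_smul α).add ((hφ x).hasFDerivAt.const_smul β)).fderiv
  unfold curl pd
  rw [h]
  ext i
  fin_cases i <;> simp <;> ring

theorem segInt_lincomb {ψ φ : E3 → E3} (hψ : Continuous ψ) (hφ : Continuous φ) (α β : ℝ) (a b : E3) :
    segInt (α • ψ + β • φ) a b = α * segInt ψ a b + β * segInt φ a b := by
  unfold segInt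
  rw [← intervalIntegral.integral_const_mul, ← intervalIntegral.integral_const_mul,
    ← intervalIntegral.integral_add]
  · refine intervalIntegral.integral_congr fun t _ => ?_
    simp [inner_add_left, inner_smul_left]
  · exact Continuous.intervalIntegrable (by fun_prop) _ _
  · exact Continuous.intervalIntegrable (by fun_prop) _ _

end

section

variable {U : Set E3} {h : ℝ} {Ψ Φ : E3 → E3} {G H : Fin 3 → E3 → E3}

theorem l2Norm_lincomb_le {f g : E3 → E3} (hf : AEStronglyMeasurable f (volume.restrict U))
    (hg : AEStronglyMeasurable g (volume.restrict U)) (α β : ℝ) :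
    l2Norm U (α • f + β • g) ≤ ‖α‖ₑ * l2Norm U f + ‖β‖ₑ * l2Norm U g := by
  refine (eLpNorm_add_le (hf.const_smul α) (hg.const_smul β) (by norm_num)).trans ?_
  rw [eLpNorm_const_smul, eLpNorm_const_smul]
  rfl

theorem h1Dist_lincomb_le (hU : ConvexElement U h) (hΨ : ConstCurlField U Ψ G) (hΦ : ConstCurlField U Φ H)
    {ψ φ : E3 → E3} (hψ : ContDiff ℝ ∞ ψ) (hφ : ContDiff ℝ ∞ φ) (α β : ℝ) :
    h1Dist U (α • Ψ + β • Φ) (fun i => α • G i + β • H i) (α • ψ + β • φ)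
      ≤ ‖α‖ₑ * h1Dist U Ψ G ψ + ‖β‖ₑ * h1Dist U Φ H φ := by
  unfold h1Dist
  have e0 : α • ψ + β • φ - (α • Ψ + β • Φ) = α • (ψ - Ψ) + β • (φ - Φ) := by module
  have e1 : ∀ i, (fun x => fderiv ℝ (α • ψ + β • φ) x (unitVec i) - (α • G i + β • H i) x)
      = α • (fun x => fderiv ℝ ψ x (unitVec i) - G i x) + β • fun x => fderiv ℝ φ x (unitVec i) - H i x := by
    intro i; ext1 x
    have hd : fderiv ℝ (α • ψ + β • φ) x = α • fderiv ℝ ψ x + β • fderiv ℝ φ x :=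
      (((hψ.differentiable (by simp) x).hasFDerivAt.const_smul α).add
        ((hφ.differentiable (by simp) x).hasFDerivAt.const_smul β)).fderiv
    rw [hd]
    simp only [Pi.add_apply, Pi.smul_apply, ContinuousLinearMap.add_apply, ContinuousLinearMap.smul_apply]
    module
  simp_rw [e0, e1]
  have m1 := fun i => (hU.memLp_pderiv (hψ.of_le (by simp)) (unitVec i)).1
  have m2 := fun i => (hU.memLp_pderiv (hφ.of_le (by simp)) (unitVec i)).1
  refine (add_le_add (l2Norm_lincomb_le (hψ.continuous.aestronglyMeasurable.sub hΨ.memLp.1)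
    (hφ.continuous.aestronglyMeasurable.sub hΦ.memLp.1) α β) (Finset.sum_le_sum fun i _ =>
      l2Norm_lincomb_le ((m1 i).sub (hΨ.isWeakGrad.1 i).1)
        ((m2 i).sub (hΦ.isWeakGrad.1 i).1) α β)).trans (le_of_eq ?_)
  rw [Finset.sum_add_distrib, ← Finset.mul_sum, ← Finset.mul_sum, mul_add, mul_add]
  exact add_add_add_comm _ _ _ _

theorem ConvexElement.segLimit_lincomb (hU : ConvexElement U h) (hΨ : ConstCurlField U Ψ G)
    (hΦ : ConstCurlField U Φ H) {α β : ℝ} {ℓ m n : E3 → E3 → ℝ} (hℓ : ConvexElement.IsSegLimit U h Ψ G ℓ)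
    (hm : ConvexElement.IsSegLimit U h Φ H m)
    {J : Fin 3 → E3 → E3} (hΞ : ConstCurlField U (α • Ψ + β • Φ) J)
    (hn : ConvexElement.IsSegLimit U h (α • Ψ + β • Φ) J n)
    {a b : E3} (ha : a ∈ closure U) (hb : b ∈ closure U) : n a b = α * ℓ a b + β * m a b := by
  have hJ : ∀ i, J i =ᵐ[volume.restrict U] (fun i => α • G i + β • H i) i :=
    hΞ.isWeakGrad.ae_eq hU.isOpen (IsWeakGrad.lincomb hΨ.memLp hΦ.memLp hΨ.isWeakGrad hΦ.isWeakGrad α β)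
  have hdist : ∀ ψ, h1Dist U (α • Ψ + β • Φ) J ψ
      = h1Dist U (α • Ψ + β • Φ) (fun i => α • G i + β • H i) ψ := fun ψ => by
    unfold h1Dist l2Norm
    congr 1
    refine Finset.sum_congr rfl fun i _ => eLpNorm_congr_ae ?_
    filter_upwards [hJ i] with x hx
    rw [hx]
  have hC := hU.segConst_ne_top
  have hle : ‖n a b - (α * ℓ a b + β * m a b)‖ₑ ≤ 0 := by
    refine le_of_forall_ofReal_add (C := (ConvexElement.segConst U h + 1) * (‖α‖ₑ + ‖β‖ₑ))
      (by finiteness) fun ε hε => ?_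
    obtain ⟨ψ, h1, h2, h3, -⟩ := hU.exists_uniform_approx hΨ hℓ hε
    obtain ⟨φ, k1, k2, k3, -⟩ := hU.exists_uniform_approx hΦ hm hε
    have hs : SmoothConst U (α • ψ + β • φ) := by
      obtain ⟨w, hw⟩ := h1.2
      obtain ⟨w', hw'⟩ := k1.2
      refine ⟨(h1.1.const_smul α).add (k1.1.const_smul β), α • w + β • w', fun x hx => ?_⟩
      rw [curl_lincomb (h1.1.differentiable (by simp)) (k1.1.differentiable (by simp)), hw x hx, hw' x hx]
    have h4 := hn _ hs a ha b hb
    rw [hdist] at h4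
    have h5 := h4.trans (mul_le_mul_right (h1Dist_lincomb_le hU hΨ hΦ h1.1 k1.1 α β) _)
    have h6 : ‖segInt ψ a b - ℓ a b‖ₑ ≤ ENNReal.ofReal ε := by
      rw [← ofReal_norm]; exact ENNReal.ofReal_le_ofReal (h3 a ha b hb)
    have k6 : ‖segInt φ a b - m a b‖ₑ ≤ ENNReal.ofReal ε := by
      rw [← ofReal_norm]; exact ENNReal.ofReal_le_ofReal (k3 a ha b hb)
    have e : n a b - (α * ℓ a b + β * m a b) = -(segInt (α • ψ + β • φ) a b - n a b)
        + (α * (segInt ψ a b - ℓ a b) + β * (segInt φ a b - m a b)) := by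
      rw [segInt_lincomb h1.1.continuous k1.1.continuous]; ring
    rw [e, zero_add]
    refine (enorm_add_le _ _).trans ?_
    rw [enorm_neg]
    refine (add_le_add h5 ((enorm_add_le _ _).trans_eq (by rw [enorm_mul, enorm_mul]))).trans ?_
    calc ConvexElement.segConst U h * (‖α‖ₑ * h1Dist U Ψ G ψ + ‖β‖ₑ * h1Dist U Φ H φ)
          + (‖α‖ₑ * ‖segInt ψ a b - ℓ a b‖ₑ + ‖β‖ₑ * ‖segInt φ a b - m a b‖ₑ)
        ≤ ConvexElement.segConst U h * (‖α‖ₑ * ENNReal.ofReal ε + ‖β‖ₑ * ENNReal.ofReal ε)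
          + (‖α‖ₑ * ENNReal.ofReal ε + ‖β‖ₑ * ENNReal.ofReal ε) := by gcongr
      _ = _ := by ring
  exact sub_eq_zero.1 (enorm_eq_zero.1 (le_antisymm hle zero_le))

end

theorem edgeInterp_lincomb {Ω Γ : Set E3} {T : Finset (Finset E3)} {Ψ Φ : E3 → E3}
    (hΩ : IsLipschitzDomain Ω) (hT : IsConformingMesh Ω T)
    (hΨ : Ψ ∈ discreteCurlFields Ω Γ T) (hΦ : Φ ∈ discreteCurlFields Ω Γ T) (α β : ℝ) :
    edgeInterp Γ T (α • Ψ + β • Φ) = α • edgeInterp Γ T Ψ + β • edgeInterp Γ T Φ := by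
  classical
  obtain ⟨G, w, ℓ, -, -, hw, hℓ⟩ := exists_segFamily hΩ hT hΨ
  obtain ⟨H, w', m, -, -, hw', hm⟩ := exists_segFamily hΩ hT hΦ
  obtain ⟨J, w'', n, -, -, hw'', hn⟩ := exists_segFamily hΩ hT (discreteCurlFields_lincomb hΨ hΦ α β)
  ext1 x
  simp only [edgeInterp, Pi.add_apply, Pi.smul_apply, Finset.smul_sum, ← Finset.sum_add_distrib]
  refine Finset.sum_congr rfl fun E hE => ?_
  obtain ⟨K, hK, hEK⟩ := mem_edges.1 (Finset.mem_filter.1 hE).1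
  have hsub := (Finset.mem_powersetCard.1 hEK).1
  obtain ⟨ht, hh⟩ := (hT.isTetra hK).mem_closure_of_edge hEK
  rw [edgeIntegral_eq hK hsub (hasEdgeIntegral_segLimit hΩ hT hw hℓ hK hEK),
    edgeIntegral_eq hK hsub (hasEdgeIntegral_segLimit hΩ hT hw' hm hK hEK),
    edgeIntegral_eq hK hsub (hasEdgeIntegral_segLimit hΩ hT hw'' hn hK hEK),
    (hT.isTetra hK).convexElement.segLimit_lincomb (hℓ.field K hK) (hm.field K hK) (hℓ.lim K hK)
      (hm.lim K hK) (hn.field K hK) (hn.lim K hK) ht hh]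
  module

/-! ### Global estimates -/

section

variable {Ω Γ : Set E3} {T : Finset (Finset E3)} {Ψ w : E3 → E3} {G : Fin 3 → E3 → E3}
  {ℓ : Finset E3 → E3 → E3 → ℝ}

theorem IsConformingMesh.sq_l2Norm (hT : IsConformingMesh Ω T) (hΩ : IsLipschitzDomain Ω) (f : E3 → E3) :
    l2Norm Ω f ^ 2 = ∑ K ∈ T, l2Norm (interior (hull K)) f ^ 2 := by
  simp only [l2Norm, sq_eLpNorm_two]
  exact hT.lintegral_eq_sum hΩ _

theorem sum_le_three_mul (a : Fin 3 → ℝ≥0∞) : ∑ i, a i ≤ 3 * (∑ i, a i ^ 2) ^ (1 / 2 : ℝ) := by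
  have h : ∀ i, a i ≤ (∑ i, a i ^ 2) ^ (1 / 2 : ℝ) := fun i => by
    apply ENNReal_le_of_sq_le
    rw [rpow_half_sq]
    exact Finset.single_le_sum (f := fun i => a i ^ 2) (fun _ _ => zero_le) (Finset.mem_univ i)
  refine (Finset.sum_le_card_nsmul _ _ _ fun i _ => h i).trans ?_
  simp

theorem IsConformingMesh.l2Norm_le_h1Seminorm_of_local (hT : IsConformingMesh Ω T)
    (hΩ : IsLipschitzDomain Ω) (hG : IsWeakGrad Ω Ψ G) {f : E3 → E3} {c : ℝ≥0∞}
    (h : ∀ K ∈ T, l2Norm (interior (hull K)) f ≤ c * ∑ i, l2Norm (interior (hull K)) (G i)) :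
    l2Norm Ω f ≤ 3 * c * h1Seminorm Ω Ψ := by
  apply ENNReal_le_of_sq_le
  rw [hT.sq_l2Norm hΩ, mul_pow, h1Seminorm_eq hΩ.1 hG, rpow_half_sq]
  simp_rw [hT.sq_l2Norm hΩ]
  rw [Finset.sum_comm, Finset.mul_sum]
  refine Finset.sum_le_sum fun K hK => ?_
  calc l2Norm (interior (hull K)) f ^ 2
      ≤ (c * (3 * (∑ i, l2Norm (interior (hull K)) (G i) ^ 2) ^ (1 / 2 : ℝ))) ^ 2 :=
        pow_le_pow_left' ((h K hK).trans (mul_le_mul_right (sum_le_three_mul _) _)) 2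
    _ = _ := by rw [mul_pow, mul_pow, rpow_half_sq]; ring

theorem IsConformingMesh.isBounded (hT : IsConformingMesh Ω T) : Bornology.IsBounded Ω := by
  refine Bornology.IsBounded.subset ?_ (subset_closure (s := Ω))
  rw [hT.cover]
  exact (Bornology.isBounded_biUnion_finset T).2 fun K _ => (isCompact_hull K).isBounded

theorem IsConformingMesh.elemDiam_le (hT : IsConformingMesh Ω T) {K : Finset E3} (hK : K ∈ T) :
    elemDiam K ≤ Metric.diam Ω := by
  rw [← Metric.diam_closure Ω]
  exact Metric.diam_mono (hT.hull_subset hK) hT.isBounded.closure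

theorem shapeMeasure_le {K : Finset E3} (hK : K ∈ T) : shapeMeasure K ≤ meshShapeMeasure T :=
  le_ciSup (f := fun K : T => shapeMeasure (K : Finset E3)) (finite_range _).bddAbove ⟨K, hK⟩

theorem l2Norm_congr {U : Set E3} (hU : MeasurableSet U) {f g : E3 → E3} (h : ∀ x ∈ U, f x = g x) :
    l2Norm U f = l2Norm U g :=
  eLpNorm_congr_ae ((ae_restrict_mem hU).mono h)

variable {ρ : ℝ}

theorem local_error_le (hΩ : IsLipschitzDomain Ω) (hT : IsConformingMesh Ω T)
    (hΓ : Resolves Ω Γ T) (hΨw : IsHcurl Ω Γ Ψ w) (hℓ : IsSegFamily Ω T Ψ G ℓ)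
    (hρ : meshShapeMeasure T ≤ ρ) {K : Finset E3} (hK : K ∈ T) :
    l2Norm (interior (hull K)) (fun x => Ψ x - edgeInterp Γ T Ψ x)
      ≤ ENNReal.ofReal ((3 + 264 * ρ) * elemDiam K) * ∑ i, l2Norm (interior (hull K)) (G i) := by
  refine le_of_eq_of_le (l2Norm_congr isOpen_interior.measurableSet fun x hx => ?_)
    ((hT.isTetra hK).interp_error_le (hℓ.field K hK) (hℓ.lim K hK) ((shapeMeasure_le hK).trans hρ))
  rw [edgeInterp_eq_meshField hΩ hT hΓ hΨw hℓ, meshField, hT.sum_indicator _ hK hx]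
  rfl

theorem weighted_error_le (hΩ : IsLipschitzDomain Ω) (hT : IsConformingMesh Ω T)
    (hΓ : Resolves Ω Γ T) (hΨw : IsHcurl Ω Γ Ψ w) (hG : IsWeakGrad Ω Ψ G) (hℓ : IsSegFamily Ω T Ψ G ℓ)
    (hρ : meshShapeMeasure T ≤ ρ) (hρ0 : 0 ≤ ρ) :
    l2Norm Ω (fun x => (meshWidth T x)⁻¹ • (Ψ x - edgeInterp Γ T Ψ x))
      ≤ ENNReal.ofReal (9 + 792 * ρ) * h1Seminorm Ω Ψ := by
  refine (hT.l2Norm_le_h1Seminorm_of_local hΩ hG (c := ENNReal.ofReal (3 + 264 * ρ))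
    fun K hK => ?_).trans_eq ?_
  · have hd := (hT.isTetra hK).elemDiam_pos
    have e : l2Norm (interior (hull K)) (fun x => (meshWidth T x)⁻¹ • (Ψ x - edgeInterp Γ T Ψ x))
        = ENNReal.ofReal (elemDiam K)⁻¹
          * l2Norm (interior (hull K)) (fun x => Ψ x - edgeInterp Γ T Ψ x) := by
      rw [l2Norm_congr (g := (elemDiam K)⁻¹ • fun x => Ψ x - edgeInterp Γ T Ψ x)
        isOpen_interior.measurableSet fun x hx => by
          rw [meshWidth, hT.sum_indicator (fun K _ => elemDiam K) hK hx]; rfl]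
      unfold l2Norm
      rw [eLpNorm_const_smul, Real.enorm_of_nonneg (inv_nonneg.2 hd.le)]
    rw [e]
    refine (mul_le_mul_right (local_error_le hΩ hT hΓ hΨw hℓ hρ hK) _).trans_eq ?_
    rw [← mul_assoc, ← ENNReal.ofReal_mul (inv_nonneg.2 hd.le)]
    congr 2
    field_simp
  · rw [show (3:ℝ≥0∞) = ENNReal.ofReal 3 by norm_num, ← ENNReal.ofReal_mul (by norm_num)]
    congr 2; ring

theorem error_le (hΩ : IsLipschitzDomain Ω) (hT : IsConformingMesh Ω T)
    (hΓ : Resolves Ω Γ T) (hΨw : IsHcurl Ω Γ Ψ w) (hG : IsWeakGrad Ω Ψ G) (hℓ : IsSegFamily Ω T Ψ G ℓ)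
    (hρ : meshShapeMeasure T ≤ ρ) (hρ0 : 0 ≤ ρ) :
    l2Norm Ω (fun x => Ψ x - edgeInterp Γ T Ψ x)
      ≤ ENNReal.ofReal ((9 + 792 * ρ) * Metric.diam Ω) * h1Seminorm Ω Ψ := by
  refine (hT.l2Norm_le_h1Seminorm_of_local hΩ hG (c := ENNReal.ofReal ((3 + 264 * ρ) * Metric.diam Ω))
    fun K hK => (local_error_le hΩ hT hΓ hΨw hℓ hρ hK).trans ?_).trans_eq ?_
  · have := hT.elemDiam_le hK
    gcongr
  · rw [show (3:ℝ≥0∞) = ENNReal.ofReal 3 by norm_num, ← ENNReal.ofReal_mul (by norm_num)]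
    congr 2; ring

theorem curl_edgeInterp_le (hΩ : IsLipschitzDomain Ω) (hT : IsConformingMesh Ω T)
    (hG : IsWeakGrad Ω Ψ G) (hℓ : IsSegFamily Ω T Ψ G ℓ) (hρ : meshShapeMeasure T ≤ ρ) :
    l2Norm Ω (meshField T fun K _ => (2:ℝ) • localCurl K (ℓ K))
      ≤ ENNReal.ofReal (792 * ρ ^ 2) * h1Seminorm Ω Ψ := by
  refine (hT.l2Norm_le_h1Seminorm_of_local hΩ hG (c := ENNReal.ofReal (264 * ρ ^ 2))
    fun K hK => ?_).trans_eq ?_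
  · rw [l2Norm_congr (g := fun _ => (2:ℝ) • localCurl K (ℓ K)) isOpen_interior.measurableSet fun x hx => by
      rw [meshField, hT.sum_indicator _ hK hx]]
    unfold l2Norm
    rw [eLpNorm_const_two, enorm_smul, mul_assoc, mul_comm ‖localCurl K (ℓ K)‖ₑ,
      Real.enorm_of_nonneg (by norm_num)]
    refine (mul_le_mul_right ((hT.isTetra hK).curl_interp_le (hℓ.field K hK) (hℓ.lim K hK)
      ((shapeMeasure_le hK).trans hρ)) _).trans_eq ?_
    rw [← mul_assoc, ← ENNReal.ofReal_mul (by norm_num)]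
    congr 2; ring
  · rw [show (3:ℝ≥0∞) = ENNReal.ofReal 3 by norm_num, ← ENNReal.ofReal_mul (by norm_num)]
    congr 2; ring

theorem hcurlNorm_le {v w : E3 → E3} (h : IsHcurl Ω Γ v w) : hcurlNorm Ω v ≤ l2Norm Ω v + l2Norm Ω w := by
  have h' : IsHcurl Ω ∅ v w := ⟨h.1, h.2.1, fun φ hφ hc hd => h.2.2 φ hφ hc
    (hd.mono_right (closure_mono (by rw [sdiff_empty]; exact sdiff_subset)))⟩
  apply ENNReal_le_of_sq_le
  rw [hcurlNorm, rpow_half_sq]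
  calc l2Norm Ω v ^ 2 + (⨅ (w : E3 → E3) (_ : IsHcurl Ω ∅ v w), l2Norm Ω w) ^ 2
      ≤ l2Norm Ω v ^ 2 + l2Norm Ω w ^ 2 := by gcongr; exact iInf₂_le w h'
    _ ≤ l2Norm Ω v ^ 2 + l2Norm Ω w ^ 2 + 2 * l2Norm Ω v * l2Norm Ω w := le_self_add
    _ = _ := by ring

theorem hcurlNorm_edgeInterp_le (hΩ : IsLipschitzDomain Ω) (hT : IsConformingMesh Ω T)
    (hΓ : Resolves Ω Γ T) (hm : MemLp Ψ 2 (volume.restrict Ω)) (hΨw : IsHcurl Ω Γ Ψ w)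
    (hG : IsWeakGrad Ω Ψ G) (hℓ : IsSegFamily Ω T Ψ G ℓ)
    (hρ : meshShapeMeasure T ≤ ρ) (hρ0 : 0 ≤ ρ) :
    hcurlNorm Ω (edgeInterp Γ T Ψ)
      ≤ ENNReal.ofReal ((10 + 792 * ρ + 792 * ρ ^ 2) * (1 + Metric.diam Ω)) * h1Norm Ω Ψ := by
  have hI := isHcurl_edgeInterp hΩ hT hΓ hΨw hℓ
  have hd : 0 ≤ Metric.diam Ω := Metric.diam_nonneg
  have h1 : l2Norm Ω (edgeInterp Γ T Ψ)
      ≤ h1Norm Ω Ψ + ENNReal.ofReal ((9 + 792 * ρ) * Metric.diam Ω) * h1Norm Ω Ψ := by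
    have e : edgeInterp Γ T Ψ = Ψ - fun x => Ψ x - edgeInterp Γ T Ψ x := by ext1 x; simp
    have := eLpNorm_sub_le hm.1 (hm.1.sub hI.1.1) (p := 2) (by norm_num)
    calc l2Norm Ω (edgeInterp Γ T Ψ) = l2Norm Ω (Ψ - fun x => Ψ x - edgeInterp Γ T Ψ x) := by rw [← e]
      _ ≤ l2Norm Ω Ψ + l2Norm Ω (fun x => Ψ x - edgeInterp Γ T Ψ x) := this
      _ ≤ _ := add_le_add (l2Norm_le_h1Norm _ _) ((error_le hΩ hT hΓ hΨw hG hℓ hρ hρ0).trans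
          (mul_le_mul_right (h1Seminorm_le_h1Norm _ _) _))
  have h2 := (curl_edgeInterp_le hΩ hT hG hℓ hρ).trans (mul_le_mul_right (h1Seminorm_le_h1Norm _ _) _)
  refine ((hcurlNorm_le hI).trans (add_le_add h1 h2)).trans ?_
  calc h1Norm Ω Ψ + ENNReal.ofReal ((9 + 792 * ρ) * Metric.diam Ω) * h1Norm Ω Ψ
        + ENNReal.ofReal (792 * ρ ^ 2) * h1Norm Ω Ψ
      = ENNReal.ofReal (1 + (9 + 792 * ρ) * Metric.diam Ω + 792 * ρ ^ 2) * h1Norm Ω Ψ := by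
        rw [ENNReal.ofReal_add (by positivity) (by positivity),
          ENNReal.ofReal_add (by positivity) (by positivity), ENNReal.ofReal_one]
        ring
    _ ≤ _ := by
        refine mul_le_mul_left (ENNReal.ofReal_le_ofReal ?_) _
        have : 0 ≤ ρ ^ 2 * Metric.diam Ω := by positivity
        nlinarith

end

end EdgeFEM
open EdgeFEM
theorem lemma2p1 (ρ : ℝ) :
    ∃ C : ℝ, 0 < C ∧ ∀ (Ω Γ : Set E3) (T : Finset (Finset E3)),
      IsLipschitzDomain Ω → IsConformingMesh Ω T → Resolves Ω Γ T → meshShapeMeasure T ≤ ρ →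
      -- `Π_h` is well defined, with values in the edge element space, and bounded
      (∀ Ψ ∈ discreteCurlFields Ω Γ T,
        (∀ E ∈ allEdges T, ∃ c, HasEdgeIntegral T E Ψ c) ∧
        (∀ K ∈ T, ∀ E ⊆ K, E.card = 2 → ContinuousOn Ψ (hull K) →
          edgeIntegral T E Ψ = lineIntegral E Ψ) ∧
        MemEdgeSpace Ω Γ T (edgeInterp Γ T Ψ) ∧
        hcurlNorm Ω (edgeInterp Γ T Ψ)
          ≤ ENNReal.ofReal (C * (1 + Metric.diam Ω)) * h1Norm Ω Ψ) ∧
      -- `Π_h` is linear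
      (∀ Ψ ∈ discreteCurlFields Ω Γ T, ∀ Φ ∈ discreteCurlFields Ω Γ T, ∀ α β : ℝ,
        edgeInterp Γ T (α • Ψ + β • Φ) = α • edgeInterp Γ T Ψ + β • edgeInterp Γ T Φ) ∧
      -- the interpolation error estimate
      (∀ Ψ ∈ discreteCurlFields Ω Γ T,
        l2Norm Ω (fun x => (meshWidth T x)⁻¹ • (Ψ x - edgeInterp Γ T Ψ x))
          ≤ ENNReal.ofReal C * h1Seminorm Ω Ψ) := by
  refine ⟨10 + 792 * |ρ| + 792 * |ρ| ^ 2, by positivity, fun Ω Γ T hΩ hT hΓ hρ => ⟨fun Ψ hΨ => ?_,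
    fun Ψ hΨ Φ hΦ α β => edgeInterp_lincomb hΩ hT hΨ hΦ α β, fun Ψ hΨ => ?_⟩⟩
  · obtain ⟨G, w, ℓ, hm, hG, hw, hℓ⟩ := exists_segFamily hΩ hT hΨ
    refine ⟨fun E hE => ?_, fun K hK E hE hc hcont => ?_, memEdgeSpace_edgeInterp hΩ hT hΓ hw hℓ,
      hcurlNorm_edgeInterp_le hΩ hT hΓ hm hw hG hℓ (hρ.trans (le_abs_self ρ)) (abs_nonneg ρ)⟩
    · obtain ⟨K, hK, hEK⟩ := mem_edges.1 hE
      exact ⟨_, hasEdgeIntegral_segLimit hΩ hT hw hℓ hK hEK⟩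
    · have hEK := Finset.mem_powersetCard.2 ⟨hE, hc⟩
      rw [edgeIntegral_eq hK hE (hasEdgeIntegral_segLimit hΩ hT hw hℓ hK hEK)]
      exact (hT.isTetra hK).segLimit_eq_lineIntegral (hℓ.field K hK) (hℓ.lim K hK) hEK hcont
  · obtain ⟨G, w, ℓ, hm, hG, hw, hℓ⟩ := exists_segFamily hΩ hT hΨ
    refine (weighted_error_le hΩ hT hΓ hw hG hℓ (hρ.trans (le_abs_self ρ)) (abs_nonneg ρ)).trans ?_
    refine mul_le_mul_left (ENNReal.ofReal_le_ofReal ?_) _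
    nlinarith [sq_nonneg |ρ|]
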